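/- Let $d\in\{1,2\}$, $\mathbb T^d=\mathbb R^d/\mathbb Z^d$, let $H:\mathbb T^d\to(0,\infty)$ be smooth, and put $$\Omega=\{(X,Y)\in\mathbb T^d\times\mathbb R:\ Y>-H(X)\},\qquad \Gamma=\{(X,Y):\ Y=-H(X)\}.$$ Let $0\le r<1$ and let $Q$ be a real polynomial in one variable. For a function $G$ on $\Omega$ and $Y>0$ write $\widehat G_j(Y)=\int_{\mathbb T^d}G(X,Y)e^{-2\pi i j\cdot X}\,dX$, $j\in\mathbb Z^d$. Then there is a polynomial $Q_1$ such that the following holds for every $F\in L^2(\Omega)^{d+1}$ with $$\|\widehat F_0(Y)\|\le Q(Y)e^{-Y},\qquad \|\widehat F_j(Y)\|\le Q(Y)e^{-\|j\|Y}\quad (j\in\mathbb Z^d\setminus\{0\})$$ for almost every $Y>0$ ($\|j\|$ is the Euclidean norm), and every $D\in H^{1/2}(\mathbb T^d)^{d+1}$. The Stokes problem $$-(1-r)\Delta U+\nabla P=F,\quad \operatorname{div}U=0\ \text{ in }\Omega,\qquad U(X,-H(X))=D(X)\ \text{ on }\Gamma,$$ understood in the sense of distributions in $\Omega$ and of traces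 on $\Gamma$, has one and only one solution $(U,P)$ (up to null sets) with $U\in L^2(\Omega\cap\{Y<R\})$ for all $R$, $\nabla U\in L^2(\Omega)$ and $P\in L^2(\Omega)$. On $\{Y>0\}$ it has a representative that is continuous, and smooth in $X$ for each fixed $Y$. There is $U_\infty\in\mathbb R^{d+1}$ such that, for this representative: (1) for all $Y>0$, $$\|\widehat U_0(Y)-U_\infty\|+|\widehat P_0(Y)|\le Q_1(Y)e^{-Y},\qquad \|\widehat U_0'(Y)\|+|\widehat P_0'(Y)|\le Q_1(Y)e^{-Y};$$ here $\widehat U_0$ is differentiable at every $Y>0$, and $\widehat P_0$ is Lipschitz continuous on $(0,\infty)$, the bound on $\widehat P_0'(Y)$ being asserted wherever this derivative exists; (2) for every $\delta>0$ there are polynomials $q_\ell$, $\ell\ge0$, such that for all $X\in\mathbb T^d$ and all $Y\ge\delta$ $$\|U(X,Y)-U_\infty\|+|P(X,Y)|\le q_0(Y)e^{-Y},\qquad \|\partial_X^\ell U(X,Y)\|+|\partial_X^\ell P(X,Y)|\le q_\ell(Y)e^{-Y}\quad(\ell\ge1);$$ (3) if moreover $F$ is smooth in $\Omega$, then $\widehat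 P_0$ is differentiable at every $Y>0$, and there are polynomials $q_\ell$ such that the bounds in (2) hold for all $X\in\mathbb T^d$ and all $Y>0$. -/

import Mathlib

open MeasureTheory Set
open scoped ContDiff

/-- Points `(X, Y)` of `ℝ^d × ℝ`. Functions on `𝕋^d × ℝ`, with `𝕋^d = ℝ^d / ℤ^d`, are functions
on `ℝ^d × ℝ` that are `ℤ^d`-periodic in `X`. -/
abbrev LayerPt (d : ℕ) : Type := (Fin d → ℝ) × ℝ

/-- Vectors of `ℝ^(d+1)`, Euclidean norm; the last coordinate is the vertical one. -/
abbrev LayerVec (d : ℕ) : Type := EuclideanSpace ℝ (Fin (d + 1))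

/-- `ℤ^d`-periodicity of a function of `X`. -/
def TorusPeriodic {d : ℕ} {α : Type} (f : (Fin d → ℝ) → α) : Prop :=
  ∀ (j : Fin d → ℤ) (X : Fin d → ℝ), f (fun k => X k + (j k : ℝ)) = f X

/-- `ℤ^d`-periodicity in `X` of a function of `(X, Y)`. -/
def LayerPeriodic {d : ℕ} {α : Type} (f : LayerPt d → α) : Prop :=
  ∀ Y : ℝ, TorusPeriodic (fun X => f (X, Y))

/-- The unit cube, a fundamental cell of `𝕋^d`. -/
def unitCube (d : ℕ) : Set (Fin d → ℝ) := Set.univ.pi fun _ => Set.Ico (0 : ℝ) 1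

/-- The (lifted) boundary layer domain `Y > -H(X)`. -/
def layerDomain {d : ℕ} (H : (Fin d → ℝ) → ℝ) : Set (LayerPt d) :=
  {z | -H z.1 < z.2}

/-- One period of the boundary layer domain. -/
def layerCell {d : ℕ} (H : (Fin d → ℝ) → ℝ) : Set (LayerPt d) :=
  {z | z.1 ∈ unitCube d ∧ -H z.1 < z.2}

/-- Lebesgue measure on the boundary layer domain in `𝕋^d × ℝ`. -/
noncomputable def layerMeasure {d : ℕ} (H : (Fin d → ℝ) → ℝ) : Measure (LayerPt d) :=
  volume.restrict (layerCell H)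

/-- The coordinate directions: the `d` horizontal ones, then the vertical one. -/
noncomputable def layerDir {d : ℕ} (i : Fin (d + 1)) : LayerPt d :=
  Fin.lastCases (motive := fun _ => LayerPt d) ((0 : Fin d → ℝ), (1 : ℝ))
    (fun k => (Pi.single k (1 : ℝ), (0 : ℝ))) i

/-- The partial derivative in the `i`-th coordinate direction. -/
noncomputable def layerPartial {d : ℕ} (i : Fin (d + 1)) (φ : LayerPt d → ℝ) (z : LayerPt d) : ℝ :=
  fderiv ℝ φ z (layerDir i)

/-- Smooth periodic functions whose support in `𝕋^d × ℝ` is compact and contained in the open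
set `Y > -H(X)`. -/
structure IsInteriorTest {d : ℕ} (H : (Fin d → ℝ) → ℝ) (φ : LayerPt d → ℝ) : Prop where
  smooth : ContDiff ℝ ∞ φ
  periodic : LayerPeriodic φ
  support : ∃ δ > 0, ∃ R : ℝ, ∀ z, φ z ≠ 0 → -H z.1 + δ ≤ z.2 ∧ z.2 ≤ R

/-- Smooth periodic functions vanishing for large `Y`, with no condition at the boundary. -/
structure IsBoundaryTest {d : ℕ} (φ : LayerPt d → ℝ) : Prop where
  smooth : ContDiff ℝ ∞ φ
  periodic : LayerPeriodic φ
  support : ∃ R : ℝ, ∀ z, φ z ≠ 0 → z.2 ≤ R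

/-- `G i` is the weak partial derivative of `U` in the `i`-th direction, for every `i`. -/
def HasWeakGradient {d : ℕ} (H : (Fin d → ℝ) → ℝ) (U : LayerPt d → LayerVec d)
    (G : Fin (d + 1) → LayerPt d → LayerVec d) : Prop :=
  ∀ φ : LayerPt d → ℝ, IsInteriorTest H φ → ∀ i,
    ∫ z, layerPartial i φ z • U z ∂(layerMeasure H) = -∫ z, φ z • G i z ∂(layerMeasure H)

/-- The (non-unit) outward normal `-(∇H, 1)` of the boundary `Y = -H(X)`. -/
noncomputable def layerNormal {d : ℕ} (H : (Fin d → ℝ) → ℝ) (X : Fin d → ℝ) (i : Fin (d + 1)) : ℝ :=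
  Fin.lastCases (motive := fun _ => ℝ) (-1) (fun k => -(fderiv ℝ H X (Pi.single k (1 : ℝ)))) i

/-- `U` (with weak gradient `G`) has trace `D` on the boundary `Y = -H(X)`, in the sense of Green's
formula. The surface element multiplied by the unit outward normal is `-(∇H, 1) dX`. -/
def HasBoundaryTrace {d : ℕ} (H : (Fin d → ℝ) → ℝ) (U : LayerPt d → LayerVec d)
    (G : Fin (d + 1) → LayerPt d → LayerVec d) (D : (Fin d → ℝ) → LayerVec d) : Prop :=
  ∀ φ : LayerPt d → ℝ, IsBoundaryTest φ → ∀ i,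
    ∫ z, (layerPartial i φ z • U z + φ z • G i z) ∂(layerMeasure H) =
      ∫ X in unitCube d, (layerNormal H X i * φ (X, -H X)) • D X

/-- `(U, P)` is a (weak) solution, with `∇U` and `P` in `L²`, of
`-(1-r) ΔU + ∇P = F` and `div U = 0` in `Y > -H(X)`, `U = D` on `Y = -H(X)`. -/
structure IsStokesLayerSolution {d : ℕ} (H : (Fin d → ℝ) → ℝ) (r : ℝ)
    (F : LayerPt d → LayerVec d) (D : (Fin d → ℝ) → LayerVec d)
    (U : LayerPt d → LayerVec d) (P : LayerPt d → ℝ) : Prop where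
  periodic_U : LayerPeriodic U
  periodic_P : LayerPeriodic P
  /-- `U` is square integrable on the bounded parts of the domain. -/
  locally_sq_integrable_U :
    ∀ R : ℝ, MemLp U 2 ((layerMeasure H).restrict {z | z.2 < R})
  sq_integrable_P : MemLp P 2 (layerMeasure H)
  equations : ∃ G : Fin (d + 1) → LayerPt d → LayerVec d,
    (∀ i, MemLp (G i) 2 (layerMeasure H)) ∧
    HasWeakGradient H U G ∧
    HasBoundaryTrace H U G D ∧
    (∀ᵐ z ∂(layerMeasure H), ∑ i, G i z i = 0) ∧
    ∀ φ : LayerPt d → ℝ, IsInteriorTest H φ → ∀ i,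
      (1 - r) * ∑ k, ∫ z, layerPartial k φ z * G k z i ∂(layerMeasure H)
        - ∫ z, P z * layerPartial i φ z ∂(layerMeasure H)
        = ∫ z, F z i * φ z ∂(layerMeasure H)

/-- The `j`-th Fourier coefficient of a `ℤ^d`-periodic scalar function. -/
noncomputable def torusCoeff {d : ℕ} (f : (Fin d → ℝ) → ℝ) (j : Fin d → ℤ) : ℂ :=
  ∫ X in unitCube d,
    Complex.exp (-(2 * Real.pi * (∑ k, (j k : ℝ) * X k) : ℝ) * Complex.I) * (f X : ℂ)

/-- The `j`-th Fourier coefficient of a `ℤ^d`-periodic vector function. -/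
noncomputable def torusVecCoeff {d : ℕ} (f : (Fin d → ℝ) → LayerVec d) (j : Fin d → ℤ) :
    EuclideanSpace ℂ (Fin (d + 1)) :=
  WithLp.toLp 2 fun i => torusCoeff (fun X => f X i) j

/-- The Fourier coefficient `Û_j(Y)` with respect to `X` of a vector field. -/
noncomputable def vecMode {d : ℕ} (U : LayerPt d → LayerVec d) (j : Fin d → ℤ) (Y : ℝ) :
    EuclideanSpace ℂ (Fin (d + 1)) :=
  torusVecCoeff (fun X => U (X, Y)) j

/-- The Fourier coefficient `P̂_j(Y)` with respect to `X` of a scalar field. -/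
noncomputable def scalarMode {d : ℕ} (P : LayerPt d → ℝ) (j : Fin d → ℤ) (Y : ℝ) : ℂ :=
  torusCoeff (fun X => P (X, Y)) j

/-- The Euclidean norm of a frequency. -/
noncomputable def freqNorm {d : ℕ} (j : Fin d → ℤ) : ℝ :=
  Real.sqrt (∑ k, (j k : ℝ) ^ 2)

/-- A real vector seen as a complex one. -/
noncomputable def toComplexVec {n : ℕ} (v : EuclideanSpace ℝ (Fin n)) : EuclideanSpace ℂ (Fin n) :=
  WithLp.toLp 2 fun i => (v i : ℂ)

/-- Membership in the Sobolev space `H^(1/2)(𝕋^d)` of vector functions. -/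
structure MemTorusHalf {d : ℕ} (D : (Fin d → ℝ) → LayerVec d) : Prop where
  periodic : TorusPeriodic D
  sq_integrable : MemLp D 2 (volume.restrict (unitCube d))
  summable : Summable fun j : Fin d → ℤ => freqNorm j * ‖torusVecCoeff D j‖ ^ 2

/-- For `X ∈ 𝕋^d` and `Y ∈ S`, the functions `U - Uinf`, `P` and each of their `X`-derivatives
are bounded by a polynomial in `Y` times `e^(-Y)`; the polynomial may depend on the order. -/
def LayerDecay {d : ℕ} (U : LayerPt d → LayerVec d) (P : LayerPt d → ℝ) (Uinf : LayerVec d)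
    (S : Set ℝ) : Prop :=
  (∃ q : Polynomial ℝ, ∀ X : Fin d → ℝ, ∀ Y ∈ S,
    ‖U (X, Y) - Uinf‖ + |P (X, Y)| ≤ q.eval Y * Real.exp (-Y)) ∧
  ∀ l : ℕ, 1 ≤ l → ∃ q : Polynomial ℝ, ∀ X : Fin d → ℝ, ∀ Y ∈ S,
    ‖iteratedFDeriv ℝ l (fun X' => U (X', Y)) X‖ + ‖iteratedFDeriv ℝ l (fun X' => P (X', Y)) X‖
      ≤ q.eval Y * Real.exp (-Y)

/-! The shear `(X, Y) ↦ (X, Y + H X)` flattens the domain and preserves volume. In the flat half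
space, questions about traces, divergences and gradients are read off the Fourier modes in `X`, each
of which is a problem on a half line. There `WeakDerivOn.exists_eq_primitive` makes every mode a
primitive of its weak derivative.

Existence. The unknown is the gradient rather than the velocity: a function of zero trace is the
vertical primitive of its vertical derivative (`IsZeroTracePair.ae_eq_flatPrim`), so the gradients
of such functions form a closed subspace of `L²`. On it the Stokes system is a saddle point problem,
solved by `exists_saddle_point` once the divergence is known to be onto `L²`. This is
`exists_zeroTrace_div`: with `w = 2π|j|`, let `x' + w x = p̂_j` and `x(0) = 0`; the field with modes
`-i (j_m/|j|) x` horizontally and `x` vertically has zero trace and divergence `p`, while `w x` and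
`x'` are bounded in `L²` by `p̂_j` uniformly in `j`. The velocities are only locally square
integrable, so the force is paired with them through its tail integral over `(Y, ∞)`. That tail is
in `L²` because the assumed decay of the modes of `F` provides an exponential weight
(`flatWeightedL2_of_modes`). Boundary data in `H^(1/2)` are lifted by `e^{-wy}` in flat coordinates
(`exists_isTracePair`).

Uniqueness. Square integrable fields of zero divergence are orthogonal to gradients of functions of
zero trace (`IsWeakDiv.integral_mul_grad_eq_zero`). Applied to the difference of two stress tensors,
this gives equal gradients when tested with the velocity difference, and then equal pressures when
tested with a field whose divergence is the pressure difference.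

Decay, `j ≠ 0`. The pressure mode and its slope solve a first order system equivalent to `p'' = w²
p` with forcing from `F`; each velocity mode solves `u'' = w² u` with forcing from `F` and the
pressure. The combinations `u' ± w u` decouple such a system: the growing one is controlled by the
forcing alone, because the solution is square integrable, and the decaying one by the forcing and
its mean on a strip (`WeakDerivOn.ae_le_of_second_order`). The means are bounded uniformly in `j` by
`L¹` norms on the strip. Since `2π|j| ≥ |j| + 1/2`, the forcing rate `|j|` is not resonant, and the
contribution of the strip decays faster than the forcing. The outcome is `IsStokesModes.ae_le`, with
constants polynomial in `|j|`. At height `δ` a factor `e^{-δ|j|}` beats every power of `|j|`, so the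
Fourier series converge with all `X`-derivatives and represent the solution.

Decay, `j = 0`. The means solve `p' = F̂` and `ν u'' = -F̂` horizontally, with constant vertical
velocity, and are integrated from infinity (`IsStokesModes.zero_mode`). Square integrability fixes
the constants of integration of the pressure and of the velocity gradient, so the bounds involve
only `Q` and `r`, and `Q₁` does not depend on `F` or `D`.

Smooth `F`. As `H` is bounded below by a positive number, the strip can be placed at negative
heights, where the modes of `F` decay faster than any power of `|j|`; the bounds then reach all `Y >
0`. -/

open Real (exp)
open scoped ComplexConjugate Real

/-- Lebesgue measure on the half line `(a, ∞)`. -/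
notation:max "volIoi " a:max => Measure.restrict volume (Ioi a)

/-! ### Fourier series on the torus, carried over to the unit cube. -/

section TorusFourier

variable {d : ℕ}

/-- The character `X ↦ exp (2πi j·X)` of the torus. -/
noncomputable def torusChar (j : Fin d → ℤ) (X : Fin d → ℝ) : ℂ :=
  Complex.exp ((2 * π * (∑ k, (j k : ℝ) * X k) : ℝ) * Complex.I)

/-- Fourier coefficients of complex functions on the torus. -/
noncomputable def charCoeff (f : (Fin d → ℝ) → ℂ) (j : Fin d → ℤ) : ℂ :=
  ∫ X in unitCube d, conj (torusChar j X) * f X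

theorem conj_torusChar (j : Fin d → ℤ) (X : Fin d → ℝ) :
    conj (torusChar j X) = Complex.exp (-(2 * π * (∑ k, (j k : ℝ) * X k) : ℝ) * Complex.I) := by
  rw [torusChar, ← Complex.exp_conj, map_mul, Complex.conj_ofReal, Complex.conj_I]
  congr 1
  ring

theorem torusChar_neg (j : Fin d → ℤ) (X : Fin d → ℝ) :
    torusChar (-j) X = conj (torusChar j X) := by
  rw [conj_torusChar, torusChar]
  congr 1
  simp [Finset.sum_neg_distrib]

theorem torusChar_zero (X : Fin d → ℝ) : torusChar (0 : Fin d → ℤ) X = 1 := by simp [torusChar]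

@[simp]
theorem norm_torusChar (j : Fin d → ℤ) (X : Fin d → ℝ) : ‖torusChar j X‖ = 1 := by
  rw [torusChar, Complex.norm_exp_ofReal_mul_I]

theorem torusCoeff_eq_charCoeff (f : (Fin d → ℝ) → ℝ) (j : Fin d → ℤ) :
    torusCoeff f j = charCoeff (fun X => (f X : ℂ)) j := by
  simp only [torusCoeff, charCoeff, conj_torusChar]

theorem contDiff_torusChar (j : Fin d → ℤ) : ContDiff ℝ ∞ (torusChar j) := by
  unfold torusChar
  refine Complex.contDiff_exp.comp (ContDiff.mul ?_ contDiff_const)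
  exact Complex.ofRealCLM.contDiff.comp (contDiff_const.mul
    (ContDiff.sum fun k _ => contDiff_const.mul (contDiff_apply ℝ ℝ k)))

@[fun_prop]
theorem continuous_torusChar (j : Fin d → ℤ) : Continuous (torusChar j) :=
  (contDiff_torusChar j).continuous

theorem measurableSet_unitCube : MeasurableSet (unitCube d) :=
  MeasurableSet.univ_pi fun _ => measurableSet_Ico

theorem volume_unitCube : volume (unitCube d) = 1 := by simp [unitCube, Real.volume_pi_Ico]

instance isProbabilityMeasure_unitCube :
    IsProbabilityMeasure (volume.restrict (unitCube d)) :=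
  ⟨by rw [Measure.restrict_apply_univ, volume_unitCube]⟩

theorem torusChar_periodic (j : Fin d → ℤ) : TorusPeriodic (torusChar j) := by
  intro l X
  have h : (2 * π * (∑ k, (j k : ℝ) * (X k + (l k : ℝ))) : ℝ) * Complex.I
      = (2 * π * (∑ k, (j k : ℝ) * X k) : ℝ) * Complex.I
        + ((∑ k, j k * l k : ℤ) : ℂ) * (2 * π * Complex.I) := by
    simp only [mul_add, Finset.sum_add_distrib]
    push_cast
    ring
  simp only [torusChar]
  rw [h]
  exact Complex.exp_periodic.int_mul _ _

/-- The section of the covering `ℝ^d → 𝕋^d` with values in `(0, 1]^d`. -/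
noncomputable def torusSection (d : ℕ) (t : UnitAddTorus (Fin d)) : Fin d → ℝ :=
  (UnitAddTorus.measurableEquivPiIoc (fun _ : Fin d => (0 : ℝ)) t).1

/-- The torus is parametrised by `(0, 1]^d` while the coefficients are integrals over `[0, 1)^d`;
both boxes agree with the closed cube up to faces of measure zero. -/
theorem unitCube_ae_eq :
    (unitCube d : Set (Fin d → ℝ)) =ᵐ[volume]
      {x : Fin d → ℝ | ∀ i, x i ∈ Ioc (0 : ℝ) (0 + 1)} := by
  have h : {x : Fin d → ℝ | ∀ i, x i ∈ Ioc (0 : ℝ) (0 + 1)}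
      = Set.univ.pi fun _ : Fin d => Ioc (0 : ℝ) 1 := by ext x; simp
  rw [h]
  exact (Measure.univ_pi_Ico_ae_eq_Icc (μ := fun _ : Fin d => (volume : Measure ℝ))
    (f := fun _ => (0 : ℝ)) (g := fun _ => (1 : ℝ))).trans
    (Measure.univ_pi_Ioc_ae_eq_Icc (μ := fun _ : Fin d => (volume : Measure ℝ))
    (f := fun _ => (0 : ℝ)) (g := fun _ => (1 : ℝ))).symm

attribute [local instance] instMeasureSpaceUnitAddCircle

theorem measurePreserving_torusSection :
    MeasurePreserving (torusSection d) volume (volume.restrict (unitCube d)) := by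
  have h1 := UnitAddTorus.measurePreserving_equivPiIoc (fun _ : Fin d => (0 : ℝ))
  have h2 : MeasurePreserving (Subtype.val :
      {x : Fin d → ℝ // ∀ i, x i ∈ Ioc (0 : ℝ) (0 + 1)} → (Fin d → ℝ))
      (Measure.comap Subtype.val volume) (volume.restrict (unitCube d)) := by
    refine ⟨measurable_subtype_coe, ?_⟩
    rw [Measure.restrict_congr_set unitCube_ae_eq]
    have hm : MeasurableSet {x : Fin d → ℝ | ∀ i, x i ∈ Ioc (0 : ℝ) (0 + 1)} :=
      MeasurableSet.univ_pi' fun i => measurableSet_Ioc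
    exact map_comap_subtype_coe hm volume
  exact h2.comp h1

theorem mFourier_eq_torusChar (j : Fin d → ℤ) (t : UnitAddTorus (Fin d)) :
    UnitAddTorus.mFourier j t = torusChar j (torusSection d t) := by
  have ht : t = fun k => ((torusSection d t k : ℝ) : UnitAddCircle) :=
    ((UnitAddTorus.measurableEquivPiIoc (fun _ : Fin d => (0 : ℝ))).symm_apply_apply t).symm
  generalize torusSection d t = s at ht
  subst ht
  have h1 : ∀ k, fourier (j k) ((s k : ℝ) : UnitAddCircle)
      = Complex.exp (2 * π * Complex.I * (j k) * (s k) / (1 : ℝ)) :=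
    fun k => fourier_coe_apply
  simp only [UnitAddTorus.mFourier, ContinuousMap.coe_mk, torusChar, h1]
  rw [← Complex.exp_sum]
  congr 1
  push_cast
  rw [Finset.mul_sum, Finset.sum_mul]
  refine Finset.sum_congr rfl fun k _ => ?_
  simp only [div_one]
  ring

theorem mFourierCoeff_comp_torusSection (f : (Fin d → ℝ) → ℂ) (j : Fin d → ℤ)
    (hf : AEStronglyMeasurable f (volume.restrict (unitCube d))) :
    UnitAddTorus.mFourierCoeff (fun t => f (torusSection d t)) j = charCoeff f j := by
  unfold UnitAddTorus.mFourierCoeff charCoeff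
  rw [← measurePreserving_torusSection.map_eq, integral_map]
  · refine integral_congr_ae (ae_of_all _ fun t => ?_)
    simp only [UnitAddTorus.mFourier_neg, mFourier_eq_torusChar, smul_eq_mul]
  · exact measurePreserving_torusSection.measurable.aemeasurable
  · rw [measurePreserving_torusSection.map_eq]
    exact AEStronglyMeasurable.mul
      (Complex.continuous_conj.comp (continuous_torusChar j)).aestronglyMeasurable hf

/-- Parseval's identity on the unit cube. -/
theorem hasSum_charCoeff {f g : (Fin d → ℝ) → ℂ}
    (hf : MemLp f 2 (volume.restrict (unitCube d)))
    (hg : MemLp g 2 (volume.restrict (unitCube d))) :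
    HasSum (fun j => conj (charCoeff f j) * charCoeff g j)
      (∫ X in unitCube d, conj (f X) * g X) := by
  have hf' := hf.comp_measurePreserving measurePreserving_torusSection
  have hg' := hg.comp_measurePreserving measurePreserving_torusSection
  have key := UnitAddTorus.hasSum_prod_mFourierCoeff (hf'.toLp _) (hg'.toLp _)
  have hco : ∀ {u : (Fin d → ℝ) → ℂ} (hu : MemLp u 2 (volume.restrict (unitCube d)))
      (hu' : MemLp (u ∘ torusSection d) 2 volume) (j : Fin d → ℤ),
      UnitAddTorus.mFourierCoeff (hu'.toLp _) j = charCoeff u j := by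
    intro u hu hu' j
    rw [← mFourierCoeff_comp_torusSection u j hu.1]
    unfold UnitAddTorus.mFourierCoeff
    refine integral_congr_ae ?_
    filter_upwards [hu'.coeFn_toLp] with t ht
    rw [ht]; rfl
  simp only [hco hf hf', hco hg hg'] at key
  convert key using 1
  rw [← measurePreserving_torusSection.map_eq, integral_map]
  · refine integral_congr_ae ?_
    filter_upwards [hf'.coeFn_toLp, hg'.coeFn_toLp] with t ht ht'
    rw [ht, ht']; rfl
  · exact measurePreserving_torusSection.measurable.aemeasurable
  · rw [measurePreserving_torusSection.map_eq]
    exact (Complex.continuous_conj.comp_aestronglyMeasurable hf.1).mul hg.1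

theorem hasSum_norm_sq_charCoeff {f : (Fin d → ℝ) → ℂ}
    (hf : MemLp f 2 (volume.restrict (unitCube d))) :
    HasSum (fun j => ‖charCoeff f j‖ ^ 2) (∫ X in unitCube d, ‖f X‖ ^ 2) := by
  have h := hasSum_charCoeff hf hf
  have h2 : ∀ z : ℂ, conj z * z = ((‖z‖ ^ 2 : ℝ) : ℂ) := by
    intro z; rw [mul_comm, Complex.mul_conj, Complex.normSq_eq_norm_sq]
  simp only [h2] at h
  rw [integral_complex_ofReal] at h
  exact_mod_cast h

theorem charCoeff_torusChar (j l : Fin d → ℤ) :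
    charCoeff (torusChar l) j = if j = l then 1 else 0 := by
  have h := orthonormal_iff_ite.mp (UnitAddTorus.orthonormal_mFourier (d := Fin d)) j l
  rw [← h, ContinuousMap.inner_toLp]
  rw [charCoeff, ← measurePreserving_torusSection.map_eq, integral_map]
  · refine integral_congr_ae (ae_of_all _ fun t => ?_)
    simp only [mFourier_eq_torusChar, mul_comm]
  · exact measurePreserving_torusSection.measurable.aemeasurable
  · exact ((Complex.continuous_conj.comp (continuous_torusChar j)).mul
      (continuous_torusChar l)).aestronglyMeasurable

theorem integrable_unitCube_of_continuous {E : Type*} [NormedAddCommGroup E]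
    {f : (Fin d → ℝ) → E} (hf : Continuous f) :
    Integrable f (volume.restrict (unitCube d)) := by
  have hK : IsCompact (Set.univ.pi fun _ : Fin d => Icc (0 : ℝ) 1) :=
    isCompact_univ_pi fun _ => isCompact_Icc
  refine (hf.continuousOn.integrableOn_compact hK).mono_set ?_
  exact Set.pi_mono fun _ _ => Ico_subset_Icc_self

theorem memLp_unitCube_of_continuous {E : Type*} [NormedAddCommGroup E]
    {f : (Fin d → ℝ) → E} (hf : Continuous f) (p : ENNReal) :
    MemLp f p (volume.restrict (unitCube d)) := by
  have hK : IsCompact (Set.univ.pi fun _ : Fin d => Icc (0 : ℝ) 1) :=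
    isCompact_univ_pi fun _ => isCompact_Icc
  obtain ⟨C, hC⟩ := hK.exists_bound_of_continuousOn hf.continuousOn
  refine MemLp.of_bound hf.aestronglyMeasurable C ?_
  rw [ae_restrict_iff' measurableSet_unitCube]
  exact ae_of_all _ fun X hX =>
    hC X (Set.pi_mono (fun _ _ => Ico_subset_Icc_self) hX)

theorem charCoeff_add {f g : (Fin d → ℝ) → ℂ}
    (hf : Integrable f (volume.restrict (unitCube d)))
    (hg : Integrable g (volume.restrict (unitCube d))) (j : Fin d → ℤ) :
    charCoeff (fun X => f X + g X) j = charCoeff f j + charCoeff g j := by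
  unfold charCoeff
  rw [← integral_add]
  · simp only [mul_add]
  · exact hf.bdd_mul (Complex.continuous_conj.comp (continuous_torusChar j)).aestronglyMeasurable
      (ae_of_all _ fun X => by simp : ∀ᵐ X ∂_, ‖_‖ ≤ (1 : ℝ))
  · exact hg.bdd_mul (Complex.continuous_conj.comp (continuous_torusChar j)).aestronglyMeasurable
      (ae_of_all _ fun X => by simp : ∀ᵐ X ∂_, ‖_‖ ≤ (1 : ℝ))

theorem charCoeff_const_mul (c : ℂ) (f : (Fin d → ℝ) → ℂ) (j : Fin d → ℤ) :
    charCoeff (fun X => c * f X) j = c * charCoeff f j := by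
  unfold charCoeff
  rw [← integral_const_mul]
  congr 1
  ext X
  ring

theorem charCoeff_congr_ae {f g : (Fin d → ℝ) → ℂ}
    (h : f =ᵐ[volume.restrict (unitCube d)] g) (j : Fin d → ℤ) :
    charCoeff f j = charCoeff g j := by
  refine integral_congr_ae ?_
  filter_upwards [h] with X hX
  rw [hX]

theorem norm_charCoeff_le (f : (Fin d → ℝ) → ℂ) (j : Fin d → ℤ) :
    ‖charCoeff f j‖ ≤ ∫ X in unitCube d, ‖f X‖ := by
  refine (norm_integral_le_integral_norm _).trans (le_of_eq ?_)
  simp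

theorem continuous_tsum_torusChar {c : (Fin d → ℤ) → ℂ} (hc : Summable fun j => ‖c j‖) :
    Continuous fun X => ∑' j, c j * torusChar j X :=
  continuous_tsum (fun j => by fun_prop) hc fun j X => by simp

/-- Absolute summability lets the sum and the integral be exchanged; orthonormality of the
characters leaves a single term. -/
theorem charCoeff_tsum {c : (Fin d → ℤ) → ℂ} (hc : Summable fun j => ‖c j‖) (l : Fin d → ℤ) :
    charCoeff (fun X => ∑' j, c j * torusChar j X) l = c l := by
  have h1 : HasSum (fun j => ∫ X in unitCube d, conj (torusChar l X) * (c j * torusChar j X))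
      (∫ X in unitCube d, ∑' j, conj (torusChar l X) * (c j * torusChar j X)) := by
    refine hasSum_integral_of_summable_integral_norm (fun j => ?_) ?_
    · refine integrable_unitCube_of_continuous ?_
      exact (Complex.continuous_conj.comp (continuous_torusChar l)).mul
        (continuous_const.mul (continuous_torusChar j))
    · simpa using hc
  have h2 : ∀ j, ∫ X in unitCube d, conj (torusChar l X) * (c j * torusChar j X)
      = if l = j then c l else 0 := by
    intro j
    have := charCoeff_const_mul (c j) (torusChar j) l
    rw [charCoeff_torusChar] at this
    unfold charCoeff at this
    rw [this]
    split_ifs with h <;> simp [h]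
  simp only [h2, tsum_mul_left] at h1
  exact h1.unique (by simpa [eq_comm] using hasSum_ite_eq l (c l))

end TorusFourier

/-! ### Weak derivatives on a half line and primitives of integrable functions. -/

section WeakDerivative

variable {a : ℝ} {η : ℝ → ℝ} {f : ℝ → ℂ}

/-- Smooth functions of one variable with compact support contained in `(a, ∞)`. -/
structure IsHalfLineTest (a : ℝ) (η : ℝ → ℝ) : Prop where
  smooth : ContDiff ℝ ∞ η
  support : ∃ b c, a < b ∧ ∀ y, η y ≠ 0 → b ≤ y ∧ y ≤ c

/-- Smooth functions of one variable vanishing near `∞`. -/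
structure IsUpperTest (η : ℝ → ℝ) : Prop where
  smooth : ContDiff ℝ ∞ η
  support : ∃ c, ∀ y, η y ≠ 0 → y ≤ c

theorem IsHalfLineTest.isUpperTest (h : IsHalfLineTest a η) :
    IsUpperTest η := ⟨h.smooth, let ⟨_, c, _, hc⟩ := h.support; ⟨c, fun y hy => (hc y hy).2⟩⟩

/-- `f` is the weak derivative of `u` on `(a, ∞)`. -/
def WeakDerivOn (a : ℝ) (u f : ℝ → ℂ) : Prop := ∀ η : ℝ → ℝ, IsHalfLineTest a η →
    ∫ y in Ioi a, ((deriv η y : ℝ) : ℂ) * u y = -∫ y in Ioi a, (η y : ℂ) * f y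

/-- `f` is the weak derivative of `u` on `(a, ∞)`, and `u` vanishes at `a`. -/
def WeakDerivZeroOn (a : ℝ) (u f : ℝ → ℂ) : Prop := ∀ η : ℝ → ℝ, IsUpperTest η →
    ∫ y in Ioi a, ((deriv η y : ℝ) : ℂ) * u y = -∫ y in Ioi a, (η y : ℂ) * f y

/-- Fubini on the triangle `s < y`. It serves as integration by parts for primitives of functions
that are merely integrable. -/
theorem integral_mul_primitive {a c : ℝ} {g f : ℝ → ℂ} (hg : IntegrableOn g (Ioc a c))
    (hf : IntegrableOn f (Ioc a c)) :
    ∫ y in Ioc a c, g y * ∫ s in Ioc a y, f s = ∫ s in Ioc a c, (∫ y in Ioc s c, g y) * f s := by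
  have hprod : Integrable (fun z : ℝ × ℝ => {z : ℝ × ℝ | z.2 < z.1}.indicator
      (fun z => g z.1 * f z.2) z)
      ((volume.restrict (Ioc a c)).prod (volume.restrict (Ioc a c))) :=
    (Integrable.mul_prod hg hf).indicator (measurableSet_lt measurable_snd measurable_fst)
  have hsw := integral_integral_swap (f := fun y s => {z : ℝ × ℝ | z.2 < z.1}.indicator
      (fun z => g z.1 * f z.2) (y, s)) hprod
  have h1 : ∀ y ∈ Ioc a c, ∫ s in Ioc a c, {z : ℝ × ℝ | z.2 < z.1}.indicator
      (fun z => g z.1 * f z.2) (y, s) = g y * ∫ s in Ioc a y, f s := by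
    intro y hy
    rw [← integral_const_mul, integral_Ioc_eq_integral_Ioo (x := a) (y := y)]
    have : ∀ s, {z : ℝ × ℝ | z.2 < z.1}.indicator (fun z => g z.1 * f z.2) (y, s)
        = (Iio y).indicator (fun s => g y * f s) s := by
      intro s; simp [indicator]
    simp only [this]
    rw [setIntegral_indicator measurableSet_Iio]
    congr 2
    ext s
    simp only [mem_inter_iff, mem_Ioc, mem_Iio, mem_Ioo]
    constructor
    · rintro ⟨⟨h1, h2⟩, h3⟩; exact ⟨h1, h3⟩
    · rintro ⟨h1, h2⟩; exact ⟨⟨h1, h2.le.trans hy.2⟩, h2⟩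
  have h2 : ∀ s ∈ Ioc a c, ∫ y in Ioc a c, {z : ℝ × ℝ | z.2 < z.1}.indicator
      (fun z => g z.1 * f z.2) (y, s) = (∫ y in Ioc s c, g y) * f s := by
    intro s hs
    rw [← integral_mul_const]
    have : ∀ y, {z : ℝ × ℝ | z.2 < z.1}.indicator (fun z => g z.1 * f z.2) (y, s)
        = (Ioi s).indicator (fun y => g y * f s) y := by
      intro s; simp [indicator]
    simp only [this]
    rw [setIntegral_indicator measurableSet_Ioi]
    congr 2
    ext y
    simp only [mem_inter_iff, mem_Ioc, mem_Ioi]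
    constructor
    · rintro ⟨⟨h1, h2⟩, h3⟩; exact ⟨h3, h2⟩
    · rintro ⟨h1, h2⟩; exact ⟨⟨hs.1.trans h1, h2⟩, h1⟩
  rw [setIntegral_congr_fun measurableSet_Ioc h1, setIntegral_congr_fun measurableSet_Ioc h2] at hsw
  exact hsw

theorem continuousOn_primitive_Ioc
    (hf : ∀ T, IntegrableOn f (Ioc a T)) :
    ContinuousOn (fun y => ∫ s in Ioc a y, f s) (Ici a) := by
  intro y hy
  have h := intervalIntegral.continuousOn_primitive (f := f) (a := a) (b := y + 1) (μ := volume)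
    (by rw [integrableOn_Icc_iff_integrableOn_Ioc]; exact hf _)
  have h2 := h y ⟨hy, by linarith⟩
  refine h2.mono_of_mem_nhdsWithin ?_
  have : Icc a (y + 1) = Ici a ∩ Iic (y + 1) := by ext; simp
  rw [this]
  exact Filter.inter_mem self_mem_nhdsWithin (mem_nhdsWithin_of_mem_nhds (Iic_mem_nhds (by linarith)))

theorem integral_deriv_upper (hη : ContDiff ℝ ∞ η) (s c : ℝ) (hsc : s ≤ c) :
    ∫ y in Ioc s c, ((deriv η y : ℝ) : ℂ) = (η c : ℂ) - η s := by
  rw [integral_complex_ofReal, ← intervalIntegral.integral_of_le hsc,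
    intervalIntegral.integral_deriv_eq_sub
      (fun x _ => (hη.differentiable (by simp)).differentiableAt)
      ((hη.continuous_deriv (by simp)).intervalIntegrable _ _)]
  push_cast
  rfl

theorem integrableOn_mul_of_continuous {u : ℝ → ℂ} (hu : ∀ T, IntegrableOn u (Ioc a T))
    {θ : ℝ → ℝ} (hθ : Continuous θ) {c : ℝ} (hc : ∀ y, θ y ≠ 0 → y ≤ c) :
    IntegrableOn (fun y => (θ y : ℂ) * u y) (Ioi a) := by
  have h0 : IntegrableOn (fun y => (θ y : ℂ) * u y) (Ioc a c) := by
    have h1 : IntegrableOn u (Icc a c) := by rw [integrableOn_Icc_iff_integrableOn_Ioc]; exact hu c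
    have := h1.continuousOn_mul (Complex.continuous_ofReal.comp hθ).continuousOn isCompact_Icc
    exact this.mono_set Ioc_subset_Icc_self
  refine h0.of_forall_sdiff_eq_zero measurableSet_Ioi fun y hy => ?_
  have : θ y = 0 := by
    by_contra h
    exact hy.2 ⟨hy.1, hc y h⟩
  simp [this]

theorem setIntegral_Ioi_eq_Ioc {a c : ℝ} {g : ℝ → ℂ} (h : ∀ y, c < y → g y = 0) :
    ∫ y in Ioi a, g y = ∫ y in Ioc a c, g y := by
  refine (setIntegral_eq_of_subset_of_forall_sdiff_eq_zero measurableSet_Ioi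
    (fun y hy => hy.1) fun y hy => h y ?_)
  by_contra h2
  exact hy.2 ⟨hy.1, not_lt.mp h2⟩

theorem deriv_eq_zero_of_upper {c : ℝ} (hc : ∀ y, η y ≠ 0 → y ≤ c) {y : ℝ}
    (hy : c < y) : deriv η y = 0 := by
  have : η =ᶠ[nhds y] fun _ => 0 := by
    filter_upwards [Ioi_mem_nhds hy] with x hx
    by_contra h
    exact absurd (hc x h) (not_le.mpr hx)
  rw [this.deriv_eq]; simp

/-- This is `integral_mul_primitive` for `g = η'`, whose integral over `(s, c]` is `-η s`. The
constant survives only through `η a`, and this term distinguishes functions vanishing at `a` from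
the others. -/
theorem integral_deriv_mul_primitive (hf : ∀ T, IntegrableOn f (Ioc a T))
    (hη : IsUpperTest η) (C : ℂ) :
    ∫ y in Ioi a, ((deriv η y : ℝ) : ℂ) * (C + ∫ s in Ioc a y, f s)
      = -(C * η a) - ∫ y in Ioi a, (η y : ℂ) * f y := by
  obtain ⟨c₀, hc₀⟩ := hη.support
  set c := max c₀ (a + 1) with hcdef
  have hac : a ≤ c := le_trans (by linarith) (le_max_right _ _)
  have hc : ∀ y, η y ≠ 0 → y ≤ c := fun y hy => (hc₀ y hy).trans (le_max_left _ _)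
  have hηc : ∀ y, c < y → η y = 0 := fun y hy => by
    by_contra h; exact absurd (hc y h) (not_le.mpr hy)
  -- The support condition gives zero only strictly above `c`; continuity gives the end point.
  have hηc' : η c = 0 := by
    by_contra h
    have h1 : ∀ᶠ y in nhds c, η y ≠ 0 := hη.smooth.continuous.continuousAt.eventually_ne h
    have h2 : ∃ᶠ y in nhdsWithin c (Ioi c), η y ≠ 0 :=
      (h1.filter_mono nhdsWithin_le_nhds).frequently
    obtain ⟨y, hy1, hy2⟩ := (h2.and_eventually self_mem_nhdsWithin).exists
    exact hy1 (hηc y hy2)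
  rw [setIntegral_Ioi_eq_Ioc (c := c) (fun y hy => by rw [deriv_eq_zero_of_upper hc hy]; simp),
    setIntegral_Ioi_eq_Ioc (c := c) (g := fun y => (η y : ℂ) * f y) (fun y hy => by
      rw [hηc y hy]; simp)]
  have hd : Continuous (deriv η) := hη.smooth.continuous_deriv (by simp)
  have hdi : IntegrableOn (fun y => ((deriv η y : ℝ) : ℂ)) (Ioc a c) :=
    ((Complex.continuous_ofReal.comp hd).integrableOn_Icc).mono_set Ioc_subset_Icc_self
  have hpi : IntegrableOn (fun y => ((deriv η y : ℝ) : ℂ) * ∫ s in Ioc a y, f s) (Ioc a c) := by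
    have := (((Complex.continuous_ofReal.comp hd).continuousOn (s := Icc a c)).mul
      ((continuousOn_primitive_Ioc hf).mono Icc_subset_Ici_self)).integrableOn_compact
      (μ := volume) isCompact_Icc
    exact this.mono_set Ioc_subset_Icc_self
  simp only [mul_add]
  rw [integral_add (hdi.mul_const C) hpi, integral_mul_primitive hdi (hf c), integral_mul_const,
    integral_deriv_upper hη.smooth a c hac, hηc']
  have h3 : ∀ s ∈ Ioc a c, (∫ y in Ioc s c, ((deriv η y : ℝ) : ℂ)) * f s = -((η s : ℂ) * f s) := by
    intro s hs
    rw [integral_deriv_upper hη.smooth s c hs.2, hηc']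
    push_cast; ring
  rw [setIntegral_congr_fun measurableSet_Ioc h3, integral_neg]
  push_cast; ring

theorem exists_halfLine_bump (a : ℝ) :
    ∃ η : ℝ → ℝ, IsHalfLineTest a η ∧ ∫ y, η y = 1 := by
  let φ : ContDiffBump (a + 2) := ⟨1 / 2, 1, by norm_num, by norm_num⟩
  refine ⟨φ.normed volume, ⟨φ.contDiff_normed, a + 1, a + 3, by linarith, fun y hy => ?_⟩,
    φ.integral_normed⟩
  have h1 : y ∈ Function.support (φ.normed volume) := hy
  rw [φ.support_normed_eq, Metric.mem_ball, Real.dist_eq, abs_lt] at h1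
  change -1 < y - (a + 2) ∧ y - (a + 2) < 1 at h1
  constructor <;> linarith [h1.1, h1.2]

/-- Primitives of test functions of integral zero are test functions. -/
theorem exists_test_primitive {θ : ℝ → ℝ} (hθ : IsHalfLineTest a θ)
    (h0 : ∫ y, θ y = 0) : ∃ η, IsHalfLineTest a η ∧ deriv η = θ := by
  obtain ⟨b, c, hab, hbc⟩ := hθ.support
  have hcont := hθ.smooth.continuous
  have hd : ∀ y, HasDerivAt (fun y => ∫ t in b..y, θ t) (θ y) y := fun y =>
    intervalIntegral.integral_hasDerivAt_right (hcont.intervalIntegrable _ _)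
      (hcont.stronglyMeasurableAtFilter _ _) hcont.continuousAt
  have hderiv : deriv (fun y => ∫ t in b..y, θ t) = θ := funext fun y => (hd y).deriv
  refine ⟨fun y => ∫ t in b..y, θ t, ⟨?_, b, c, hab, fun y hy => ?_⟩, hderiv⟩
  · rw [contDiff_infty_iff_deriv, hderiv]
    exact ⟨fun y => (hd y).differentiableAt, hθ.smooth⟩
  · have hz : ∀ t, t < b ∨ c < t → θ t = 0 := by
      intro t ht
      by_contra h
      have := hbc t h
      rcases ht with ht | ht <;> linarith [this.1, this.2]
    refine ⟨?_, ?_⟩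
    · by_contra hlt
      push Not at hlt
      apply hy
      rw [intervalIntegral.integral_symm, intervalIntegral.integral_of_le hlt.le,
        integral_Ioc_eq_integral_Ioo, setIntegral_congr_fun measurableSet_Ioo
          (fun t ht => hz t (Or.inl ht.2))]
      simp
    · by_contra hlt
      push Not at hlt
      apply hy
      rcases le_or_gt b y with hby | hby
      · rw [intervalIntegral.integral_of_le hby, ← h0, ← integral_Icc_eq_integral_Ioc]
        refine setIntegral_eq_integral_of_forall_compl_eq_zero fun t ht => ?_
        by_contra h
        exact ht ⟨(hbc t h).1, (hbc t h).2.trans hlt.le⟩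
      · rw [intervalIntegral.integral_symm, intervalIntegral.integral_of_le hby.le,
          integral_Ioc_eq_integral_Ioo, setIntegral_congr_fun measurableSet_Ioo
            (fun t ht => hz t (Or.inl ht.2))]
        simp

theorem isHalfLineTest_of_tsupport {a : ℝ} {g : ℝ → ℝ} (hg : ContDiff ℝ ∞ g)
    (hgc : HasCompactSupport g) (hgs : tsupport g ⊆ Ioi a) : IsHalfLineTest a g := by
  refine ⟨hg, ?_⟩
  rcases (tsupport g).eq_empty_or_nonempty with he | hne
  · refine ⟨a + 1, a + 1, by linarith, fun y hy => absurd (subset_tsupport _ hy) ?_⟩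
    rw [he]; exact notMem_empty y
  · obtain ⟨b, hb⟩ := hgc.isCompact.exists_isLeast hne
    obtain ⟨c, hc⟩ := hgc.isCompact.exists_isGreatest hne
    exact ⟨b, c, hgs hb.1, fun y hy => ⟨hb.2 (subset_tsupport _ hy), hc.2 (subset_tsupport _ hy)⟩⟩

/-- **du Bois-Reymond**: a function with an integrable weak derivative is a primitive of it. -/
theorem WeakDerivOn.exists_eq_primitive {u f : ℝ → ℂ} (h : WeakDerivOn a u f)
    (hu : ∀ T, IntegrableOn u (Ioc a T)) (hf : ∀ T, IntegrableOn f (Ioc a T)) :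
    ∃ C : ℂ, ∀ᵐ y ∂volIoi a, u y = C + ∫ s in Ioc a y, f s := by
  set w : ℝ → ℂ := fun y => u y - ∫ s in Ioc a y, f s with hw
  have hprim : ∀ T, IntegrableOn (fun y => ∫ s in Ioc a y, f s) (Ioc a T) := fun T =>
    (((continuousOn_primitive_Ioc hf).mono Icc_subset_Ici_self).integrableOn_compact
      (isCompact_Icc (b := T))).mono_set Ioc_subset_Icc_self
  have hwi : ∀ T, IntegrableOn w (Ioc a T) := fun T => (hu T).sub (hprim T)
  have h1 : ∀ η, IsHalfLineTest a η → ∫ y in Ioi a, ((deriv η y : ℝ) : ℂ) * w y = 0 := by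
    intro η hη
    obtain ⟨b, c, hab, hbc⟩ := hη.support
    have hd : Continuous (deriv η) := hη.smooth.continuous_deriv (by simp)
    have hdc : ∀ y, deriv η y ≠ 0 → y ≤ c := fun y hy => by
      by_contra h2
      exact hy (deriv_eq_zero_of_upper (fun y hy => (hbc y hy).2) (not_le.mp h2))
    have hηa : η a = 0 := by
      by_contra h2; linarith [(hbc a h2).1]
    have h2 := integral_deriv_mul_primitive hf hη.isUpperTest 0
    simp only [zero_add, zero_mul, neg_zero, zero_sub] at h2
    simp only [hw, mul_sub]
    rw [integral_sub (integrableOn_mul_of_continuous hu hd hdc)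
      (integrableOn_mul_of_continuous hprim hd hdc), h η hη, h2, sub_self]
  obtain ⟨η₀, hη₀, hη₀1⟩ := exists_halfLine_bump a
  set C : ℂ := ∫ y in Ioi a, (η₀ y : ℂ) * w y with hC
  refine ⟨C, ?_⟩
  have hwC : ∀ T, IntegrableOn (fun y => w y - C) (Ioc a T) := fun T =>
    (hwi T).sub (integrableOn_const (by simp))
  have hloc : LocallyIntegrableOn (fun y => w y - C) (Ioi a) := fun x hx => by
    refine ⟨Ioc a (x + 1), ?_, hwC _⟩
    exact mem_nhdsWithin_of_mem_nhds (Ioc_mem_nhds hx (by linarith))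
  have key := isOpen_Ioi.ae_eq_zero_of_integral_contDiff_smul_eq_zero (U := Ioi a) hloc ?_
  · rw [ae_restrict_iff' measurableSet_Ioi]
    filter_upwards [key] with y hy hy'
    have := hy hy'
    simp only [hw] at this
    linear_combination this
  intro g hg hgc hgs
  have hsub : ∀ y, g y ≠ 0 → y ∈ Ioi a := fun y hy => hgs (subset_tsupport _ hy)
  have hgT := isHalfLineTest_of_tsupport hg hgc hgs
  obtain ⟨c₁, hc₁⟩ := hgT.isUpperTest.support
  obtain ⟨c₂, hc₂⟩ := hη₀.isUpperTest.support
  -- Subtracting `I` times the normalised bump leaves a test function of mean zero, hence the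
  -- derivative of a test function, against which `w` integrates to zero. So `w - C` integrates to
  -- zero against every `g`.
  set I := ∫ y, g y with hI
  have hθ : IsHalfLineTest a (fun y => g y - I * η₀ y) := by
    obtain ⟨b, c, hab, hbc⟩ := hgT.support
    obtain ⟨b', c', hab', hbc'⟩ := hη₀.support
    refine ⟨hg.sub (contDiff_const.mul hη₀.smooth), min b b', max c c', lt_min hab hab',
      fun y hy => ?_⟩
    by_cases h2 : g y = 0
    · have h3 : η₀ y ≠ 0 := by rintro h3; exact hy (by simp [h2, h3])
      exact ⟨(min_le_right _ _).trans (hbc' y h3).1, (hbc' y h3).2.trans (le_max_right _ _)⟩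
    · exact ⟨(min_le_left _ _).trans (hbc y h2).1, (hbc y h2).2.trans (le_max_left _ _)⟩
  have hη₀i : Integrable η₀ := by
    by_contra h2
    rw [integral_undef h2] at hη₀1
    exact zero_ne_one hη₀1
  have hgi : Integrable g := hg.continuous.integrable_of_hasCompactSupport hgc
  have hθ0 : ∫ y, (g y - I * η₀ y) = 0 := by
    rw [integral_sub hgi (hη₀i.const_mul I), integral_const_mul, hη₀1]
    simp [hI]
  obtain ⟨η, hη, hηd⟩ := exists_test_primitive hθ hθ0
  have h3 := h1 η hη
  rw [hηd] at h3
  have h4 : ∫ y in Ioi a, (g y : ℂ) * w y = I * C := by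
    have e1 := integrableOn_mul_of_continuous hwi hg.continuous hc₁
    have e2 := integrableOn_mul_of_continuous hwi hη₀.smooth.continuous hc₂
    have : ∀ y, ((g y - I * η₀ y : ℝ) : ℂ) * w y = (g y : ℂ) * w y - I * ((η₀ y : ℂ) * w y) := by
      intro y; push_cast; ring
    simp only [this] at h3
    rw [integral_sub e1 (e2.const_mul _), integral_const_mul] at h3
    exact sub_eq_zero.mp h3
  have h5 : ∫ y in Ioi a, (g y : ℂ) * C = I * C := by
    rw [integral_mul_const, setIntegral_eq_integral_of_forall_compl_eq_zero, integral_complex_ofReal]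
    intro y hy
    by_contra h2
    exact hy (hsub y (by simpa using h2))
  have h6 : ∫ y, g y • (w y - C) = ∫ y in Ioi a, g y • (w y - C) := by
    rw [setIntegral_eq_integral_of_forall_compl_eq_zero]
    intro y hy
    have : g y = 0 := by
      by_contra h2
      exact hy (hsub y h2)
    simp [this]
  rw [h6]
  simp only [Complex.real_smul, mul_sub]
  rw [integral_sub (integrableOn_mul_of_continuous hwi hg.continuous hc₁) ?_, h4, h5, sub_self]
  exact (hgi.ofReal (𝕜 := ℂ)).integrableOn.mul_const C

theorem exists_upperTest (a : ℝ) : ∃ η : ℝ → ℝ, IsUpperTest η ∧ η a = 1 := by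
  refine ⟨fun y => Real.smoothTransition (a + 1 - y), ⟨?_, a + 1, fun y hy => ?_⟩, ?_⟩
  · exact Real.smoothTransition.contDiff.comp (contDiff_const.sub contDiff_id)
  · by_contra h
    exact hy (Real.smoothTransition.zero_of_nonpos (by linarith))
  · exact Real.smoothTransition.one_of_one_le (by linarith)

theorem WeakDerivZeroOn.weakDerivOn {u f : ℝ → ℂ} (h : WeakDerivZeroOn a u f) :
    WeakDerivOn a u f := fun η hη => h η hη.isUpperTest

theorem WeakDerivZeroOn.eq_primitive {u f : ℝ → ℂ} (h : WeakDerivZeroOn a u f)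
    (hu : ∀ T, IntegrableOn u (Ioc a T)) (hf : ∀ T, IntegrableOn f (Ioc a T)) :
    ∀ᵐ y ∂volIoi a, u y = ∫ s in Ioc a y, f s := by
  obtain ⟨C, hC⟩ := h.weakDerivOn.exists_eq_primitive hu hf
  -- A test function equal to one at `a` isolates the boundary term `C * η a`.
  obtain ⟨η, hη, hη1⟩ := exists_upperTest a
  have h1 := h η hη
  have h2 := integral_deriv_mul_primitive hf hη C
  have h3 : ∫ y in Ioi a, ((deriv η y : ℝ) : ℂ) * u y
      = ∫ y in Ioi a, ((deriv η y : ℝ) : ℂ) * (C + ∫ s in Ioc a y, f s) := by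
    refine integral_congr_ae ?_
    filter_upwards [hC] with y hy
    rw [hy]
  rw [h3, h2, hη1] at h1
  have : C = 0 := by
    push_cast at h1
    linear_combination -h1
  filter_upwards [hC] with y hy
  rw [hy, this, zero_add]

/-- A function with a nonzero limit stays away from zero on a half line, which has infinite measure.
-/
theorem eq_zero_of_tendsto_of_integrableOn {h : ℝ → ℂ} {l : ℂ}
    (hi : IntegrableOn h (Ioi a)) (hl : Filter.Tendsto h Filter.atTop (nhds l)) : l = 0 := by
  by_contra hne
  have hpos : 0 < ‖l‖ := norm_pos_iff.mpr hne
  have h1 : ∀ᶠ y in Filter.atTop, ‖l‖ / 2 < ‖h y‖ := hl.norm.eventually (lt_mem_nhds (by linarith))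
  obtain ⟨R, hR⟩ := Filter.eventually_atTop.mp h1
  have h2 : IntegrableOn (fun _ : ℝ => ‖l‖ / 2) (Ioi (max a R)) := by
    refine Integrable.mono' ((hi.mono_set (Ioi_subset_Ioi (le_max_left _ _))).norm) (by fun_prop) ?_
    rw [ae_restrict_iff' measurableSet_Ioi]
    refine ae_of_all _ fun y hy => ?_
    rw [Real.norm_of_nonneg (by positivity)]
    exact (hR y ((le_max_right _ _).trans (le_of_lt hy))).le
  rw [integrableOn_const_iff] at h2
  rcases h2 with h2 | h2
  · simp at h2; exact hne h2
  · simp at h2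

theorem MemLp.integrableOn_Ioc {u : ℝ → ℂ}
    (hu : MemLp u 2 volIoi a) (T : ℝ) : IntegrableOn u (Ioc a T) := by
  have h1 : MemLp u 2 (volume.restrict (Ioc a T)) :=
    hu.mono_measure (Measure.restrict_mono (fun y hy => hy.1) le_rfl)
  exact h1.integrable (by norm_num)

/-- Integration by parts on a half line for square integrable functions with square integrable
derivatives, the second one vanishing at the end point. -/
theorem integral_mul_add_mul_eq_zero {v b w α : ℝ → ℂ}
    (hv : MemLp v 2 volIoi a) (hb : MemLp b 2 volIoi a)
    (hw : MemLp w 2 volIoi a) (hα : MemLp α 2 volIoi a)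
    (hvb : WeakDerivZeroOn a v b) (hwα : WeakDerivOn a w α) :
    ∫ y in Ioi a, (α y * v y + w y * b y) = 0 := by
  have hbI := MemLp.integrableOn_Ioc hb
  have hαI := MemLp.integrableOn_Ioc hα
  have e1 := hvb.eq_primitive (MemLp.integrableOn_Ioc hv) hbI
  obtain ⟨C, e2⟩ := hwα.exists_eq_primitive (MemLp.integrableOn_Ioc hw) hαI
  set v' : ℝ → ℂ := fun y => ∫ s in Ioc a y, b s with hv'
  set w' : ℝ → ℂ := fun y => C + ∫ s in Ioc a y, α s with hw'
  have hint : IntegrableOn (fun y => α y * v y + w y * b y) (Ioi a) :=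
    (MemLp.integrable_mul hα hv).add (MemLp.integrable_mul hw hb)
  -- An exact formula on `(a, T]`; there is no boundary term at `a` because `v'` starts from zero.
  have hfin : ∀ T, a ≤ T → ∫ y in Ioc a T, (α y * v y + w y * b y) = w' T * v' T := fun T hT => by
    have hsub : Ioc a T ⊆ Ioi a := fun y hy => hy.1
    have hle : volume.restrict (Ioc a T) ≤ volIoi a := Measure.restrict_mono hsub le_rfl
    have i1 : IntegrableOn (fun y => α y * v y) (Ioc a T) :=
      (MemLp.integrable_mul hα hv).mono_measure hle
    have i2 : IntegrableOn (fun y => w y * b y) (Ioc a T) :=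
      (MemLp.integrable_mul hw hb).mono_measure hle
    rw [integral_add i1 i2]
    have s1 : ∫ y in Ioc a T, α y * v y = ∫ y in Ioc a T, α y * v' y := by
      refine integral_congr_ae ?_
      filter_upwards [ae_mono hle e1] with y hy
      rw [hy]
    have s2 : ∫ y in Ioc a T, w y * b y = ∫ y in Ioc a T, w' y * b y := by
      refine integral_congr_ae ?_
      filter_upwards [ae_mono hle e2] with y hy
      rw [hy]
    rw [s1, s2, integral_mul_primitive (hαI T) (hbI T)]
    have s3 : ∀ s ∈ Ioc a T, (∫ y in Ioc s T, α y) * b s = w' T * b s - w' s * b s := fun s hs => by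
      have : ∫ y in Ioc a T, α y = (∫ y in Ioc a s, α y) + ∫ y in Ioc s T, α y := by
        rw [← setIntegral_union (Ioc_disjoint_Ioc_of_le le_rfl) measurableSet_Ioc
          (hαI s) ((hαI T).mono_set (Ioc_subset_Ioc_left hs.1.le)),
          Ioc_union_Ioc_eq_Ioc hs.1.le hs.2]
      simp only [hw', this]
      ring
    rw [setIntegral_congr_fun measurableSet_Ioc s3]
    have i3 : IntegrableOn (fun y => w' y * b y) (Ioc a T) := by
      refine i2.congr ?_
      filter_upwards [ae_mono hle e2] with y hy
      rw [hy]
    rw [integral_sub ((hbI T).const_mul _) i3, integral_const_mul]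
    ring
  have hlim : Filter.Tendsto (fun T => w' T * v' T) Filter.atTop
      (nhds (∫ y in Ioi a, (α y * v y + w y * b y))) := by
    have := intervalIntegral_tendsto_integral_Ioi a hint Filter.tendsto_id
    refine this.congr' ?_
    filter_upwards [Filter.eventually_ge_atTop a] with T hT
    rw [id, intervalIntegral.integral_of_le hT, hfin T hT]
  -- The product `w v` has a limit at infinity because the integral converges, and it is itself
  -- integrable as a product of two square integrable functions. Its limit is therefore zero.
  refine eq_zero_of_tendsto_of_integrableOn (a := a) ?_ hlim
  refine (MemLp.integrable_mul hw hv).congr ?_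
  filter_upwards [e1, e2] with y h1 h2
  simp only [Pi.mul_apply]
  rw [h1, h2]

end WeakDerivative

/-! ### Fourier modes in the horizontal variable of functions on a slab. -/

section Modes

variable {d : ℕ} {f : LayerPt d → ℂ}

/-- The product of the unit cube with a measure in the vertical variable. -/
noncomputable def slabMeasure (d : ℕ) (ν : Measure ℝ) : Measure (LayerPt d) :=
  (volume.restrict (unitCube d)).prod ν

/-- Fourier coefficients in the horizontal variable. -/
noncomputable def cMode (f : LayerPt d → ℂ) (j : Fin d → ℤ) (Y : ℝ) : ℂ :=
  charCoeff (fun X => f (X, Y)) j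

/-- Fourier coefficients of a real function, as complex numbers. -/
notation:max "rcMode " f:max => cMode (fun z => (f z : ℂ))

variable {ν : Measure ℝ} [SFinite ν]

instance : SFinite (slabMeasure d ν) := by unfold slabMeasure; infer_instance

theorem AEStronglyMeasurable.slice {E : Type*} [NormedAddCommGroup E] {f : LayerPt d → E}
    (hf : AEStronglyMeasurable f (slabMeasure d ν)) :
    ∀ᵐ Y ∂ν, AEStronglyMeasurable (fun X => f (X, Y)) (volume.restrict (unitCube d)) :=
  hf.prod_swap.prodMk_left

theorem MemLp.slice {E : Type*} [NormedAddCommGroup E] {f : LayerPt d → E}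
    (hf : MemLp f 2 (slabMeasure d ν)) :
    ∀ᵐ Y ∂ν, MemLp (fun X => f (X, Y)) 2 (volume.restrict (unitCube d)) := by
  have h1 := hf.integrable_norm_pow (by norm_num)
  have h2 := Integrable.prod_left_ae (μ := volume.restrict (unitCube d)) (ν := ν) h1
  filter_upwards [h2, AEStronglyMeasurable.slice hf.1] with Y hY hY'
  exact (memLp_two_iff_integrable_sq_norm hY').mpr (by simpa using hY)

theorem aestronglyMeasurable_cMode
    (hf : AEStronglyMeasurable f (slabMeasure d ν)) (j : Fin d → ℤ) :
    AEStronglyMeasurable (cMode f j) ν := by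
  have h1 : AEStronglyMeasurable (fun z : LayerPt d => conj (torusChar j z.1) * f z)
      (slabMeasure d ν) := ((Complex.continuous_conj.comp ((continuous_torusChar j).comp
      continuous_fst)).aestronglyMeasurable).mul hf
  exact h1.prod_swap.integral_prod_right'

theorem MemLp.integrable_slice_sq (hf : MemLp f 2 (slabMeasure d ν)) :
    Integrable (fun Y => ∫ X in unitCube d, ‖f (X, Y)‖ ^ 2) ν := by
  have h1 := hf.integrable_norm_pow (by norm_num)
  exact Integrable.integral_prod_right (μ := volume.restrict (unitCube d)) (ν := ν) h1

theorem ae_norm_cMode_sq_le (hf : MemLp f 2 (slabMeasure d ν))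
    (s : Finset (Fin d → ℤ)) :
    ∀ᵐ Y ∂ν, ∑ j ∈ s, ‖cMode f j Y‖ ^ 2 ≤ ∫ X in unitCube d, ‖f (X, Y)‖ ^ 2 := by
  filter_upwards [MemLp.slice hf] with Y hY
  exact sum_le_hasSum s (fun _ _ => by positivity) (hasSum_norm_sq_charCoeff hY)

theorem MemLp.cMode (hf : MemLp f 2 (slabMeasure d ν)) (j : Fin d → ℤ) :
    MemLp (cMode f j) 2 ν := by
  have hm := aestronglyMeasurable_cMode hf.1 j
  refine (memLp_two_iff_integrable_sq_norm hm).mpr ?_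
  refine (MemLp.integrable_slice_sq hf).mono' (hm.norm.pow 2) ?_
  filter_upwards [ae_norm_cMode_sq_le hf {j}] with Y hY
  simpa using hY

/-- Bessel's inequality on each slice bounds every finite partial sum by the squared norm of `f`. -/
theorem summable_integral_norm_cMode_sq (hf : MemLp f 2 (slabMeasure d ν)) :
    Summable fun j => ∫ Y, ‖_root_.cMode f j Y‖ ^ 2 ∂ν := by
  refine summable_of_sum_le (c := ∫ Y, (∫ X in unitCube d, ‖f (X, Y)‖ ^ 2) ∂ν)
    (fun j => by positivity) fun s => ?_
  rw [← integral_finsetSum s fun j _ => (MemLp.cMode hf j).integrable_norm_pow (by norm_num)]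
  refine integral_mono_ae (integrable_finsetSum s fun j _ =>
    (MemLp.cMode hf j).integrable_norm_pow (by norm_num)) (MemLp.integrable_slice_sq hf) ?_
  exact ae_norm_cMode_sq_le hf s

/-- Parseval's identity in the horizontal variable. -/
theorem hasSum_integral_cMode {f g : LayerPt d → ℂ} (hf : MemLp f 2 (slabMeasure d ν))
    (hg : MemLp g 2 (slabMeasure d ν)) :
    HasSum (fun j => ∫ Y, conj (cMode f j Y) * cMode g j Y ∂ν)
      (∫ z, conj (f z) * g z ∂(slabMeasure d ν)) := by
  have hint : Integrable (fun z => conj (f z) * g z) (slabMeasure d ν) := by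
    have : MemLp (fun z => conj (f z)) 2 (slabMeasure d ν) := hf.star
    exact MemLp.integrable_mul this hg
  have hmul : ∀ j, Integrable (fun Y => conj (cMode f j Y) * cMode g j Y) ν := fun j => by
    have : MemLp (fun Y => conj (cMode f j Y)) 2 ν := (MemLp.cMode hf j).star
    exact MemLp.integrable_mul this (MemLp.cMode hg j)
  have h1 := hasSum_integral_of_summable_integral_norm hmul ?_
  · have h4 : ∫ z, conj (f z) * g z ∂(slabMeasure d ν)
        = ∫ Y, ∑' j, conj (cMode f j Y) * cMode g j Y ∂ν := by
      unfold slabMeasure at hint ⊢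
      rw [integral_prod_symm _ hint]
      refine integral_congr_ae ?_
      filter_upwards [MemLp.slice hf, MemLp.slice hg] with Y h2 h3
      exact (hasSum_charCoeff h2 h3).tsum_eq.symm
    rw [h4]
    exact h1
  · have h2 := ((summable_integral_norm_cMode_sq hf).add (summable_integral_norm_cMode_sq hg))
    refine Summable.of_nonneg_of_le (fun j => by positivity) (fun j => ?_) h2
    have i1 := (MemLp.cMode hf j).integrable_norm_pow (p := 2) (by norm_num)
    have i2 := (MemLp.cMode hg j).integrable_norm_pow (p := 2) (by norm_num)
    rw [← integral_add i1 i2]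
    refine integral_mono (hmul j).norm (i1.add i2) fun Y => ?_
    simp only [norm_mul, RCLike.norm_conj]
    nlinarith [sq_nonneg (‖cMode f j Y‖ - ‖cMode g j Y‖), sq_nonneg ‖cMode f j Y‖,
      sq_nonneg ‖cMode g j Y‖]

theorem ae_eq_zero_of_cMode (hf : MemLp f 2 (slabMeasure d ν))
    (h : ∀ j, cMode f j =ᵐ[ν] 0) : f =ᵐ[slabMeasure d ν] 0 := by
  have h1 := hasSum_integral_cMode hf hf
  have h0 : ∀ j, ∫ Y, conj (cMode f j Y) * cMode f j Y ∂ν = 0 := fun j => by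
    rw [← integral_zero ℝ ℂ (μ := ν)]
    refine integral_congr_ae ?_
    filter_upwards [h j] with Y hY
    rw [hY]; simp
  simp only [h0] at h1
  have h2 := h1.unique hasSum_zero
  have h3 : ∀ z : ℂ, conj z * z = ((‖z‖ ^ 2 : ℝ) : ℂ) := by
    intro z; rw [mul_comm, Complex.mul_conj, Complex.normSq_eq_norm_sq]
  simp only [h3] at h2
  rw [integral_complex_ofReal] at h2
  have h4 : ∫ z, ‖f z‖ ^ 2 ∂(slabMeasure d ν) = 0 := by exact_mod_cast h2
  have h5 := (integral_eq_zero_iff_of_nonneg (fun X => by positivity)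
    (hf.integrable_norm_pow (by norm_num))).mp (by simpa using h4)
  filter_upwards [h5] with X hX
  simpa using hX

/-- Pairing with a product of a character and a function of the vertical variable. -/
theorem integral_char_mul (j : Fin d → ℤ) (η : ℝ → ℂ)
    (hf : Integrable (fun z : LayerPt d => η z.2 * f z) (slabMeasure d ν)) :
    ∫ z, conj (torusChar j z.1) * η z.2 * f z ∂(slabMeasure d ν) = ∫ Y, η Y * cMode f j Y ∂ν := by
  have h1 : Integrable (fun z : LayerPt d => conj (torusChar j z.1) * (η z.2 * f z))
      (slabMeasure d ν) := by
    refine hf.bdd_mul (c := 1) ?_ (ae_of_all _ fun z => by simp)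
    exact (Complex.continuous_conj.comp ((continuous_torusChar j).comp
      continuous_fst)).aestronglyMeasurable
  simp only [mul_assoc]
  unfold slabMeasure at h1 ⊢
  rw [integral_prod_symm _ h1]
  congr 1
  ext Y
  unfold cMode charCoeff
  rw [← integral_const_mul]
  congr 1
  ext X
  ring

theorem cMode_add {f g : LayerPt d → ℂ} (hf : MemLp f 2 (slabMeasure d ν))
    (hg : MemLp g 2 (slabMeasure d ν)) (j : Fin d → ℤ) :
    cMode (fun z => f z + g z) j =ᵐ[ν] fun Y => cMode f j Y + cMode g j Y := by
  filter_upwards [MemLp.slice hf, MemLp.slice hg] with Y h1 h2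
  exact charCoeff_add (h1.integrable (by norm_num)) (h2.integrable (by norm_num)) j

theorem cMode_const_mul (c : ℂ) (f : LayerPt d → ℂ) (j : Fin d → ℤ) (Y : ℝ) :
    cMode (fun z => c * f z) j Y = c * cMode f j Y := charCoeff_const_mul c _ j

theorem cMode_sum {ι : Type*} (s : Finset ι) {f : ι → LayerPt d → ℂ}
    (hf : ∀ i ∈ s, MemLp (f i) 2 (slabMeasure d ν)) (j : Fin d → ℤ) :
    cMode (fun z => ∑ i ∈ s, f i z) j =ᵐ[ν] fun Y => ∑ i ∈ s, cMode (f i) j Y := by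
  classical
  induction s using Finset.induction_on with
  | empty =>
    refine ae_of_all _ fun Y => ?_
    simp [cMode, charCoeff]
  | insert a s ha ih =>
    have h1 := cMode_add (hf a (Finset.mem_insert_self a s))
      (memLp_finsetSum s fun i hi => hf i (Finset.mem_insert_of_mem hi)) j
    have h2 := ih fun i hi => hf i (Finset.mem_insert_of_mem hi)
    simp only [Finset.sum_insert ha]
    filter_upwards [h1, h2] with Y e1 e2
    rw [e1, e2]

theorem cMode_congr_ae {f g : LayerPt d → ℂ} (h : f =ᵐ[slabMeasure d ν] g) (j : Fin d → ℤ) :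
    cMode f j =ᵐ[ν] cMode g j := by
  have h1 : ∀ᵐ z ∂(ν.prod (volume.restrict (unitCube d))), f z.swap = g z.swap :=
    (Measure.measurePreserving_swap (μ := ν)
      (ν := volume.restrict (unitCube d))).quasiMeasurePreserving.ae h
  filter_upwards [Measure.ae_ae_of_ae_prod h1] with Y hY
  exact charCoeff_congr_ae hY j

end Modes

/-! ### The shear, test functions and weak divergence equations. -/

section Tests

variable {d : ℕ} {H : (Fin d → ℝ) → ℝ} {A : Fin (d + 1) → LayerPt d → ℝ} {B : LayerPt d → ℝ}
  {φ : LayerPt d → ℝ} {ψ : LayerPt d → ℝ}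

@[simp]
theorem layerDir_last : layerDir (Fin.last d) = ((0 : Fin d → ℝ), (1 : ℝ)) := by simp [layerDir]

@[simp]
theorem layerDir_castSucc (k : Fin d) :
    layerDir k.castSucc = (Pi.single k (1 : ℝ), (0 : ℝ)) := by simp [layerDir]

@[simp]
theorem layerNormal_last (H : (Fin d → ℝ) → ℝ) (X : Fin d → ℝ) :
    layerNormal H X (Fin.last d) = -1 := by simp [layerNormal]

@[simp]
theorem layerNormal_castSucc (H : (Fin d → ℝ) → ℝ) (X : Fin d → ℝ) (k : Fin d) :
    layerNormal H X k.castSucc = -(fderiv ℝ H X (Pi.single k (1 : ℝ))) := by simp [layerNormal]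

theorem slabMeasure_restrict (S : Set ℝ) :
    slabMeasure d (volume.restrict S) = volume.restrict (unitCube d ×ˢ S) := by
  rw [slabMeasure, Measure.prod_restrict]; rfl

theorem layerMeasure_const (a : ℝ) :
    layerMeasure (fun _ : Fin d → ℝ => -a) = slabMeasure d volIoi a := by
  rw [slabMeasure_restrict, layerMeasure]
  congr 1
  ext z
  simp [layerCell]

theorem measurableSet_layerCell (hH : Measurable H) :
    MeasurableSet (layerCell H) := (measurable_fst measurableSet_unitCube).inter
    (measurableSet_lt (hH.comp measurable_fst).neg measurable_snd)

/-- The shear mapping the flat half space to the domain above the graph of `-H`. -/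
def layerShear (H : (Fin d → ℝ) → ℝ) (z : LayerPt d) : LayerPt d := (z.1, z.2 - H z.1)

/-- The inverse of `layerShear`. -/
def layerUnshear (H : (Fin d → ℝ) → ℝ) (z : LayerPt d) : LayerPt d := (z.1, z.2 + H z.1)

@[simp]
theorem layerShear_unshear (H : (Fin d → ℝ) → ℝ) (z : LayerPt d) :
    layerShear H (layerUnshear H z) = z := by simp [layerShear, layerUnshear]

@[simp]
theorem layerUnshear_shear (H : (Fin d → ℝ) → ℝ) (z : LayerPt d) :
    layerUnshear H (layerShear H z) = z := by simp [layerShear, layerUnshear]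

/-- The Lebesgue measure on one period of the flat half space `y > 0`. -/
noncomputable abbrev flatMeasure (d : ℕ) : Measure (LayerPt d) := slabMeasure d volIoi 0

/-- On each vertical line the map is the translation by `-H X`, so Fubini gives invariance of the
volume; one period of the half space `y > 0` is the preimage of the cell of the domain. -/
theorem measurePreserving_layerShear (hH : Measurable H) :
    MeasurePreserving (layerShear H) (flatMeasure d) (layerMeasure H) := by
  have h1 : MeasurePreserving (layerShear H)
      (volume : Measure (LayerPt d)) (volume : Measure (LayerPt d)) := by
    refine MeasurePreserving.skew_product (μa := (volume : Measure (Fin d → ℝ)))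
      (μc := (volume : Measure ℝ)) (f := id) (g := fun X y => y - H X)
      (MeasurePreserving.id _) ?_ ?_
    · exact measurable_snd.sub (hH.comp measurable_fst)
    · refine ae_of_all _ fun X => ?_
      exact (measurePreserving_sub_right volume (H X)).map_eq
  have h2 := h1.restrict_preimage (measurableSet_layerCell hH)
  have h3 : layerShear H ⁻¹' layerCell H = unitCube d ×ˢ Ioi 0 := by
    ext z
    simp [layerShear, layerCell]
  rw [h3] at h2
  rw [flatMeasure, slabMeasure_restrict]
  exact h2

theorem measurePreserving_layerUnshear (hH : Measurable H) :
    MeasurePreserving (layerUnshear H) (layerMeasure H) (flatMeasure d) := by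
  have h1 : Measurable (layerUnshear H) :=
    measurable_fst.prodMk (measurable_snd.add (hH.comp measurable_fst))
  refine ⟨h1, ?_⟩
  rw [← (measurePreserving_layerShear hH).map_eq,
    Measure.map_map h1 (measurePreserving_layerShear hH).measurable]
  have : layerUnshear H ∘ layerShear H = id := funext fun z => layerUnshear_shear H z
  rw [this, Measure.map_id]

theorem measurableEmbedding_layerShear (hH : Measurable H) :
    MeasurableEmbedding (layerShear H) := by
  let e : LayerPt d ≃ᵐ LayerPt d := {
      toFun := layerShear H
      invFun := layerUnshear H
      left_inv := layerUnshear_shear H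
      right_inv := layerShear_unshear H
      measurable_toFun := measurable_fst.prodMk (measurable_snd.sub (hH.comp measurable_fst))
      measurable_invFun := measurable_fst.prodMk (measurable_snd.add (hH.comp measurable_fst)) }
  exact e.measurableEmbedding

theorem integral_layerShear {E : Type*} [NormedAddCommGroup E] [NormedSpace ℝ E]
    (hH : Measurable H) (f : LayerPt d → E) :
    ∫ z, f (layerShear H z) ∂(flatMeasure d) = ∫ z, f z ∂(layerMeasure H) :=
  (measurePreserving_layerShear hH).integral_comp (measurableEmbedding_layerShear hH) f

/-- Chain rule for the composition with the inverse shear. -/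
theorem fderiv_comp_unshear {E : Type*} [NormedAddCommGroup E] [NormedSpace ℝ E]
    (hH : ContDiff ℝ ∞ H) {ψ : LayerPt d → E}
    (z v : LayerPt d) (hψ : DifferentiableAt ℝ ψ (layerUnshear H z)) :
    fderiv ℝ (fun z => ψ (layerUnshear H z)) z v =
      fderiv ℝ ψ (layerUnshear H z) (v.1, v.2 + fderiv ℝ H z.1 v.1) := by
  have h1 : HasFDerivAt H (fderiv ℝ H z.1) z.1 := ((hH.differentiable (by simp)) z.1).hasFDerivAt
  have h2 : HasFDerivAt (layerUnshear H)
      ((ContinuousLinearMap.fst ℝ (Fin d → ℝ) ℝ).prod (ContinuousLinearMap.snd ℝ (Fin d → ℝ) ℝ +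
          (fderiv ℝ H z.1).comp (ContinuousLinearMap.fst ℝ (Fin d → ℝ) ℝ))) z :=
    hasFDerivAt_fst.prodMk (hasFDerivAt_snd.add (h1.comp z hasFDerivAt_fst))
  have h3 := hψ.hasFDerivAt.comp z h2
  have h4 : (fun z => ψ (layerUnshear H z)) = ψ ∘ layerUnshear H := rfl
  rw [h4, h3.fderiv]
  simp

theorem contDiff_layerUnshear {n : WithTop ℕ∞} (hH : ContDiff ℝ n H) :
    ContDiff ℝ n (layerUnshear H) := contDiff_fst.prodMk (contDiff_snd.add (hH.comp contDiff_fst))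

theorem layerPartial_comp_unshear_last (hH : ContDiff ℝ ∞ H)
    (z : LayerPt d) (hψ : DifferentiableAt ℝ ψ (layerUnshear H z)) :
    layerPartial (Fin.last d) (fun z => ψ (layerUnshear H z)) z =
      layerPartial (Fin.last d) ψ (layerUnshear H z) := by
  unfold layerPartial
  rw [fderiv_comp_unshear hH _ _ hψ]
  simp

theorem layerPartial_comp_unshear_castSucc (hH : ContDiff ℝ ∞ H)
    (z : LayerPt d) (k : Fin d)
    (hψ : DifferentiableAt ℝ ψ (layerUnshear H z)) :
    layerPartial k.castSucc (fun z => ψ (layerUnshear H z)) z =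
      layerPartial k.castSucc ψ (layerUnshear H z) +
        fderiv ℝ H z.1 (Pi.single k 1) * layerPartial (Fin.last d) ψ (layerUnshear H z) := by
  unfold layerPartial
  rw [fderiv_comp_unshear hH _ _ hψ]
  simp only [layerDir_castSucc, layerDir_last, zero_add]
  have : ((Pi.single k (1 : ℝ) : Fin d → ℝ), fderiv ℝ H z.1 (Pi.single k 1))
      = (Pi.single k (1 : ℝ), (0 : ℝ)) + fderiv ℝ H z.1 (Pi.single k 1) • ((0 : Fin d → ℝ), (1 : ℝ)) := by
    simp
  rw [this, map_add, map_smul, smul_eq_mul]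

theorem LayerPeriodic.comp_unshear {α : Type} (hH : TorusPeriodic H)
    {ψ : LayerPt d → α} (hψ : LayerPeriodic ψ) : LayerPeriodic (fun z => ψ (layerUnshear H z)) := by
  intro Y j X
  simp only [layerUnshear]
  rw [hH j X]
  exact hψ _ j X

theorem IsInteriorTest.comp_unshear (hH : ContDiff ℝ ∞ H)
    (hHper : TorusPeriodic H) {M : ℝ} (hM : ∀ X, -M ≤ H X)
    (hψ : IsInteriorTest (fun _ => 0) ψ) : IsInteriorTest H (fun z => ψ (layerUnshear H z)) := by
  obtain ⟨δ, hδ, R, hR⟩ := hψ.support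
  refine ⟨hψ.smooth.comp (contDiff_layerUnshear hH), hψ.periodic.comp_unshear hHper, δ, hδ,
    R + M, fun z hz => ?_⟩
  have h1 := hR _ hz
  simp only [layerUnshear] at h1
  have h2 := hM z.1
  constructor <;> linarith [h1.1, h1.2]

theorem IsBoundaryTest.comp_unshear (hH : ContDiff ℝ ∞ H)
    (hHper : TorusPeriodic H) {M : ℝ} (hM : ∀ X, -M ≤ H X)
    (hψ : IsBoundaryTest ψ) : IsBoundaryTest (fun z => ψ (layerUnshear H z)) := by
  obtain ⟨R, hR⟩ := hψ.support
  refine ⟨hψ.smooth.comp (contDiff_layerUnshear hH), hψ.periodic.comp_unshear hHper,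
    R + M, fun z hz => ?_⟩
  have h1 := hR _ hz
  simp only [layerUnshear] at h1
  have h2 := hM z.1
  linarith

theorem IsInteriorTest.isBoundaryTest
    (h : IsInteriorTest H φ) : IsBoundaryTest φ :=
  ⟨h.smooth, h.periodic, let ⟨_, _, R, hR⟩ := h.support; ⟨R, fun z hz => (hR z hz).2⟩⟩

/-- The weak form `∫ A·∇φ + φ B = 0` for all interior test functions, i.e. `div A = B` in the
sense of distributions. -/
def IsWeakDiv (H : (Fin d → ℝ) → ℝ) (A : Fin (d + 1) → LayerPt d → ℝ) (B : LayerPt d → ℝ) : Prop :=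
  ∀ φ : LayerPt d → ℝ, IsInteriorTest H φ →
    ∫ z, ((∑ i, layerPartial i φ z * A i z) + φ z * B z) ∂(layerMeasure H) = 0

/-- The weak form `∫ A·∇φ + φ B = 0` for all test functions not necessarily vanishing at the
boundary, i.e. `div A = B` and the normal component of `A` vanishes at the boundary. -/
def IsWeakDivZero (H : (Fin d → ℝ) → ℝ) (A : Fin (d + 1) → LayerPt d → ℝ) (B : LayerPt d → ℝ) :
    Prop := ∀ φ : LayerPt d → ℝ, IsBoundaryTest φ →
    ∫ z, ((∑ i, layerPartial i φ z * A i z) + φ z * B z) ∂(layerMeasure H) = 0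

/-- The components of a vector field after the shear to the flat half space (Piola transform). -/
noncomputable def flatField (H : (Fin d → ℝ) → ℝ) (A : Fin (d + 1) → LayerPt d → ℝ)
    (i : Fin (d + 1)) (z : LayerPt d) : ℝ := Fin.lastCases (motive := fun _ => ℝ)
    (A (Fin.last d) (layerShear H z) +
      ∑ k : Fin d, fderiv ℝ H z.1 (Pi.single k 1) * A k.castSucc (layerShear H z))
    (fun k => A k.castSucc (layerShear H z)) i

/-- By the chain rule `∂_k (ψ ∘ unshear) = ∂_k ψ + ∂_k H ∂_y ψ`. The surplus terms all carry `∂_y ψ`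
and are collected in the vertical component of `flatField`; as the shear preserves volume, the
divergence form persists without any Jacobian. -/
theorem integral_weakForm_flat (hH : ContDiff ℝ ∞ H)
    (A : Fin (d + 1) → LayerPt d → ℝ) (B : LayerPt d → ℝ)
    (hψ : ContDiff ℝ ∞ ψ) :
    ∫ z, ((∑ i, layerPartial i (fun z => ψ (layerUnshear H z)) z * A i z) +
        ψ (layerUnshear H z) * B z) ∂(layerMeasure H) =
      ∫ z, ((∑ i, layerPartial i ψ z * flatField H A i z) + ψ z * B (layerShear H z))
        ∂(flatMeasure d) := by
  rw [← integral_layerShear hH.continuous.measurable]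
  congr 1
  ext z
  have hd : ∀ w, DifferentiableAt ℝ ψ w := fun w => (hψ.differentiable (by simp)) w
  simp only [layerUnshear_shear]
  congr 1
  rw [Fin.sum_univ_castSucc, Fin.sum_univ_castSucc, layerPartial_comp_unshear_last hH _ (hd _)]
  simp only [layerPartial_comp_unshear_castSucc hH _ _ (hd _), layerUnshear_shear, flatField,
    Fin.lastCases_last, Fin.lastCases_castSucc]
  simp only [layerShear, add_mul, Finset.sum_add_distrib, mul_add, Finset.mul_sum]
  have : ∀ k : Fin d, fderiv ℝ H z.1 (Pi.single k 1) * layerPartial (Fin.last d) ψ z *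
      A k.castSucc (z.1, z.2 - H z.1) = layerPartial (Fin.last d) ψ z *
      (fderiv ℝ H z.1 (Pi.single k 1) * A k.castSucc (z.1, z.2 - H z.1)) := fun k => by ring
  simp only [this]
  ring

theorem exists_bound_of_torusPeriodic {E : Type} [NormedAddCommGroup E] {f : (Fin d → ℝ) → E}
    (hf : Continuous f) (hper : TorusPeriodic f) : ∃ M, 0 ≤ M ∧ ∀ X, ‖f X‖ ≤ M := by
  have hK : IsCompact (univ.pi fun _ : Fin d => Icc (0 : ℝ) 1) :=
    isCompact_univ_pi fun _ => isCompact_Icc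
  obtain ⟨C, hC⟩ := hK.exists_bound_of_continuousOn hf.continuousOn
  refine ⟨max C 0, le_max_right _ _, fun X => ?_⟩
  have h1 := hper (fun k => -⌊X k⌋) X
  rw [← h1]
  refine (hC _ fun k _ => ?_).trans (le_max_left _ _)
  push_cast
  exact ⟨by linarith [Int.floor_le (X k)], by linarith [Int.lt_floor_add_one (X k)]⟩

/-- The flat profile is written `-0` to make it the case `a = 0` of the half spaces `fun _ => -a`,
for which the mode equations are stated. -/
theorem IsWeakDiv.flat (hH : ContDiff ℝ ∞ H) (hHper : TorusPeriodic H)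
    (h : IsWeakDiv H A B) :
    IsWeakDiv (fun _ => -0) (flatField H A) (fun z => B (layerShear H z)) := by
  intro ψ hψ
  obtain ⟨M, -, hM⟩ := exists_bound_of_torusPeriodic hH.continuous hHper
  rw [layerMeasure_const, ← integral_weakForm_flat hH A B hψ.smooth]
  refine h _ (IsInteriorTest.comp_unshear hH hHper (M := M) (fun X => ?_) (by simpa using hψ))
  exact (abs_le.mp (hM X)).1

theorem layerPartial_eq_zero_of_support {S : Set (LayerPt d)}
    (hS : IsClosed S) (h : ∀ z, φ z ≠ 0 → z ∈ S) (i : Fin (d + 1)) {z : LayerPt d} (hz : z ∉ S) :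
    layerPartial i φ z = 0 := by
  have : φ =ᶠ[nhds z] fun _ => 0 := by
    filter_upwards [hS.isOpen_compl.mem_nhds hz] with w hw
    by_contra h2
    exact hw (h w h2)
  rw [layerPartial, this.fderiv_eq]
  simp

/-- Restriction of a weak divergence equation to a half space contained in the domain. -/
theorem IsWeakDiv.restrict (hHc : Measurable H) {a : ℝ}
    (ha : ∀ X, -H X ≤ a)
    (h : IsWeakDiv H A B) : IsWeakDiv (fun _ => -a) A B := by
  intro φ hφ
  obtain ⟨δ, hδ, R, hR⟩ := hφ.support
  -- Test functions supported strictly above `a` are also admissible in the larger domain.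
  have h1 : IsInteriorTest H φ := ⟨hφ.smooth, hφ.periodic, δ, hδ, R, fun z hz => by
    have := hR z hz
    exact ⟨by linarith [ha z.1, this.1], this.2⟩⟩
  rw [← h φ h1, layerMeasure, layerMeasure]
  symm
  refine setIntegral_eq_of_subset_of_forall_sdiff_eq_zero (measurableSet_layerCell hHc)
    (fun z hz => ⟨hz.1, lt_of_le_of_lt (ha z.1) (by simpa using hz.2)⟩) fun z hz => ?_
  have hcl : IsClosed {z : LayerPt d | a + δ ≤ z.2} := isClosed_le continuous_const continuous_snd
  have hz2 : z ∉ {z : LayerPt d | a + δ ≤ z.2} := fun h3 => by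
    have h3' : a + δ ≤ z.2 := h3
    exact hz.2 ⟨hz.1.1, by simp only [neg_neg]; linarith⟩
  have hsup : ∀ z, φ z ≠ 0 → z ∈ {z : LayerPt d | a + δ ≤ z.2} := fun z hz => by
    have := (hR z hz).1; simpa using this
  have h0 : φ z = 0 := by
    by_contra h3; exact hz2 (hsup z h3)
  simp [layerPartial_eq_zero_of_support hcl hsup _ hz2, h0]

end Tests

/-! ### Mode equations derived from a weak divergence equation. -/

section ModeEquations

variable {d : ℕ} {a : ℝ} {A : Fin (d + 1) → LayerPt d → ℝ} {B : LayerPt d → ℝ} {f : LayerPt d → ℂ}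
  {η : ℝ → ℝ}

/-- Square integrability on the bounded parts of a half space. -/
def SlabL2 (a : ℝ) (f : LayerPt d → ℂ) : Prop :=
  ∀ T, MemLp f 2 (slabMeasure d (volume.restrict (Ioc a T)))

theorem slabMeasure_mono {S T : Set ℝ} (h : S ⊆ T) :
    slabMeasure d (volume.restrict S) ≤ slabMeasure d (volume.restrict T) := by
  rw [slabMeasure_restrict, slabMeasure_restrict]
  exact Measure.restrict_mono (Set.prod_mono le_rfl h) le_rfl

theorem MemLp.slabL2
    (hf : MemLp f 2 (slabMeasure d volIoi a)) : SlabL2 a f := fun _ =>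
  hf.mono_measure (slabMeasure_mono fun _ hy => hy.1)

theorem SlabL2.add {f g : LayerPt d → ℂ} (hf : SlabL2 a f) (hg : SlabL2 a g) :
    SlabL2 a (fun z => f z + g z) := fun T => (hf T).add (hg T)

theorem SlabL2.const_mul (hf : SlabL2 a f) (c : ℂ) :
    SlabL2 a (fun z => c * f z) := fun T => (hf T).const_mul c

theorem integrable_slab_Ioi {a c : ℝ}
    (hf : Integrable f (slabMeasure d (volume.restrict (Ioc a c))))
    (h0 : ∀ z, c < z.2 → f z = 0) :
    Integrable f (slabMeasure d volIoi a) := by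
  rw [slabMeasure_restrict] at hf ⊢
  refine IntegrableOn.of_forall_sdiff_eq_zero hf (measurableSet_unitCube.prod measurableSet_Ioi)
    fun z hz => h0 z ?_
  by_contra h
  exact hz.2 ⟨hz.1.1, hz.1.2, not_lt.mp h⟩

theorem SlabL2.integrable_mul (hf : SlabL2 a f) {θ : ℝ → ℝ}
    (hθ : Continuous θ) {c : ℝ} (hc : ∀ y, θ y ≠ 0 → y ≤ c) :
    Integrable (fun z : LayerPt d => (θ z.2 : ℂ) * f z)
      (slabMeasure d volIoi a) := by
  refine integrable_slab_Ioi (c := c) ?_ fun z hz => ?_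
  · obtain ⟨C, hC⟩ := isCompact_Icc.exists_bound_of_continuousOn (s := Icc a c) hθ.continuousOn
    have : IsFiniteMeasure (slabMeasure d (volume.restrict (Ioc a c))) := by
      unfold slabMeasure; infer_instance
    refine ((hf c).integrable (by norm_num)).bdd_mul (c := C) ?_ ?_
    · exact (Complex.continuous_ofReal.comp (hθ.comp continuous_snd)).aestronglyMeasurable
    · rw [slabMeasure_restrict, ae_restrict_iff' (measurableSet_unitCube.prod measurableSet_Ioc)]
      refine ae_of_all _ fun z hz => ?_
      simpa using hC z.2 (Ioc_subset_Icc_self hz.2)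
  · have : θ z.2 = 0 := by
      by_contra h
      exact absurd (hc _ h) (not_le.mpr hz)
    simp [this]

theorem SlabL2.cMode_memLp (hf : SlabL2 a f) (j : Fin d → ℤ) (T : ℝ) :
    MemLp (cMode f j) 2 (volume.restrict (Ioc a T)) := MemLp.cMode (hf T) j

theorem SlabL2.cMode_integrableOn (hf : SlabL2 a f)
    (j : Fin d → ℤ) (T : ℝ) : IntegrableOn (cMode f j) (Ioc a T) :=
  (hf.cMode_memLp j T).integrable (by norm_num)

theorem fderiv_torusChar (j : Fin d → ℤ) (X : Fin d → ℝ) (k : Fin d) :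
    fderiv ℝ (torusChar j) X (Pi.single k 1) = 2 * π * Complex.I * j k * torusChar j X := by
  have h1 : HasFDerivAt (fun X : Fin d → ℝ => 2 * π * (∑ k, (j k : ℝ) * X k))
      ((2 * π) • ∑ k, (j k : ℝ) • ContinuousLinearMap.proj (R := ℝ) (φ := fun _ => ℝ) k) X := by
    refine HasFDerivAt.const_mul ?_ _
    refine HasFDerivAt.fun_sum fun k _ => ?_
    exact (hasFDerivAt_apply k X).const_mul _
  have h2 := ((Complex.ofRealCLM.hasFDerivAt.comp X h1).mul_const Complex.I).cexp
  have h3 : fderiv ℝ (torusChar j) X = _ := h2.fderiv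
  rw [h3]
  simp [torusChar, Pi.single_apply]
  ring

/-- The restriction of a complex test function `e_{-j}(X) η(Y)` to the reals. -/
theorem contDiff_charTest (L : ℂ →L[ℝ] ℝ) (j : Fin d → ℤ) (hη : ContDiff ℝ ∞ η) :
    ContDiff ℝ ∞ (fun z : LayerPt d => L (torusChar j z.1) * η z.2) :=
  (L.contDiff.comp ((contDiff_torusChar j).comp contDiff_fst)).mul (hη.comp contDiff_snd)

theorem periodic_charTest (L : ℂ →L[ℝ] ℝ) (j : Fin d → ℤ) (η : ℝ → ℝ) :
    LayerPeriodic (fun z : LayerPt d => L (torusChar j z.1) * η z.2) := by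
  intro Y l X
  simp only [torusChar_periodic j l X]

theorem isInteriorTest_charTest (L : ℂ →L[ℝ] ℝ) (j : Fin d → ℤ)
    (hη : IsHalfLineTest a η) :
    IsInteriorTest (fun _ => -a) (fun z : LayerPt d => L (torusChar j z.1) * η z.2) := by
  obtain ⟨b, c, hab, hbc⟩ := hη.support
  refine ⟨contDiff_charTest L j hη.smooth, periodic_charTest L j η, b - a, by linarith, c,
    fun z hz => ?_⟩
  have := hbc z.2 (right_ne_zero_of_mul hz)
  exact ⟨by linarith [this.1], this.2⟩

theorem isBoundaryTest_charTest (L : ℂ →L[ℝ] ℝ) (j : Fin d → ℤ)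
    (hη : IsUpperTest η) :
    IsBoundaryTest (fun z : LayerPt d => L (torusChar j z.1) * η z.2) := by
  obtain ⟨c, hc⟩ := hη.support
  exact ⟨contDiff_charTest L j hη.smooth, periodic_charTest L j η, c, fun z hz =>
    hc z.2 (right_ne_zero_of_mul hz)⟩

theorem hasFDerivAt_charTest (L : ℂ →L[ℝ] ℝ) (j : Fin d → ℤ) (hη : ContDiff ℝ ∞ η)
    (z : LayerPt d) :
    HasFDerivAt (fun z : LayerPt d => L (torusChar j z.1) * η z.2)
      (L (torusChar j z.1) • (deriv η z.2) • ContinuousLinearMap.snd ℝ (Fin d → ℝ) ℝ +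
        η z.2 • (L.comp ((fderiv ℝ (torusChar j) z.1).comp
          (ContinuousLinearMap.fst ℝ (Fin d → ℝ) ℝ)))) z := by
  have h1 : HasFDerivAt (torusChar j) (fderiv ℝ (torusChar j) z.1) z.1 :=
    (((contDiff_torusChar j).differentiable (by simp)) z.1).hasFDerivAt
  have h2 : HasDerivAt η (deriv η z.2) z.2 := ((hη.differentiable (by simp)) z.2).hasDerivAt
  have h3 := L.hasFDerivAt.comp z (h1.comp z hasFDerivAt_fst)
  have h4 := h2.comp_hasFDerivAt z (hasFDerivAt_snd (𝕜 := ℝ) (p := z))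
  exact h3.mul h4

theorem layerPartial_charTest_last (L : ℂ →L[ℝ] ℝ) (j : Fin d → ℤ)
    (hη : ContDiff ℝ ∞ η) (z : LayerPt d) :
    layerPartial (Fin.last d) (fun z : LayerPt d => L (torusChar j z.1) * η z.2) z =
      L (torusChar j z.1) * deriv η z.2 := by
  rw [layerPartial, (hasFDerivAt_charTest L j hη z).fderiv]
  simp

theorem layerPartial_charTest_castSucc (L : ℂ →L[ℝ] ℝ) (j : Fin d → ℤ)
    (hη : ContDiff ℝ ∞ η) (z : LayerPt d) (k : Fin d) :
    layerPartial k.castSucc (fun z : LayerPt d => L (torusChar j z.1) * η z.2) z =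
      L (2 * π * Complex.I * j k * torusChar j z.1) * η z.2 := by
  rw [layerPartial, (hasFDerivAt_charTest L j hη z).fderiv]
  simp [fderiv_torusChar, mul_comm]

/-- The two real test functions `Re e_{-j}(X) η(Y)`, `Im e_{-j}(X) η(Y)` in a weak divergence
equation yield the equation for the Fourier modes. -/
theorem weakForm_modes
    (hA : ∀ i, SlabL2 a (fun z => (A i z : ℂ))) (hB : SlabL2 a (fun z => (B z : ℂ)))
    (j : Fin d → ℤ) (hη : IsUpperTest η)
    (h : ∀ L : ℂ →L[ℝ] ℝ, ∫ z, ((∑ i, layerPartial i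
      (fun z : LayerPt d => L (torusChar (-j) z.1) * η z.2) z * A i z) +
        (L (torusChar (-j) z.1) * η z.2) * B z) ∂(slabMeasure d volIoi a) = 0) :
    ∫ y in Ioi a, ((deriv η y : ℝ) : ℂ) * rcMode (A (Fin.last d)) j y =
      -∫ y in Ioi a, (η y : ℂ) * (rcMode B j y - ∑ k : Fin d, 2 * π * Complex.I * j k *
          rcMode (A k.castSucc) j y) := by
  obtain ⟨c, hc⟩ := hη.support
  set μ := slabMeasure d volIoi a with hμ
  have hηc := hη.smooth.continuous
  have hd : Continuous (deriv η) := hη.smooth.continuous_deriv (by simp)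
  have hdc : ∀ y, deriv η y ≠ 0 → y ≤ c := fun y hy => by
    by_contra h2
    exact hy (deriv_eq_zero_of_upper hc (not_le.mp h2))
  have hbd : ∀ {g : LayerPt d → ℂ}, Integrable g μ →
      Integrable (fun z : LayerPt d => torusChar (-j) z.1 * g z) μ := fun {g} hg =>
    hg.bdd_mul (c := 1) ((continuous_torusChar (-j)).comp continuous_fst).aestronglyMeasurable
      (ae_of_all _ fun z => by simp)
  have iA : ∀ i, Integrable (fun z : LayerPt d => (η z.2 : ℂ) * (A i z : ℂ)) μ := fun i =>
    (hA i).integrable_mul hηc hc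
  have iB : Integrable (fun z : LayerPt d => (η z.2 : ℂ) * (B z : ℂ)) μ := hB.integrable_mul hηc hc
  have iD : Integrable (fun z : LayerPt d => ((deriv η z.2 : ℝ) : ℂ) * (A (Fin.last d) z : ℂ)) μ :=
    (hA _).integrable_mul hd hdc
  -- The pairing with the real test function built from `L` is `L` of the integral of `Ψ`; the real
  -- and imaginary parts as `L` show that this integral vanishes. The character is `e_{-j} = conj
  -- e_j`, hence the factors `-j k`.
  set Ψ : LayerPt d → ℂ := fun z =>
    (∑ k : Fin d, (2 * π * Complex.I * (-j k : ℤ)) *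
        (torusChar (-j) z.1 * ((η z.2 : ℂ) * (A k.castSucc z : ℂ))) +
      torusChar (-j) z.1 * (((deriv η z.2 : ℝ) : ℂ) * (A (Fin.last d) z : ℂ))) +
      torusChar (-j) z.1 * ((η z.2 : ℂ) * (B z : ℂ)) with hΨ
  have iΨ : Integrable Ψ μ :=
    ((integrable_finsetSum _ fun k _ => (hbd (iA _)).const_mul _).add (hbd iD)).add (hbd iB)
  have hL : ∀ (L : ℂ →L[ℝ] ℝ) (z : LayerPt d), (∑ i, layerPartial i
      (fun z : LayerPt d => L (torusChar (-j) z.1) * η z.2) z * A i z) +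
        (L (torusChar (-j) z.1) * η z.2) * B z = L (Ψ z) := by
    intro L z
    rw [Fin.sum_univ_castSucc, layerPartial_charTest_last L _ hη.smooth]
    simp only [layerPartial_charTest_castSucc L _ hη.smooth, hΨ, map_add, map_sum]
    have hr : ∀ (w : ℂ) (x y : ℝ), L (w * ((x : ℂ) * (y : ℂ))) = L w * x * y := fun w x y => by
      have : w * ((x : ℂ) * (y : ℂ)) = (x * y) • w := by rw [Complex.real_smul]; push_cast; ring
      rw [this, map_smul, smul_eq_mul]; ring
    have hr2 : ∀ (v w : ℂ) (x y : ℝ), L (v * (w * ((x : ℂ) * (y : ℂ)))) = L (v * w) * x * y := by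
      intro v w x y
      rw [← mul_assoc, hr]
    simp only [hr, hr2, Pi.neg_apply]
  have h0 : ∫ z, Ψ z ∂μ = 0 := by
    have e : ∀ L : ℂ →L[ℝ] ℝ, L (∫ z, Ψ z ∂μ) = 0 := fun L => by
      rw [← L.integral_comp_comm iΨ, ← h L]
      exact integral_congr_ae (ae_of_all _ fun z => (hL L z).symm)
    exact Complex.ext (e Complex.reCLM) (e Complex.imCLM)
  have hp : ∀ (θ : ℝ → ℝ) (f : LayerPt d → ℂ),
      Integrable (fun z : LayerPt d => (θ z.2 : ℂ) * f z) μ →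
      ∫ z, torusChar (-j) z.1 * ((θ z.2 : ℂ) * f z) ∂μ
        = ∫ y in Ioi a, (θ y : ℂ) * cMode f j y := by
    intro θ f hf
    rw [← integral_char_mul (ν := volIoi a) j (fun y => (θ y : ℂ)) hf]
    congr 1
    ext z
    rw [torusChar_neg]; ring
  have mB := integrableOn_mul_of_continuous (a := a) (hB.cMode_integrableOn j) hηc hc
  have mA := fun i => integrableOn_mul_of_continuous (a := a) ((hA i).cMode_integrableOn j) hηc hc
  have i1 : Integrable (fun z : LayerPt d => ∑ k : Fin d, (2 * π * Complex.I * (-j k : ℤ)) *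
      (torusChar (-j) z.1 * ((η z.2 : ℂ) * (A k.castSucc z : ℂ)))) μ :=
    integrable_finsetSum _ fun k _ => (hbd (iA _)).const_mul _
  have e0 : ∫ z, Ψ z ∂μ = (∫ z : LayerPt d, ∑ k : Fin d, (2 * π * Complex.I * (-j k : ℤ)) *
        (torusChar (-j) z.1 * ((η z.2 : ℂ) * (A k.castSucc z : ℂ))) ∂μ) +
      (∫ z : LayerPt d, torusChar (-j) z.1 * (((deriv η z.2 : ℝ) : ℂ) * (A (Fin.last d) z : ℂ)) ∂μ) +
      ∫ z : LayerPt d, torusChar (-j) z.1 * ((η z.2 : ℂ) * (B z : ℂ)) ∂μ := by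
    rw [← integral_add i1 (hbd iD)]
    exact integral_add (i1.add (hbd iD)) (hbd iB)
  rw [e0, integral_finsetSum _ (fun k _ => (hbd (iA _)).const_mul _)] at h0
  simp only [integral_const_mul] at h0
  rw [hp _ _ iB, hp _ _ iD] at h0
  simp only [hp _ _ (iA _)] at h0
  have hexp : ∫ y in Ioi a, (η y : ℂ) * (rcMode B j y -
        ∑ k : Fin d, 2 * π * Complex.I * j k * rcMode (A k.castSucc) j y)
      = (∫ y in Ioi a, (η y : ℂ) * rcMode B j y) -
        ∑ k : Fin d, 2 * π * Complex.I * j k *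
          ∫ y in Ioi a, (η y : ℂ) * rcMode (A k.castSucc) j y := by
    simp only [← integral_const_mul]
    rw [← integral_finsetSum _ (fun k _ => (mA _).const_mul _), ← integral_sub mB
      (integrable_finsetSum _ fun k _ => (mA _).const_mul _)]
    congr 1
    ext y
    rw [mul_sub, Finset.mul_sum]
    congr 1
    refine Finset.sum_congr rfl fun k _ => ?_
    ring
  rw [hexp]
  have hneg : ∑ k : Fin d, 2 * π * Complex.I * ((-j k : ℤ) : ℂ) *
          ∫ y in Ioi a, (η y : ℂ) * rcMode (A k.castSucc) j y
      = -∑ k : Fin d, 2 * π * Complex.I * j k *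
          ∫ y in Ioi a, (η y : ℂ) * rcMode (A k.castSucc) j y := by
    rw [← Finset.sum_neg_distrib]
    refine Finset.sum_congr rfl fun k _ => ?_
    push_cast; ring
  rw [hneg] at h0
  linear_combination h0

theorem IsWeakDiv.modes
    (h : IsWeakDiv (fun _ => -a) A B)
    (hA : ∀ i, SlabL2 a (fun z => (A i z : ℂ))) (hB : SlabL2 a (fun z => (B z : ℂ)))
    (j : Fin d → ℤ) :
    WeakDerivOn a (rcMode (A (Fin.last d)) j)
      (fun y => rcMode B j y -
        ∑ k : Fin d, 2 * π * Complex.I * j k * rcMode (A k.castSucc) j y) := by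
  intro η hη
  refine weakForm_modes hA hB j hη.isUpperTest fun L => ?_
  rw [← layerMeasure_const]
  exact h _ (isInteriorTest_charTest L (-j) hη)

theorem IsWeakDivZero.modes
    (h : IsWeakDivZero (fun _ => -a) A B)
    (hA : ∀ i, SlabL2 a (fun z => (A i z : ℂ))) (hB : SlabL2 a (fun z => (B z : ℂ)))
    (j : Fin d → ℤ) :
    WeakDerivZeroOn a (rcMode (A (Fin.last d)) j)
      (fun y => rcMode B j y -
        ∑ k : Fin d, 2 * π * Complex.I * j k * rcMode (A k.castSucc) j y) := by
  intro η hη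
  refine weakForm_modes hA hB j hη fun L => ?_
  rw [← layerMeasure_const]
  exact h _ (isBoundaryTest_charTest L (-j) hη)

end ModeEquations

/-! ### Functions of zero trace and their gradients in flat coordinates. -/

section ZeroTrace

variable {d : ℕ} {H : (Fin d → ℝ) → ℝ} {φ : LayerPt d → ℝ} {V : LayerPt d → ℝ} {R : ℝ}

/-- Square integrability on the parts of the domain that are bounded above. -/
def LayerLocL2 (H : (Fin d → ℝ) → ℝ) (V : LayerPt d → ℝ) : Prop :=
  ∀ R : ℝ, MemLp V 2 ((layerMeasure H).restrict {z | z.2 < R})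

theorem MemLp.layerLocL2
    (h : MemLp V 2 (layerMeasure H)) : LayerLocL2 H V := fun _ => h.restrict _

theorem layerMeasure_restrict_lt_top {M : ℝ} (hM : ∀ X, H X ≤ M) (R : ℝ) :
    (layerMeasure H) {z | z.2 < R} < ⊤ := by
  have h1 : (layerMeasure H) {z | z.2 < R} ≤ volume (unitCube d ×ˢ Ioo (-M) R) := by
    rw [layerMeasure, Measure.restrict_apply (measurableSet_lt measurable_snd measurable_const)]
    refine measure_mono fun z hz => ⟨hz.2.1, ?_, hz.1⟩
    have := hz.2.2
    linarith [hM z.1]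
  refine h1.trans_lt ?_
  have h2 : volume (unitCube d ×ˢ Ioo (-M) R) = volume (unitCube d) * volume (Ioo (-M) R) :=
    Measure.prod_prod _ _
  rw [h2, volume_unitCube]
  simp

theorem bounded_of_layerTest {E : Type} [NormedAddCommGroup E] {φ : LayerPt d → E}
    (hc : Continuous φ) (hper : LayerPeriodic φ) (hR : ∀ z, φ z ≠ 0 → z.2 ≤ R) (m : ℝ) :
    ∃ C, ∀ z : LayerPt d, m ≤ z.2 → ‖φ z‖ ≤ C := by
  have hK : IsCompact ((univ.pi fun _ : Fin d => Icc (0 : ℝ) 1) ×ˢ Icc m R) :=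
    (isCompact_univ_pi fun _ => isCompact_Icc).prod isCompact_Icc
  obtain ⟨C, hC⟩ := hK.exists_bound_of_continuousOn hc.continuousOn
  refine ⟨max C 0, fun z hz => ?_⟩
  by_cases h0 : φ z = 0
  · simp [h0]
  have h1 := hper z.2 (fun k => -⌊z.1 k⌋) z.1
  have h1' : φ (fun k => z.1 k + ((-⌊z.1 k⌋ : ℤ) : ℝ), z.2) = φ z := h1
  rw [← h1']
  refine (hC (fun k => z.1 k + ((-⌊z.1 k⌋ : ℤ) : ℝ), z.2) ⟨fun k _ => ?_, hz, hR z h0⟩).trans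
    (le_max_left _ _)
  push_cast
  exact ⟨by linarith [Int.floor_le (z.1 k)], by linarith [Int.lt_floor_add_one (z.1 k)]⟩

theorem LayerLocL2.integrable_test_mul (hH : Continuous H)
    (hHper : TorusPeriodic H) (hV : LayerLocL2 H V)
    (hc : Continuous φ) (hper : LayerPeriodic φ) (hR : ∀ z, φ z ≠ 0 → z.2 ≤ R) :
    Integrable (fun z => φ z * V z) (layerMeasure H) := by
  obtain ⟨M, -, hM⟩ := exists_bound_of_torusPeriodic hH hHper
  obtain ⟨C, hC⟩ := bounded_of_layerTest hc hper hR (-M)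
  have hfin : IsFiniteMeasure ((layerMeasure H).restrict {z | z.2 < R + 1}) :=
    ⟨by rw [Measure.restrict_apply_univ]
        exact layerMeasure_restrict_lt_top (fun X => (abs_le.mp (hM X)).2) _⟩
  have h1 : IntegrableOn (fun z => φ z * V z) {z | z.2 < R + 1} (layerMeasure H) := by
    refine ((hV (R + 1)).integrable (by norm_num)).bdd_mul (c := C) hc.aestronglyMeasurable ?_
    refine ae_restrict_of_ae ?_
    rw [layerMeasure, ae_restrict_iff' (measurableSet_layerCell hH.measurable)]
    refine ae_of_all _ fun z hz => hC z ?_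
    have := hz.2
    linarith [(abs_le.mp (hM z.1)).2]
  rw [← integrableOn_univ]
  refine h1.of_forall_sdiff_eq_zero MeasurableSet.univ fun z hz => ?_
  have : φ z = 0 := by
    by_contra h
    exact hz.2 (show z.2 < R + 1 by linarith [hR z h])
  simp [this]

theorem continuous_layerPartial (hφ : ContDiff ℝ 1 φ) (i : Fin (d + 1)) :
    Continuous (layerPartial i φ) := (hφ.continuous_fderiv (by norm_num)).clm_apply continuous_const

theorem periodic_layerPartial (hper : LayerPeriodic φ) (i : Fin (d + 1)) :
    LayerPeriodic (layerPartial i φ) := by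
  intro Y j X
  have h1 : (fun z : LayerPt d => φ (z + ((fun k => (j k : ℝ)), 0))) = φ := by
    ext z
    have := hper z.2 j z.1
    rw [show z + ((fun k => (j k : ℝ)), (0 : ℝ)) = (fun k => z.1 k + (j k : ℝ), z.2) by
      ext <;> simp]
    exact this
  have h2 : fderiv ℝ φ ((X, Y) + ((fun k => (j k : ℝ)), 0)) = fderiv ℝ φ (X, Y) := by
    conv_rhs => rw [← h1]
    rw [fderiv_comp_add_right]
  have h3 : ((fun k => X k + (j k : ℝ), Y) : LayerPt d) = (X, Y) + ((fun k => (j k : ℝ)), 0) := by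
    ext <;> simp
  simp only [layerPartial]
  rw [h3, h2]

theorem support_layerPartial (hR : ∀ z, φ z ≠ 0 → z.2 ≤ R)
    (i : Fin (d + 1)) : ∀ z, layerPartial i φ z ≠ 0 → z.2 ≤ R := by
  intro z hz
  by_contra h
  exact hz (layerPartial_eq_zero_of_support (S := {z : LayerPt d | z.2 ≤ R})
    (isClosed_le continuous_snd continuous_const) hR i h)

/-- Pairs of a function and its square integrable weak gradient, with vanishing trace. -/
structure IsZeroTracePair (H : (Fin d → ℝ) → ℝ) (V : LayerPt d → ℝ)
    (g : Fin (d + 1) → LayerPt d → ℝ) : Prop where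
  locL2 : LayerLocL2 H V
  memLp : ∀ i, MemLp (g i) 2 (layerMeasure H)
  green : ∀ φ : LayerPt d → ℝ, IsBoundaryTest φ → ∀ i,
    ∫ z, (layerPartial i φ z * V z + φ z * g i z) ∂(layerMeasure H) = 0

theorem IsBoundaryTest.integrable_mul (hH : Continuous H)
    (hHper : TorusPeriodic H) (hφ : IsBoundaryTest φ)
    (hV : LayerLocL2 H V) : Integrable (fun z => φ z * V z) (layerMeasure H) :=
  let ⟨_, hR⟩ := hφ.support
  hV.integrable_test_mul hH hHper hφ.smooth.continuous hφ.periodic hR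

theorem IsBoundaryTest.integrable_partial_mul (hH : Continuous H)
    (hHper : TorusPeriodic H) (hφ : IsBoundaryTest φ)
    (hV : LayerLocL2 H V) (i : Fin (d + 1)) :
    Integrable (fun z => layerPartial i φ z * V z) (layerMeasure H) := let ⟨_, hR⟩ := hφ.support
  hV.integrable_test_mul hH hHper (continuous_layerPartial (hφ.smooth.of_le (by simp)) i)
    (periodic_layerPartial hφ.periodic i) (support_layerPartial hR i)

/-- The gradient in flat coordinates. -/
noncomputable def flatGrad (H : (Fin d → ℝ) → ℝ) (g : Fin (d + 1) → LayerPt d → ℝ)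
    (i : Fin (d + 1)) (z : LayerPt d) : ℝ :=
  Fin.lastCases (motive := fun _ => ℝ) (g (Fin.last d) (layerShear H z))
    (fun k => g k.castSucc (layerShear H z) -
      fderiv ℝ H z.1 (Pi.single k 1) * g (Fin.last d) (layerShear H z)) i

@[simp]
theorem flatGrad_last (H : (Fin d → ℝ) → ℝ) (g : Fin (d + 1) → LayerPt d → ℝ) :
    flatGrad H g (Fin.last d) = fun z => g (Fin.last d) (layerShear H z) := by
  ext z; simp [flatGrad]

@[simp]
theorem flatGrad_castSucc (H : (Fin d → ℝ) → ℝ) (g : Fin (d + 1) → LayerPt d → ℝ) (k : Fin d) :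
    flatGrad H g k.castSucc = fun z => g k.castSucc (layerShear H z) -
      fderiv ℝ H z.1 (Pi.single k 1) * g (Fin.last d) (layerShear H z) := by ext z; simp [flatGrad]

theorem contDiff_partial_profile (hH : ContDiff ℝ ∞ H) (k : Fin d) :
    ContDiff ℝ ∞ (fun X => fderiv ℝ H X (Pi.single k 1)) :=
  (hH.fderiv_right (m := ∞) (by simp)).clm_apply contDiff_const

theorem periodic_partial_profile (hper : TorusPeriodic H) (k : Fin d) :
    TorusPeriodic (fun X => fderiv ℝ H X (Pi.single k 1)) := by
  intro j X
  have h1 : (fun X : Fin d → ℝ => H (X + fun k => (j k : ℝ))) = H := funext fun X => hper j X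
  have h2 : fderiv ℝ H (X + fun k => (j k : ℝ)) = fderiv ℝ H X := by
    conv_rhs => rw [← h1]
    rw [fderiv_comp_add_right]
  have h3 : (fun k => X k + (j k : ℝ)) = X + fun k => (j k : ℝ) := rfl
  simp only [h3, h2]

theorem IsBoundaryTest.profile_mul (hφ : IsBoundaryTest φ)
    {f : (Fin d → ℝ) → ℝ} (hf : ContDiff ℝ ∞ f) (hper : TorusPeriodic f) :
    IsBoundaryTest (fun z => f z.1 * φ z) := by
  obtain ⟨R, hR⟩ := hφ.support
  refine ⟨(hf.comp contDiff_fst).mul hφ.smooth, fun Y j X => ?_, R,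
    fun z hz => hR z (right_ne_zero_of_mul hz)⟩
  have e1 := hper j X
  have e2 := hφ.periodic Y j X
  simp only at e1 e2
  simp only [e1, e2]

theorem layerPartial_profile_mul (hφ : Differentiable ℝ φ) {f : (Fin d → ℝ) → ℝ}
    (hf : ContDiff ℝ ∞ f) (i : Fin (d + 1)) (z : LayerPt d) :
    layerPartial i (fun z => f z.1 * φ z) z =
      f z.1 * layerPartial i φ z + fderiv ℝ f z.1 (layerDir i).1 * φ z := by
  have f1 : HasFDerivAt (fun z : LayerPt d => f z.1)
      ((fderiv ℝ f z.1).comp (ContinuousLinearMap.fst ℝ (Fin d → ℝ) ℝ)) z :=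
    ((hf.differentiable (by simp)) z.1).hasFDerivAt.comp z hasFDerivAt_fst
  have f4 : fderiv ℝ (fun z => f z.1 * φ z) z = _ :=
    (f1.mul (hφ z).hasFDerivAt).fderiv
  rw [layerPartial, f4]
  simp [layerPartial]
  ring

/-- Multiplication by a bounded continuous profile. -/
theorem memLp_bounded_profile_mul {f : (Fin d → ℝ) → ℝ} (hf : Continuous f)
    (hper : TorusPeriodic f) {μ : Measure (LayerPt d)} {v : LayerPt d → ℝ} (hv : MemLp v 2 μ) :
    MemLp (fun z => f z.1 * v z) 2 μ := by
  obtain ⟨M, -, hM⟩ := exists_bound_of_torusPeriodic hf hper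
  have h1 : MemLp (fun z : LayerPt d => f z.1) ⊤ μ :=
    memLp_top_of_bound (hf.comp continuous_fst).aestronglyMeasurable M
      (ae_of_all _ fun z => hM z.1)
  exact hv.mul h1

theorem IsBoundaryTest.integrable_green (hH : Continuous H) (hHper : TorusPeriodic H)
    (hφ : IsBoundaryTest φ) (hV : LayerLocL2 H V) {g : LayerPt d → ℝ}
    (hg : MemLp g 2 (layerMeasure H)) (i : Fin (d + 1)) :
    Integrable (fun z => layerPartial i φ z * V z + φ z * g z) (layerMeasure H) :=
  (hφ.integrable_partial_mul hH hHper hV i).add (hφ.integrable_mul hH hHper (MemLp.layerLocL2 hg))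

theorem memLp_profile_mul (hH : ContDiff ℝ ∞ H) (hper : TorusPeriodic H)
    (k : Fin d) {μ : Measure (LayerPt d)} {f : LayerPt d → ℝ} (hf : MemLp f 2 μ) :
    MemLp (fun z => fderiv ℝ H z.1 (Pi.single k 1) * f z) 2 μ :=
  memLp_bounded_profile_mul (contDiff_partial_profile hH k).continuous
    (periodic_partial_profile hper k) hf

theorem MemLp.flat (hH : Measurable H) {f : LayerPt d → ℝ}
    (hf : MemLp f 2 (layerMeasure H)) : MemLp (fun z => f (layerShear H z)) 2 (flatMeasure d) :=
  hf.comp_measurePreserving (measurePreserving_layerShear hH)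

theorem LayerLocL2.flat (hH : Measurable H) {M : ℝ} (hM : ∀ X, -M ≤ H X)
    (hV : LayerLocL2 H V) :
    LayerLocL2 (fun _ : Fin d → ℝ => -0) (fun z => V (layerShear H z)) := by
  intro R
  rw [layerMeasure_const]
  have h1 := (measurePreserving_layerShear hH).restrict_preimage
    (measurableSet_lt measurable_snd measurable_const : MeasurableSet {z : LayerPt d | z.2 < R + M})
  have h2 := (hV (R + M)).comp_measurePreserving h1
  refine h2.mono_measure (Measure.restrict_mono (fun z hz => ?_) le_rfl)
  have hz' : z.2 < R := hz
  show z.2 - H z.1 < R + M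
  linarith [hM z.1]

theorem LayerLocL2.slabL2 {a : ℝ} (hV : LayerLocL2 (fun _ => -a) V) :
    SlabL2 a (fun z => (V z : ℂ)) := by
  intro T
  have h1 := hV (T + 1)
  rw [layerMeasure_const, slabMeasure_restrict, Measure.restrict_restrict
    (measurableSet_lt measurable_snd measurable_const)] at h1
  rw [slabMeasure_restrict]
  refine MemLp.ofReal (h1.mono_measure (Measure.restrict_mono (fun z hz => ?_) le_rfl))
  exact ⟨show z.2 < T + 1 by linarith [hz.2.2], hz.1, hz.2.1⟩

/-- For `φ = ψ ∘ unshear` one has `(∂_k ψ) ∘ unshear = ∂_k φ - ∂_k H ∂_y φ`. The second term is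
handled by Green's formula in the vertical direction with the test function `∂_k H φ`, which is
legitimate because `∂_k H` depends on `X` only. -/
theorem IsZeroTracePair.flat (hH : ContDiff ℝ ∞ H)
    (hHper : TorusPeriodic H) {g : Fin (d + 1) → LayerPt d → ℝ}
    (h : IsZeroTracePair H V g) :
    IsZeroTracePair (fun _ => -0) (fun z => V (layerShear H z)) (flatGrad H g) := by
  obtain ⟨M, -, hM⟩ := exists_bound_of_torusPeriodic hH.continuous hHper
  have hM' : ∀ X, -M ≤ H X := fun X => (abs_le.mp (hM X)).1
  have hHm := hH.continuous.measurable
  refine ⟨h.locL2.flat hHm hM', fun i => ?_, fun ψ hψ i => ?_⟩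
  · rw [layerMeasure_const]
    refine Fin.lastCases ?_ (fun k => ?_) i
    · rw [flatGrad_last]
      exact MemLp.flat hHm (h.memLp (Fin.last d))
    · rw [flatGrad_castSucc]
      exact (MemLp.flat hHm (h.memLp k.castSucc)).sub
        (memLp_profile_mul hH hHper k (MemLp.flat hHm (h.memLp (Fin.last d))))
  · have hφ := hψ.comp_unshear hH hHper hM'
    have hd : ∀ w, DifferentiableAt ℝ ψ w := fun w => (hψ.smooth.differentiable (by simp)) w
    rw [layerMeasure_const]
    refine Fin.lastCases ?_ (fun k => ?_) i
    · refine Eq.trans ?_ (h.green _ hφ (Fin.last d))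
      rw [← integral_layerShear hHm]
      congr 1
      ext z
      simp only [layerPartial_comp_unshear_last hH _ (hd _), layerUnshear_shear, flatGrad_last]
    · set φ : LayerPt d → ℝ := fun z => ψ (layerUnshear H z) with hφdef
      set χ : LayerPt d → ℝ := fun z => fderiv ℝ H z.1 (Pi.single k 1) * φ z with hχdef
      have hχ : IsBoundaryTest χ :=
        hφ.profile_mul (contDiff_partial_profile hH k) (periodic_partial_profile hHper k)
      have hχl : ∀ z, layerPartial (Fin.last d) χ z =
          fderiv ℝ H z.1 (Pi.single k 1) * layerPartial (Fin.last d) φ z := fun z => by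
        rw [hχdef, layerPartial_profile_mul (hφ.smooth.differentiable (by simp))
          (contDiff_partial_profile hH k), layerDir_last, map_zero, zero_mul, _root_.add_zero]
      have e1 := h.green φ hφ k.castSucc
      have e2 := h.green χ hχ (Fin.last d)
      have i1 := hφ.integrable_green hH.continuous hHper h.locL2 (h.memLp k.castSucc) k.castSucc
      have i2 := hχ.integrable_green hH.continuous hHper h.locL2 (h.memLp (Fin.last d)) (Fin.last d)
      have e4 : ∫ z, ((layerPartial k.castSucc φ z * V z + φ z * g k.castSucc z) -
          (layerPartial (Fin.last d) χ z * V z + χ z * g (Fin.last d) z)) ∂(layerMeasure H)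
          = 0 := by
        rw [integral_sub i1 i2, e1, e2, sub_zero]
      refine Eq.trans ?_ e4
      rw [← integral_layerShear hHm]
      congr 1
      ext z
      rw [hχl, hφdef, layerPartial_comp_unshear_last hH _ (hd _),
        layerPartial_comp_unshear_castSucc hH _ _ (hd _)]
      simp only [hχdef, hφdef, layerUnshear_shear, flatGrad_castSucc]
      simp only [layerShear]
      ring

end ZeroTrace

/-! ### Orthogonality of divergence free fields and gradients of zero trace functions. -/

section OrthogonalityOfGradients

variable {d : ℕ} {a : ℝ} {H : (Fin d → ℝ) → ℝ} {A : Fin (d + 1) → LayerPt d → ℝ}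

theorem ae_eq_zero_of_halfLineTest {f : ℝ → ℂ} (hf : ∀ T, IntegrableOn f (Ioc a T))
    (h : ∀ η : ℝ → ℝ, IsHalfLineTest a η → ∫ y in Ioi a, (η y : ℂ) * f y = 0) :
    f =ᵐ[volIoi a] 0 := by
  have hloc : LocallyIntegrableOn f (Ioi a) := fun x hx =>
    ⟨Ioc a (x + 1), mem_nhdsWithin_of_mem_nhds (Ioc_mem_nhds hx (by linarith)), hf _⟩
  have key := isOpen_Ioi.ae_eq_zero_of_integral_contDiff_smul_eq_zero (U := Ioi a) hloc ?_
  · exact (ae_restrict_iff' measurableSet_Ioi).mpr key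
  intro g hg hgc hgs
  have hsub : ∀ y, g y ≠ 0 → y ∈ Ioi a := fun y hy => hgs (subset_tsupport _ hy)
  have hgT := isHalfLineTest_of_tsupport hg hgc hgs
  rw [← h g hgT, setIntegral_eq_integral_of_forall_compl_eq_zero]
  · simp only [Complex.real_smul]
  · intro y hy
    have : g y = 0 := by
      by_contra h2; exact hy (hsub y h2)
    simp [this]

theorem WeakDerivOn.conj {u f : ℝ → ℂ} (h : WeakDerivOn a u f) :
    WeakDerivOn a (fun y => conj (u y)) (fun y => conj (f y)) := by
  intro η hη
  have h1 := congrArg conj (h η hη)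
  rw [map_neg, ← integral_conj, ← integral_conj] at h1
  simpa using h1

theorem cMode_zero (j : Fin d → ℤ) (Y : ℝ) : cMode (fun _ => 0) j Y = 0 := by
  simp [cMode, charCoeff]

theorem ae_slab_of_forall_Ioc {p : LayerPt d → Prop}
    (h : ∀ T, ∀ᵐ z ∂(slabMeasure d (volume.restrict (Ioc a T))), p z) :
    ∀ᵐ z ∂(slabMeasure d volIoi a), p z := by
  have h1 : unitCube d ×ˢ Ioi a = ⋃ n : ℕ, unitCube d ×ˢ Ioc a n := by
    ext z
    simp only [mem_prod, mem_Ioi, mem_iUnion, mem_Ioc]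
    constructor
    · rintro ⟨h1, h2⟩
      obtain ⟨n, hn⟩ := exists_nat_ge z.2
      exact ⟨n, h1, h2, hn⟩
    · rintro ⟨n, h1, h2, -⟩
      exact ⟨h1, h2⟩
  rw [slabMeasure_restrict, h1, ae_restrict_iUnion_iff]
  intro n
  rw [← slabMeasure_restrict]
  exact h n

theorem ae_Ioi_of_forall_Ioc {p : ℝ → Prop}
    (h : ∀ T, ∀ᵐ y ∂(volume.restrict (Ioc a T)), p y) :
    ∀ᵐ y ∂volIoi a, p y := by
  have h1 : Ioi a = ⋃ n : ℕ, Ioc a n := by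
    ext z
    simp only [mem_Ioi, mem_iUnion, mem_Ioc]
    constructor
    · intro h2
      obtain ⟨n, hn⟩ := exists_nat_ge z
      exact ⟨n, h2, hn⟩
    · rintro ⟨n, h2, -⟩
      exact h2
  rw [h1, ae_restrict_iUnion_iff]
  exact fun n => h n

/-- Functions on a half space all of whose Fourier modes vanish. -/
theorem SlabL2.ae_eq_zero {f : LayerPt d → ℂ} (hf : SlabL2 a f)
    (h : ∀ j, cMode f j =ᵐ[volIoi a] 0) :
    f =ᵐ[slabMeasure d volIoi a] 0 := by
  refine ae_slab_of_forall_Ioc fun T => ?_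
  exact ae_eq_zero_of_cMode (hf T) fun j =>
    ae_mono (Measure.restrict_mono (fun y hy => hy.1) le_rfl) (h j)

variable {V : LayerPt d → ℝ} {g : Fin (d + 1) → LayerPt d → ℝ}

theorem MemLp.slab_ofReal {f : LayerPt d → ℝ}
    (hf : MemLp f 2 (layerMeasure (fun _ : Fin d → ℝ => -a))) :
    MemLp (fun z => (f z : ℂ)) 2 (slabMeasure d volIoi a) := by
  rw [layerMeasure_const] at hf
  exact hf.ofReal

/-- Green's formula in direction `i` is the weak divergence equation of the field `V e_i`; in this
way the mode equations of divergences apply to single partial derivatives. -/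
theorem IsZeroTracePair.weakDivZero (h : IsZeroTracePair H V g)
    (i : Fin (d + 1)) : IsWeakDivZero H (fun l z => if l = i then V z else 0) (g i) := by
  intro φ hφ
  refine Eq.trans ?_ (h.green φ hφ i)
  congr 1
  ext z
  simp

theorem IsZeroTracePair.modes_last (h : IsZeroTracePair (fun _ => -a) V g) (j : Fin d → ℤ) :
    WeakDerivZeroOn a (rcMode V j)
      (rcMode (g (Fin.last d)) j) := by
  have h1 := (h.weakDivZero (Fin.last d)).modes (fun l => ?_)
    (MemLp.slabL2 (MemLp.slab_ofReal (h.memLp (Fin.last d)))) j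
  · have h2 : ∀ k : Fin d, (k.castSucc = Fin.last d) = False := fun k => by simp
    simpa [h2, cMode_zero] using h1
  · by_cases hl : l = Fin.last d
    · simpa [hl] using h.locL2.slabL2
    · simp only [hl, if_false]
      intro T; simp

/-- The field `V e_k` has no vertical component, so its mode equation contains no derivative of the
test function and reduces to an identity almost everywhere. -/
theorem IsWeakDiv.modes_castSucc {V g : LayerPt d → ℝ} {k : Fin d}
    (h : IsWeakDiv (fun _ => -a) (fun l z => if l = k.castSucc then V z else 0) g)
    (hV : SlabL2 a (fun z => (V z : ℂ))) (hg : SlabL2 a (fun z => (g z : ℂ))) (j : Fin d → ℤ) :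
    rcMode g j =ᵐ[volIoi a]
      fun y => 2 * π * Complex.I * j k * rcMode V j y := by
  have h1 := h.modes (fun l => ?_) hg j
  · have h2 : (Fin.last d = k.castSucc) = False := by simpa using (Fin.castSucc_lt_last k).ne'
    have h3 : ∀ k' : Fin d, (k'.castSucc = k.castSucc) = (k' = k) := fun k' => by simp
    simp only [h2, h3, if_false] at h1
    have h4 : ∀ k' y, cMode (fun z => ((if k' = k then V z else 0 : ℝ) : ℂ)) j y
        = if k' = k then rcMode V j y else 0 := by
      intro k' y
      split_ifs
      · rfl
      · simp [cMode_zero]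
    simp only [h4, mul_ite, mul_zero, Finset.sum_ite_eq', Finset.mem_univ, if_true] at h1
    have h5 := ae_eq_zero_of_halfLineTest (a := a) (f := fun y =>
      rcMode g j y -
        2 * π * Complex.I * j k * rcMode V j y) (fun T => ?_) ?_
    · filter_upwards [h5] with y hy
      exact sub_eq_zero.mp hy
    · exact (hg.cMode_integrableOn j T).sub ((hV.cMode_integrableOn j T).const_mul _)
    · intro η hη
      have h6 := h1 η hη
      simpa [cMode_zero] using h6
  · by_cases hl : l = k.castSucc
    · simpa [hl] using hV
    · simp only [hl, if_false]
      intro T; simp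

theorem IsWeakDiv.modes_last {V g : LayerPt d → ℝ}
    (h : IsWeakDiv (fun _ => -a) (fun l z => if l = Fin.last d then V z else 0) g)
    (hV : SlabL2 a (fun z => (V z : ℂ))) (hg : SlabL2 a (fun z => (g z : ℂ))) (j : Fin d → ℤ) :
    WeakDerivOn a (rcMode V j) (rcMode g j) := by
  have h1 := h.modes (fun l => ?_) hg j
  · have h2 : ∀ k : Fin d, (k.castSucc = Fin.last d) = False := fun k => by simp
    simpa [h2, cMode_zero] using h1
  · by_cases hl : l = Fin.last d
    · simpa [hl] using hV
    · simp only [hl, if_false]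
      intro T; simp

theorem IsWeakDivZero.isWeakDiv
    {B : LayerPt d → ℝ} (h : IsWeakDivZero H A B) : IsWeakDiv H A B :=
  fun φ hφ => h φ hφ.isBoundaryTest

theorem IsZeroTracePair.modes_castSucc (h : IsZeroTracePair (fun _ => -a) V g) (j : Fin d → ℤ)
    (k : Fin d) :
    rcMode (g k.castSucc) j =ᵐ[volIoi a]
      fun y => 2 * π * Complex.I * j k * rcMode V j y :=
  (h.weakDivZero k.castSucc).isWeakDiv.modes_castSucc h.locL2.slabL2
    (MemLp.slabL2 (MemLp.slab_ofReal (h.memLp k.castSucc))) j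

/-- A function of zero trace and zero gradient vanishes. -/
theorem IsZeroTracePair.ae_eq_zero (hH : ContDiff ℝ ∞ H)
    (hHper : TorusPeriodic H) (h : IsZeroTracePair H V g)
    (hg : ∀ i, g i =ᵐ[layerMeasure H] 0) : V =ᵐ[layerMeasure H] 0 := by
  have hm := hH.continuous.measurable
  have hf := h.flat hH hHper
  have h1 : (fun z => ((V (layerShear H z) : ℝ) : ℂ)) =ᵐ[flatMeasure d] 0 := by
    refine SlabL2.ae_eq_zero hf.locL2.slabL2 fun j => ?_
    have h2 := (hf.modes_last j).eq_primitive (hf.locL2.slabL2.cMode_integrableOn j)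
      ((MemLp.slabL2 (MemLp.slab_ofReal (hf.memLp (Fin.last d)))).cMode_integrableOn j)
    have h3 : (fun z => (flatGrad H g (Fin.last d) z : ℂ)) =ᵐ[flatMeasure d] fun _ => 0 := by
      have := (measurePreserving_layerShear hm).quasiMeasurePreserving.ae (hg (Fin.last d))
      filter_upwards [this] with z hz
      simp [hz]
    have h4 := cMode_congr_ae h3 j
    filter_upwards [h2] with y hy
    rw [hy, setIntegral_congr_ae (g := fun _ => 0) measurableSet_Ioc]
    · simp
    · rw [Filter.EventuallyEq, ae_restrict_iff' measurableSet_Ioi] at h4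
      filter_upwards [h4] with s hs hs'
      rw [hs hs'.1, cMode_zero]
  have h5 := (measurePreserving_layerUnshear hm).quasiMeasurePreserving.ae h1
  filter_upwards [h5] with z hz
  simpa using hz

/-- The Piola transform of a field and the change of variables of a gradient are dual to each other:
the terms with `∂_k H` cancel. -/
theorem sum_flatField_mul_flatGrad (H : (Fin d → ℝ) → ℝ) (A : Fin (d + 1) → LayerPt d → ℝ)
    (g : Fin (d + 1) → LayerPt d → ℝ) (z : LayerPt d) :
    ∑ i, flatField H A i z * flatGrad H g i z =
      ∑ i, A i (layerShear H z) * g i (layerShear H z) := by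
  rw [Fin.sum_univ_castSucc, Fin.sum_univ_castSucc]
  simp only [flatGrad_last, flatGrad_castSucc, flatField, Fin.lastCases_last,
    Fin.lastCases_castSucc, mul_sub, Finset.sum_sub_distrib, add_mul, Finset.sum_mul]
  have : ∀ k : Fin d, fderiv ℝ H z.1 (Pi.single k 1) * A k.castSucc (layerShear H z) *
      g (Fin.last d) (layerShear H z) = A k.castSucc (layerShear H z) *
      (fderiv ℝ H z.1 (Pi.single k 1) * g (Fin.last d) (layerShear H z)) := fun k => by ring
  simp only [this]
  ring

theorem memLp_flatField (hH : ContDiff ℝ ∞ H) (hHper : TorusPeriodic H)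
    (hA : ∀ i, MemLp (A i) 2 (layerMeasure H))
    (i : Fin (d + 1)) : MemLp (flatField H A i) 2 (flatMeasure d) := by
  have hm := hH.continuous.measurable
  refine Fin.lastCases ?_ (fun k => ?_) i
  · have : flatField H A (Fin.last d) = fun z => A (Fin.last d) (layerShear H z) +
        ∑ k : Fin d, fderiv ℝ H z.1 (Pi.single k 1) * A k.castSucc (layerShear H z) := by
      ext z; simp [flatField]
    rw [this]
    exact (MemLp.flat hm (hA _)).add (memLp_finsetSum _ fun k _ =>
      memLp_profile_mul hH hHper k (MemLp.flat hm (hA _)))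
  · have : flatField H A k.castSucc = fun z => A k.castSucc (layerShear H z) := by
      ext z; simp [flatField]
    rw [this]
    exact MemLp.flat hm (hA _)

/-- Orthogonality, mode by mode, of a divergence free field and of a gradient. -/
theorem sum_integral_mode_mul_eq_zero {v : ℝ → ℂ} {b w : Fin (d + 1) → ℝ → ℂ}
    (j : Fin d → ℤ) (hb : ∀ i, MemLp (b i) 2 volIoi a)
    (hw : ∀ i, MemLp (w i) 2 volIoi a)
    (hv : WeakDerivZeroOn a v (b (Fin.last d)))
    (hk : ∀ k : Fin d, b k.castSucc =ᵐ[volIoi a] fun y => 2 * π * Complex.I * j k * v y)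
    (hwd : WeakDerivOn a (w (Fin.last d))
      fun y => ∑ k : Fin d, 2 * π * Complex.I * j k * w k.castSucc y) :
    ∑ i, ∫ y in Ioi a, w i y * b i y = 0 := by
  rw [Fin.sum_univ_castSucc]
  -- For the mean, `v` need not be square integrable, so the integration by parts used for the other
  -- modes does not apply. Instead the horizontal `b` vanish, and the vertical `w` is a constant in
  -- `L²`, hence zero.
  by_cases hj : j = 0
  · subst hj
    simp only [Pi.zero_apply, Int.cast_zero, mul_zero, zero_mul, Finset.sum_const_zero] at hwd hk
    obtain ⟨C, hC⟩ := hwd.exists_eq_primitive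
      (MemLp.integrableOn_Ioc (hw (Fin.last d))) (fun T => integrableOn_zero)
    have hC0 : C = 0 := by
      have h2 := (hw (Fin.last d)).integrable_norm_pow (p := 2) (by norm_num)
      have h3 : IntegrableOn (fun _ : ℝ => ‖C‖ ^ 2) (Ioi a) := by
        refine h2.congr ?_
        filter_upwards [hC] with y hy
        rw [hy]; simp
      have h4 := eq_zero_of_tendsto_of_integrableOn (h := fun _ => ((‖C‖ ^ 2 : ℝ) : ℂ))
        (Integrable.ofReal (𝕜 := ℂ) (f := fun _ => ‖C‖ ^ 2) h3) tendsto_const_nhds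
      simpa using h4
    have e1 : ∀ k : Fin d, ∫ y in Ioi a, w k.castSucc y * b k.castSucc y = 0 := fun k => by
      rw [← integral_zero ℝ ℂ (μ := volIoi a)]
      refine integral_congr_ae ?_
      filter_upwards [hk k] with y hy
      rw [hy]; simp
    simp only [e1, Finset.sum_const_zero, zero_add]
    rw [← integral_zero ℝ ℂ (μ := volIoi a)]
    refine integral_congr_ae ?_
    filter_upwards [hC] with y hy
    rw [hy, hC0]; simp
  · obtain ⟨k₀, hk₀⟩ : ∃ k, j k ≠ 0 := by
      by_contra h2; push Not at h2; exact hj (funext h2)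
    -- A horizontal derivative with `j k₀ ≠ 0` is a nonzero multiple of `v`.
    have v2 : MemLp v 2 volIoi a := by
      have h2 : MemLp (fun y => (2 * π * Complex.I * j k₀)⁻¹ * b k₀.castSucc y) 2
        volIoi a := (hb _).const_mul _
      refine (memLp_congr_ae ?_).mp h2
      filter_upwards [hk k₀] with y hy
      rw [hy, inv_mul_cancel_left₀]
      have h3 : (j k₀ : ℂ) ≠ 0 := by exact_mod_cast hk₀
      have h4 : (π : ℂ) ≠ 0 := by exact_mod_cast Real.pi_ne_zero
      exact mul_ne_zero (mul_ne_zero (mul_ne_zero two_ne_zero h4) Complex.I_ne_zero) h3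
    have α2 : MemLp (fun y => ∑ k : Fin d, 2 * (π : ℂ) * Complex.I * j k *
        w k.castSucc y) 2 volIoi a := memLp_finsetSum _ fun k _ => (hw k.castSucc).const_mul _
    have key := integral_mul_add_mul_eq_zero v2 (hb (Fin.last d)) (hw (Fin.last d)) α2 hv hwd
    have i1 : ∀ i, Integrable (fun y => w i y * b i y) volIoi a := fun i =>
      MemLp.integrable_mul (hw _) (hb _)
    rw [← integral_finsetSum _ (fun k _ => i1 _), ← integral_add
      (integrable_finsetSum _ fun k _ => i1 _) (i1 _), ← key]
    refine integral_congr_ae ?_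
    have hk' := ae_all_iff.mpr hk
    filter_upwards [hk'] with y hy
    congr 1
    rw [Finset.sum_mul]
    refine Finset.sum_congr rfl fun k _ => ?_
    rw [hy k]
    ring

/-- Weakly divergence free fields are orthogonal to gradients of functions of zero trace. -/
theorem IsWeakDiv.integral_mul_grad_eq_zero (hH : ContDiff ℝ ∞ H)
    (hHper : TorusPeriodic H)
    (hA : ∀ i, MemLp (A i) 2 (layerMeasure H)) (hdiv : IsWeakDiv H A (fun _ => 0))
    (h : IsZeroTracePair H V g) :
    ∫ z, ∑ i, A i z * g i z ∂(layerMeasure H) = 0 := by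
  have hm := hH.continuous.measurable
  have hf := h.flat hH hHper
  have hdf := hdiv.flat hH hHper
  rw [← integral_layerShear hm]
  simp only [← sum_flatField_mul_flatGrad]
  set A' := flatField H A with hA'
  set g' := flatGrad H g with hg'
  set V' : LayerPt d → ℝ := fun z => V (layerShear H z) with hV'
  have mA : ∀ i, MemLp (A' i) 2 (flatMeasure d) := memLp_flatField hH hHper hA
  have mg : ∀ i, MemLp (g' i) 2 (flatMeasure d) := fun i => by
    have := hf.memLp i
    rwa [layerMeasure_const] at this
  have mAc : ∀ i, MemLp (fun z => (A' i z : ℂ)) 2 (flatMeasure d) := fun i => (mA i).ofReal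
  have mgc : ∀ i, MemLp (fun z => (g' i z : ℂ)) 2 (flatMeasure d) := fun i => (mg i).ofReal
  set ν := (volIoi (0 : ℝ) : Measure ℝ) with hν
  have a2 : ∀ i j, MemLp (fun y => conj (rcMode (A' i) j y)) 2 ν :=
    fun i j => (MemLp.cMode (mAc i) j).star
  have g2 : ∀ i j, MemLp (rcMode (g' i) j) 2 ν := fun i j => MemLp.cMode (mgc i) j
  have hsum := hasSum_sum (s := Finset.univ) fun i _ => hasSum_integral_cMode (mAc i) (mgc i)
  -- Parseval reduces the claim to one identity per frequency, so zero trace functions need not be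
  -- approximated by compactly supported ones.
  have hzero : ∀ j : Fin d → ℤ, ∑ i, ∫ y, conj (rcMode (A' i) j y) * rcMode (g' i) j y ∂ν = 0 := by
    intro j
    have hwd := (hdf.modes (fun i => MemLp.slabL2 (mAc i)) (by intro T; simp) j).conj
    simp only [Complex.ofReal_zero, cMode_zero, zero_sub, map_neg, map_sum, map_mul,
      Complex.conj_I, Complex.conj_ofReal, map_ofNat, map_intCast] at hwd
    have hV := hf.modes_last j
    have hk := fun k => hf.modes_castSucc j k
    refine sum_integral_mode_mul_eq_zero (v := rcMode V' j) j (fun i => g2 i j)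
      (fun i => a2 i j) hV hk ?_
    convert hwd using 2 with y
    rw [← Finset.sum_neg_distrib]
    refine Finset.sum_congr rfl fun k _ => ?_
    ring
  have h1 := (hsum.congr_fun fun j => (hzero j).symm).unique hasSum_zero
  have h2 : ∀ i, ∫ z, conj ((A' i z : ℂ)) * (g' i z : ℂ) ∂(flatMeasure d)
      = ((∫ z, A' i z * g' i z ∂(flatMeasure d) : ℝ) : ℂ) := by
    intro i
    rw [← integral_complex_ofReal]
    simp
  simp only [h2] at h1
  refine (integral_finsetSum _ fun i _ => MemLp.integrable_mul (mA i) (mg i)).trans ?_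
  exact_mod_cast h1

end OrthogonalityOfGradients

/-! ### Green's formula for smooth functions. -/

section Green

variable {d : ℕ} {H : (Fin d → ℝ) → ℝ} {ψ : LayerPt d → ℝ} {R : ℝ}

/-- The integral of a derivative of a periodic function vanishes. -/
theorem integral_unitCube_partial {E : Type} [NormedAddCommGroup E] [NormedSpace ℝ E]
    [CompleteSpace E] {f : (Fin d → ℝ) → E} (hf : ContDiff ℝ 1 f)
    (hper : TorusPeriodic f) (k : Fin d) :
    ∫ X in unitCube d, fderiv ℝ f X (Pi.single k 1) = 0 := by
  obtain ⟨n, rfl⟩ : ∃ n, d = n + 1 := ⟨d - 1, by have := k.pos; omega⟩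
  have hcont : Continuous fun X => fderiv ℝ f X (Pi.single k 1) :=
    (hf.continuous_fderiv (by norm_num)).clm_apply continuous_const
  have h1 : ∫ X in unitCube (n + 1), fderiv ℝ f X (Pi.single k 1) =
      ∫ X in Icc (0 : Fin (n + 1) → ℝ) 1, fderiv ℝ f X (Pi.single k 1) := by
    rw [unitCube]
    exact setIntegral_congr_set (Measure.univ_pi_Ico_ae_eq_Icc
      (μ := fun _ : Fin (n + 1) => (volume : Measure ℝ)) (f := fun _ => (0 : ℝ))
      (g := fun _ => (1 : ℝ)))
  have key := integral_divergence_of_hasFDerivAt_off_countable' (E := E) (0 : Fin (n + 1) → ℝ) 1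
    (fun i => by simp) (fun i X => if i = k then f X else 0)
    (fun i X => if i = k then fderiv ℝ f X else 0) ∅ countable_empty
    (fun i => by
      by_cases h : i = k
      · simpa [h] using hf.continuous.continuousOn
      · simpa [h] using continuousOn_const)
    (fun X _ i => by
      by_cases h : i = k
      · simpa [h] using ((hf.differentiable (by norm_num)) X).hasFDerivAt
      · simpa [h] using hasFDerivAt_const (0 : E) X)
    (by
      refine Continuous.integrableOn_Icc ?_
      refine continuous_finsetSum _ fun i _ => ?_
      by_cases h : i = k
      · subst h; simpa using hcont
      · simpa [h] using continuous_const)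
  have h2 : ∀ X : Fin (n + 1) → ℝ, ∑ i, (if i = k then fderiv ℝ f X else 0) (Pi.single i 1)
      = fderiv ℝ f X (Pi.single k 1) := by
    intro X
    rw [Finset.sum_eq_single k (fun i _ hi => by simp [hi]) (by simp)]
    simp
  rw [h1, ← integral_congr_ae (ae_of_all _ h2), key]
  -- The contributions of opposite faces of the cube cancel by periodicity.
  refine Finset.sum_eq_zero fun i _ => ?_
  rw [sub_eq_zero]
  congr 1
  ext x
  by_cases h : i = k
  · subst h
    simp only [if_true]
    have h3 := hper (Pi.single i 1) (i.insertNth 0 x)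
    simp only [Pi.zero_apply, Pi.one_apply] at h3 ⊢
    rw [← h3]
    congr 1
    ext l
    refine Fin.succAboveCases i ?_ (fun m => ?_) l
    · simp
    · simp [Fin.succAbove_ne]
  · simp [h]

theorem integrable_of_layerTest {E : Type} [NormedAddCommGroup E] {φ : LayerPt d → E}
    (hc : Continuous φ) (hper : LayerPeriodic φ) (hR : ∀ z, φ z ≠ 0 → z.2 ≤ R) :
    Integrable φ (flatMeasure d) := by
  obtain ⟨C, hC⟩ := bounded_of_layerTest hc hper hR 0
  have hfin : IsFiniteMeasure (slabMeasure d (volume.restrict (Ioc 0 R))) := by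
    unfold slabMeasure; infer_instance
  have h1 : IntegrableOn φ (unitCube d ×ˢ Ioc 0 R) := by
    rw [IntegrableOn, ← slabMeasure_restrict]
    refine Integrable.of_bound hc.aestronglyMeasurable C ?_
    rw [slabMeasure_restrict, ae_restrict_iff' (measurableSet_unitCube.prod measurableSet_Ioc)]
    exact ae_of_all _ fun z hz => hC z hz.2.1.le
  rw [flatMeasure, slabMeasure_restrict]
  refine IntegrableOn.of_forall_sdiff_eq_zero h1 (measurableSet_unitCube.prod measurableSet_Ioi)
    fun z hz => ?_
  by_contra h
  exact hz.2 ⟨hz.1.1, hz.1.2, hR z h⟩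

theorem integral_flat_partial_castSucc (hψ : ContDiff ℝ 1 ψ)
    (hper : LayerPeriodic ψ) (hR : ∀ z, ψ z ≠ 0 → z.2 ≤ R) (k : Fin d) :
    ∫ z, layerPartial k.castSucc ψ z ∂(flatMeasure d) = 0 := by
  have hi := integrable_of_layerTest (continuous_layerPartial hψ k.castSucc)
    (periodic_layerPartial hper k.castSucc) (support_layerPartial hR k.castSucc)
  rw [flatMeasure, slabMeasure] at hi ⊢
  rw [integral_prod_symm _ hi]
  refine integral_eq_zero_of_ae (ae_of_all _ fun Y => ?_)
  simp only [Pi.zero_apply]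
  have h1 : ContDiff ℝ 1 (fun X : Fin d → ℝ => ψ (X, Y)) :=
    hψ.comp (contDiff_id.prodMk contDiff_const)
  rw [← integral_unitCube_partial h1 (hper Y) k]
  congr 1
  ext X
  have h2 : HasFDerivAt (fun X : Fin d → ℝ => ((X, Y) : LayerPt d))
      (ContinuousLinearMap.inl ℝ (Fin d → ℝ) ℝ) X := hasFDerivAt_prodMk_left X Y
  have h3 := ((hψ.differentiable (by norm_num)) (X, Y)).hasFDerivAt.comp X h2
  have h4 : fderiv ℝ (fun X : Fin d → ℝ => ψ (X, Y)) X = _ := h3.fderiv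
  rw [h4]
  simp [layerPartial]

theorem integral_flat_partial_last (hψ : ContDiff ℝ 1 ψ)
    (hper : LayerPeriodic ψ) (hR : ∀ z, ψ z ≠ 0 → z.2 ≤ R) :
    ∫ z, layerPartial (Fin.last d) ψ z ∂(flatMeasure d) = -∫ X in unitCube d, ψ (X, 0) := by
  have hi := integrable_of_layerTest (continuous_layerPartial hψ (Fin.last d))
    (periodic_layerPartial hper (Fin.last d)) (support_layerPartial hR (Fin.last d))
  rw [flatMeasure, slabMeasure] at hi ⊢
  rw [integral_prod _ hi, ← integral_neg]
  congr 1
  ext X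
  have hd : ∀ y, HasDerivAt (fun y => ψ (X, y)) (layerPartial (Fin.last d) ψ (X, y)) y := by
    intro y
    have h2 : HasDerivAt (fun y : ℝ => ((X, y) : LayerPt d)) ((0 : Fin d → ℝ), (1 : ℝ)) y :=
      (hasDerivAt_const y X).prodMk (hasDerivAt_id y)
    have h3 := ((hψ.differentiable (by norm_num)) (X, y)).hasFDerivAt.comp_hasDerivAt y h2
    rw [layerPartial, layerDir_last]
    exact h3
  set T := max 0 (R + 1)
  have hT : ψ (X, T) = 0 := by
    by_contra h
    have := hR _ h
    have h2 : R + 1 ≤ T := le_max_right _ _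
    simp only at this
    linarith
  have hcont : Continuous fun y => layerPartial (Fin.last d) ψ (X, y) :=
    (continuous_layerPartial hψ (Fin.last d)).comp (by fun_prop)
  rw [setIntegral_eq_of_subset_of_forall_sdiff_eq_zero (s := Ioc 0 T) measurableSet_Ioi
    (fun y hy => hy.1) (fun y hy => ?_), ← intervalIntegral.integral_of_le (le_max_left _ _),
    intervalIntegral.integral_eq_sub_of_hasDerivAt (fun y _ => hd y)
      (hcont.intervalIntegrable _ _), hT, zero_sub]
  by_contra h
  have h1 := support_layerPartial hR (Fin.last d) _ h
  have h2 : R + 1 ≤ T := le_max_right _ _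
  simp only at h1
  exact hy.2 ⟨hy.1, by linarith⟩

theorem contDiff_layerShear {n : WithTop ℕ∞} (hH : ContDiff ℝ n H) :
    ContDiff ℝ n (layerShear H) := contDiff_fst.prodMk (contDiff_snd.sub (hH.comp contDiff_fst))

theorem LayerPeriodic.comp_shear {α : Type} (hH : TorusPeriodic H)
    {ψ : LayerPt d → α} (hψ : LayerPeriodic ψ) : LayerPeriodic (fun z => ψ (layerShear H z)) := by
  intro Y j X
  simp only [layerShear]
  rw [hH j X]
  exact hψ _ j X

/-- **Green's formula** in the domain above the graph of `-H`. -/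
theorem integral_layerPartial (hH : ContDiff ℝ ∞ H)
    (hHper : TorusPeriodic H) (hψ : ContDiff ℝ 1 ψ) (hper : LayerPeriodic ψ)
    (hR : ∀ z, ψ z ≠ 0 → z.2 ≤ R) (i : Fin (d + 1)) :
    ∫ z, layerPartial i ψ z ∂(layerMeasure H) =
      ∫ X in unitCube d, layerNormal H X i * ψ (X, -H X) := by
  obtain ⟨M, -, hM⟩ := exists_bound_of_torusPeriodic hH.continuous hHper
  have hHm := hH.continuous.measurable
  set ψ' : LayerPt d → ℝ := fun z => ψ (layerShear H z) with hψ'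
  have h1 : ContDiff ℝ 1 ψ' := hψ.comp (contDiff_layerShear (hH.of_le (by simp)))
  have hper' : LayerPeriodic ψ' := hper.comp_shear hHper
  have hR' : ∀ z, ψ' z ≠ 0 → z.2 ≤ R + M := fun z hz => by
    have := hR _ hz
    simp only [layerShear] at this
    linarith [(abs_le.mp (hM z.1)).2]
  have heq : ψ = fun z => ψ' (layerUnshear H z) := by ext z; simp [hψ']
  have hd : ∀ w, DifferentiableAt ℝ ψ' w := fun w => (h1.differentiable (by norm_num)) w
  have h0 : ∀ X, ψ' (X, 0) = ψ (X, -H X) := fun X => by simp [hψ', layerShear]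
  rw [← integral_layerShear hHm]
  refine Fin.lastCases ?_ (fun k => ?_) i
  · have e : ∀ z, layerPartial (Fin.last d) ψ (layerShear H z) = layerPartial (Fin.last d) ψ' z := by
      intro z
      conv_lhs => rw [heq]
      rw [layerPartial_comp_unshear_last hH _ (hd _), layerUnshear_shear]
    simp only [e, layerNormal_last]
    rw [integral_flat_partial_last h1 hper' hR']
    simp [h0, integral_neg]
  -- In flat coordinates `∂_k` becomes the flat `∂_k` plus the vertical derivative of `∂_k H ψ'`.
  -- The first integrates to zero by periodicity, the second produces the horizontal component of
  -- the normal.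
  · set χ : LayerPt d → ℝ := fun z => fderiv ℝ H z.1 (Pi.single k 1) * ψ' z with hχ
    have c1 : ContDiff ℝ 1 χ :=
      (((contDiff_partial_profile hH k).of_le (by simp)).comp contDiff_fst).mul h1
    have c2 : LayerPeriodic χ := fun Y j X => by
      have e1 := periodic_partial_profile hHper k j X
      have e2 := hper' Y j X
      simp only at e1 e2
      simp only [hχ, e1, e2]
    have c3 : ∀ z, χ z ≠ 0 → z.2 ≤ R + M := fun z hz => hR' z (right_ne_zero_of_mul hz)
    have e : ∀ z, layerPartial k.castSucc ψ (layerShear H z) =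
        layerPartial k.castSucc ψ' z + layerPartial (Fin.last d) χ z := by
      intro z
      conv_lhs => rw [heq]
      rw [layerPartial_comp_unshear_castSucc hH _ _ (hd _), layerUnshear_shear]
      congr 1
      rw [hχ, layerPartial_profile_mul hd (contDiff_partial_profile hH k), layerDir_last]
      simp [layerPartial, layerShear]
    simp only [e]
    rw [integral_add (integrable_of_layerTest (continuous_layerPartial h1 k.castSucc)
        (periodic_layerPartial hper' k.castSucc) (support_layerPartial hR' k.castSucc))
      (integrable_of_layerTest (continuous_layerPartial c1 (Fin.last d))
        (periodic_layerPartial c2 (Fin.last d)) (support_layerPartial c3 (Fin.last d))),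
      integral_flat_partial_castSucc h1 hper' hR' k, integral_flat_partial_last c1 c2 c3, zero_add,
      ← integral_neg]
    congr 1
    ext X
    simp [hχ, h0]

/-- Integration by parts against a test function. -/
theorem integral_test_parts (hH : ContDiff ℝ ∞ H)
    (hHper : TorusPeriodic H) {φ f : LayerPt d → ℝ} (hφ : IsBoundaryTest φ) (hf : ContDiff ℝ 1 f)
    (hper : LayerPeriodic f) (i : Fin (d + 1)) :
    ∫ z, (layerPartial i φ z * f z + φ z * layerPartial i f z) ∂(layerMeasure H) =
      ∫ X in unitCube d, layerNormal H X i * φ (X, -H X) * f (X, -H X) := by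
  obtain ⟨R, hR⟩ := hφ.support
  have h1 := integral_layerPartial hH hHper (ψ := fun z => φ z * f z)
    ((hφ.smooth.of_le (by simp)).mul hf) (fun Y j X => by
      have e1 := hφ.periodic Y j X
      have e2 := hper Y j X
      simp only at e1 e2
      simp only [e1, e2]) (fun z hz => hR z (left_ne_zero_of_mul hz)) i
  simp only [mul_assoc] at h1 ⊢
  rw [← h1]
  congr 1
  ext z
  have f4 : fderiv ℝ (fun z => φ z * f z) z = _ :=
    (((hφ.smooth.differentiable (by simp)) z).hasFDerivAt.mul
      ((hf.differentiable (by norm_num)) z).hasFDerivAt).fderiv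
  simp only [layerPartial, f4]
  simp
  ring

end Green

/-! ### Vertical primitives and tail integrals, and their duality. -/

section Primitives

variable {d : ℕ} {f : LayerPt d → ℝ}

theorem lintegral_mul_sq_le {α : Type*} [MeasurableSpace α] (μ : Measure α) {f g : α → ENNReal}
    (hf : AEMeasurable f μ) (hg : AEMeasurable g μ) :
    (∫⁻ x, f x * g x ∂μ) ^ 2 ≤ (∫⁻ x, f x ^ 2 ∂μ) * ∫⁻ x, g x ^ 2 ∂μ := by
  have h := ENNReal.lintegral_mul_le_Lp_mul_Lq μ (p := 2) (q := 2)
    (by constructor <;> norm_num) hf hg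
  have h2 := pow_le_pow_left' h 2
  refine h2.trans (le_of_eq ?_)
  rw [mul_pow, ← ENNReal.rpow_natCast, ← ENNReal.rpow_natCast, ← ENNReal.rpow_mul,
    ← ENNReal.rpow_mul]
  norm_num

theorem memLp_two_iff_lintegral {α E : Type*} [MeasurableSpace α] [NormedAddCommGroup E]
    {μ : Measure α} {f : α → E} (hf : AEStronglyMeasurable f μ) :
    MemLp f 2 μ ↔ ∫⁻ x, ‖f x‖ₑ ^ 2 ∂μ < ⊤ := by
  have h : eLpNorm f 2 μ < ⊤ ↔ ∫⁻ x, ‖f x‖ₑ ^ (2 : ℝ) ∂μ < ⊤ := by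
    simpa using eLpNorm_lt_top_iff_lintegral_rpow_enorm_lt_top (f := f) (μ := μ) (p := 2)
      (by norm_num) (by norm_num)
  simp only [ENNReal.rpow_ofNat] at h
  exact ⟨fun h1 => h.mp h1.2, fun h1 => ⟨hf, h.mpr h1⟩⟩

/-- The integral over `(Y, ∞)`. -/
noncomputable def flatTail (f : LayerPt d → ℝ) (z : LayerPt d) : ℝ := ∫ t in Ioi z.2, f (z.1, t)

/-- The primitive in the vertical variable vanishing at `0`. -/
noncomputable def flatPrim (g : LayerPt d → ℝ) (z : LayerPt d) : ℝ := ∫ s in Ioc 0 z.2, g (z.1, s)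

/-- Square integrability with the weight `exp (y / 2)`. -/
def FlatWeightedL2 (f : LayerPt d → ℝ) : Prop :=
  MemLp (fun z : LayerPt d => exp (z.2 / 2) * f z) 2 (flatMeasure d)

theorem ae_flat_of_slices {p : (Fin d → ℝ) → Prop}
    (h : ∀ᵐ X ∂(volume.restrict (unitCube d)), p X) : ∀ᵐ z ∂(flatMeasure d), p z.1 :=
  Measure.quasiMeasurePreserving_fst.ae h

theorem ae_flat_pos : ∀ᵐ z : LayerPt d ∂(flatMeasure d), 0 < z.2 := by
  rw [flatMeasure, slabMeasure_restrict, ae_restrict_iff' (measurableSet_unitCube.prod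
    measurableSet_Ioi)]
  exact ae_of_all _ fun z hz => hz.2

theorem flatTail_congr {f f' : LayerPt d → ℝ} (h : f =ᵐ[flatMeasure d] f') :
    flatTail f =ᵐ[flatMeasure d] flatTail f' := by
  filter_upwards [ae_flat_of_slices (Measure.ae_ae_of_ae_prod h), ae_flat_pos] with z hz hpos
  refine integral_congr_ae ?_
  exact ae_mono (Measure.restrict_mono (Ioi_subset_Ioi hpos.le) le_rfl) hz

theorem flatPrim_congr {f f' : LayerPt d → ℝ} (h : f =ᵐ[flatMeasure d] f') :
    flatPrim f =ᵐ[flatMeasure d] flatPrim f' := by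
  filter_upwards [ae_flat_of_slices (Measure.ae_ae_of_ae_prod h)] with z hz
  refine integral_congr_ae ?_
  exact ae_mono (Measure.restrict_mono (fun y hy => hy.1) le_rfl) hz

theorem stronglyMeasurable_flatTail (hf : StronglyMeasurable f) :
    StronglyMeasurable (flatTail f) := by
  have h1 : StronglyMeasurable (Function.uncurry fun (z : LayerPt d) (t : ℝ) =>
      (Ioi z.2).indicator (fun t => f (z.1, t)) t) := by
    have : (Function.uncurry fun (z : LayerPt d) (t : ℝ) =>
        (Ioi z.2).indicator (fun t => f (z.1, t)) t) =
        {w : LayerPt d × ℝ | w.1.2 < w.2}.indicator (fun w => f (w.1.1, w.2)) := by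
      ext w; simp [Function.uncurry, indicator]
    rw [this]
    exact (hf.comp_measurable (by fun_prop)).indicator (measurableSet_lt (by fun_prop) (by fun_prop))
  have h2 := h1.integral_prod_right (ν := (volume : Measure ℝ))
  have h3 : flatTail f = fun z => ∫ t, (Ioi z.2).indicator (fun t => f (z.1, t)) t := by
    ext z; rw [flatTail, ← integral_indicator measurableSet_Ioi]
  rw [h3]
  exact h2

theorem stronglyMeasurable_flatPrim (hf : StronglyMeasurable f) :
    StronglyMeasurable (flatPrim f) := by
  have h1 : StronglyMeasurable (Function.uncurry fun (z : LayerPt d) (t : ℝ) =>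
      (Ioc 0 z.2).indicator (fun t => f (z.1, t)) t) := by
    have : (Function.uncurry fun (z : LayerPt d) (t : ℝ) =>
        (Ioc 0 z.2).indicator (fun t => f (z.1, t)) t) =
        {w : LayerPt d × ℝ | 0 < w.2 ∧ w.2 ≤ w.1.2}.indicator (fun w => f (w.1.1, w.2)) := by
      ext w; simp [Function.uncurry, indicator]
    rw [this]
    refine (hf.comp_measurable (by fun_prop)).indicator ?_
    have a1 : MeasurableSet {w : LayerPt d × ℝ | 0 < w.2} :=
      measurableSet_lt measurable_const measurable_snd
    have a2 : MeasurableSet {w : LayerPt d × ℝ | w.2 ≤ w.1.2} :=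
      measurableSet_le measurable_snd (measurable_snd.comp measurable_fst)
    exact a1.inter a2
  have h2 := h1.integral_prod_right (ν := (volume : Measure ℝ))
  have h3 : flatPrim f = fun z => ∫ t, (Ioc 0 z.2).indicator (fun t => f (z.1, t)) t := by
    ext z; rw [flatPrim, ← integral_indicator measurableSet_Ioc]
  rw [h3]
  exact h2

theorem lintegral_Ioi_exp_neg (Y : ℝ) :
    ∫⁻ t in Ioi Y, ENNReal.ofReal (exp (-t)) = ENNReal.ofReal (exp (-Y)) := by
  rw [← ofReal_integral_eq_lintegral_ofReal (integrableOn_exp_neg_Ioi Y)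
    (ae_of_all _ fun t => (Real.exp_pos _).le), integral_exp_neg_Ioi]

/-- Cauchy–Schwarz for `F = e^{-t/2} · e^{t/2} F` bounds the squared tail at height `Y` by `e^{-Y} ∫
e^t F²`, and `e^{-Y}` is integrable. This is the origin of the weight in `FlatWeightedL2`. -/
theorem lintegral_tail_sq_le {F : LayerPt d → ENNReal} (hF : Measurable F) :
    ∫⁻ z, (∫⁻ t in Ioi z.2, F (z.1, t)) ^ 2 ∂(flatMeasure d) ≤
      ∫⁻ z, ENNReal.ofReal (exp z.2) * F z ^ 2 ∂(flatMeasure d) := by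
  set A : (Fin d → ℝ) → ENNReal := fun X =>
    ∫⁻ t in Ioi 0, ENNReal.ofReal (exp t) * F (X, t) ^ 2 with hA
  have hmE : Measurable fun z : LayerPt d => ENNReal.ofReal (exp z.2) * F z ^ 2 := by fun_prop
  have hAm : Measurable A := hmE.lintegral_prod_right'
  have h1 : ∀ᵐ z : LayerPt d ∂(flatMeasure d), (∫⁻ t in Ioi z.2, F (z.1, t)) ^ 2 ≤
      A z.1 * ENNReal.ofReal (exp (-z.2)) := by
    filter_upwards [ae_flat_pos] with z hz
    have e1 : ∀ t : ℝ, F (z.1, t) = ENNReal.ofReal (exp (-t / 2)) *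
        (ENNReal.ofReal (exp (t / 2)) * F (z.1, t)) := by
      intro t
      rw [← mul_assoc, ← ENNReal.ofReal_mul (Real.exp_pos _).le, ← Real.exp_add]
      simp [neg_div]
    have e2 : ∀ t : ℝ, ENNReal.ofReal (exp (-t / 2)) ^ 2 = ENNReal.ofReal (exp (-t)) := fun t => by
      rw [← ENNReal.ofReal_pow (Real.exp_pos _).le, ← Real.exp_nat_mul]
      congr 2; push_cast; ring
    have e3 : ∀ t : ℝ, (ENNReal.ofReal (exp (t / 2)) * F (z.1, t)) ^ 2 =
        ENNReal.ofReal (exp t) * F (z.1, t) ^ 2 := by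
      intro t
      rw [mul_pow, ← ENNReal.ofReal_pow (Real.exp_pos _).le, ← Real.exp_nat_mul]
      congr 3; push_cast; ring
    rw [lintegral_congr e1]
    refine (lintegral_mul_sq_le _ (by fun_prop) (by fun_prop)).trans ?_
    simp only [e2, e3]
    rw [lintegral_Ioi_exp_neg, mul_comm]
    gcongr
    exact lintegral_mono_set (Ioi_subset_Ioi hz.le)
  refine (lintegral_mono_ae h1).trans (le_of_eq ?_)
  rw [flatMeasure, slabMeasure, lintegral_prod_mul (f := A)
    (g := fun Y => ENNReal.ofReal (exp (-Y))) hAm.aemeasurable (by fun_prop),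
    lintegral_Ioi_exp_neg, lintegral_prod _ hmE.aemeasurable]
  simp [hA]

/-- Cauchy–Schwarz on `(0, z.2]` costs one factor `T` and the integration in `z.2` another;
primitives are thereby controlled on bounded slabs only. -/
theorem lintegral_prim_sq_le {G : LayerPt d → ENNReal} (hG : Measurable G) (T : ℝ) :
    ∫⁻ z, (∫⁻ s in Ioc 0 z.2, G (z.1, s)) ^ 2 ∂(slabMeasure d (volume.restrict (Ioc 0 T))) ≤
      ENNReal.ofReal T ^ 2 * ∫⁻ z, G z ^ 2 ∂(flatMeasure d) := by
  set B : (Fin d → ℝ) → ENNReal := fun X => ∫⁻ s in Ioi 0, G (X, s) ^ 2 with hB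
  have hmE : Measurable fun z : LayerPt d => G z ^ 2 := by fun_prop
  have hBm : Measurable B := hmE.lintegral_prod_right'
  have h1 : ∀ᵐ z : LayerPt d ∂(slabMeasure d (volume.restrict (Ioc 0 T))),
      (∫⁻ s in Ioc 0 z.2, G (z.1, s)) ^ 2 ≤ B z.1 * ENNReal.ofReal T := by
    rw [slabMeasure_restrict, ae_restrict_iff' (measurableSet_unitCube.prod measurableSet_Ioc)]
    refine ae_of_all _ fun z hz => ?_
    have e1 : ∀ s : ℝ, G (z.1, s) = 1 * G (z.1, s) := fun s => (one_mul _).symm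
    rw [lintegral_congr e1]
    refine (lintegral_mul_sq_le _ (by fun_prop) (by fun_prop)).trans ?_
    rw [mul_comm]
    gcongr
    · exact lintegral_mono_set fun y hy => hy.1
    · simp only [one_pow, lintegral_one, Measure.restrict_apply MeasurableSet.univ, univ_inter,
        Real.volume_Ioc, sub_zero]
      exact ENNReal.ofReal_le_ofReal hz.2.2
  refine (lintegral_mono_ae h1).trans (le_of_eq ?_)
  rw [slabMeasure, lintegral_prod_mul (f := B)
    (g := fun _ => ENNReal.ofReal T) hBm.aemeasurable (by fun_prop), flatMeasure, slabMeasure,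
    lintegral_prod _ hmE.aemeasurable]
  simp [hB]
  ring

theorem enorm_flatTail_le (f : LayerPt d → ℝ) (z : LayerPt d) :
    ‖flatTail f z‖ₑ ≤ ∫⁻ t in Ioi z.2, ‖f (z.1, t)‖ₑ := enorm_integral_le_lintegral_enorm _

theorem enorm_flatPrim_le (f : LayerPt d → ℝ) (z : LayerPt d) :
    ‖flatPrim f z‖ₑ ≤ ∫⁻ t in Ioc 0 z.2, ‖f (z.1, t)‖ₑ := enorm_integral_le_lintegral_enorm _

theorem lintegral_weighted_lt_top (hf : FlatWeightedL2 f) :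
    ∫⁻ z, ENNReal.ofReal (exp z.2) * ‖f z‖ₑ ^ 2 ∂(flatMeasure d) < ⊤ := by
  have h1 := (memLp_two_iff_lintegral hf.1).mp hf
  refine lt_of_eq_of_lt (lintegral_congr fun z => ?_) h1
  rw [enorm_mul, mul_pow, Real.enorm_of_nonneg (Real.exp_pos _).le,
    ← ENNReal.ofReal_pow (Real.exp_pos _).le, ← Real.exp_nat_mul]
  congr 3; push_cast; ring

theorem FlatWeightedL2.aestronglyMeasurable (hf : FlatWeightedL2 f) :
    AEStronglyMeasurable f (flatMeasure d) := by
  have h1 : AEStronglyMeasurable (fun z : LayerPt d => exp (-(z.2 / 2)))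
      (flatMeasure d) := Continuous.aestronglyMeasurable (by fun_prop)
  refine (h1.mul hf.1).congr (ae_of_all _ fun z => ?_)
  simp only [Pi.mul_apply]
  rw [← mul_assoc, ← Real.exp_add]
  simp

theorem FlatWeightedL2.congr {f f' : LayerPt d → ℝ} (hf : FlatWeightedL2 f)
    (h : f =ᵐ[flatMeasure d] f') : FlatWeightedL2 f' := by
  refine (memLp_congr_ae ?_).mp hf
  filter_upwards [h] with z hz
  rw [hz]

theorem memLp_flatTail (hf : FlatWeightedL2 f) :
    MemLp (flatTail f) 2 (flatMeasure d) := by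
  have hm := hf.aestronglyMeasurable
  have hmk := hm.stronglyMeasurable_mk
  refine (memLp_congr_ae (flatTail_congr hm.ae_eq_mk)).mpr ?_
  refine (memLp_two_iff_lintegral (stronglyMeasurable_flatTail hmk).aestronglyMeasurable).mpr
    ?_
  refine lt_of_le_of_lt (lintegral_mono fun z => pow_le_pow_left' (enorm_flatTail_le _ z) 2) ?_
  refine lt_of_le_of_lt (lintegral_tail_sq_le (F := fun z => ‖hm.mk f z‖ₑ) hmk.measurable.enorm) ?_
  exact lintegral_weighted_lt_top (hf.congr hm.ae_eq_mk)

theorem memLp_flatPrim {g : LayerPt d → ℝ} (hg : MemLp g 2 (flatMeasure d)) (T : ℝ) :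
    MemLp (flatPrim g) 2 (slabMeasure d (volume.restrict (Ioc 0 T))) := by
  have hmk := hg.1.stronglyMeasurable_mk
  have hc := ae_mono (slabMeasure_mono (d := d) (S := Ioc 0 T) (T := Ioi 0) fun y hy => hy.1)
    (flatPrim_congr hg.1.ae_eq_mk)
  refine (memLp_congr_ae hc).mpr ?_
  refine (memLp_two_iff_lintegral (stronglyMeasurable_flatPrim hmk).aestronglyMeasurable).mpr
    ?_
  refine lt_of_le_of_lt (lintegral_mono fun z => pow_le_pow_left' (enorm_flatPrim_le _ z) 2) ?_
  refine lt_of_le_of_lt (lintegral_prim_sq_le (G := fun z => ‖hg.1.mk g z‖ₑ)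
    hmk.measurable.enorm T) ?_
  refine ENNReal.mul_lt_top (by finiteness) ?_
  exact (memLp_two_iff_lintegral hmk.aestronglyMeasurable).mp
    ((memLp_congr_ae hg.1.ae_eq_mk).mp hg)

/-- The kernel `f (X, t) g (X, s)`, `s < t`. -/
noncomputable def triangleKernel (f g : LayerPt d → ℝ) (X : Fin d → ℝ) (s t : ℝ) : ℝ :=
  (Ioi s).indicator (fun t => f (X, t) * g (X, s)) t

/-- Integrating the modulus in `t` first leaves the tail of `|f|` times `|g|`. Both factors are
square integrable, the first by the weighted bound. -/
theorem integrable_triangleKernel {f g : LayerPt d → ℝ} (hf : FlatWeightedL2 f)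
    (hg : MemLp g 2 (flatMeasure d)) (hfm : StronglyMeasurable f) (hgm : StronglyMeasurable g) :
    Integrable (fun w : LayerPt d × ℝ => triangleKernel f g w.1.1 w.1.2 w.2)
      ((flatMeasure d).prod volIoi 0) := by
  have heq : (fun w : LayerPt d × ℝ => triangleKernel f g w.1.1 w.1.2 w.2) =
      {w : LayerPt d × ℝ | w.1.2 < w.2}.indicator (fun w => f (w.1.1, w.2) * g w.1) := by
    ext w; simp [triangleKernel, indicator]
  have hm : StronglyMeasurable (fun w : LayerPt d × ℝ => triangleKernel f g w.1.1 w.1.2 w.2) := by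
    rw [heq]
    exact ((hfm.comp_measurable (by fun_prop)).mul (hgm.comp_measurable measurable_fst)).indicator
      (measurableSet_lt (by fun_prop) (by fun_prop))
  refine ⟨hm.aestronglyMeasurable, ?_⟩
  rw [hasFiniteIntegral_iff_enorm, lintegral_prod _ hm.enorm.aemeasurable]
  have h1 : ∀ᵐ z ∂(flatMeasure d), ∫⁻ t in Ioi 0, ‖triangleKernel f g z.1 z.2 t‖ₑ =
      (∫⁻ t in Ioi z.2, ‖f (z.1, t)‖ₑ) * ‖g z‖ₑ := by
    filter_upwards [ae_flat_pos] with z hz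
    rw [← lintegral_mul_const' _ _ (by finiteness)]
    have : ∀ t, ‖triangleKernel f g z.1 z.2 t‖ₑ =
        (Ioi z.2).indicator (fun t => ‖f (z.1, t)‖ₑ * ‖g z‖ₑ) t := by
      intro t
      rw [triangleKernel, enorm_indicator_eq_indicator_enorm]
      simp
    simp only [this]
    rw [lintegral_indicator measurableSet_Ioi, Measure.restrict_restrict measurableSet_Ioi,
      Ioi_inter_Ioi, max_eq_left hz.le]
  rw [lintegral_congr_ae h1]
  have hF : Measurable fun z : LayerPt d => ‖f z‖ₑ := hfm.measurable.enorm
  have hT : Measurable fun z : LayerPt d => ∫⁻ t in Ioi z.2, ‖f (z.1, t)‖ₑ := by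
    have h2 : Measurable fun w : LayerPt d × ℝ =>
        {w : LayerPt d × ℝ | w.1.2 < w.2}.indicator (fun w => ‖f (w.1.1, w.2)‖ₑ) w :=
      (hF.comp (by fun_prop : Measurable fun w : LayerPt d × ℝ => (w.1.1, w.2))).indicator
        (measurableSet_lt (by fun_prop) (by fun_prop))
    have h3 := h2.lintegral_prod_right' (ν := (volume : Measure ℝ))
    have h3e : (fun z : LayerPt d => ∫⁻ t in Ioi z.2, ‖f (z.1, t)‖ₑ) = fun z => ∫⁻ t,
        {w : LayerPt d × ℝ | w.1.2 < w.2}.indicator (fun w => ‖f (w.1.1, w.2)‖ₑ) (z, t) := by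
      funext z
      rw [← lintegral_indicator measurableSet_Ioi]
      rfl
    rw [h3e]
    exact h3
  have h4 := lintegral_mul_sq_le (flatMeasure d) hT.aemeasurable hgm.measurable.enorm.aemeasurable
  have h5 := lt_of_le_of_lt (lintegral_tail_sq_le hF) (lintegral_weighted_lt_top hf)
  have h6 := (memLp_two_iff_lintegral hg.1).mp hg
  have h7 := lt_of_le_of_lt h4 (ENNReal.mul_lt_top h5 h6)
  by_contra h8
  rw [not_lt, top_le_iff] at h8
  rw [h8] at h7
  simp at h7

/-- The two sides are the two iterated integrals of `triangleKernel`; the equivalence `e` exchanges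
the two vertical variables. Through this duality a force can be paired with functions of zero trace
that are not square integrable at infinity. -/
theorem integrable_mul_flatPrim_of_stronglyMeasurable {f g : LayerPt d → ℝ} (hf : FlatWeightedL2 f)
    (hg : MemLp g 2 (flatMeasure d)) (hfm : StronglyMeasurable f) (hgm : StronglyMeasurable g) :
    Integrable (fun z => f z * flatPrim g z) (flatMeasure d) ∧
      ∫ z, f z * flatPrim g z ∂(flatMeasure d) = ∫ z, flatTail f z * g z ∂(flatMeasure d) := by
  have hK := integrable_triangleKernel hf hg hfm hgm
  set I := volIoi (0 : ℝ) with hI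
  set C := volume.restrict (unitCube d) with hC
  set e : (LayerPt d × ℝ) ≃ᵐ (LayerPt d × ℝ) := MeasurableEquiv.prodAssoc.trans
    ((MeasurableEquiv.prodCongr (MeasurableEquiv.refl _) MeasurableEquiv.prodComm).trans
      MeasurableEquiv.prodAssoc.symm) with he
  have hsw : MeasurePreserving e ((C.prod I).prod I) ((C.prod I).prod I) :=
    (measurePreserving_prodAssoc C I I).trans
      (((MeasurePreserving.id C).prod Measure.measurePreserving_swap).trans
        (measurePreserving_prodAssoc C I I).symm)
  have hL : Integrable (fun w : LayerPt d × ℝ => triangleKernel f g w.1.1 w.2 w.1.2)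
      ((flatMeasure d).prod I) := hsw.integrable_comp_of_integrable hK
  have eL : ∀ᵐ z ∂(flatMeasure d), ∫ s, triangleKernel f g z.1 s z.2 ∂I = f z * flatPrim g z := by
    refine ae_of_all _ fun z => ?_
    have h1 : ∀ s, triangleKernel f g z.1 s z.2 =
        (Iio z.2).indicator (fun s => f z * g (z.1, s)) s := by
      intro s; simp [triangleKernel, indicator]
    simp only [h1]
    rw [integral_indicator measurableSet_Iio, hI, Measure.restrict_restrict measurableSet_Iio,
      integral_const_mul, flatPrim, integral_Ioc_eq_integral_Ioo]
    congr 3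
    ext s; simp [and_comm]
  have eR : ∀ᵐ z ∂(flatMeasure d), ∫ t, triangleKernel f g z.1 z.2 t ∂I = flatTail f z * g z := by
    filter_upwards [ae_flat_pos] with z hz
    simp only [triangleKernel]
    rw [integral_indicator measurableSet_Ioi, hI, Measure.restrict_restrict measurableSet_Ioi,
      Ioi_inter_Ioi, max_eq_left hz.le, integral_mul_const]
    rfl
  refine ⟨hL.integral_prod_left.congr eL, ?_⟩
  rw [← integral_congr_ae eL, ← integral_congr_ae eR, ← integral_prod _ hL, ← integral_prod _ hK]
  exact hsw.integral_comp' (fun w : LayerPt d × ℝ => triangleKernel f g w.1.1 w.1.2 w.2)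

theorem FlatWeightedL2.integrable_mul_flatPrim {f g : LayerPt d → ℝ} (hf : FlatWeightedL2 f)
    (hg : MemLp g 2 (flatMeasure d)) :
    Integrable (fun z => f z * flatPrim g z) (flatMeasure d) ∧
      ∫ z, f z * flatPrim g z ∂(flatMeasure d) = ∫ z, flatTail f z * g z ∂(flatMeasure d) := by
  have hm := hf.aestronglyMeasurable
  have h := integrable_mul_flatPrim_of_stronglyMeasurable (hf.congr hm.ae_eq_mk)
    ((memLp_congr_ae hg.1.ae_eq_mk).mp hg) hm.stronglyMeasurable_mk hg.1.stronglyMeasurable_mk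
  have e1 : (fun z => f z * flatPrim g z) =ᵐ[flatMeasure d]
      fun z => hm.mk f z * flatPrim (hg.1.mk g) z := by
    filter_upwards [hm.ae_eq_mk, flatPrim_congr hg.1.ae_eq_mk] with z h1 h2
    rw [h1, h2]
  have e2 : (fun z => flatTail f z * g z) =ᵐ[flatMeasure d]
      fun z => flatTail (hm.mk f) z * hg.1.mk g z := by
    filter_upwards [flatTail_congr hm.ae_eq_mk, hg.1.ae_eq_mk] with z h1 h2
    rw [h1, h2]
  exact ⟨h.1.congr e1.symm, by rw [integral_congr_ae e1, integral_congr_ae e2, h.2]⟩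

end Primitives

/-! ### Functions and trace pairs with prescribed Fourier modes. -/

section Synthesis

variable {d : ℕ} {ψ : LayerPt d → ℝ} {V : LayerPt d → ℝ} {g : Fin (d + 1) → LayerPt d → ℝ}

theorem charCoeff_conj (f : (Fin d → ℝ) → ℂ) (j : Fin d → ℤ) :
    charCoeff (fun X => conj (f X)) j = conj (charCoeff f (-j)) := by
  unfold charCoeff
  rw [← integral_conj]
  congr 1
  ext X
  rw [torusChar_neg]
  simp

theorem cMode_ofReal_neg (f : LayerPt d → ℝ) (j : Fin d → ℤ) (y : ℝ) :
    rcMode f (-j) y = conj (rcMode f j y) := by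
  have h := charCoeff_conj (fun X => (f (X, y) : ℂ)) (-j)
  simp only [Complex.conj_ofReal, neg_neg] at h
  exact h

theorem norm_sum_sq_of_pairwise_orthogonal {ι E : Type*} [NormedAddCommGroup E]
    [InnerProductSpace ℂ E] {x : ι → E} (h : ∀ i j, i ≠ j → inner ℂ (x i) (x j) = 0)
    (s : Finset ι) : ‖∑ i ∈ s, x i‖ ^ 2 = ∑ i ∈ s, ‖x i‖ ^ 2 := by
  classical
  have h1 : inner ℂ (∑ i ∈ s, x i) (∑ i ∈ s, x i) = ∑ i ∈ s, inner ℂ (x i) (x i) := by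
    rw [sum_inner]
    refine Finset.sum_congr rfl fun i hi => ?_
    rw [inner_sum]
    exact Finset.sum_eq_single_of_mem i hi fun j _ hj => h i j hj.symm
  simp only [inner_self_eq_norm_sq_to_K] at h1
  exact_mod_cast h1

/-- By Pythagoras the squared norm of a finite block of the series is a finite block of the series
of squared norms, so the Cauchy criterion transfers. -/
theorem summable_of_pairwise_orthogonal {ι E : Type*} [NormedAddCommGroup E]
    [InnerProductSpace ℂ E] [CompleteSpace E] {x : ι → E}
    (h : ∀ i j, i ≠ j → inner ℂ (x i) (x j) = 0) (hs : Summable fun i => ‖x i‖ ^ 2) :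
    Summable x := by
  rw [summable_iff_vanishing_norm]
  intro ε hε
  obtain ⟨s, hs'⟩ := summable_iff_vanishing_norm.mp hs (ε ^ 2) (by positivity)
  refine ⟨s, fun t ht => ?_⟩
  have h1 := hs' t ht
  rw [← norm_sum_sq_of_pairwise_orthogonal h, norm_pow, norm_norm] at h1
  exact lt_of_pow_lt_pow_left₀ 2 hε.le h1

theorem inner_toLp_eq_integral {α : Type*} [MeasurableSpace α] {μ : Measure α} {f g : α → ℂ}
    (hf : MemLp f 2 μ) (hg : MemLp g 2 μ) :
    inner ℂ (hf.toLp f) (hg.toLp g) = ∫ x, conj (f x) * g x ∂μ := by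
  rw [L2.inner_def]
  refine integral_congr_ae ?_
  filter_upwards [hf.coeFn_toLp, hg.coeFn_toLp] with x h1 h2
  rw [h1, h2, RCLike.inner_apply, mul_comm]

variable {ν : Measure ℝ} [SFinite ν]

theorem memLp_char_mul {b : ℝ → ℂ} (hb : MemLp b 2 ν) (j : Fin d → ℤ) :
    MemLp (fun z : LayerPt d => torusChar j z.1 * b z.2) 2 (slabMeasure d ν) := by
  have h1 : MemLp (fun z : LayerPt d => b z.2) 2 (slabMeasure d ν) :=
    hb.comp_snd (volume.restrict (unitCube d))
  refine h1.of_le ?_ (ae_of_all _ fun z => by simp)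
  exact (((continuous_torusChar j).comp continuous_fst).aestronglyMeasurable).mul h1.1

theorem integral_conj_char_mul_mul {f : LayerPt d → ℂ} (hf : MemLp f 2 (slabMeasure d ν))
    {b : ℝ → ℂ} (hb : MemLp b 2 ν) (j : Fin d → ℤ) :
    ∫ z, conj (torusChar j z.1 * b z.2) * f z ∂(slabMeasure d ν) =
      ∫ y, conj (b y) * cMode f j y ∂ν := by
  have h1 : MemLp (fun z : LayerPt d => conj (b z.2)) 2 (slabMeasure d ν) :=
    (hb.comp_snd (volume.restrict (unitCube d))).star
  rw [← integral_char_mul j (fun y => conj (b y)) (MemLp.integrable_mul h1 hf)]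
  simp [mul_assoc]

theorem cMode_char_mul (b : ℝ → ℂ) (i j : Fin d → ℤ) (y : ℝ) :
    cMode (fun z : LayerPt d => torusChar i z.1 * b z.2) j y = if j = i then b y else 0 := by
  have h := charCoeff_const_mul (b y) (torusChar i) j
  rw [charCoeff_torusChar] at h
  have h2 : cMode (fun z : LayerPt d => torusChar i z.1 * b z.2) j y =
      charCoeff (fun X => b y * torusChar i X) j := by simp [cMode, mul_comm]
  rw [h2, h]
  simp

/-- A square summable family of square integrable functions consists of the Fourier coefficients
of a square integrable function. -/
theorem exists_cMode_eq {b : (Fin d → ℤ) → ℝ → ℂ} (hb : ∀ j, MemLp (b j) 2 ν)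
    (hs : Summable fun j => ∫ y, ‖b j y‖ ^ 2 ∂ν) :
    ∃ f : LayerPt d → ℂ, MemLp f 2 (slabMeasure d ν) ∧ ∀ j, cMode f j =ᵐ[ν] b j := by
  set x : (Fin d → ℤ) → Lp ℂ 2 (slabMeasure d ν) := fun j =>
    (memLp_char_mul (hb j) j).toLp _ with hx
  have hin : ∀ (j : Fin d → ℤ) (c : ℝ → ℂ) (hc : MemLp c 2 ν) (i : Fin d → ℤ),
      inner ℂ ((memLp_char_mul hc j).toLp _) (x i) =
        if j = i then ∫ y, conj (c y) * b i y ∂ν else 0 := by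
    intro j c hc i
    rw [hx, inner_toLp_eq_integral, integral_conj_char_mul_mul (memLp_char_mul (hb i) i) hc]
    simp only [cMode_char_mul]
    split_ifs <;> simp
  have horth : ∀ i j, i ≠ j → inner ℂ (x i) (x j) = 0 := fun i j hij => by
    rw [hx, hin i (b i) (hb i) j, if_neg hij]
  have hnorm : ∀ j, ‖x j‖ ^ 2 = ∫ y, ‖b j y‖ ^ 2 ∂ν := fun j => by
    have h1 := hin j (b j) (hb j) j
    rw [if_pos rfl] at h1
    have h2 : inner ℂ (x j) (x j) = ((‖x j‖ ^ 2 : ℝ) : ℂ) := by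
      rw [inner_self_eq_norm_sq_to_K]; norm_cast
    have h3 : ∀ w : ℂ, conj w * w = ((‖w‖ ^ 2 : ℝ) : ℂ) := fun w => by
      rw [mul_comm, Complex.mul_conj, Complex.normSq_eq_norm_sq]
    simp only [h3] at h1
    rw [integral_complex_ofReal] at h1
    exact_mod_cast h2.symm.trans h1
  have hsum : Summable x := summable_of_pairwise_orthogonal horth (by simpa only [hnorm] using hs)
  set f := ∑' j, x j with hf
  refine ⟨f, Lp.memLp f, fun j => ?_⟩
  have hm := MemLp.cMode (Lp.memLp f) j
  have hd := hm.sub (hb j)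
  -- The inner product of `e_j δ` with the sum is computed twice, from the series and from the mode
  -- of `f`; the two values differ by the squared norm of `δ`.
  set δ : ℝ → ℂ := cMode f j - b j with hδ
  have h1 : inner ℂ ((memLp_char_mul hd j).toLp _) f = ∫ y, conj (δ y) * b j y ∂ν := by
    have h2 := (hsum.hasSum.mapL (innerSL ℂ ((memLp_char_mul hd j).toLp _))).tsum_eq
    simp only [innerSL_apply_apply, hin j δ hd] at h2
    rw [tsum_eq_single j fun i hi => if_neg hi.symm, if_pos rfl] at h2
    exact h2.symm
  have h3 : inner ℂ ((memLp_char_mul hd j).toLp _) f = ∫ y, conj (δ y) * cMode f j y ∂ν := by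
    rw [← integral_conj_char_mul_mul (Lp.memLp f) hd]
    conv_lhs => rw [← Lp.toLp_coeFn f (Lp.memLp f)]
    rw [inner_toLp_eq_integral]
  have h4 : inner ℂ (hd.toLp δ) (hd.toLp δ) = 0 := by
    rw [inner_toLp_eq_integral]
    have h5 : ∀ y, conj (δ y) * δ y = conj (δ y) * cMode f j y - conj (δ y) * b j y := fun y => by
      simp [hδ]; ring
    simp only [h5]
    refine (integral_sub (MemLp.integrable_mul hd.star hm)
      (MemLp.integrable_mul hd.star (hb j))).trans ?_
    exact sub_eq_zero.mpr (h3.symm.trans h1)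
  have h6 := hd.coeFn_toLp
  rw [inner_self_eq_zero.mp h4] at h6
  filter_upwards [h6, Lp.coeFn_zero ℂ 2 ν] with y e1 e2
  rw [e2] at e1
  exact sub_eq_zero.mp e1.symm

/-- The symmetry of `b` gives `conj f` the same modes as `f`, so passing to the real part does not
change them. -/
theorem exists_real_cMode_eq {b : (Fin d → ℤ) → ℝ → ℂ} (hb : ∀ j, MemLp (b j) 2 ν)
    (hs : Summable fun j => ∫ y, ‖b j y‖ ^ 2 ∂ν) (hsym : ∀ j y, b (-j) y = conj (b j y)) :
    ∃ f : LayerPt d → ℝ, MemLp f 2 (slabMeasure d ν) ∧ ∀ j, rcMode f j =ᵐ[ν] b j := by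
  obtain ⟨f, hf, hfb⟩ := exists_cMode_eq hb hs
  refine ⟨fun z => (f z).re, hf.re, fun j => ?_⟩
  have h1 : ∀ z, (((f z).re : ℝ) : ℂ) = (1 / 2 : ℂ) * f z + (1 / 2 : ℂ) * conj (f z) := fun z => by
    rw [← mul_add, Complex.add_conj]; push_cast; ring
  have hc : MemLp (fun z => conj (f z)) 2 (slabMeasure d ν) := hf.star
  simp only [h1]
  have h2 := cMode_add (hf.const_mul (1 / 2 : ℂ)) (hc.const_mul (1 / 2 : ℂ)) j
  filter_upwards [h2, hfb j, hfb (-j)] with y e1 e2 e3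
  have e4 : cMode (fun z => conj (f z)) j y = conj (cMode f (-j) y) :=
    charCoeff_conj (fun X => f (X, y)) j
  rw [e1, cMode_const_mul, cMode_const_mul, e4, e3, e2, hsym, Complex.conj_conj]
  ring

/-- Fubini for the vertical primitive. -/
theorem cMode_flatPrim {g : LayerPt d → ℝ} (hg : MemLp g 2 (flatMeasure d)) (j : Fin d → ℤ)
    (y : ℝ) : rcMode (flatPrim g) j y = ∫ s in Ioc 0 y, rcMode g j s := by
  have h1 : MemLp (fun z => (g z : ℂ)) 2 (slabMeasure d (volume.restrict (Ioc 0 y))) :=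
    (hg.mono_measure (slabMeasure_mono fun _ hy => hy.1)).ofReal
  have : IsFiniteMeasure (slabMeasure d (volume.restrict (Ioc 0 y))) := by
    unfold slabMeasure; infer_instance
  have h2 : Integrable (fun z : LayerPt d => conj (torusChar j z.1) * (g z : ℂ))
      (slabMeasure d (volume.restrict (Ioc 0 y))) := by
    refine (h1.integrable (by norm_num)).bdd_mul (c := 1) ?_ (ae_of_all _ fun z => by simp)
    exact (Complex.continuous_conj.comp ((continuous_torusChar j).comp
      continuous_fst)).aestronglyMeasurable
  have h3 := integral_integral_swap (f := fun X s => conj (torusChar j X) * (g (X, s) : ℂ)) h2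
  simp only [cMode, charCoeff]
  rw [← h3]
  congr 1
  ext X
  rw [integral_const_mul, flatPrim, ← integral_complex_ofReal]

theorem memLp_of_layerTest {φ : LayerPt d → ℝ} (hφ : Continuous φ) (hper : LayerPeriodic φ) {R : ℝ}
    (hR : ∀ z, φ z ≠ 0 → z.2 ≤ R) : MemLp φ 2 (flatMeasure d) := by
  refine (memLp_two_iff_integrable_sq hφ.aestronglyMeasurable).mpr ?_
  refine integrable_of_layerTest (hφ.pow 2) (fun Y j X => ?_) (R := R) fun z hz => hR z fun h => ?_
  · have := hper Y j X
    simp only at this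
    simp only [this]
  · simp [h] at hz

theorem test_eq_add_flatPrim (hψ : ContDiff ℝ 1 ψ) {z : LayerPt d}
    (hz : 0 ≤ z.2) : ψ z = ψ (z.1, 0) + flatPrim (layerPartial (Fin.last d) ψ) z := by
  have h1 : ∀ s : ℝ, HasDerivAt (fun s => ψ (z.1, s)) (layerPartial (Fin.last d) ψ (z.1, s)) s := by
    intro s
    have h2 := ((hψ.differentiable (by norm_num)) (z.1, s)).hasFDerivAt.comp_hasDerivAt s
      ((hasDerivAt_const s z.1).prodMk (hasDerivAt_id s))
    simp only [layerPartial, layerDir_last]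
    exact h2
  have h3 := intervalIntegral.integral_eq_sub_of_hasDerivAt (a := 0) (b := z.2)
    (fun s _ => h1 s) (((continuous_layerPartial hψ (Fin.last d)).comp
      (by fun_prop : Continuous fun s : ℝ => ((z.1, s) : LayerPt d))).intervalIntegrable _ _)
  rw [intervalIntegral.integral_of_le hz] at h3
  rw [flatPrim, h3]
  simp

theorem cMode_test (hψ : IsBoundaryTest ψ) (j : Fin d → ℤ) {y : ℝ}
    (hy : 0 ≤ y) : rcMode ψ j y = charCoeff (fun X => (ψ (X, 0) : ℂ)) j +
      ∫ s in Ioc 0 y, rcMode (layerPartial (Fin.last d) ψ) j s := by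
  obtain ⟨R, hR⟩ := hψ.support
  have hψ1 : ContDiff ℝ 1 ψ := hψ.smooth.of_le (by simp)
  have hc := continuous_layerPartial hψ1 (Fin.last d)
  have hm := memLp_of_layerTest hc (periodic_layerPartial hψ.periodic _)
    (support_layerPartial hR (Fin.last d))
  rw [← cMode_flatPrim hm]
  have c1 : Continuous fun X : Fin d → ℝ => (ψ (X, 0) : ℂ) :=
    Complex.continuous_ofReal.comp (hψ1.continuous.comp (by fun_prop))
  have c2 : Continuous fun X : Fin d → ℝ => (ψ (X, y) : ℂ) :=
    Complex.continuous_ofReal.comp (hψ1.continuous.comp (by fun_prop))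
  have e : ∀ X : Fin d → ℝ, (flatPrim (layerPartial (Fin.last d) ψ) (X, y) : ℂ) =
      (ψ (X, y) : ℂ) - (ψ (X, 0) : ℂ) := fun X => by
    rw [test_eq_add_flatPrim hψ1 (z := (X, y)) hy]; push_cast; ring
  simp only [cMode]
  rw [← charCoeff_add (integrable_unitCube_of_continuous c1)]
  · simp only [e]
    congr 1; ext X; ring
  · simp only [e]
    exact integrable_unitCube_of_continuous (c2.sub c1)

theorem isWeakDiv_test (hψ : IsBoundaryTest ψ) (k : Fin (d + 1)) :
    IsWeakDiv (fun _ => -0) (fun l z => if l = k then ψ z else 0) (layerPartial k ψ) := by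
  intro φ hφ
  have h := integral_test_parts (H := fun _ : Fin d → ℝ => (-0 : ℝ)) contDiff_const
    (fun _ _ => rfl) hφ.isBoundaryTest (hψ.smooth.of_le (by simp)) hψ.periodic k
  obtain ⟨δ, hδ, R, hR⟩ := hφ.support
  have h0 : ∀ X : Fin d → ℝ, φ (X, -(-0 : ℝ)) = 0 := fun X => by
    by_contra hne
    have := (hR _ hne).1
    simp only at this
    linarith
  simp only [h0, mul_zero, zero_mul, integral_zero] at h
  simpa using h

theorem cMode_partial_test (hψ : IsBoundaryTest ψ) (j : Fin d → ℤ)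
    (k : Fin d) : rcMode (layerPartial k.castSucc ψ) j =ᵐ[volIoi 0]
      fun y => 2 * π * Complex.I * j k * rcMode ψ j y := by
  obtain ⟨R, hR⟩ := hψ.support
  refine (isWeakDiv_test hψ k.castSucc).modes_castSucc ?_ ?_ j
  · exact MemLp.slabL2 (memLp_of_layerTest hψ.smooth.continuous hψ.periodic hR).ofReal
  · exact MemLp.slabL2 (memLp_of_layerTest (continuous_layerPartial (hψ.smooth.of_le (by simp)) _)
      (periodic_layerPartial hψ.periodic _) (support_layerPartial hR _)).ofReal

theorem IntegrableOn.Icc_of_Ioc {f : ℝ → ℂ} {a b : ℝ} (h : IntegrableOn f (Ioc a b)) :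
    IntegrableOn f (Icc a b) := by rw [integrableOn_Icc_iff_integrableOn_Ioc]; exact h

theorem integrableOn_mul_add_primitive {R : ℝ} {A γ : ℝ → ℂ} (hA : IntegrableOn A (Ioc 0 R))
    (hγ : IntegrableOn γ (Ioc 0 R)) (c : ℂ) :
    IntegrableOn (fun y => A y * (c + ∫ s in Ioc 0 y, γ s)) (Ioc 0 R) :=
  ((IntegrableOn.Icc_of_Ioc hA).mul_continuousOn (continuousOn_const.add
    (intervalIntegral.continuousOn_primitive (IntegrableOn.Icc_of_Ioc hγ)))
    isCompact_Icc).mono_set Ioc_subset_Icc_self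

theorem integrableOn_add_primitive_mul {R : ℝ} {A γ : ℝ → ℂ} (hA : IntegrableOn A (Ioc 0 R))
    (hγ : IntegrableOn γ (Ioc 0 R)) (c : ℂ) :
    IntegrableOn (fun y => (c + ∫ s in Ioc 0 y, A s) * γ y) (Ioc 0 R) := by
  simpa only [mul_comm] using integrableOn_mul_add_primitive hγ hA c

theorem integral_primitive_parts {R : ℝ} {A γ : ℝ → ℂ} (hA : IntegrableOn A (Ioc 0 R))
    (hγ : IntegrableOn γ (Ioc 0 R)) :
    ∫ y in Ioc 0 R, (A y * (∫ s in Ioc 0 y, γ s) + (∫ s in Ioc 0 y, A s) * γ y) =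
      (∫ y in Ioc 0 R, A y) * ∫ y in Ioc 0 R, γ y := by
  have i1 := integrableOn_mul_add_primitive hA hγ 0
  have i2 := integrableOn_add_primitive_mul hA hγ 0
  simp only [zero_add] at i1 i2
  have h1 : ∀ s ∈ Ioc 0 R, (∫ y in Ioc s R, A y) * γ s =
      (∫ y in Ioc 0 R, A y) * γ s - (∫ y in Ioc 0 s, A y) * γ s := by
    intro s hs
    rw [← Ioc_union_Ioc_eq_Ioc hs.1.le hs.2, setIntegral_union (Ioc_disjoint_Ioc_of_le le_rfl)
      measurableSet_Ioc (hA.mono_set (Ioc_subset_Ioc_right hs.2))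
      (hA.mono_set (Ioc_subset_Ioc_left hs.1.le))]
    ring
  rw [integral_add i1 i2, integral_mul_primitive hA hγ, setIntegral_congr_fun measurableSet_Ioc h1,
    integral_sub (hγ.const_mul _) i2, integral_const_mul]
  ring

/-- `V` has weak gradient `g` and trace `D`, for scalar functions. -/
structure IsTracePair (H : (Fin d → ℝ) → ℝ) (V : LayerPt d → ℝ)
    (g : Fin (d + 1) → LayerPt d → ℝ) (D : (Fin d → ℝ) → ℝ) : Prop where
  locL2 : LayerLocL2 H V
  memLp : ∀ i, MemLp (g i) 2 (layerMeasure H)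
  green : ∀ φ : LayerPt d → ℝ, IsBoundaryTest φ → ∀ i,
    ∫ z, (layerPartial i φ z * V z + φ z * g i z) ∂(layerMeasure H) =
      ∫ X in unitCube d, layerNormal H X i * φ (X, -H X) * D X

theorem isTracePair_zero_iff {H : (Fin d → ℝ) → ℝ} :
    IsTracePair H V g (fun _ => 0) ↔ IsZeroTracePair H V g :=
  ⟨fun h => ⟨h.1, h.2, by simpa using h.3⟩, fun h => ⟨h.1, h.2, by simpa using h.3⟩⟩

/-- Green's formula in the flat half space from the Fourier coefficients. -/
theorem isTracePair_of_modes
    {D : (Fin d → ℝ) → ℝ} (hV : LayerLocL2 (fun _ : Fin d → ℝ => -0) V)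
    (hg : ∀ i, MemLp (g i) 2 (flatMeasure d)) (hD : MemLp D 2 (volume.restrict (unitCube d)))
    (hlast : ∀ j, rcMode V j =ᵐ[volIoi 0] fun y =>
      charCoeff (fun X => (D X : ℂ)) j +
        ∫ s in Ioc 0 y, rcMode (g (Fin.last d)) j s)
    (hk : ∀ (k : Fin d) j, rcMode (g k.castSucc) j =ᵐ[volIoi 0]
      fun y => 2 * π * Complex.I * j k * rcMode V j y) :
    IsTracePair (fun _ => -0) V g D := by
  refine ⟨hV, by simpa only [layerMeasure_const] using hg, fun ψ hψ i => ?_⟩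
  obtain ⟨R₀, hR₀⟩ := hψ.support
  -- The extra unit makes `ψ` vanish at the height `R` itself, so no boundary term arises there.
  set R := max R₀ 0 + 1 with hRdef
  have hR0 : 0 ≤ R := by positivity
  have hR' : ∀ z, ψ z ≠ 0 → z.2 < R := fun z hz => by linarith [hR₀ z hz, le_max_left R₀ 0]
  have hR : ∀ z, ψ z ≠ 0 → z.2 ≤ R := fun z hz => (hR' z hz).le
  have hψ1 : ContDiff ℝ 1 ψ := hψ.smooth.of_le (by simp)
  set ν := (volume : Measure ℝ).restrict (Ioc 0 R) with hν
  have hle : slabMeasure d ν ≤ flatMeasure d := slabMeasure_mono fun _ hy => hy.1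
  have hlev : ν ≤ volIoi 0 := Measure.restrict_mono (fun _ hy => hy.1) le_rfl
  have mV : MemLp (fun z => (V z : ℂ)) 2 (slabMeasure d ν) := hV.slabL2 R
  have mg : ∀ i, MemLp (fun z => (g i z : ℂ)) 2 (slabMeasure d ν) := fun i =>
    ((hg i).mono_measure hle).ofReal
  have mψ : MemLp (fun z => (ψ z : ℂ)) 2 (slabMeasure d ν) :=
    ((memLp_of_layerTest hψ1.continuous hψ.periodic hR).mono_measure hle).ofReal
  have mdψ : ∀ i, MemLp (fun z => (layerPartial i ψ z : ℂ)) 2 (slabMeasure d ν) := fun i =>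
    ((memLp_of_layerTest (continuous_layerPartial hψ1 _) (periodic_layerPartial hψ.periodic _)
      (support_layerPartial hR _)).mono_measure hle).ofReal
  have h1 := (hasSum_integral_cMode (mdψ i) mV).add (hasSum_integral_cMode mψ (mg i))
  have h2 : (∫ z, conj (layerPartial i ψ z : ℂ) * (V z : ℂ) ∂(slabMeasure d ν)) +
      ∫ z, conj (ψ z : ℂ) * (g i z : ℂ) ∂(slabMeasure d ν) =
      ((∫ z, (layerPartial i ψ z * V z + ψ z * g i z) ∂(layerMeasure fun _ : Fin d → ℝ => -0) : ℝ) :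
        ℂ) := by
    refine (integral_add (MemLp.integrable_mul (mdψ i).star mV)
      (MemLp.integrable_mul mψ.star (mg i))).symm.trans ?_
    rw [layerMeasure_const, ← integral_complex_ofReal, slabMeasure_restrict, slabMeasure_restrict]
    symm
    refine (setIntegral_eq_of_subset_of_forall_sdiff_eq_zero (measurableSet_unitCube.prod
      measurableSet_Ioi) (prod_mono le_rfl fun (y : ℝ) (hy : y ∈ Ioc 0 R) => hy.1)
      fun z hz => ?_).trans ?_
    · have h3 : ¬ z.2 ≤ R := fun h => hz.2 ⟨hz.1.1, hz.1.2, h⟩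
      have h4 : ψ z = 0 := by_contra fun h => h3 (hR z h)
      have h5 : layerPartial i ψ z = 0 := by_contra fun h => h3 (support_layerPartial hR i z h)
      simp [h4, h5]
    · congr 1
      ext z
      simp
  rw [h2] at h1
  -- Green's formula for one frequency. Vertically it is integration by parts for two primitives
  -- whose values at `0` come from `D` and `ψ`; horizontally the factors `2πi j_k` have opposite
  -- signs after conjugation and the terms cancel.
  have hj : ∀ j, (∫ y, conj (rcMode (layerPartial i ψ) j y) *
      rcMode V j y ∂ν) + ∫ y, conj (rcMode ψ j y) * rcMode (g i) j y ∂ν =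
      conj (charCoeff (fun X => (layerNormal (fun _ : Fin d → ℝ => (-0 : ℝ)) X i * ψ (X, 0) : ℂ)) j) *
        charCoeff (fun X => (D X : ℂ)) j := by
    intro j
    set w := rcMode V j with hw
    refine Fin.lastCases ?_ (fun k => ?_) i
    · set A : ℝ → ℂ := fun y => conj (rcMode (layerPartial (Fin.last d) ψ) j y)
        with hA
      set γ := rcMode (g (Fin.last d)) j with hγ
      set p := charCoeff (fun X => (ψ (X, 0) : ℂ)) j with hp
      set D' := charCoeff (fun X => (D X : ℂ)) j with hD'
      have iA : IntegrableOn A (Ioc 0 R) :=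
        ((MemLp.cMode (mdψ (Fin.last d)) j).star).integrable (by norm_num)
      have iγ : IntegrableOn γ (Ioc 0 R) :=
        (MemLp.cMode (mg (Fin.last d)) j).integrable (by norm_num)
      have t : ∀ y, 0 ≤ y → conj (rcMode ψ j y) = conj p + ∫ s in Ioc 0 y, A s := fun y hy => by
        rw [cMode_test hψ j hy, map_add, ← integral_conj]
      have tR : conj p + ∫ s in Ioc 0 R, A s = 0 := by
        have h3 : ∀ X : Fin d → ℝ, ψ (X, R) = 0 := fun X =>
          by_contra fun h => lt_irrefl _ (hR' _ h)
        rw [← t R hR0]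
        simp [cMode, h3, charCoeff]
      have k1 := integrableOn_mul_add_primitive iA iγ
      have k2 := integrableOn_add_primitive_mul iA iγ
      have j3 : IntegrableOn (fun y => A y * (∫ s in Ioc 0 y, γ s) + (∫ s in Ioc 0 y, A s) * γ y)
          (Ioc 0 R) := by
        have := (k1 0).add (k2 0)
        simp only [zero_add] at this
        exact this
      have e1 : ∫ y, A y * w y ∂ν = ∫ y, A y * (D' + ∫ s in Ioc 0 y, γ s) ∂ν := by
        refine integral_congr_ae ?_
        filter_upwards [ae_mono hlev (hlast j)] with y hy
        rw [hw, hy]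
      have e2 : ∫ y, conj (rcMode ψ j y) * γ y ∂ν = ∫ y, (conj p + ∫ s in Ioc 0 y, A s) * γ y ∂ν :=
        setIntegral_congr_fun measurableSet_Ioc fun y hy => by simp only [t y hy.1.le]
      have e3 : ∀ y, A y * (D' + ∫ s in Ioc 0 y, γ s) + (conj p + ∫ s in Ioc 0 y, A s) * γ y =
          (A y * D' + conj p * γ y) +
            (A y * (∫ s in Ioc 0 y, γ s) + (∫ s in Ioc 0 y, A s) * γ y) := fun y => by ring
      rw [e1, e2, ← integral_add (k1 D') (k2 _)]
      simp only [e3]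
      have e6 : ∫ y, (A y * D' + conj p * γ y) ∂ν = (∫ y, A y ∂ν) * D' + conj p * ∫ y, γ y ∂ν := by
        rw [integral_add (iA.mul_const _) (iγ.const_mul _), integral_mul_const, integral_const_mul]
      refine (integral_add (f := fun y => A y * D' + conj p * γ y)
        ((iA.mul_const _).add (iγ.const_mul _)) j3).trans ?_
      rw [integral_primitive_parts iA iγ, e6]
      have e4 : ∫ y, A y ∂ν = -conj p := eq_neg_of_add_eq_zero_right tR
      have e5 : charCoeff (fun X => ((layerNormal (fun _ : Fin d → ℝ => (-0 : ℝ)) X (Fin.last d) : ℝ)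
          * ψ (X, 0) : ℂ)) j = -p := by
        simp only [layerNormal_last]
        have := charCoeff_const_mul (-1) (fun X => (ψ (X, 0) : ℂ)) j
        simpa using this
      rw [e4, e5, map_neg]
      ring
    · have e1 : ∫ y, conj (rcMode (layerPartial k.castSucc ψ) j y) * w y ∂ν =
          ∫ y, -(conj (rcMode ψ j y) * rcMode (g k.castSucc) j y) ∂ν := by
        refine integral_congr_ae ?_
        filter_upwards [ae_mono hlev (hk k j), ae_mono hlev (cMode_partial_test hψ j k)] with y h3 h4
        rw [h3, h4]
        simp only [hw, map_mul, Complex.conj_I, Complex.conj_ofReal, map_ofNat, map_intCast]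
        ring
      rw [e1, integral_neg]
      simp [charCoeff]
  simp only [hj] at h1
  have c1 : Continuous fun X : Fin d → ℝ =>
      (layerNormal (fun _ : Fin d → ℝ => (-0 : ℝ)) X i * ψ (X, 0) : ℂ) := by
    refine Fin.lastCases ?_ (fun k => ?_) i
    · simp only [layerNormal_last]
      exact continuous_const.mul
        (Complex.continuous_ofReal.comp (hψ1.continuous.comp (by fun_prop)))
    · simp [continuous_const]
  have h3 := hasSum_charCoeff (memLp_unitCube_of_continuous c1 2) hD.ofReal
  have h4 := h1.unique h3
  rw [← Complex.ofReal_inj, h4, ← integral_complex_ofReal]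
  simp

end Synthesis

/-! ### Algebra of trace pairs, and gradients characterised without their potentials. -/

section TracePairs

variable {d : ℕ} {H : (Fin d → ℝ) → ℝ} {V W : LayerPt d → ℝ} {g g' : Fin (d + 1) → LayerPt d → ℝ}
  {φ : LayerPt d → ℝ}
  {D : (Fin d → ℝ) → ℝ}

theorem IsBoundaryTest.green_add_mul (hH : Continuous H) (hHper : TorusPeriodic H)
    {φ : LayerPt d → ℝ} (hφ : IsBoundaryTest φ) (hV : LayerLocL2 H V) (hW : LayerLocL2 H W)
    (hg : ∀ i, MemLp (g i) 2 (layerMeasure H)) (hg' : ∀ i, MemLp (g' i) 2 (layerMeasure H))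
    (c : ℝ) (i : Fin (d + 1)) :
    ∫ z, (layerPartial i φ z * (V z + c * W z) + φ z * (g i z + c * g' i z)) ∂(layerMeasure H) =
      ∫ z, (layerPartial i φ z * V z + φ z * g i z) ∂(layerMeasure H) +
        c * ∫ z, (layerPartial i φ z * W z + φ z * g' i z) ∂(layerMeasure H) := by
  have i1 := hφ.integrable_green hH hHper hV (hg i) i
  have i2 := hφ.integrable_green hH hHper hW (hg' i) i
  rw [← integral_const_mul]
  rw [← integral_add i1 (i2.const_mul c)]
  congr 1; ext z; ring

theorem IsZeroTracePair.add (hH : Continuous H) (hHper : TorusPeriodic H)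
    (h : IsZeroTracePair H V g) (h' : IsZeroTracePair H W g') :
    IsZeroTracePair H (fun z => V z + W z) (fun i z => g i z + g' i z) := by
  refine ⟨fun R => (h.locL2 R).add (h'.locL2 R), fun i => (h.memLp i).add (h'.memLp i),
    fun φ hφ i => ?_⟩
  have h1 := hφ.green_add_mul hH hHper h.locL2 h'.locL2 h.memLp h'.memLp 1 i
  simpa only [one_mul, h.green φ hφ i, h'.green φ hφ i, add_zero] using h1

theorem IsZeroTracePair.const_mul (c : ℝ) (h : IsZeroTracePair H V g) :
    IsZeroTracePair H (fun z => c * V z) (fun i z => c * g i z) := by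
  refine ⟨fun R => (h.locL2 R).const_mul c, fun i => (h.memLp i).const_mul c, fun φ hφ i => ?_⟩
  have h1 := congrArg (c * ·) (h.green φ hφ i)
  simp only [← integral_const_mul, mul_zero] at h1
  rw [← h1]
  congr 1; ext z; ring

theorem IsZeroTracePair.zero : IsZeroTracePair H (fun _ => 0) (fun _ _ => 0) :=
  ⟨fun _ => by simp, fun _ => by simp, fun _ _ _ => by simp⟩

theorem IsZeroTracePair.sum (hH : Continuous H) (hHper : TorusPeriodic H) {ι : Type}
    (s : Finset ι) {V : ι → LayerPt d → ℝ} {g : ι → Fin (d + 1) → LayerPt d → ℝ}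
    (h : ∀ m, IsZeroTracePair H (V m) (g m)) :
    IsZeroTracePair H (fun z => ∑ m ∈ s, V m z) (fun i z => ∑ m ∈ s, g m i z) := by
  classical
  induction s using Finset.induction_on with
  | empty => simpa using IsZeroTracePair.zero
  | insert a s ha ih =>
    simp only [Finset.sum_insert ha]
    exact (h a).add hH hHper ih

/-- The product rule puts `∂f · V` into the gradient, whence the requirement that `V` be square
integrable on the whole domain and not just locally. -/
theorem IsZeroTracePair.profile_mul (h : IsZeroTracePair H V g) (hV : MemLp V 2 (layerMeasure H))
    {f : (Fin d → ℝ) → ℝ} (hf : ContDiff ℝ ∞ f) (hper : TorusPeriodic f)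
    (hper' : ∀ k, TorusPeriodic fun X => fderiv ℝ f X (Pi.single k 1)) :
    IsZeroTracePair H (fun z => f z.1 * V z)
      (fun i z => f z.1 * g i z + fderiv ℝ f z.1 (layerDir i).1 * V z) := by
  refine ⟨fun R => memLp_bounded_profile_mul hf.continuous hper (h.locL2 R), fun i => ?_,
    fun φ hφ i => ?_⟩
  · refine (memLp_bounded_profile_mul hf.continuous hper (h.memLp i)).add ?_
    refine Fin.lastCases ?_ (fun k => ?_) i
    · simp
    · simp only [layerDir_castSucc]
      exact memLp_bounded_profile_mul (f := fun X => fderiv ℝ f X (Pi.single k 1))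
        (contDiff_partial_profile hf k).continuous (hper' k) hV
  · refine Eq.trans ?_ (h.green _ (hφ.profile_mul hf hper) i)
    congr 1; ext z
    rw [layerPartial_profile_mul (hφ.smooth.differentiable (by simp)) hf]
    ring

/-- The gradient in physical coordinates of a function with flat gradient `γ`. -/
noncomputable def physGrad (H : (Fin d → ℝ) → ℝ) (γ : Fin (d + 1) → LayerPt d → ℝ)
    (i : Fin (d + 1)) (z : LayerPt d) : ℝ :=
  γ i (layerUnshear H z) + fderiv ℝ H z.1 (layerDir i).1 * γ (Fin.last d) (layerUnshear H z)

theorem LayerLocL2.unshear (hH : Measurable H) {M : ℝ} (hM : ∀ X, H X ≤ M)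
    (hV : LayerLocL2 (fun _ : Fin d → ℝ => -0) V) :
    LayerLocL2 H (fun z => V (layerUnshear H z)) := by
  intro R
  have hV' := hV (R + M)
  rw [layerMeasure_const] at hV'
  have h1 := (measurePreserving_layerUnshear hH).restrict_preimage
    (measurableSet_lt measurable_snd measurable_const : MeasurableSet {z : LayerPt d | z.2 < R + M})
  have h2 := hV'.comp_measurePreserving h1
  refine h2.mono_measure (Measure.restrict_mono (fun z hz => ?_) le_rfl)
  have hz' : z.2 < R := hz
  show z.2 + H z.1 < R + M
  linarith [hM z.1]

theorem IsBoundaryTest.comp_shear (hH : ContDiff ℝ ∞ H) (hHper : TorusPeriodic H)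
    (hφ : IsBoundaryTest φ) :
    IsBoundaryTest (fun z => φ (layerShear H z)) := by
  obtain ⟨M, -, hM⟩ := exists_bound_of_torusPeriodic hH.continuous hHper
  obtain ⟨R, hR⟩ := hφ.support
  refine ⟨hφ.smooth.comp (contDiff_layerShear hH), hφ.periodic.comp_shear hHper, R + M,
    fun z hz => ?_⟩
  have := hR _ hz
  simp only [layerShear] at this
  linarith [(abs_le.mp (hM z.1)).2]

theorem IsTracePair.unshear (hH : ContDiff ℝ ∞ H) (hHper : TorusPeriodic H)
    (h : IsTracePair (fun _ => -0) V g D) :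
    IsTracePair H (fun z => V (layerUnshear H z)) (physGrad H g) D := by
  obtain ⟨M, -, hM⟩ := exists_bound_of_torusPeriodic hH.continuous hHper
  have hHm := hH.continuous.measurable
  have hg := h.memLp
  rw [layerMeasure_const] at hg
  have hgu : ∀ i, MemLp (fun z => g i (layerUnshear H z)) 2 (layerMeasure H) := fun i =>
    (hg i).comp_measurePreserving (measurePreserving_layerUnshear hHm)
  refine ⟨h.locL2.unshear hHm fun X => (abs_le.mp (hM X)).2, fun i => (hgu i).add ?_,
    fun φ hφ i => ?_⟩
  · refine Fin.lastCases ?_ (fun k => ?_) i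
    · simp
    · simp only [layerDir_castSucc]
      exact memLp_profile_mul hH hHper k (hgu (Fin.last d))
  · have hψ := hφ.comp_shear hH hHper
    set ψ : LayerPt d → ℝ := fun z => φ (layerShear H z) with hψdef
    have heq : φ = fun z => ψ (layerUnshear H z) := by ext z; simp [hψdef]
    have hd : ∀ w, DifferentiableAt ℝ ψ w := fun w => (hψ.smooth.differentiable (by simp)) w
    rw [← integral_layerShear hHm]
    refine Fin.lastCases ?_ (fun k => ?_) i
    · refine Eq.trans ?_ ((h.green ψ hψ (Fin.last d)).trans ?_)
      · rw [layerMeasure_const]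
        congr 1; ext z
        conv_lhs => rw [heq]
        rw [layerPartial_comp_unshear_last hH _ (hd _)]
        simp [physGrad]
      · simp [hψdef, layerShear]
    · have hχ := hψ.profile_mul (contDiff_partial_profile hH k) (periodic_partial_profile hHper k)
      have e1 := h.green ψ hψ k.castSucc
      have e2 := h.green _ hχ (Fin.last d)
      have c0 : Continuous fun _ : Fin d → ℝ => (-0 : ℝ) := continuous_const
      have e3 := integral_add (hψ.integrable_green c0 (fun _ _ => rfl) h.locL2
        (h.memLp k.castSucc) k.castSucc)
        (hχ.integrable_green c0 (fun _ _ => rfl) h.locL2 (h.memLp (Fin.last d)) (Fin.last d))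
      rw [e1, e2] at e3
      refine Eq.trans ?_ (e3.trans ?_)
      · rw [layerMeasure_const]
        congr 1; ext z
        conv_lhs => rw [heq]
        rw [layerPartial_comp_unshear_castSucc hH _ _ (hd _)]
        simp only [layerPartial_profile_mul hd (contDiff_partial_profile hH k), physGrad, layerUnshear_shear, layerDir_castSucc, layerDir_last, map_zero]
        simp only [layerShear]
        ring
      · simp [hψdef, layerShear]

theorem IsZeroTracePair.unshear (hH : ContDiff ℝ ∞ H) (hHper : TorusPeriodic H)
    (h : IsZeroTracePair (fun _ => -0) V g) :
    IsZeroTracePair H (fun z => V (layerUnshear H z)) (physGrad H g) :=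
  isTracePair_zero_iff.mp ((isTracePair_zero_iff.mpr h).unshear hH hHper)

theorem slabL2_flatPrim {f : LayerPt d → ℝ} (hf : MemLp f 2 (flatMeasure d)) :
    SlabL2 0 (fun z => (flatPrim f z : ℂ)) := fun T => (memLp_flatPrim hf T).ofReal

theorem layerLocL2_flatPrim {f : LayerPt d → ℝ} (hf : MemLp f 2 (flatMeasure d)) :
    LayerLocL2 (fun _ : Fin d → ℝ => -0) (flatPrim f) := by
  intro R
  have h := memLp_flatPrim hf R
  rw [slabMeasure_restrict] at h
  rw [layerMeasure_const, slabMeasure_restrict, Measure.restrict_restrict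
    (measurableSet_lt measurable_snd measurable_const)]
  refine h.mono_measure (Measure.restrict_mono (fun z hz => ?_) le_rfl)
  exact ⟨hz.2.1, hz.2.2, le_of_lt hz.1⟩

/-- A function of zero trace is the primitive of its vertical derivative. -/
theorem IsZeroTracePair.ae_eq_flatPrim (hH : ContDiff ℝ ∞ H) (hHper : TorusPeriodic H)
    (h : IsZeroTracePair H V g) : (fun z => V (layerShear H z)) =ᵐ[flatMeasure d]
      flatPrim (fun z => g (Fin.last d) (layerShear H z)) := by
  have hf := h.flat hH hHper
  have hg : MemLp (fun z => g (Fin.last d) (layerShear H z)) 2 (flatMeasure d) :=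
    MemLp.flat hH.continuous.measurable (h.memLp _)
  have h1 : (fun z => (V (layerShear H z) : ℂ) + (-1) *
      (flatPrim (fun z => g (Fin.last d) (layerShear H z)) z : ℂ)) =ᵐ[flatMeasure d] 0 := by
    have hs := slabL2_flatPrim hg
    refine SlabL2.ae_eq_zero (hf.locL2.slabL2.add (hs.const_mul (-1))) fun j => ?_
    have h2 := (hf.modes_last j).eq_primitive (hf.locL2.slabL2.cMode_integrableOn j) ?_
    · have h3 : ∀ᵐ y ∂(volIoi (0 : ℝ)), cMode (fun z =>
          (V (layerShear H z) : ℂ) + (-1) *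
            (flatPrim (fun z => g (Fin.last d) (layerShear H z)) z : ℂ)) j y =
          cMode (fun z => (V (layerShear H z) : ℂ)) j y + cMode (fun z => (-1) *
            (flatPrim (fun z => g (Fin.last d) (layerShear H z)) z : ℂ)) j y :=
        ae_Ioi_of_forall_Ioc fun T => cMode_add (hf.locL2.slabL2 T) (hs.const_mul (-1) T) j
      filter_upwards [h2, h3] with y e2 e3
      rw [e3, cMode_const_mul, cMode_flatPrim hg, e2]
      simp
    · intro T
      exact SlabL2.cMode_integrableOn (MemLp.slabL2 (MemLp.slab_ofReal (hf.memLp _))) j T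
  filter_upwards [h1] with z hz
  have h4 : (V (layerShear H z) : ℂ) =
      (flatPrim (fun z => g (Fin.last d) (layerShear H z)) z : ℂ) := by
    simp only [Pi.zero_apply] at hz
    linear_combination hz
  exact_mod_cast h4

theorem flatWeightedL2_of_test {f : LayerPt d → ℝ} (hf : Continuous f) (hper : LayerPeriodic f)
    {R : ℝ} (hR : ∀ z, f z ≠ 0 → z.2 ≤ R) : FlatWeightedL2 f := by
  refine memLp_of_layerTest (by fun_prop) (fun Y j X => ?_) (R := R)
    fun z hz => hR z (right_ne_zero_of_mul hz)
  have := hper Y j X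
  simp only at this
  simp only [this]

theorem IsBoundaryTest.flatWeightedL2 (hH : ContDiff ℝ ∞ H) (hHper : TorusPeriodic H)
    (hφ : IsBoundaryTest φ) :
    FlatWeightedL2 (fun z => φ (layerShear H z)) := by
  have h := hφ.comp_shear hH hHper
  obtain ⟨R, hR⟩ := h.support
  exact flatWeightedL2_of_test h.smooth.continuous h.periodic hR

theorem IsBoundaryTest.flatWeightedL2_partial (hH : ContDiff ℝ ∞ H) (hHper : TorusPeriodic H)
    (hφ : IsBoundaryTest φ) (i : Fin (d + 1)) :
    FlatWeightedL2 (fun z => layerPartial i φ (layerShear H z)) := by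
  obtain ⟨M, -, hM⟩ := exists_bound_of_torusPeriodic hH.continuous hHper
  obtain ⟨R, hR⟩ := hφ.support
  refine flatWeightedL2_of_test (R := R + M) ((continuous_layerPartial (hφ.smooth.of_le (by simp))
    i).comp (contDiff_layerShear hH).continuous)
    ((periodic_layerPartial hφ.periodic i).comp_shear hHper) fun z hz => ?_
  have := support_layerPartial hR i _ hz
  simp only [layerShear] at this
  linarith [(abs_le.mp (hM z.1)).2]

theorem IsBoundaryTest.memLp_flat (hH : ContDiff ℝ ∞ H) (hHper : TorusPeriodic H)
    (hφ : IsBoundaryTest φ) :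
    MemLp (fun z => φ (layerShear H z)) 2 (flatMeasure d) := by
  have h := hφ.comp_shear hH hHper
  obtain ⟨R, hR⟩ := h.support
  exact memLp_of_layerTest h.smooth.continuous h.periodic hR

/-- The potential can only be the vertical primitive of the last component, and the duality of
`flatPrim` and `flatTail` turns the pairing with it into an `L²` pairing with `g`. The resulting
condition no longer mentions the potential and is stable under `L²` limits. -/
theorem isZeroTracePair_flatPrim_iff (hH : ContDiff ℝ ∞ H) (hHper : TorusPeriodic H)
    (hg : ∀ i, MemLp (g i) 2 (flatMeasure d)) :
    (∃ V, IsZeroTracePair H V (fun i z => g i (layerUnshear H z))) ↔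
      ∀ φ : LayerPt d → ℝ, IsBoundaryTest φ → ∀ i,
        (∫ z, flatTail (fun z => layerPartial i φ (layerShear H z)) z * g (Fin.last d) z
          ∂(flatMeasure d)) + ∫ z, φ (layerShear H z) * g i z ∂(flatMeasure d) = 0 := by
  obtain ⟨M, -, hM⟩ := exists_bound_of_torusPeriodic hH.continuous hHper
  have hHm := hH.continuous.measurable
  have key : ∀ φ : LayerPt d → ℝ, IsBoundaryTest φ → ∀ i,
      (∫ z, flatTail (fun z => layerPartial i φ (layerShear H z)) z * g (Fin.last d) z
          ∂(flatMeasure d)) + ∫ z, φ (layerShear H z) * g i z ∂(flatMeasure d) =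
      ∫ z, (layerPartial i φ (layerShear H z) * flatPrim (g (Fin.last d)) z +
        φ (layerShear H z) * g i z) ∂(flatMeasure d) := by
    intro φ hφ i
    have h1 := (hφ.flatWeightedL2_partial hH hHper i).integrable_mul_flatPrim (hg (Fin.last d))
    rw [← h1.2]
    exact (integral_add h1.1 (MemLp.integrable_mul (hφ.memLp_flat hH hHper) (hg i))).symm
  constructor
  · rintro ⟨V, h⟩ φ hφ i
    rw [key φ hφ i, ← h.green φ hφ i, ← integral_layerShear hHm]
    refine integral_congr_ae ?_
    filter_upwards [h.ae_eq_flatPrim hH hHper] with z hz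
    simp only [hz, layerUnshear_shear]
  · intro h
    refine ⟨fun z => flatPrim (g (Fin.last d)) (layerUnshear H z),
      (layerLocL2_flatPrim (hg _)).unshear hHm fun X => (abs_le.mp (hM X)).2,
      fun i => (hg i).comp_measurePreserving (measurePreserving_layerUnshear hHm),
      fun φ hφ i => ?_⟩
    rw [← h φ hφ i, key φ hφ i, ← integral_layerShear hHm]
    simp

end TracePairs

/-! ### The scalar equation `x' + w x = c` with zero initial value. -/

section Filter

/-- The solution of `x' = -w x + c`, `x 0 = 0`. -/
noncomputable def expFilter (w : ℝ) (c : ℝ → ℂ) (y : ℝ) : ℂ :=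
  ∫ s in Ioc 0 y, (exp (-(w * (y - s))) : ℂ) * c s

theorem expFilter_eq_mul (w : ℝ) (c : ℝ → ℂ) (y : ℝ) :
    expFilter w c y = (exp (-(w * y)) : ℂ) * ∫ s in Ioc 0 y, (exp (w * s) : ℂ) * c s := by
  rw [expFilter, ← integral_const_mul]
  congr 1
  ext s
  rw [← mul_assoc, ← Complex.ofReal_mul, ← Real.exp_add]
  ring_nf

theorem integrableOn_exp_mul {c : ℝ → ℂ} (hc : ∀ T, IntegrableOn c (Ioc 0 T)) (w T : ℝ) :
    IntegrableOn (fun s => (exp (w * s) : ℂ) * c s) (Ioc 0 T) :=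
  ((IntegrableOn.Icc_of_Ioc (hc T)).continuousOn_mul
    (by fun_prop : Continuous fun s : ℝ => (exp (w * s) : ℂ)).continuousOn
    isCompact_Icc).mono_set Ioc_subset_Icc_self

theorem continuousOn_expFilter {c : ℝ → ℂ} (hc : ∀ T, IntegrableOn c (Ioc 0 T)) (w : ℝ) :
    ContinuousOn (expFilter w c) (Ici 0) := by
  have h : expFilter w c = fun y => (exp (-(w * y)) : ℂ) *
      ∫ s in Ioc 0 y, (exp (w * s) : ℂ) * c s := funext fun y => expFilter_eq_mul w c y
  rw [h]
  exact (by fun_prop : Continuous fun y : ℝ => (exp (-(w * y)) : ℂ)).continuousOn.mul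
    (continuousOn_primitive_Ioc fun T => integrableOn_exp_mul hc w T)

/-- The function `w e^{-w(t-s)}` of `t` integrates over `(s, y]` to `1 - e^{-w(y-s)}`, so exchanging
the integrals yields the differential equation in integrated form. -/
theorem expFilter_eq_primitive {c : ℝ → ℂ} (hc : ∀ T, IntegrableOn c (Ioc 0 T)) (w : ℝ) {y : ℝ} :
    expFilter w c y = ∫ s in Ioc 0 y, (c s - w * expFilter w c s) := by
  have hx : IntegrableOn (fun s => (w : ℂ) * expFilter w c s) (Ioc 0 y) :=
    ((((continuousOn_expFilter hc w).mono Icc_subset_Ici_self).integrableOn_compact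
      isCompact_Icc).mono_set Ioc_subset_Icc_self).const_mul _
  rw [integral_sub (hc y) hx]
  have h1 : ∀ s, (w : ℂ) * expFilter w c s = ((w * exp (-(w * s)) : ℝ) : ℂ) *
      ∫ t in Ioc 0 s, (exp (w * t) : ℂ) * c t := fun s => by rw [expFilter_eq_mul]; push_cast; ring
  simp only [h1]
  rw [integral_mul_primitive (Continuous.integrableOn_Ioc (by fun_prop))
    (integrableOn_exp_mul hc w y)]
  have h2 : ∀ s ∈ Ioc 0 y, (∫ t in Ioc s y, ((w * exp (-(w * t)) : ℝ) : ℂ)) *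
      ((exp (w * s) : ℂ) * c s) = c s - (exp (-(w * (y - s))) : ℂ) * c s := by
    intro s hs
    have h3 : ∫ t in Ioc s y, w * exp (-(w * t)) = exp (-(w * s)) - exp (-(w * y)) := by
      rw [← intervalIntegral.integral_of_le hs.2]
      have h4 : ∀ t, HasDerivAt (fun t => -exp (-(w * t))) (w * exp (-(w * t))) t := fun t => by
        have := (((hasDerivAt_id t).const_mul w).neg.exp).neg
        refine HasDerivAt.congr_deriv this ?_
        simp only [id, mul_one, mul_neg, neg_neg]
        exact mul_comm _ _
      rw [intervalIntegral.integral_eq_sub_of_hasDerivAt (fun t _ => h4 t)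
        (Continuous.intervalIntegrable (by fun_prop) _ _)]
      ring
    rw [integral_complex_ofReal, h3, ← mul_assoc, ← Complex.ofReal_mul, sub_mul, ← Real.exp_add,
      ← Real.exp_add]
    have e1 : -(w * s) + w * s = 0 := by ring
    have e2 : -(w * y) + w * s = -(w * (y - s)) := by ring
    rw [e1, e2, Real.exp_zero]
    push_cast
    ring
  rw [setIntegral_congr_fun measurableSet_Ioc h2]
  have hk : IntegrableOn (fun s => (exp (-(w * (y - s))) : ℂ) * c s) (Ioc 0 y) :=
    ((IntegrableOn.Icc_of_Ioc (hc y)).continuousOn_mul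
      (by fun_prop : Continuous fun s : ℝ => (exp (-(w * (y - s))) : ℂ)).continuousOn
      isCompact_Icc).mono_set Ioc_subset_Icc_self
  rw [integral_sub (hc y) hk, expFilter]
  ring

theorem lintegral_exp_le {w : ℝ} (hw : 0 < w) (y : ℝ) :
    ∫⁻ s in Iic y, ENNReal.ofReal (exp (-(w * (y - s)))) ≤ ENNReal.ofReal (1 / w) := by
  have h1 : ∀ s, exp (-(w * (y - s))) = exp (-(w * y)) * exp (w * s) := fun s => by
    rw [← Real.exp_add]; ring_nf
  simp only [h1]
  rw [← ofReal_integral_eq_lintegral_ofReal]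
  · rw [integral_const_mul, integral_exp_mul_Iic hw, mul_div_assoc', ← Real.exp_add]
    simp
  · exact (integrableOn_exp_mul_Iic hw y).const_mul _
  · exact ae_of_all _ fun s => by positivity

theorem lintegral_exp_le' {w : ℝ} (hw : 0 < w) (s : ℝ) :
    ∫⁻ y in Ici s, ENNReal.ofReal (exp (-(w * (y - s)))) ≤ ENNReal.ofReal (1 / w) := by
  have h1 : ∀ y, exp (-(w * (y - s))) = exp (w * s) * exp (-w * y) := fun y => by
    rw [← Real.exp_add]; ring_nf
  simp only [h1]
  rw [setLIntegral_congr Ioi_ae_eq_Ici.symm, ← ofReal_integral_eq_lintegral_ofReal]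
  · rw [integral_const_mul, integral_exp_mul_Ioi (by linarith), neg_div_neg_eq, mul_div_assoc',
      ← Real.exp_add]
    simp
  · exact (integrableOn_exp_mul_Ioi (by linarith) s).const_mul _
  · exact ae_of_all _ fun s => by positivity

/-- Schur's test: the kernel `e^{-w(y-s)}` on `s ≤ y` has integral at most `1/w` in each variable.
-/
theorem lintegral_expFilter_sq_le {w : ℝ} (hw : 0 < w) {C : ℝ → ENNReal} (hC : Measurable C) :
    ∫⁻ y in Ioi 0, (∫⁻ s in Ioc 0 y, ENNReal.ofReal (exp (-(w * (y - s)))) * C s) ^ 2 ≤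
      ENNReal.ofReal (1 / w) ^ 2 * ∫⁻ s in Ioi 0, C s ^ 2 := by
  set K : ℝ → ℝ → ENNReal := fun y s => ENNReal.ofReal (exp (-(w * (y - s)))) with hK
  set S : ℝ → ℝ → ENNReal := fun y s => ENNReal.ofReal (exp (-(w * (y - s)) / 2)) with hS
  have hSS : ∀ y s, S y s ^ 2 = K y s := fun y s => by
    rw [hS, hK]
    simp only
    rw [← ENNReal.ofReal_pow (Real.exp_pos _).le, ← Real.exp_nat_mul]
    congr 2; push_cast; ring
  have h1 : ∀ y, (∫⁻ s in Ioc 0 y, K y s * C s) ^ 2 ≤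
      ENNReal.ofReal (1 / w) * ∫⁻ s in Ioi 0, (Iic y).indicator (fun s => K y s * C s ^ 2) s := by
    intro y
    have e1 : ∀ s, K y s * C s = S y s * (S y s * C s) := fun s => by rw [← hSS]; ring
    simp only [e1]
    refine (lintegral_mul_sq_le _ (by fun_prop) (by fun_prop)).trans ?_
    simp only [mul_pow, hSS]
    gcongr ?_ * ?_
    · exact (lintegral_mono_set fun s hs => hs.2).trans (lintegral_exp_le hw y)
    · rw [lintegral_indicator measurableSet_Iic, Measure.restrict_restrict measurableSet_Iic]
      refine lintegral_mono_set fun s hs => ⟨hs.2, hs.1⟩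
  refine (lintegral_mono h1).trans ?_
  have hm : Measurable (Function.uncurry fun y s : ℝ =>
      (Iic y).indicator (fun s => K y s * C s ^ 2) s) := by
    have : (Function.uncurry fun y s : ℝ => (Iic y).indicator (fun s => K y s * C s ^ 2) s) =
        {p : ℝ × ℝ | p.2 ≤ p.1}.indicator fun p => K p.1 p.2 * C p.2 ^ 2 := by
      ext p; simp [Function.uncurry, indicator]
    rw [this]
    exact Measurable.indicator (by simp only [hK]; fun_prop)
      (measurableSet_le measurable_snd measurable_fst)
  have hm1 : Measurable fun y => ∫⁻ s in Ioi 0, (Iic y).indicator (fun s => K y s * C s ^ 2) s :=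
    hm.lintegral_prod_right'
  rw [lintegral_const_mul _ hm1, lintegral_lintegral_swap hm.aemeasurable, pow_two, mul_assoc]
  gcongr
  rw [← lintegral_const_mul _ (by fun_prop)]
  refine lintegral_mono fun s => ?_
  have e2 : ∀ y, (Iic y).indicator (fun s => K y s * C s ^ 2) s =
      (Ici s).indicator (fun y => K y s) y * C s ^ 2 := fun y => by by_cases h : s ≤ y <;> simp [h]
  simp only [e2]
  have hm2 : Measurable fun y => (Ici s).indicator (fun y => K y s) y :=
    Measurable.indicator (by simp only [hK]; fun_prop) measurableSet_Ici
  rw [lintegral_mul_const _ hm2]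
  gcongr
  rw [lintegral_indicator measurableSet_Ici]
  exact (lintegral_mono' (Measure.restrict_mono le_rfl Measure.restrict_le_self) le_rfl).trans
    (lintegral_exp_le' hw s)

theorem expFilter_congr {c c' : ℝ → ℂ} (h : c =ᵐ[volIoi 0] c') (w y : ℝ) :
    expFilter w c y = expFilter w c' y := by
  refine integral_congr_ae ?_
  filter_upwards [ae_mono (Measure.restrict_mono (fun s hs => hs.1) le_rfl) h] with s hs
  rw [hs]

/-- The filter is bounded by `1 / w` in `L²`. -/
theorem memLp_expFilter {w : ℝ} (hw : 0 < w) {c : ℝ → ℂ}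
    (hc : MemLp c 2 volIoi 0) :
    MemLp (expFilter w c) 2 volIoi 0 ∧
      ∫ y in Ioi 0, ‖(w : ℂ) * expFilter w c y‖ ^ 2 ≤ ∫ y in Ioi 0, ‖c y‖ ^ 2 := by
  have hcI := MemLp.integrableOn_Ioc hc
  have hm : AEStronglyMeasurable (expFilter w c) volIoi 0 :=
    ((continuousOn_expFilter hcI w).mono Ioi_subset_Ici_self).aestronglyMeasurable measurableSet_Ioi
  set c' := hc.1.mk c with hc'
  have hmk := hc.1.stronglyMeasurable_mk
  have h1 : ∫⁻ y in Ioi 0, ‖expFilter w c y‖ₑ ^ 2 ≤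
      ENNReal.ofReal (1 / w) ^ 2 * ∫⁻ y in Ioi 0, ‖c y‖ₑ ^ 2 := by
    have e0 : ∫⁻ y in Ioi 0, ‖c y‖ₑ ^ 2 = ∫⁻ y in Ioi 0, ‖c' y‖ₑ ^ 2 := by
      refine lintegral_congr_ae ?_
      filter_upwards [hc.1.ae_eq_mk] with y hy
      rw [hy]
    rw [e0]
    refine le_trans (lintegral_mono fun y => ?_)
      (lintegral_expFilter_sq_le hw (C := fun s => ‖c' s‖ₑ) hmk.measurable.enorm)
    rw [expFilter_congr hc.1.ae_eq_mk]
    refine pow_le_pow_left' ((enorm_integral_le_lintegral_enorm _).trans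
      (lintegral_mono fun s => ?_)) 2
    rw [enorm_mul, ← ofReal_norm, Complex.norm_real, Real.norm_of_nonneg (Real.exp_pos _).le]
  have h2 := (memLp_two_iff_lintegral hc.1).mp hc
  have h3 : MemLp (expFilter w c) 2 volIoi 0 :=
    (memLp_two_iff_lintegral hm).mpr (h1.trans_lt (ENNReal.mul_lt_top (by finiteness) h2))
  refine ⟨h3, ?_⟩
  have h4 : ∀ f : ℝ → ℂ, MemLp f 2 volIoi 0 → ∫⁻ y in Ioi 0, ‖f y‖ₑ ^ 2 =
      ENNReal.ofReal (∫ y in Ioi 0, ‖f y‖ ^ 2) := fun f hf => by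
    rw [ofReal_integral_eq_lintegral_ofReal (hf.integrable_norm_pow (by norm_num))
      (ae_of_all _ fun y => by positivity)]
    refine lintegral_congr fun y => ?_
    rw [← ofReal_norm, ENNReal.ofReal_pow (norm_nonneg _)]
  rw [h4 _ h3, h4 _ hc, ← ENNReal.ofReal_pow (by positivity), ← ENNReal.ofReal_mul (by positivity),
    ENNReal.ofReal_le_ofReal_iff (by positivity)] at h1
  simp only [norm_mul, mul_pow, Complex.norm_real, Real.norm_of_nonneg hw.le]
  rw [integral_const_mul]
  calc w ^ 2 * ∫ y in Ioi 0, ‖expFilter w c y‖ ^ 2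
      ≤ w ^ 2 * ((1 / w) ^ 2 * ∫ y in Ioi 0, ‖c y‖ ^ 2) := by gcongr
    _ = ∫ y in Ioi 0, ‖c y‖ ^ 2 := by field_simp


/-- The derivative of the filtered function. -/
noncomputable def expFilterDeriv (w : ℝ) (c : ℝ → ℂ) (y : ℝ) : ℂ := c y - w * expFilter w c y

/-- The factor `w` keeps the bound uniform down to `w = 0`, where the filter is a plain primitive
and may fail to be square integrable. -/
theorem memLp_mul_expFilter {w : ℝ} (hw : 0 ≤ w) {c : ℝ → ℂ}
    (hc : MemLp c 2 volIoi 0) :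
    MemLp (fun y => (w : ℂ) * expFilter w c y) 2 volIoi 0 ∧
      ∫ y in Ioi 0, ‖(w : ℂ) * expFilter w c y‖ ^ 2 ≤ ∫ y in Ioi 0, ‖c y‖ ^ 2 := by
  rcases hw.eq_or_lt with h | h
  · subst h
    simp only [Complex.ofReal_zero, zero_mul, norm_zero]
    exact ⟨by simp, by simp; positivity⟩
  · exact ⟨(memLp_expFilter h hc).1.const_mul _, (memLp_expFilter h hc).2⟩

theorem memLp_expFilterDeriv {w : ℝ} (hw : 0 ≤ w) {c : ℝ → ℂ}
    (hc : MemLp c 2 volIoi 0) :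
    MemLp (expFilterDeriv w c) 2 volIoi 0 ∧
      ∫ y in Ioi 0, ‖expFilterDeriv w c y‖ ^ 2 ≤ 4 * ∫ y in Ioi 0, ‖c y‖ ^ 2 := by
  obtain ⟨h1, h2⟩ := memLp_mul_expFilter hw hc
  have h3 : MemLp (expFilterDeriv w c) 2 volIoi 0 := hc.sub h1
  refine ⟨h3, ?_⟩
  have i1 := hc.integrable_norm_pow (p := 2) (by norm_num)
  have i2 := h1.integrable_norm_pow (p := 2) (by norm_num)
  calc ∫ y in Ioi 0, ‖expFilterDeriv w c y‖ ^ 2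
      ≤ ∫ y in Ioi 0, (2 * ‖c y‖ ^ 2 + 2 * ‖(w : ℂ) * expFilter w c y‖ ^ 2) := by
        refine integral_mono (h3.integrable_norm_pow (by norm_num))
          ((i1.const_mul 2).add (i2.const_mul 2)) fun y => ?_
        have := norm_sub_le (c y) ((w : ℂ) * expFilter w c y)
        simp only [expFilterDeriv]
        nlinarith [norm_nonneg (c y - (w : ℂ) * expFilter w c y), norm_nonneg (c y),
          norm_nonneg ((w : ℂ) * expFilter w c y),
          sq_nonneg (‖c y‖ - ‖(w : ℂ) * expFilter w c y‖)]
    _ = 2 * (∫ y in Ioi 0, ‖c y‖ ^ 2) + 2 * ∫ y in Ioi 0, ‖(w : ℂ) * expFilter w c y‖ ^ 2 := by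
        rw [integral_add (i1.const_mul 2) (i2.const_mul 2), integral_const_mul, integral_const_mul]
    _ ≤ 4 * ∫ y in Ioi 0, ‖c y‖ ^ 2 := by linarith

theorem expFilter_conj (w : ℝ) (c : ℝ → ℂ) (y : ℝ) :
    expFilter w (fun y => conj (c y)) y = conj (expFilter w c y) := by
  rw [expFilter, expFilter, ← integral_conj]
  simp only [map_mul, Complex.conj_ofReal]

end Filter

/-! ### Solving the divergence equation with zero trace. -/

section Divergence

variable {d : ℕ} {H : (Fin d → ℝ) → ℝ}

theorem freqNorm_neg (j : Fin d → ℤ) : freqNorm (-j) = freqNorm j := by simp [freqNorm]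

theorem freqNorm_nonneg (j : Fin d → ℤ) : 0 ≤ freqNorm j := Real.sqrt_nonneg _

theorem freqNorm_sq (j : Fin d → ℤ) : freqNorm j ^ 2 = ∑ k, (j k : ℝ) ^ 2 :=
  Real.sq_sqrt (Finset.sum_nonneg fun _ _ => sq_nonneg _)

theorem abs_le_freqNorm (j : Fin d → ℤ) (k : Fin d) : |(j k : ℝ)| ≤ freqNorm j := by
  rw [← Real.sqrt_sq_eq_abs]
  exact Real.sqrt_le_sqrt (Finset.single_le_sum (f := fun k => (j k : ℝ) ^ 2)
    (fun _ _ => sq_nonneg _) (Finset.mem_univ k))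

theorem freqNorm_eq_zero {j : Fin d → ℤ} : freqNorm j = 0 ↔ j = 0 := by
  constructor
  · intro h
    ext k
    have := abs_le_freqNorm j k
    rw [h] at this
    simpa using le_antisymm this (abs_nonneg _)
  · rintro rfl
    simp [freqNorm]

/-- A combination of Fourier coefficients with multipliers bounded by one. -/
theorem exists_real_multiplier {b c : (Fin d → ℤ) → ℝ → ℂ} {m : (Fin d → ℤ) → ℂ} {K L : ℝ}
    (hb : ∀ j, MemLp (b j) 2 volIoi 0)
    (hbc : ∀ j, ∫ y in Ioi 0, ‖b j y‖ ^ 2 ≤ K * ∫ y in Ioi 0, ‖c j y‖ ^ 2)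
    (hs : Summable fun j => ∫ y in Ioi 0, ‖c j y‖ ^ 2) (hm : ∀ j, ‖m j‖ ≤ L)
    (hsym : ∀ j y, m (-j) * b (-j) y = conj (m j * b j y)) :
    ∃ f : LayerPt d → ℝ, MemLp f 2 (flatMeasure d) ∧
      ∀ j, rcMode f j =ᵐ[volIoi 0] fun y => m j * b j y := by
  refine exists_real_cMode_eq (fun j => (hb j).const_mul _) ?_ hsym
  refine Summable.of_nonneg_of_le (fun j => by positivity) (fun j => ?_) (hs.mul_left (L ^ 2 * K))
  simp only [norm_mul, mul_pow]
  rw [integral_const_mul, mul_assoc]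
  have h0 : 0 ≤ ∫ y in Ioi 0, ‖b j y‖ ^ 2 := by positivity
  have := hbc j
  gcongr
  exact hm j

/-- Modewise solution of `w x + x' = c` with `x 0 = 0`. -/
theorem exists_mode_filter {p : LayerPt d → ℝ} (hp : MemLp p 2 (flatMeasure d)) :
    ∃ x x' : (Fin d → ℤ) → ℝ → ℂ,
      (∀ j y, x (-j) y = conj (x j y)) ∧ (∀ j y, x' (-j) y = conj (x' j y)) ∧
      (∀ j y, x j y = ∫ s in Ioc 0 y, x' j s) ∧
      (∀ j y, x' j y + (2 * π * freqNorm j : ℝ) * x j y = rcMode p j y) ∧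
      (∀ j, MemLp (fun y => ((2 * π * freqNorm j : ℝ) : ℂ) * x j y) 2 volIoi 0) ∧
      (∀ j, ∫ y in Ioi 0, ‖((2 * π * freqNorm j : ℝ) : ℂ) * x j y‖ ^ 2 ≤
        4 * ∫ y in Ioi 0, ‖rcMode p j y‖ ^ 2) ∧ (∀ j, MemLp (x' j) 2 volIoi 0) ∧
      ∀ j, ∫ y in Ioi 0, ‖x' j y‖ ^ 2 ≤ 4 * ∫ y in Ioi 0, ‖rcMode p j y‖ ^ 2 := by
  have hcm : ∀ j, MemLp (rcMode p j) 2 volIoi 0 :=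
    fun j => MemLp.cMode hp.ofReal j
  have hw0 : ∀ j : Fin d → ℤ, 0 ≤ 2 * π * freqNorm j := fun j =>
    mul_nonneg (by positivity) (freqNorm_nonneg j)
  have hcn : ∀ j, rcMode p (-j) = fun y => conj (rcMode p j y) :=
    fun j => funext fun y => cMode_ofReal_neg p j y
  have hxn : ∀ j y, expFilter (2 * π * freqNorm (-j)) (rcMode p (-j)) y =
      conj (expFilter (2 * π * freqNorm j) (rcMode p j) y) := fun j y => by
    rw [freqNorm_neg, hcn, expFilter_conj]
  refine ⟨fun j => expFilter (2 * π * freqNorm j) (rcMode p j),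
    fun j => expFilterDeriv (2 * π * freqNorm j) (rcMode p j), hxn,
    fun j y => ?_, fun j y => ?_, fun j y => by simp only [expFilterDeriv]; ring,
    fun j => (memLp_mul_expFilter (hw0 j) (hcm j)).1,
    fun j => (memLp_mul_expFilter (hw0 j) (hcm j)).2.trans ?_,
    fun j => (memLp_expFilterDeriv (hw0 j) (hcm j)).1,
    fun j => (memLp_expFilterDeriv (hw0 j) (hcm j)).2⟩
  · simp only [expFilterDeriv, hxn]
    simp only [hcn, freqNorm_neg, map_sub, map_mul, Complex.conj_ofReal]
  · exact expFilter_eq_primitive (MemLp.integrableOn_Ioc (hcm j)) _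
  · have : 0 ≤ ∫ y in Ioi 0, ‖rcMode p j y‖ ^ 2 := by positivity
    linarith

theorem one_le_freqNorm {j : Fin d → ℤ} (hj : j ≠ 0) : 1 ≤ freqNorm j := by
  obtain ⟨k, hk⟩ := Function.ne_iff.mp hj
  refine le_trans ?_ (abs_le_freqNorm j k)
  exact_mod_cast Int.one_le_abs hk

/-- The multiplier `-i j_m / |j|`. -/
noncomputable def rieszMul (m : Fin d) (j : Fin d → ℤ) : ℂ :=
  -Complex.I * ((j m : ℝ) / freqNorm j : ℝ)

theorem norm_rieszMul_le (m : Fin d) (j : Fin d → ℤ) : ‖rieszMul m j‖ ≤ 1 := by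
  simp only [rieszMul, norm_mul, norm_neg, Complex.norm_I, one_mul, Complex.norm_real, norm_div,
    Real.norm_eq_abs, abs_of_nonneg (freqNorm_nonneg j)]
  exact div_le_one_of_le₀ (abs_le_freqNorm j m) (freqNorm_nonneg j)

theorem rieszMul_neg (m : Fin d) (j : Fin d → ℤ) : rieszMul m (-j) = conj (rieszMul m j) := by
  simp only [rieszMul, freqNorm_neg]
  simp [neg_div]

theorem two_pi_I_mul_eq (m : Fin d) (j : Fin d → ℤ) :
    2 * π * Complex.I * j m = -rieszMul m j * (2 * π * freqNorm j : ℝ) := by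
  rcases eq_or_ne j 0 with h | h
  · simp [h, freqNorm_eq_zero (d := d).mpr rfl]
  · have : (freqNorm j : ℂ) ≠ 0 := by exact_mod_cast mt freqNorm_eq_zero.mp h
    simp only [rieszMul]
    push_cast
    field_simp

/-- The factor `2π|j|` makes the identity hold at `j = 0` as well, where the multipliers vanish by
the convention `0 / 0 = 0`. -/
theorem sum_rieszMul_sq (j : Fin d → ℤ) :
    ∑ m, rieszMul m j * rieszMul m j * (2 * π * freqNorm j : ℝ) = -(2 * π * freqNorm j : ℝ) := by
  rcases eq_or_ne j 0 with h | h
  · simp [freqNorm_eq_zero.mpr h]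
  · have h0 : freqNorm j ≠ 0 := mt freqNorm_eq_zero.mp h
    have h1 : ∀ m, rieszMul m j * rieszMul m j = ((-((j m : ℝ) ^ 2) / freqNorm j ^ 2 : ℝ) : ℂ) := by
      intro m
      simp only [rieszMul]
      push_cast
      linear_combination ((j m : ℂ) / freqNorm j) ^ 2 * Complex.I_sq
    simp only [h1]
    rw [← Finset.sum_mul, ← Complex.ofReal_sum, ← Finset.sum_div, Finset.sum_neg_distrib,
      ← freqNorm_sq, neg_div, div_self (pow_ne_zero 2 h0)]
    push_cast
    ring

theorem ae_eq_of_cMode {f g : LayerPt d → ℝ} (hf : MemLp f 2 (flatMeasure d))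
    (hg : MemLp g 2 (flatMeasure d)) (h : ∀ j, rcMode f j
      =ᵐ[volIoi 0] rcMode g j) : f =ᵐ[flatMeasure d] g := by
  have hf' : MemLp (fun z => (f z : ℂ)) 2 (flatMeasure d) := hf.ofReal
  have hg' : MemLp (fun z => (-1 : ℂ) * (g z : ℂ)) 2 (flatMeasure d) := hg.ofReal.const_mul _
  have hfg : MemLp (fun z => (f z : ℂ) + (-1 : ℂ) * (g z : ℂ)) 2 (flatMeasure d) := hf'.add hg'
  have h1 := ae_eq_zero_of_cMode hfg fun j => by
    filter_upwards [h j, cMode_add hf' hg' j] with y e1 e2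
    rw [e2, cMode_const_mul, e1]
    simp
  filter_upwards [h1] with z hz
  simp only [Pi.zero_apply] at hz
  have h4 : (f z : ℂ) = (g z : ℂ) := by linear_combination hz
  exact_mod_cast h4

/-- Solution of the divergence equation in the flat half space. -/
theorem exists_zeroTrace_div_flat {p : LayerPt d → ℝ} (hp : MemLp p 2 (flatMeasure d)) :
    ∃ (V : Fin (d + 1) → LayerPt d → ℝ) (γ : Fin (d + 1) → Fin (d + 1) → LayerPt d → ℝ),
      (∀ l, IsZeroTracePair (fun _ => -0) (V l) (γ l)) ∧
        (∀ m : Fin d, MemLp (V m.castSucc) 2 (flatMeasure d)) ∧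
        (fun z => ∑ i, γ i i z) =ᵐ[flatMeasure d] p := by
  -- With `R_m` the Riesz multipliers and `w = 2π|j|`, the field has modes `R_m x` horizontally and
  -- `x` vertically. As `2πi j_m = -R_m w` and `∑ R_m² w = -w`, its divergence has the mode `w x +
  -- x'`, which is that of `p`. All entries of the gradient are `w x` or `x'` times bounded
  -- multipliers.
  obtain ⟨x, x', hxn, hx'n, hxp, hxc, hwm, hwb, hx'm, hx'b⟩ := exists_mode_filter hp
  have hcs := summable_integral_norm_cMode_sq hp.ofReal
  have hu := norm_rieszMul_le (d := d)
  have hun := rieszMul_neg (d := d)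
  have hwn : ∀ (j : Fin d → ℤ) y, ((2 * π * freqNorm (-j) : ℝ) : ℂ) * x (-j) y =
      conj (((2 * π * freqNorm j : ℝ) : ℂ) * x j y) := fun j y => by
    rw [hxn, freqNorm_neg, map_mul, Complex.conj_ofReal]
  have hwp : ∀ j : Fin d → ℤ, j ≠ 0 → ((2 * π * freqNorm j : ℝ) : ℂ) ≠ 0 := fun j hj => by
    have := one_le_freqNorm hj
    have h2 := Real.pi_pos
    exact_mod_cast (by positivity : (2 * π * freqNorm j : ℝ) ≠ 0)
  -- Dividing the multiplier by `2π|j| ≥ 1` brings the bound on `2π|j| x` into play, and at `j = 0`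
  -- the multiplier is zero. So the horizontal components are square integrable on the whole half
  -- space; no such bound is claimed for the vertical one, whose mean is only a primitive.
  have exV : ∀ m : Fin d, ∃ f : LayerPt d → ℝ, MemLp f 2 (flatMeasure d) ∧
      ∀ j, rcMode f j =ᵐ[volIoi 0]
        fun y => rieszMul m j * x j y := by
    intro m
    have hb : ∀ j : Fin d → ℤ, ‖rieszMul m j / (2 * π * freqNorm j : ℝ)‖ ≤ 1 := fun j => by
      rcases eq_or_ne j 0 with h | h
      · simp [h, rieszMul]
      · rw [norm_div, Complex.norm_real, Real.norm_of_nonneg (mul_nonneg (by positivity)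
          (freqNorm_nonneg j))]
        have h1 := one_le_freqNorm h
        have h2 := Real.pi_gt_three
        exact div_le_one_of_le₀ ((hu m j).trans (by nlinarith)) (by positivity)
    obtain ⟨f, hf, hfm⟩ := exists_real_multiplier
      (m := fun j => rieszMul m j / (2 * π * freqNorm j : ℝ)) hwm hwb hcs hb
      (fun j y => by rw [hwn, hun, freqNorm_neg, ← Complex.conj_ofReal, ← map_div₀, ← map_mul, Complex.conj_ofReal])
    refine ⟨f, hf, fun j => (hfm j).trans (ae_of_all _ fun y => ?_)⟩
    rcases eq_or_ne j 0 with h | h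
    · simp [h, rieszMul]
    · have := hwp j h
      simp only
      rw [← mul_assoc, div_mul_cancel₀ _ this]
  have exL := fun m : Fin d => exists_real_multiplier (m := rieszMul m) hx'm hx'b hcs (hu m)
    fun j y => by rw [hun m, hx'n, map_mul]
  have exK := fun m k : Fin d => exists_real_multiplier (m := fun j => -rieszMul k j * rieszMul m j)
    (L := 1) hwm hwb hcs
    (fun j => by
      rw [norm_mul, norm_neg]
      exact mul_le_one₀ (hu k j) (norm_nonneg _) (hu m j))
    (fun j y => by rw [hwn]; simp only [hun, map_mul, map_neg])
  obtain ⟨gl, hgl, hglm⟩ := exists_real_multiplier (m := fun _ : Fin d → ℤ => (1 : ℂ)) (L := 1)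
    hx'm hx'b hcs (fun j => by simp) (fun j y => by simp [hx'n])
  have exKl := fun k : Fin d => exists_real_multiplier (m := fun j => -rieszMul k j) (L := 1)
    hwm hwb hcs (fun j => by rw [norm_neg]; exact hu k j)
    (fun j y => by rw [hwn]; simp only [hun, map_mul, map_neg])
  choose V hV hVm using exV
  choose gL hgL hgLm using exL
  choose gK hgK hgKm using exK
  choose gl' hgl' hglm' using exKl
  refine ⟨Fin.lastCases (flatPrim gl) V,
    Fin.lastCases (Fin.lastCases gl gl') (fun m => Fin.lastCases (gL m) (gK m)), fun l => ?_,
    fun m => by simpa using hV m, ?_⟩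
  · rw [← isTracePair_zero_iff]
    have hz : ∀ j : Fin d → ℤ, charCoeff (fun _ => ((0 : ℝ) : ℂ)) j = 0 := fun j => by
      simp [charCoeff]
    refine Fin.lastCases ?_ (fun m => ?_) l
    · simp only [Fin.lastCases_last]
      refine isTracePair_of_modes (layerLocL2_flatPrim hgl)
        (Fin.lastCases (by simpa using hgl) fun k => by simpa using hgl' k) (by simp)
        (fun j => ?_) (fun k j => ?_)
      · refine ae_of_all _ fun y => ?_
        simp only [Fin.lastCases_last]
        rw [hz, zero_add]
        exact cMode_flatPrim hgl j y
      · simp only [Fin.lastCases_castSucc]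
        filter_upwards [hglm' k j] with y hy
        rw [hy, cMode_flatPrim hgl]
        have : ∫ s in Ioc 0 y, rcMode gl j s = x j y := by
          rw [hxp]
          refine integral_congr_ae ?_
          filter_upwards [ae_mono (Measure.restrict_mono (fun s hs => hs.1) le_rfl) (hglm j)]
            with s hs
          rw [hs, one_mul]
        rw [this, two_pi_I_mul_eq]
        ring
    · simp only [Fin.lastCases_castSucc]
      refine isTracePair_of_modes (MemLp.layerLocL2 (by rw [layerMeasure_const]; exact hV m))
        (Fin.lastCases (by simpa using hgL m) fun k => by simpa using hgK m k) (by simp)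
        (fun j => ?_) (fun k j => ?_)
      · simp only [Fin.lastCases_last]
        filter_upwards [hVm m j] with y hy
        rw [hz, zero_add, hy, hxp, ← integral_const_mul]
        refine integral_congr_ae ?_
        filter_upwards [ae_mono (Measure.restrict_mono (fun s hs => hs.1) le_rfl) (hgLm m j)]
          with s hs
        rw [hs]
      · simp only [Fin.lastCases_castSucc]
        filter_upwards [hgKm m k j, hVm m j] with y h1 h2
        rw [h1, h2, two_pi_I_mul_eq]
        ring
  · simp only [Fin.sum_univ_castSucc, Fin.lastCases_last, Fin.lastCases_castSucc]
    have hsm : MemLp (fun z => ∑ m : Fin d, gK m m z) 2 (flatMeasure d) :=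
      memLp_finsetSum _ fun m _ => hgK m m
    refine ae_eq_of_cMode (hsm.add hgl) hp fun j => ?_
    have h1 := cMode_add hsm.ofReal hgl.ofReal j
    have h2 := cMode_sum (ν := volIoi 0) Finset.univ
      (fun m _ => (hgK m m).ofReal (K := ℂ)) j
    have h3 : ∀ᵐ y ∂(volIoi (0 : ℝ)), ∀ m : Fin d,
        rcMode (gK m m) j y =
          -rieszMul m j * rieszMul m j * (((2 * π * freqNorm j : ℝ) : ℂ) * x j y) :=
      ae_all_iff.mpr fun m => hgKm m m j
    filter_upwards [h1, h2, h3, hglm j] with y e1 e2 e3 e4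
    have e5 : cMode (fun z => ((∑ m : Fin d, gK m m z + gl z : ℝ) : ℂ)) j y =
        cMode (fun z => ((∑ m : Fin d, gK m m z : ℝ) : ℂ) + (gl z : ℂ)) j y := by
      congr 1; ext z; push_cast; rfl
    have e6 : cMode (fun z => ((∑ m : Fin d, gK m m z : ℝ) : ℂ)) j y =
        cMode (fun z => ∑ m : Fin d, (gK m m z : ℂ)) j y := by congr 1; ext z; push_cast; rfl
    refine e5.trans (e1.trans ?_)
    rw [← hxc j y]
    refine (congrArg₂ (· + ·) (e6.trans e2) e4).trans ?_
    have e7 := sum_rieszMul_sq j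
    have e8 : ∑ m : Fin d, rcMode (gK m m) j y =
        -(∑ m, rieszMul m j * rieszMul m j * (2 * π * freqNorm j : ℝ)) * x j y := by
      rw [← Finset.sum_neg_distrib, Finset.sum_mul]
      refine Finset.sum_congr rfl fun m _ => ?_
      rw [e3 m]; ring
    refine (congrArg (· + (1 : ℂ) * x' j y) (e8.trans (by rw [e7]))).trans ?_
    ring

/-- Every square integrable function is the divergence of a field of zero trace. -/
theorem exists_zeroTrace_div (hH : ContDiff ℝ ∞ H) (hHper : TorusPeriodic H)
    {p : LayerPt d → ℝ} (hp : MemLp p 2 (flatMeasure d)) :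
    ∃ (V : Fin (d + 1) → LayerPt d → ℝ) (G : Fin (d + 1) → Fin (d + 1) → LayerPt d → ℝ),
      (∀ l, IsZeroTracePair H (V l) (G l)) ∧
        (fun z => ∑ i, G i i (layerShear H z)) =ᵐ[flatMeasure d] p := by
  obtain ⟨V, γ, hpair, hV, hdiv⟩ := exists_zeroTrace_div_flat hp
  -- Unshearing adds `∂_m H ∂_y V_m` to the `m`-th diagonal entry of the gradient. The correction
  -- `-∑ ∂_m H V_m` of the vertical component removes these terms from the divergence.
  have hcorr := fun m : Fin d => ((hpair m.castSucc).profile_mul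
    (by rw [layerMeasure_const]; exact hV m) (contDiff_partial_profile hH m)
    (periodic_partial_profile hHper m)
    (fun k => periodic_partial_profile (periodic_partial_profile hHper m) k)).const_mul (-1)
  have hsum := (hpair (Fin.last d)).add continuous_const (fun _ _ => rfl)
    (IsZeroTracePair.sum continuous_const (fun _ _ => rfl) Finset.univ hcorr)
  have hall : ∀ l : Fin (d + 1), ∃ (W : LayerPt d → ℝ) (g : Fin (d + 1) → LayerPt d → ℝ),
      IsZeroTracePair H W g ∧ ∀ z, g l (layerShear H z) = γ l l z +
        Fin.lastCases (motive := fun _ => ℝ)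
          (-∑ m : Fin d, fderiv ℝ H z.1 (Pi.single m 1) * γ m.castSucc (Fin.last d) z)
          (fun m => fderiv ℝ H z.1 (Pi.single m 1) * γ m.castSucc (Fin.last d) z) l := by
    intro l
    refine Fin.lastCases ⟨_, _, hsum.unshear hH hHper, fun z => ?_⟩
      (fun m => ⟨_, _, (hpair m.castSucc).unshear hH hHper, fun z => ?_⟩) l
    · simp [physGrad]
    · simp only [physGrad, layerUnshear_shear, layerDir_castSucc, Fin.lastCases_castSucc]
      rfl
  choose W G hWG hG using hall
  refine ⟨W, G, hWG, ?_⟩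
  filter_upwards [hdiv] with z hz
  rw [← hz]
  simp only [hG, Finset.sum_add_distrib]
  refine add_eq_left.mpr ?_
  rw [Fin.sum_univ_castSucc]
  simp

end Divergence

/-! ### Lifting boundary data of class `H^(1/2)`. -/

section Lift

variable {d : ℕ} {H : (Fin d → ℝ) → ℝ}

theorem integral_exp_sq_Ioi {w : ℝ} (hw : 0 < w) :
    IntegrableOn (fun y => exp (-(w * y)) ^ 2) (Ioi 0) ∧
      ∫ y in Ioi 0, exp (-(w * y)) ^ 2 = 1 / (2 * w) := by
  have h1 : ∀ y, exp (-(w * y)) ^ 2 = exp (-(2 * w) * y) := fun y => by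
    rw [← Real.exp_nat_mul]; congr 1; push_cast; ring
  simp only [h1]
  refine ⟨integrableOn_exp_mul_Ioi (by linarith) 0, ?_⟩
  rw [integral_exp_mul_Ioi (by linarith)]
  simp

/-- Synthesis of the harmonic extension of boundary data with a multiplier of order one. -/
theorem exists_harmonic_multiplier {D : (Fin d → ℝ) → ℝ}
    (hs : Summable fun j : Fin d → ℤ => freqNorm j * ‖charCoeff (fun X => (D X : ℂ)) j‖ ^ 2)
    {m : (Fin d → ℤ) → ℂ} (hm : ∀ j, ‖m j‖ ≤ 2 * π * freqNorm j)
    (hsym : ∀ j, m (-j) = conj (m j)) :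
    ∃ f : LayerPt d → ℝ, MemLp f 2 (flatMeasure d) ∧ ∀ j, rcMode f j =ᵐ[volIoi 0] fun y =>
        m j * charCoeff (fun X => (D X : ℂ)) j * (exp (-(2 * π * freqNorm j * y)) : ℂ) := by
  -- The squared norm of `e^{-2π|j|y}` is `1 / (4π|j|)`. It absorbs one of the two powers of `|j|`
  -- coming from the squared multiplier, and the remaining `π|j|` is the weight of `H^(1/2)`. At `j
  -- = 0` the multiplier vanishes.
  have key : ∀ j, MemLp (fun y : ℝ => m j * charCoeff (fun X => (D X : ℂ)) j *
        (exp (-(2 * π * freqNorm j * y)) : ℂ)) 2 volIoi 0 ∧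
      ∫ y in Ioi 0, ‖m j * charCoeff (fun X => (D X : ℂ)) j *
        (exp (-(2 * π * freqNorm j * y)) : ℂ)‖ ^ 2 ≤
      π * (freqNorm j * ‖charCoeff (fun X => (D X : ℂ)) j‖ ^ 2) := by
    intro j
    rcases eq_or_ne j 0 with h | h
    · have h0 : freqNorm j = 0 := freqNorm_eq_zero.mpr h
      have h1 : m j = 0 := by
        have := hm j
        rw [h0, mul_zero] at this
        exact norm_le_zero_iff.mp this
      simp [h0, h1]
    · have h1 := one_le_freqNorm h
      have hw : 0 < 2 * π * freqNorm j := by have := Real.pi_pos; positivity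
      obtain ⟨i1, i2⟩ := integral_exp_sq_Ioi hw
      have e : ∀ y : ℝ, ‖m j * charCoeff (fun X => (D X : ℂ)) j *
          (exp (-(2 * π * freqNorm j * y)) : ℂ)‖ ^ 2 =
          (‖m j‖ * ‖charCoeff (fun X => (D X : ℂ)) j‖) ^ 2 *
            exp (-(2 * π * freqNorm j * y)) ^ 2 := fun y => by
        rw [norm_mul, norm_mul, Complex.norm_real, Real.norm_of_nonneg (Real.exp_pos _).le, mul_pow]
      constructor
      · refine (memLp_two_iff_integrable_sq_norm (by fun_prop)).mpr ?_
        simp only [e]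
        exact i1.const_mul _
      · simp only [e]
        rw [integral_const_mul, i2, mul_pow]
        have h2 : ‖m j‖ ^ 2 ≤ (2 * π * freqNorm j) ^ 2 := by gcongr; exact hm j
        calc ‖m j‖ ^ 2 * ‖charCoeff (fun X => (D X : ℂ)) j‖ ^ 2 * (1 / (2 * (2 * π * freqNorm j)))
            ≤ (2 * π * freqNorm j) ^ 2 * ‖charCoeff (fun X => (D X : ℂ)) j‖ ^ 2 *
              (1 / (2 * (2 * π * freqNorm j))) := by gcongr
          _ = π * (freqNorm j * ‖charCoeff (fun X => (D X : ℂ)) j‖ ^ 2) := by field_simp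
  refine exists_real_cMode_eq (fun j => (key j).1) ?_ fun j y => ?_
  · exact Summable.of_nonneg_of_le (fun j => by positivity) (fun j => (key j).2)
      (hs.mul_left π)
  · have h := charCoeff_conj (fun X => (D X : ℂ)) (-j)
    simp only [Complex.conj_ofReal, neg_neg] at h
    rw [hsym, freqNorm_neg, h, map_mul, map_mul, Complex.conj_ofReal]

/-- Extension of boundary data in `H^(1/2)`. -/
theorem exists_isTracePair (hH : ContDiff ℝ ∞ H) (hHper : TorusPeriodic H)
    {D : (Fin d → ℝ) → ℝ} (hD : MemLp D 2 (volume.restrict (unitCube d)))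
    (hs : Summable fun j : Fin d → ℤ => freqNorm j * ‖charCoeff (fun X => (D X : ℂ)) j‖ ^ 2) :
    ∃ V g, IsTracePair H V g D := by
  set c : (Fin d → ℤ) → ℂ := charCoeff (fun X => (D X : ℂ)) with hc
  -- The mean is left out here and added later as the constant `(c 0).re`, because a nonzero
  -- constant is not square integrable on the half space.
  obtain ⟨f, hf, hfm⟩ := exists_harmonic_multiplier hs (m := fun j => if j = 0 then 0 else 1)
    (fun j => by
      split_ifs with h
      · simp [h, freqNorm_eq_zero (d := d).mpr rfl]
      · have h1 := one_le_freqNorm h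
        have h2 := Real.pi_gt_three
        simp only [norm_one]
        nlinarith)
    (fun j => by simp only [neg_eq_zero]; split_ifs <;> simp)
  obtain ⟨gl, hgl, hglm⟩ := exists_harmonic_multiplier hs
    (m := fun j => -(2 * π * freqNorm j : ℝ))
    (fun j => by
      rw [norm_neg, Complex.norm_real, Real.norm_of_nonneg (mul_nonneg (by positivity)
        (freqNorm_nonneg j))])
    (fun j => by rw [freqNorm_neg, map_neg, Complex.conj_ofReal])
  have exk := fun k : Fin d => exists_harmonic_multiplier hs
    (m := fun j => 2 * π * Complex.I * j k)
    (fun j => by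
      rw [two_pi_I_mul_eq, norm_mul, norm_neg, Complex.norm_real, Real.norm_of_nonneg
        (mul_nonneg (by positivity) (freqNorm_nonneg j))]
      exact mul_le_of_le_one_left (mul_nonneg (by positivity) (freqNorm_nonneg j))
        (norm_rieszMul_le k j))
    (fun j => by
      simp only [map_mul, Complex.conj_I, Complex.conj_ofReal, map_ofNat, map_intCast, Pi.neg_apply]
      push_cast; ring)
  choose gk hgk hgkm using exk
  have hc0 : conj (c 0) = c 0 := by
    have h := charCoeff_conj (fun X => (D X : ℂ)) 0
    simp only [Complex.conj_ofReal, neg_zero] at h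
    exact h.symm
  have hc0' : ((c 0).re : ℂ) = c 0 := Complex.conj_eq_iff_re.mp hc0
  have hconst : ∀ j y, cMode (fun _ : LayerPt d => (((c 0).re : ℝ) : ℂ)) j y =
      if j = 0 then c 0 else 0 := fun j y => by
    have h1 := charCoeff_const_mul ((c 0).re : ℂ) (torusChar (0 : Fin d → ℤ)) j
    simp only [torusChar_zero, mul_one] at h1
    rw [cMode, h1, hc0']
    rw [charCoeff_torusChar]
    simp
  have hVm : ∀ j, cMode (fun z => ((f z + (c 0).re : ℝ) : ℂ)) j =ᵐ[volIoi 0] fun y =>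
      c j * (exp (-(2 * π * freqNorm j * y)) : ℂ) := by
    intro j
    have h1 : ∀ᵐ y ∂(volIoi (0 : ℝ)), cMode (fun z => (f z : ℂ) + ((c 0).re : ℂ)) j y =
        rcMode f j y + cMode (fun _ => ((c 0).re : ℂ)) j y := by
      refine ae_Ioi_of_forall_Ioc fun T => ?_
      have : IsFiniteMeasure (slabMeasure d (volume.restrict (Ioc 0 T))) := by
        unfold slabMeasure; infer_instance
      exact cMode_add (hf.mono_measure (slabMeasure_mono fun y hy => hy.1)).ofReal
        (memLp_const _) j
    filter_upwards [h1, hfm j] with y e1 e2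
    simp only [Complex.ofReal_add]
    rw [e1, e2, hconst]
    rcases eq_or_ne j 0 with h | h
    · simp [h, freqNorm_eq_zero (d := d).mpr rfl]
    · simp [h, hc]
  refine ⟨_, _, (isTracePair_of_modes (V := fun z => f z + (c 0).re)
    (g := Fin.lastCases gl gk) (D := D) ?_ ?_ hD (fun j => ?_) (fun k j => ?_)).unshear hH hHper⟩
  · intro R
    refine MemLp.add ?_ ?_
    · rw [layerMeasure_const]; exact hf.restrict _
    · have := layerMeasure_restrict_lt_top (d := d) (H := fun _ => -0) (M := 0) (by simp) R
      have : IsFiniteMeasure ((layerMeasure fun _ : Fin d → ℝ => (-0 : ℝ)).restrict {z | z.2 < R}) :=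
        ⟨by rwa [Measure.restrict_apply_univ]⟩
      exact memLp_const _
  · exact Fin.lastCases (by simpa using hgl) fun k => by simpa using hgk k
  · simp only [Fin.lastCases_last]
    filter_upwards [hVm j, ae_restrict_mem measurableSet_Ioi] with y hy hy0
    rw [hy]
    have h1 : ∫ s in Ioc 0 y, rcMode gl j s = ∫ s in Ioc 0 y, c j * ((-(2 * π * freqNorm j) *
          exp (-(2 * π * freqNorm j * s)) : ℝ) : ℂ) := by
      refine integral_congr_ae ?_
      filter_upwards [ae_mono (Measure.restrict_mono (fun s hs => hs.1) le_rfl) (hglm j)] with s hs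
      rw [hs]; push_cast; ring
    have h4 : ∀ t, HasDerivAt (fun t => exp (-(2 * π * freqNorm j * t)))
        (-(2 * π * freqNorm j) * exp (-(2 * π * freqNorm j * t))) t := fun t => by
      have := ((((hasDerivAt_id t).const_mul (2 * π * freqNorm j)).neg).exp)
      refine HasDerivAt.congr_deriv this ?_
      simp only [id, mul_one]
      exact mul_comm _ _
    rw [h1, integral_const_mul, integral_complex_ofReal,
      ← intervalIntegral.integral_of_le (le_of_lt hy0),
      intervalIntegral.integral_eq_sub_of_hasDerivAt (fun t _ => h4 t)
        (Continuous.intervalIntegrable (by fun_prop) _ _)]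
    push_cast
    simp only [mul_zero, neg_zero, Complex.exp_zero]
    ring
  · simp only [Fin.lastCases_castSucc]
    filter_upwards [hVm j, hgkm k j] with y h1 h2
    rw [h1, h2]; ring

end Lift

/-! ### Abstract saddle point problems in Hilbert space. -/

section SaddlePoint

/-- A constrained quadratic minimization problem with a surjective constraint has a multiplier. -/
theorem exists_saddle_point {N M : Type*} [NormedAddCommGroup N] [InnerProductSpace ℝ N]
    [CompleteSpace N] [NormedAddCommGroup M] [InnerProductSpace ℝ M] [CompleteSpace M]
    (T : N →L[ℝ] M) (hT : Function.Surjective T) {ν : ℝ} (hν : ν ≠ 0) (ℓ : N →L[ℝ] ℝ) (m₀ : M) :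
    ∃ G p, T G = m₀ ∧ ∀ W, ν * inner ℝ G W - inner ℝ p (T W) = ℓ W := by
  obtain ⟨G₀, hG₀⟩ := hT m₀
  have : CompleteSpace T.ker := T.isClosed_ker.completeSpace_coe
  set r := (InnerProductSpace.toDual ℝ N).symm ℓ with hr
  have hrW : ∀ W, inner ℝ r W = ℓ W := fun W => InnerProductSpace.toDual_symm_apply
  -- Correcting the particular solution `G₀` by this projection makes the residual `q` orthogonal to
  -- the kernel of `T`.
  set s := T.ker.starProjection (ν⁻¹ • r - G₀) with hs
  have hsK : T s = 0 := (T.ker.starProjection_apply_mem _ : s ∈ T.ker)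
  set q := ν • (G₀ + s) - r with hq
  have hqK : ∀ W, T W = 0 → inner ℝ q W = 0 := fun W hW => by
    have h1 : q = -(ν • ((ν⁻¹ • r - G₀) - s)) := by
      rw [hq, smul_sub, smul_sub, smul_inv_smul₀ hν, smul_add]; abel
    have h2 : inner ℝ ((ν⁻¹ • r - G₀) - s) W = 0 :=
      (Submodule.mem_orthogonal' _ _).mp (T.ker.sub_starProjection_mem_orthogonal _) W hW
    rw [h1, inner_neg_left, inner_smul_left, h2, mul_zero, neg_zero]
  -- The functional `⟨q, ·⟩` vanishes on the kernel, hence factors through `T`. The norm control of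
  -- preimages given by the open mapping theorem makes the factor continuous, and its Riesz vector
  -- is the multiplier.
  obtain ⟨C, hC, hpre⟩ := T.exists_preimage_norm_le hT
  choose P hP hPn using hpre
  have hwd : ∀ a b, T a = T b → inner ℝ q a = inner ℝ q b := fun a b hab => by
    have := hqK (a - b) (by rw [map_sub, hab, sub_self])
    rwa [inner_sub_right, sub_eq_zero] at this
  let Λ : M →ₗ[ℝ] ℝ := {
      toFun := fun m => inner ℝ q (P m)
      map_add' := fun a b => by
        rw [← inner_add_right]
        exact hwd _ _ (by rw [map_add, hP, hP, hP])
      map_smul' := fun c a => by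
        rw [RingHom.id_apply, smul_eq_mul, ← real_inner_smul_right]
        exact hwd _ _ (by rw [map_smul, hP, hP]) }
  let Λ' : M →L[ℝ] ℝ := Λ.mkContinuous (‖q‖ * C) fun m =>
    (norm_inner_le_norm q (P m)).trans (by
      rw [mul_assoc]; exact mul_le_mul_of_nonneg_left (hPn m) (norm_nonneg _))
  refine ⟨G₀ + s, (InnerProductSpace.toDual ℝ M).symm Λ', by rw [map_add, hG₀, hsK, add_zero],
    fun W => ?_⟩
  have h1 : inner ℝ ((InnerProductSpace.toDual ℝ M).symm Λ') (T W) = inner ℝ q (P (T W)) :=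
    InnerProductSpace.toDual_symm_apply
  rw [h1, hwd _ W (hP _), ← hrW, hq, inner_sub_left, inner_smul_left]
  simp

end SaddlePoint

/-! ### Weak solvability of the Stokes system. -/

section Existence

variable {d : ℕ} {H : (Fin d → ℝ) → ℝ}

/-- Square integrable matrix fields on the flat half space. -/
abbrev GradSpace (d : ℕ) : Type :=
  PiLp 2 fun _ : Fin (d + 1) × Fin (d + 1) => Lp ℝ 2 (flatMeasure d)

theorem inner_Lp_eq_integral {α : Type*} [MeasurableSpace α] {μ : Measure α} (f g : Lp ℝ 2 μ)
    {f' g' : α → ℝ} (hf : f =ᵐ[μ] f') (hg : g =ᵐ[μ] g') :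
    inner ℝ f g = ∫ x, f' x * g' x ∂μ := by
  rw [L2.inner_def]
  refine integral_congr_ae ?_
  filter_upwards [hf, hg] with x h1 h2
  rw [h1, h2, RCLike.inner_apply, conj_trivial, mul_comm]

/-- Gradients of vector fields of zero trace, in sheared coordinates. The entry `(k, l)` is the
`k`-th derivative of the `l`-th component. -/
def zeroTraceSpace (H : (Fin d → ℝ) → ℝ) : Submodule ℝ (GradSpace d) where
  -- Tail and test function enter as arbitrary `L²` classes `t`, `u`. The definition then needs no
  -- integrability proofs and is visibly an intersection of closed hyperplanes.
  carrier := {G | ∀ l k (t u : Lp ℝ 2 (flatMeasure d)), (∃ φ, IsBoundaryTest φ ∧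
    t =ᵐ[flatMeasure d] flatTail (fun z => layerPartial k φ (layerShear H z)) ∧
    u =ᵐ[flatMeasure d] fun z => φ (layerShear H z)) →
      inner ℝ t (G (Fin.last d, l)) + inner ℝ u (G (k, l)) = 0}
  add_mem' := fun {a b} ha hb l k t u h => by
    have h1 := ha l k t u h
    have h2 := hb l k t u h
    simp only [PiLp.add_apply, inner_add_right]
    linarith
  zero_mem' := fun l k t u h => by simp
  smul_mem' := fun c a ha l k t u h => by
    have h1 := ha l k t u h
    simp only [PiLp.smul_apply, real_inner_smul_right]
    linear_combination c * h1

theorem isClosed_zeroTraceSpace : IsClosed (zeroTraceSpace H : Set (GradSpace d)) := by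
  have : (zeroTraceSpace H : Set (GradSpace d)) =
      ⋂ (l : Fin (d + 1)) (k : Fin (d + 1)) (t : Lp ℝ 2 (flatMeasure d))
        (u : Lp ℝ 2 (flatMeasure d)) (_ : ∃ φ, IsBoundaryTest φ ∧
    t =ᵐ[flatMeasure d] flatTail (fun z => layerPartial k φ (layerShear H z)) ∧
    u =ᵐ[flatMeasure d] fun z => φ (layerShear H z)),
      {G : GradSpace d | inner ℝ t (G (Fin.last d, l)) + inner ℝ u (G (k, l)) = 0} := by
    ext G
    simp only [mem_iInter]
    rfl
  rw [this]
  refine isClosed_iInter fun l => isClosed_iInter fun k => isClosed_iInter fun t =>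
    isClosed_iInter fun u => isClosed_iInter fun _ => isClosed_eq ?_ continuous_const
  exact ((innerSL ℝ t).continuous.comp (PiLp.continuous_apply 2 _ _)).add
    ((innerSL ℝ u).continuous.comp (PiLp.continuous_apply 2 _ _))

theorem mem_zeroTraceSpace_iff (hH : ContDiff ℝ ∞ H) (hHper : TorusPeriodic H) {G : GradSpace d} :
    G ∈ zeroTraceSpace H ↔
      ∀ l, ∃ V, IsZeroTracePair H V (fun k z => G (k, l) (layerUnshear H z)) := by
  have h1 := fun l => isZeroTracePair_flatPrim_iff (g := fun k z => G (k, l) z) hH hHper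
    fun k => Lp.memLp (G (k, l))
  refine Iff.trans ?_ (forall_congr' h1).symm
  constructor
  · intro h l φ hφ k
    have h2 := h l k ((memLp_flatTail (hφ.flatWeightedL2_partial hH hHper k)).toLp _)
      ((hφ.memLp_flat hH hHper).toLp _) ⟨φ, hφ, MemLp.coeFn_toLp _, MemLp.coeFn_toLp _⟩
    rwa [inner_Lp_eq_integral _ _ (MemLp.coeFn_toLp _) (ae_eq_refl _),
      inner_Lp_eq_integral _ _ (MemLp.coeFn_toLp _) (ae_eq_refl _)] at h2
  · rintro h l k t u ⟨φ, hφ, ht, hu⟩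
    rw [inner_Lp_eq_integral _ _ ht (ae_eq_refl _), inner_Lp_eq_integral _ _ hu (ae_eq_refl _)]
    exact h l φ hφ k

theorem IsZeroTracePair.congr {V : LayerPt d → ℝ} {g g' : Fin (d + 1) → LayerPt d → ℝ}
    (h : IsZeroTracePair H V g) (hg : ∀ i, g i =ᵐ[layerMeasure H] g' i) : IsZeroTracePair H V g' := by
  refine ⟨h.locL2, fun i => (memLp_congr_ae (hg i)).mp (h.memLp i), fun φ hφ i => ?_⟩
  rw [← h.green φ hφ i]
  refine integral_congr_ae ?_
  filter_upwards [hg i] with z hz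
  rw [hz]

theorem ae_comp_unshear (hH : Measurable H) {p : LayerPt d → Prop} (h : ∀ᵐ z ∂(flatMeasure d), p z) :
    ∀ᵐ z ∂(layerMeasure H), p (layerUnshear H z) :=
  (measurePreserving_layerUnshear hH).quasiMeasurePreserving.ae h

theorem exists_mem_zeroTraceSpace (hH : ContDiff ℝ ∞ H) (hHper : TorusPeriodic H)
    {V : Fin (d + 1) → LayerPt d → ℝ} {g : Fin (d + 1) → Fin (d + 1) → LayerPt d → ℝ}
    (h : ∀ l, IsZeroTracePair H (V l) (g l)) :
    ∃ W ∈ zeroTraceSpace H, ∀ k l, W (k, l) =ᵐ[flatMeasure d] fun z => g l k (layerShear H z) := by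
  have hHm := hH.continuous.measurable
  set W : GradSpace d := WithLp.toLp 2 fun kl => (MemLp.flat hHm ((h kl.2).memLp kl.1)).toLp _ with hW
  have hWg : ∀ k l, W (k, l) =ᵐ[flatMeasure d] fun z => g l k (layerShear H z) := fun k l =>
    MemLp.coeFn_toLp (MemLp.flat hHm ((h l).memLp k))
  refine ⟨W, (mem_zeroTraceSpace_iff hH hHper).mpr fun l => ⟨V l, (h l).congr fun k => ?_⟩, hWg⟩
  filter_upwards [ae_comp_unshear hHm (hWg k l)] with z hz
  rw [hz, layerShear_unshear]

/-- The divergence. -/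
noncomputable def gradTrace (d : ℕ) : GradSpace d →L[ℝ] Lp ℝ 2 (flatMeasure d) :=
  ∑ i : Fin (d + 1), PiLp.proj 2 (fun _ : Fin (d + 1) × Fin (d + 1) => Lp ℝ 2 (flatMeasure d)) (i, i)

theorem gradTrace_apply (G : GradSpace d) : gradTrace d G = ∑ i, G (i, i) := by simp [gradTrace]

theorem coeFn_sum_Lp {α ι : Type*} [MeasurableSpace α] {μ : Measure α} (s : Finset ι)
    (f : ι → Lp ℝ 2 μ) : (∑ i ∈ s, f i : Lp ℝ 2 μ) =ᵐ[μ] fun x => ∑ i ∈ s, f i x := by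
  classical
  induction s using Finset.induction_on with
  | empty => simp only [Finset.sum_empty]; exact Lp.coeFn_zero ℝ 2 μ
  | insert a s ha ih =>
    simp only [Finset.sum_insert ha]
    filter_upwards [Lp.coeFn_add (f a) (∑ i ∈ s, f i), ih] with x h1 h2
    rw [h1, Pi.add_apply, h2]

theorem surjective_gradTrace (hH : ContDiff ℝ ∞ H) (hHper : TorusPeriodic H) :
    Function.Surjective ((gradTrace d).comp (zeroTraceSpace H).subtypeL) := by
  intro p
  obtain ⟨V, g, hVg, hdiv⟩ := exists_zeroTrace_div hH hHper (Lp.memLp p)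
  obtain ⟨W, hW, hWg⟩ := exists_mem_zeroTraceSpace hH hHper hVg
  refine ⟨⟨W, hW⟩, Lp.ext ?_⟩
  have h1 : ((gradTrace d).comp (zeroTraceSpace H).subtypeL) ⟨W, hW⟩ = ∑ i, W (i, i) :=
    gradTrace_apply W
  rw [h1]
  have h2 : ∀ᵐ z ∂(flatMeasure d), ∀ i, W (i, i) z = g i i (layerShear H z) :=
    ae_all_iff.mpr fun i => hWg i i
  filter_upwards [coeFn_sum_Lp Finset.univ fun i => W (i, i), h2, hdiv] with z e1 e2 e3
  rw [e1, ← e3]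
  exact Finset.sum_congr rfl fun i _ => e2 i

theorem isZeroTracePair_test (hH : ContDiff ℝ ∞ H) (hHper : TorusPeriodic H) {φ : LayerPt d → ℝ}
    (hφ : IsInteriorTest H φ) : IsZeroTracePair H φ (fun i => layerPartial i φ) := by
  have hHm := hH.continuous.measurable
  have hb := hφ.isBoundaryTest
  obtain ⟨R, hR⟩ := hb.support
  have hc1 : ContDiff ℝ 1 φ := hφ.smooth.of_le (by simp)
  have key : ∀ f : LayerPt d → ℝ, FlatWeightedL2 (fun z => f (layerShear H z)) → Continuous f →
      LayerPeriodic f → (∀ z, f z ≠ 0 → z.2 ≤ R) → MemLp f 2 (layerMeasure H) := by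
    intro f _ hf hper hR
    obtain ⟨M, -, hM⟩ := exists_bound_of_torusPeriodic hH.continuous hHper
    have h2 : MemLp (fun z => f (layerShear H z)) 2 (flatMeasure d) := by
      refine memLp_of_layerTest (R := R + M) (hf.comp (contDiff_layerShear hH).continuous)
        (hper.comp_shear hHper) fun z hz => ?_
      have := hR _ hz
      simp only [layerShear] at this
      linarith [(abs_le.mp (hM z.1)).2]
    have h3 := h2.comp_measurePreserving (measurePreserving_layerUnshear hHm)
    simpa [Function.comp_def] using h3
  refine ⟨MemLp.layerLocL2 (key φ (hb.flatWeightedL2 hH hHper) hc1.continuous hφ.periodic hR),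
    fun i => key _ (hb.flatWeightedL2_partial hH hHper i) (continuous_layerPartial hc1 i)
      (periodic_layerPartial hφ.periodic i) (support_layerPartial hR i), fun ψ hψ i => ?_⟩
  rw [integral_test_parts hH hHper hψ hc1 hφ.periodic i]
  obtain ⟨δ, hδ, R', hR'⟩ := hφ.support
  have h0 : ∀ X : Fin d → ℝ, φ (X, -H X) = 0 := fun X => by
    by_contra hne
    have := (hR' _ hne).1
    simp only at this
    linarith
  simp [h0]

/-- Weak solvability of the Stokes problem, for a given extension of the boundary data. -/
theorem exists_stokes_weak (hH : ContDiff ℝ ∞ H) (hHper : TorusPeriodic H) {ν : ℝ} (hν : ν ≠ 0)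
    {F : Fin (d + 1) → LayerPt d → ℝ} (hF : ∀ l, FlatWeightedL2 fun z => F l (layerShear H z))
    {L : Fin (d + 1) → Fin (d + 1) → LayerPt d → ℝ} (hL : ∀ l k, MemLp (L l k) 2 (layerMeasure H)) :
    ∃ (V : Fin (d + 1) → LayerPt d → ℝ) (G : Fin (d + 1) → Fin (d + 1) → LayerPt d → ℝ)
      (P : LayerPt d → ℝ), (∀ l, IsZeroTracePair H (V l) (G l)) ∧ MemLp P 2 (layerMeasure H) ∧
      (∀ᵐ z ∂(layerMeasure H), ∑ i, (G i i z + L i i z) = 0) ∧ ∀ φ, IsInteriorTest H φ → ∀ i,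
        ν * ∑ k, ∫ z, layerPartial k φ z * (G i k z + L i k z) ∂(layerMeasure H) -
          ∫ z, P z * layerPartial i φ z ∂(layerMeasure H) = ∫ z, F i z * φ z ∂(layerMeasure H) := by
  have hHm := hH.continuous.measurable
  set N := zeroTraceSpace H with hN
  have : CompleteSpace N := isClosed_zeroTraceSpace.completeSpace_coe
  have hLf : ∀ k l, MemLp (fun z => L l k (layerShear H z)) 2 (flatMeasure d) := fun k l =>
    MemLp.flat hHm (hL l k)
  set Λ : GradSpace d := WithLp.toLp 2 fun kl => (hLf kl.1 kl.2).toLp _ with hΛ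
  have hΛg : ∀ k l, Λ (k, l) =ᵐ[flatMeasure d] fun z => L l k (layerShear H z) := fun k l =>
    MemLp.coeFn_toLp (hLf k l)
  set f : Fin (d + 1) → Lp ℝ 2 (flatMeasure d) := fun l => (memLp_flatTail (hF l)).toLp _ with hf
  -- For a function of zero trace, `∫ F φ` is the pairing of the tail of `F` with the vertical
  -- derivative, so the force is represented by the square integrable matrix field `Φ`. The lift
  -- contributes `-ν Λ` to the functional and minus its trace to the constraint.
  set Φ : GradSpace d := WithLp.toLp 2 fun kl => if kl.1 = Fin.last d then f kl.2 else 0 with hΦ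
  set ℓ : N →L[ℝ] ℝ := (innerSL ℝ (Φ - ν • Λ)).comp N.subtypeL with hℓ
  obtain ⟨G, p, hG, hGW⟩ := exists_saddle_point ((gradTrace d).comp N.subtypeL)
    (surjective_gradTrace hH hHper) hν ℓ (-gradTrace d Λ)
  choose V hV using (mem_zeroTraceSpace_iff hH hHper).mp G.2
  refine ⟨V, fun l k z => (G : GradSpace d) (k, l) (layerUnshear H z), fun z => p (layerUnshear H z),
    hV, (Lp.memLp p).comp_measurePreserving (measurePreserving_layerUnshear hHm), ?_, fun φ hφ i => ?_⟩
  · have h1 : gradTrace d (G : GradSpace d) = -gradTrace d Λ := hG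
    have h2 : (∑ i, (G : GradSpace d) (i, i)) + ∑ i, Λ (i, i) = 0 := by
      rw [← gradTrace_apply, ← gradTrace_apply, h1, neg_add_cancel]
    have h3 : ∀ᵐ z ∂(flatMeasure d), ∑ i, ((G : GradSpace d) (i, i) z + L i i (layerShear H z)) = 0 := by
      have h4 : ∀ᵐ z ∂(flatMeasure d), ∀ i, Λ (i, i) z = L i i (layerShear H z) :=
        ae_all_iff.mpr fun i => hΛg i i
      have h5 := Lp.coeFn_add (∑ i, (G : GradSpace d) (i, i)) (∑ i, Λ (i, i))
      rw [h2] at h5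
      filter_upwards [h4, h5, coeFn_sum_Lp Finset.univ fun i => (G : GradSpace d) (i, i),
        coeFn_sum_Lp Finset.univ fun i => Λ (i, i), Lp.coeFn_zero ℝ 2 (flatMeasure d)]
        with z e1 e2 e3 e4 e5
      rw [e5, Pi.add_apply, e3, e4] at e2
      rw [Finset.sum_add_distrib]
      simp only [e1] at e2
      exact e2.symm
    filter_upwards [ae_comp_unshear hHm h3] with z hz
    simpa using hz
  · -- the test field `φ e_i`
    have hφz := isZeroTracePair_test hH hHper hφ
    have hφi : ∀ l, IsZeroTracePair H (fun z => if l = i then φ z else 0)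
        (fun k z => if l = i then layerPartial k φ z else 0) := fun l => by
      by_cases h : l = i
      · simpa [h] using hφz
      · simpa [h] using IsZeroTracePair.zero
    obtain ⟨W, hW, hWg⟩ := exists_mem_zeroTraceSpace hH hHper hφi
    have hW0 : ∀ k l, l ≠ i → W (k, l) = 0 := fun k l hl => by
      refine Lp.ext ?_
      filter_upwards [hWg k l, Lp.coeFn_zero ℝ 2 (flatMeasure d)] with z e1 e2
      rw [e1, e2, if_neg hl]; rfl
    have hWi : ∀ k, W (k, i) =ᵐ[flatMeasure d] fun z => layerPartial k φ (layerShear H z) := fun k => by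
      simpa using hWg k i
    have h1 := hGW ⟨W, hW⟩
    have hsum : ∀ A : GradSpace d, inner ℝ A W = ∑ k, inner ℝ (A (k, i)) (W (k, i)) := fun A => by
      rw [PiLp.inner_apply, Fintype.sum_prod_type]
      refine Finset.sum_congr rfl fun k _ => ?_
      exact Finset.sum_eq_single_of_mem i (Finset.mem_univ _) fun l _ hl => by
        rw [hW0 k l hl, inner_zero_right]
    have a1 : inner ℝ G ⟨W, hW⟩ = ∑ k, inner ℝ ((G : GradSpace d) (k, i)) (W (k, i)) := hsum G
    have a2 : inner ℝ p (((gradTrace d).comp N.subtypeL) ⟨W, hW⟩) =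
        ∫ z, p z * layerPartial i φ (layerShear H z) ∂(flatMeasure d) := by
      have : ((gradTrace d).comp N.subtypeL) ⟨W, hW⟩ = W (i, i) := by
        refine (gradTrace_apply W).trans ?_
        exact Finset.sum_eq_single_of_mem i (Finset.mem_univ _) fun l _ hl => hW0 l l hl
      rw [this]
      exact inner_Lp_eq_integral _ _ (ae_eq_refl _) (hWi i)
    have a3 : ℓ ⟨W, hW⟩ = (∫ z, F i (layerShear H z) * φ (layerShear H z) ∂(flatMeasure d)) -
        ν * ∑ k, inner ℝ (Λ (k, i)) (W (k, i)) := by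
      have : ℓ ⟨W, hW⟩ = inner ℝ (Φ - ν • Λ) W := rfl
      rw [this, inner_sub_left, real_inner_smul_left, hsum, hsum]
      congr 1
      have h2 : ∀ k, Φ (k, i) = if k = Fin.last d then f i else 0 := fun k => rfl
      simp only [h2]
      rw [Finset.sum_eq_single_of_mem (Fin.last d) (Finset.mem_univ _) fun k _ hk => by
        rw [if_neg hk, inner_zero_left], if_pos rfl,
        inner_Lp_eq_integral _ _ (MemLp.coeFn_toLp _) (hWi _),
        ← ((hF i).integrable_mul_flatPrim (MemLp.flat hHm (hφz.memLp (Fin.last d)))).2]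
      refine integral_congr_ae ?_
      filter_upwards [hφz.ae_eq_flatPrim hH hHper] with z hz
      rw [hz]
    rw [a1, a2, a3] at h1
    have a4 : ∀ k, ∫ z, layerPartial k φ z * ((G : GradSpace d) (k, i) (layerUnshear H z) + L i k z)
        ∂(layerMeasure H) = inner ℝ ((G : GradSpace d) (k, i)) (W (k, i)) +
          inner ℝ (Λ (k, i)) (W (k, i)) := fun k => by
      rw [← inner_add_left, ← integral_layerShear hHm]
      have h5 := Lp.coeFn_add ((G : GradSpace d) (k, i)) (Λ (k, i))
      rw [inner_Lp_eq_integral _ _ h5 (hWi k)]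
      refine integral_congr_ae ?_
      filter_upwards [hΛg k i] with z e1
      rw [Pi.add_apply, e1, layerUnshear_shear, mul_comm]
    simp only [a4]
    rw [Finset.sum_add_distrib, mul_add]
    have a5 : ∫ z, p (layerUnshear H z) * layerPartial i φ z ∂(layerMeasure H) =
        ∫ z, p z * layerPartial i φ (layerShear H z) ∂(flatMeasure d) := by
      rw [← integral_layerShear hHm]; simp
    rw [a5, ← integral_layerShear hHm]
    linarith

end Existence

/-! ### The Stokes system in components; existence and uniqueness. -/

section Components

variable {d : ℕ} {H : (Fin d → ℝ) → ℝ} {ν r : ℝ} {F U V : LayerPt d → LayerVec d}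
  {D : (Fin d → ℝ) → LayerVec d} {G G' : Fin (d + 1) → LayerPt d → LayerVec d}
  {P R : LayerPt d → ℝ}

/-- The weak Stokes system written in components. -/
structure IsStokesComponents (H : (Fin d → ℝ) → ℝ) (ν : ℝ) (F : LayerPt d → LayerVec d)
    (D : (Fin d → ℝ) → LayerVec d) (U : LayerPt d → LayerVec d)
    (G : Fin (d + 1) → LayerPt d → LayerVec d) (P : LayerPt d → ℝ) : Prop where
  pair : ∀ l, IsTracePair H (fun z => U z l) (fun k z => G k z l) (fun X => D X l)
  memLp : MemLp P 2 (layerMeasure H)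
  div : ∀ᵐ z ∂(layerMeasure H), ∑ i, G i z i = 0
  eq : ∀ φ : LayerPt d → ℝ, IsInteriorTest H φ → ∀ i,
    ν * ∑ k, ∫ z, layerPartial k φ z * G k z i ∂(layerMeasure H)
      - ∫ z, P z * layerPartial i φ z ∂(layerMeasure H) = ∫ z, F z i * φ z ∂(layerMeasure H)

theorem IsInteriorTest.apply_boundary {φ : LayerPt d → ℝ} (hφ : IsInteriorTest H φ)
    (X : Fin d → ℝ) : φ (X, -H X) = 0 := by
  obtain ⟨δ, hδ, R', hR'⟩ := hφ.support
  by_contra hne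
  have := (hR' _ hne).1
  simp only at this
  linarith

theorem integrable_normal_mul (hH : ContDiff ℝ ∞ H) {φ : LayerPt d → ℝ}
    (hφ : IsBoundaryTest φ) {f : (Fin d → ℝ) → ℝ} (hf : MemLp f 2 (volume.restrict (unitCube d)))
    (i : Fin (d + 1)) :
    Integrable (fun X => layerNormal H X i * φ (X, -H X) * f X) (volume.restrict (unitCube d)) := by
  have c1 : Continuous fun X => layerNormal H X i * φ (X, -H X) := by
    refine Continuous.mul ?_ (hφ.smooth.continuous.comp (continuous_id.prodMk hH.continuous.neg))
    refine Fin.lastCases ?_ (fun k => ?_) i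
    · simpa using continuous_const
    · simp only [layerNormal_castSucc]
      exact (contDiff_partial_profile hH k).continuous.neg
  exact MemLp.integrable_mul (memLp_unitCube_of_continuous c1 2) hf

/-- The two forms differ by evaluating vector integrals in coordinates. The weak gradient is not a
separate condition in components: interior test functions vanish on the boundary, so the trace
identity already contains it. -/
theorem isStokesLayerSolution_iff (hH : ContDiff ℝ ∞ H) (hHper : TorusPeriodic H)
    (hD : MemLp D 2 (volume.restrict (unitCube d))) :
    IsStokesLayerSolution H r F D U P ↔ LayerPeriodic U ∧ LayerPeriodic P ∧
      ∃ G, IsStokesComponents H (1 - r) F D U G P := by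
  have hint : ∀ {U : LayerPt d → LayerVec d} {G : Fin (d + 1) → LayerPt d → LayerVec d},
      (∀ R : ℝ, MemLp U 2 ((layerMeasure H).restrict {z | z.2 < R})) →
      (∀ i, MemLp (G i) 2 (layerMeasure H)) → ∀ φ, IsBoundaryTest φ → ∀ i l,
      Integrable (fun z => layerPartial i φ z * U z l) (layerMeasure H) ∧
      Integrable (fun z => φ z * G i z l) (layerMeasure H) := fun hU hG φ hφ i l =>
    ⟨hφ.integrable_partial_mul hH.continuous hHper (fun R => (hU R).eval_piLp l) i,
      hφ.integrable_mul hH.continuous hHper (MemLp.layerLocL2 ((hG i).eval_piLp l))⟩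
  constructor
  · rintro ⟨h1, h2, h3, h4, G, hG, -, htr, hdiv, heq⟩
    refine ⟨h1, h2, G, fun l => ⟨fun R => (h3 R).eval_piLp l, fun i => (hG i).eval_piLp l,
      fun φ hφ i => ?_⟩, h4, hdiv, heq⟩
    have h5 := congrArg (fun v : LayerVec d => v l) (htr φ hφ i)
    simp only at h5
    rw [eval_integral_piLp (fun l => by exact (hint h3 hG φ hφ i l).1.add (hint h3 hG φ hφ i l).2),
      eval_integral_piLp (fun l => by
        simpa using integrable_normal_mul hH hφ (hD.eval_piLp l) i)] at h5
    simpa using h5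
  · rintro ⟨h1, h2, G, h⟩
    have hU : ∀ R : ℝ, MemLp U 2 ((layerMeasure H).restrict {z | z.2 < R}) := fun R =>
      MemLp.of_eval_piLp fun l => (h.pair l).locL2 R
    have hG : ∀ i, MemLp (G i) 2 (layerMeasure H) := fun i =>
      MemLp.of_eval_piLp fun l => (h.pair l).memLp i
    have htr : HasBoundaryTrace H U G D := fun φ hφ i => by
      ext l
      rw [eval_integral_piLp (fun l => by
          exact (hint hU hG φ hφ i l).1.add (hint hU hG φ hφ i l).2),
        eval_integral_piLp (fun l => by simpa using integrable_normal_mul hH hφ (hD.eval_piLp l) i)]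
      simpa using (h.pair l).green φ hφ i
    refine ⟨h1, h2, hU, h.memLp, G, hG, fun φ hφ i => ?_, htr, h.div, h.eq⟩
    have h5 := htr φ hφ.isBoundaryTest i
    simp only [hφ.apply_boundary, mul_zero, zero_smul, integral_zero] at h5
    rw [integral_add] at h5
    · exact eq_neg_of_add_eq_zero_left h5
    · exact Integrable.of_eval_piLp fun l => by simpa using (hint hU hG φ hφ.isBoundaryTest i l).1
    · exact Integrable.of_eval_piLp fun l => by simpa using (hint hU hG φ hφ.isBoundaryTest i l).2

/-- The stress tensor `ν ∂_k U_l - P δ_kl`. -/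
noncomputable def stress (ν : ℝ) (G : Fin (d + 1) → LayerPt d → LayerVec d) (P : LayerPt d → ℝ)
    (l k : Fin (d + 1)) (z : LayerPt d) : ℝ := ν * G k z l - if k = l then P z else 0

theorem memLp_stress (h : IsStokesComponents H ν F D U G P) (l k : Fin (d + 1)) :
    MemLp (stress ν G P l k) 2 (layerMeasure H) := by
  refine (((h.pair l).memLp k).const_mul ν).sub ?_
  split_ifs
  · exact h.memLp
  · exact MemLp.zero

theorem IsStokesComponents.isWeakDiv_stress (hH : ContDiff ℝ ∞ H) (hHper : TorusPeriodic H)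
    (hF : MemLp F 2 (layerMeasure H)) (h : IsStokesComponents H ν F D U G P) (l : Fin (d + 1)) :
    IsWeakDiv H (stress ν G P l) (fun z => -F z l) := by
  intro φ hφ
  have hz := isZeroTracePair_test hH hHper hφ
  have i1 : ∀ k, Integrable (fun z => layerPartial k φ z * G k z l) (layerMeasure H) := fun k =>
    MemLp.integrable_mul (hz.memLp k) ((h.pair l).memLp k)
  have i2 : Integrable (fun z => P z * layerPartial l φ z) (layerMeasure H) :=
    MemLp.integrable_mul h.memLp (hz.memLp l)
  have i3 : Integrable (fun z => F z l * φ z) (layerMeasure H) := by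
    have := hφ.isBoundaryTest.integrable_mul hH.continuous hHper
      (MemLp.layerLocL2 (hF.eval_piLp l))
    simpa [mul_comm] using this
  have i4 : Integrable (fun z => ν * ∑ k, layerPartial k φ z * G k z l) (layerMeasure H) :=
    (integrable_finsetSum _ fun k _ => i1 k).const_mul ν
  have h1 := h.eq φ hφ l
  rw [← integral_finsetSum _ fun k _ => i1 k, ← integral_const_mul, ← integral_sub i4 i2,
    ← sub_eq_zero] at h1
  refine Eq.trans ?_ ((integral_sub (i4.sub i2) i3).trans h1)
  congr 1
  ext z
  simp only [stress, Pi.sub_apply, mul_sub, Finset.sum_sub_distrib, mul_ite, mul_zero, Finset.sum_ite_eq',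
    Finset.mem_univ, if_true, Finset.mul_sum]
  have : ∀ k, layerPartial k φ z * (ν * G k z l) = ν * (layerPartial k φ z * G k z l) :=
    fun k => by ring
  simp only [this]
  ring

theorem IsTracePair.sub (hH : Continuous H) (hHper : TorusPeriodic H) {V W : LayerPt d → ℝ}
    {g g' : Fin (d + 1) → LayerPt d → ℝ} {D : (Fin d → ℝ) → ℝ} (h : IsTracePair H V g D)
    (h' : IsTracePair H W g' D) :
    IsZeroTracePair H (fun z => V z - W z) (fun i z => g i z - g' i z) := by
  refine ⟨fun R => (h.locL2 R).sub (h'.locL2 R), fun i => (h.memLp i).sub (h'.memLp i),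
    fun φ hφ i => ?_⟩
  have h1 := hφ.green_add_mul hH hHper h.locL2 h'.locL2 h.memLp h'.memLp (-1) i
  simpa only [neg_one_mul, ← sub_eq_add_neg, h.green φ hφ i, h'.green φ hφ i, sub_self] using h1

theorem IsTracePair.add_zero (hH : Continuous H) (hHper : TorusPeriodic H) {V W : LayerPt d → ℝ}
    {g g' : Fin (d + 1) → LayerPt d → ℝ} {D : (Fin d → ℝ) → ℝ} (h : IsZeroTracePair H V g)
    (h' : IsTracePair H W g' D) :
    IsTracePair H (fun z => V z + W z) (fun i z => g i z + g' i z) D := by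
  refine ⟨fun R => (h.locL2 R).add (h'.locL2 R), fun i => (h.memLp i).add (h'.memLp i),
    fun φ hφ i => ?_⟩
  have h1 := hφ.green_add_mul hH hHper h.locL2 h'.locL2 h.memLp h'.memLp 1 i
  simpa only [one_mul, h.green φ hφ i, h'.green φ hφ i, zero_add] using h1

theorem IsWeakDiv.sub_eq_zero {A A' : Fin (d + 1) → LayerPt d → ℝ} {B : LayerPt d → ℝ}
    (hH : ContDiff ℝ ∞ H) (hHper : TorusPeriodic H) (hA : ∀ i, MemLp (A i) 2 (layerMeasure H))
    (hA' : ∀ i, MemLp (A' i) 2 (layerMeasure H)) (hB : MemLp B 2 (layerMeasure H))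
    (h : IsWeakDiv H A B) (h' : IsWeakDiv H A' B) :
    IsWeakDiv H (fun i z => A i z - A' i z) (fun _ => 0) := by
  intro φ hφ
  have hz := isZeroTracePair_test hH hHper hφ
  have key : ∀ A : Fin (d + 1) → LayerPt d → ℝ, (∀ i, MemLp (A i) 2 (layerMeasure H)) →
      Integrable (fun z => (∑ i, layerPartial i φ z * A i z) + φ z * B z) (layerMeasure H) :=
    fun A hA => (integrable_finsetSum _ fun i _ => MemLp.integrable_mul (hz.memLp i) (hA i)).add
      (hφ.isBoundaryTest.integrable_mul hH.continuous hHper (MemLp.layerLocL2 hB))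
  have h1 := integral_sub (key A hA) (key A' hA')
  rw [h φ hφ, h' φ hφ, sub_self] at h1
  refine Eq.trans ?_ h1
  congr 1
  ext z
  simp only [mul_sub, Finset.sum_sub_distrib, mul_zero]
  ring

/-- Uniqueness of weak solutions. -/
theorem IsStokesComponents.unique (hH : ContDiff ℝ ∞ H) (hHper : TorusPeriodic H) (hν : 0 < ν)
    (hF : MemLp F 2 (layerMeasure H)) (h : IsStokesComponents H ν F D U G P)
    (h' : IsStokesComponents H ν F D V G' R) :
    V =ᵐ[layerMeasure H] U ∧ R =ᵐ[layerMeasure H] P := by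
  have hHm := hH.continuous.measurable
  set g : Fin (d + 1) → Fin (d + 1) → LayerPt d → ℝ := fun l k z => G k z l - G' k z l with hg
  set A : Fin (d + 1) → Fin (d + 1) → LayerPt d → ℝ := fun l k z =>
    stress ν G P l k z - stress ν G' R l k z with hA
  have hpair : ∀ l, IsZeroTracePair H (fun z => U z l - V z l) (g l) := fun l =>
    (h.pair l).sub hH.continuous hHper (h'.pair l)
  have hAm : ∀ l k, MemLp (A l k) 2 (layerMeasure H) := fun l k =>
    (memLp_stress h l k).sub (memLp_stress h' l k)
  have hAdiv : ∀ l, IsWeakDiv H (A l) (fun _ => 0) := fun l =>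
    IsWeakDiv.sub_eq_zero hH hHper (memLp_stress h l) (memLp_stress h' l) (hF.eval_piLp l).neg
      (h.isWeakDiv_stress hH hHper hF l) (h'.isWeakDiv_stress hH hHper hF l)
  have hAe : ∀ l k z, A l k z = ν * g l k z - if k = l then P z - R z else 0 := fun l k z => by
    simp only [hA, hg, stress]; split_ifs <;> ring
  -- the energy identity
  have horth : ∀ (W : Fin (d + 1) → LayerPt d → ℝ) (w : Fin (d + 1) → Fin (d + 1) → LayerPt d → ℝ),
      (∀ l, IsZeroTracePair H (W l) (w l)) →
      ∫ z, ∑ l, ∑ k, A l k z * w l k z ∂(layerMeasure H) = 0 := fun W w hw => by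
    have hi : ∀ l k, Integrable (fun z => A l k z * w l k z) (layerMeasure H) := fun l k =>
      MemLp.integrable_mul (hAm l k) ((hw l).memLp k)
    rw [integral_finsetSum _ fun l _ => integrable_finsetSum _ fun k _ => hi l k]
    exact Finset.sum_eq_zero fun l _ => (hAdiv l).integral_mul_grad_eq_zero hH hHper (hAm l) (hw l)
  -- Tested with the velocity difference, the pressure drops out because that difference is
  -- divergence free, and `ν` times the squared gradient remains.
  have e1 := horth _ _ hpair
  have hdiv : ∀ᵐ z ∂(layerMeasure H), ∑ l, g l l z = 0 := by
    filter_upwards [h.div, h'.div] with z h1 h2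
    simp only [hg, Finset.sum_sub_distrib, h1, h2, sub_self]
  have e2 : ∀ᵐ z ∂(layerMeasure H), ∑ l, ∑ k, A l k z * g l k z = ν * ∑ l, ∑ k, g l k z ^ 2 := by
    filter_upwards [hdiv] with z hz
    have : ∀ l k, A l k z * g l k z = ν * g l k z ^ 2 - if k = l then (P z - R z) * g l k z else 0 :=
      fun l k => by rw [hAe]; split_ifs <;> ring
    simp only [this, Finset.sum_sub_distrib, Finset.sum_ite_eq', Finset.mem_univ, if_true,
      ← Finset.mul_sum, hz, mul_zero, sub_zero]
  have e3 : ∀ᵐ z ∂(layerMeasure H), ∑ l, ∑ k, g l k z ^ 2 = 0 := by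
    rw [integral_congr_ae e2, integral_const_mul, mul_eq_zero, or_iff_right hν.ne',
      integral_eq_zero_iff_of_nonneg (fun z => by positivity) (integrable_finsetSum _ fun l _ =>
        integrable_finsetSum _ fun k _ => ((hpair l).memLp k).integrable_sq)] at e1
    exact e1
  have e4 : ∀ l k, g l k =ᵐ[layerMeasure H] 0 := fun l k => by
    filter_upwards [e3] with z hz
    have h1 := (Finset.sum_eq_zero_iff_of_nonneg (fun l _ => by positivity)).mp hz l (Finset.mem_univ _)
    have h2 := (Finset.sum_eq_zero_iff_of_nonneg (fun l _ => by positivity)).mp h1 k (Finset.mem_univ _)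
    exact pow_eq_zero_iff (by norm_num) |>.mp h2
  constructor
  · have e5 : ∀ᵐ z ∂(layerMeasure H), ∀ l, U z l - V z l = 0 :=
      ae_all_iff.mpr fun l => (hpair l).ae_eq_zero hH hHper (e4 l)
    filter_upwards [e5] with z hz
    ext l
    exact (sub_eq_zero.mp (hz l)).symm
  · have hq : MemLp (fun z => P (layerShear H z) - R (layerShear H z)) 2 (flatMeasure d) :=
      (MemLp.flat hHm h.memLp).sub (MemLp.flat hHm h'.memLp)
    -- With equal gradients, a test field of divergence `P - R` leaves only `-(P - R)²`.
    obtain ⟨W, w, hw, hwd⟩ := exists_zeroTrace_div hH hHper hq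
    have e6 := horth W w hw
    have e7 : ∀ᵐ z ∂(layerMeasure H), ∑ i, w i i z = P z - R z := by
      filter_upwards [ae_comp_unshear hHm hwd] with z hz
      simpa using hz
    have e8 : ∀ᵐ z ∂(layerMeasure H), ∑ l, ∑ k, A l k z * w l k z = -(P z - R z) ^ 2 := by
      have e9 : ∀ᵐ z ∂(layerMeasure H), ∀ l k, g l k z = 0 :=
        ae_all_iff.mpr fun l => ae_all_iff.mpr fun k => e4 l k
      filter_upwards [e7, e9] with z h1 h2
      simp only [hAe, h2, mul_zero, zero_sub, neg_mul, ite_mul, zero_mul, Finset.sum_neg_distrib,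
        Finset.sum_ite_eq', Finset.mem_univ, if_true, ← Finset.mul_sum, h1]
      ring
    have hs : MemLp (fun z => P z - R z) 2 (layerMeasure H) := h.memLp.sub h'.memLp
    rw [integral_congr_ae e8, integral_neg, neg_eq_zero,
      integral_eq_zero_iff_of_nonneg (fun z => sq_nonneg _) hs.integrable_sq] at e6
    filter_upwards [e6] with z hz
    have := pow_eq_zero_iff (by norm_num) |>.mp hz
    linarith

/-- Existence of weak solutions. -/
theorem exists_isStokesComponents (hH : ContDiff ℝ ∞ H) (hHper : TorusPeriodic H) (hν : 0 < ν)
    (hF : ∀ l, FlatWeightedL2 fun z => F (layerShear H z) l) (hD : MemTorusHalf D) :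
    ∃ U G P, IsStokesComponents H ν F D U G P := by
  have hlift : ∀ l, ∃ V g, IsTracePair H V g (fun X => D X l) := fun l => by
    refine exists_isTracePair hH hHper (hD.sq_integrable.eval_piLp l) ?_
    refine Summable.of_nonneg_of_le (fun j => by
      have := freqNorm_nonneg j; positivity) (fun j => ?_) hD.summable
    have := freqNorm_nonneg j
    gcongr
    rw [← torusCoeff_eq_charCoeff]
    exact PiLp.norm_apply_le (torusVecCoeff D j) l
  choose W L hL using hlift
  obtain ⟨V, G, P, hV, hP, hdiv, heq⟩ := exists_stokes_weak hH hHper hν.ne' (F := fun l z => F z l) hF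
    fun l => (hL l).memLp
  refine ⟨fun z => WithLp.toLp 2 fun l => V l z + W l z,
    fun k z => WithLp.toLp 2 fun l => G l k z + L l k z, P, fun l => ?_, hP, hdiv, heq⟩
  exact IsTracePair.add_zero hH.continuous hHper (hV l) (hL l)

end Components

/-! ### Rules of calculus for weak derivatives. -/

section WeakDeriv

variable {a : ℝ} {u v f g : ℝ → ℂ}

theorem WeakDerivOn.congr (h : WeakDerivOn a u f) (hu : u =ᵐ[volIoi a] v)
    (hf : f =ᵐ[volIoi a] g) : WeakDerivOn a v g := fun η hη => by
  rw [← integral_congr_ae (hu.mono fun y hy => congrArg (((deriv η y : ℝ) : ℂ) * ·) hy),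
    ← integral_congr_ae (hf.mono fun y hy => congrArg ((η y : ℂ) * ·) hy)]
  exact h η hη

theorem WeakDerivOn.const_mul (h : WeakDerivOn a u f) (c : ℂ) :
    WeakDerivOn a (fun y => c * u y) fun y => c * f y := fun η hη => by
  simp only [mul_left_comm _ c, integral_const_mul, h η hη, mul_neg]

theorem WeakDerivOn.sum {ι : Type*} (s : Finset ι) {u f : ι → ℝ → ℂ}
    (h : ∀ i, WeakDerivOn a (u i) (f i)) (hu : ∀ i T, IntegrableOn (u i) (Ioc a T))
    (hf : ∀ i T, IntegrableOn (f i) (Ioc a T)) :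
    WeakDerivOn a (fun y => ∑ i ∈ s, u i y) fun y => ∑ i ∈ s, f i y := fun η hη => by
  obtain ⟨b, c, hb, hbc⟩ := hη.support
  have hdc : Continuous (deriv η) := hη.smooth.continuous_deriv (by simp)
  simp only [Finset.mul_sum]
  rw [integral_finsetSum _ fun i _ => integrableOn_mul_of_continuous (hu i) hdc (c := c) fun y hy =>
      le_of_not_gt fun hlt => hy (deriv_eq_zero_of_upper (fun y hy => (hbc y hy).2) hlt),
    integral_finsetSum _ fun i _ => integrableOn_mul_of_continuous (hf i) hη.smooth.continuous
      fun y hy => (hbc y hy).2, ← Finset.sum_neg_distrib]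
  exact Finset.sum_congr rfl fun i _ => h i η hη

theorem WeakDerivOn.add (h : WeakDerivOn a u f) (h' : WeakDerivOn a v g)
    (hu : ∀ T, IntegrableOn u (Ioc a T)) (hv : ∀ T, IntegrableOn v (Ioc a T))
    (hf : ∀ T, IntegrableOn f (Ioc a T)) (hg : ∀ T, IntegrableOn g (Ioc a T)) :
    WeakDerivOn a (fun y => u y + v y) fun y => f y + g y := by
  have := WeakDerivOn.sum (Finset.univ : Finset Bool) (u := fun i => cond i u v)
    (f := fun i => cond i f g) (a := a) (Bool.rec h' h) (Bool.rec hv hu) (Bool.rec hg hf)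
  simpa using this

theorem WeakDerivOn.mono {b : ℝ} (h : WeakDerivOn a u f) (hab : a ≤ b) : WeakDerivOn b u f := by
  intro η hη
  obtain ⟨b', c, hb, hbc⟩ := hη.support
  have key := h η ⟨hη.smooth, b', c, hab.trans_lt hb, hbc⟩
  have h0 : ∀ y ≤ b, η y = 0 ∧ deriv η y = 0 := fun y hy => by
    have hev : η =ᶠ[nhds y] fun _ => 0 := by
      filter_upwards [Iio_mem_nhds (hy.trans_lt hb)] with t ht
      by_contra hne
      exact absurd (hbc t hne).1 (not_le.mpr ht)
    exact ⟨hev.self_of_nhds, by rw [hev.deriv_eq, deriv_const]⟩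
  have hI : ∀ F : ℝ → ℂ, (∀ y ≤ b, F y = 0) → ∫ y in Ioi a, F y = ∫ y in Ioi b, F y := fun F hF => by
    refine setIntegral_eq_of_subset_of_forall_sdiff_eq_zero measurableSet_Ioi (Ioi_subset_Ioi hab)
      fun y hy => hF y (not_lt.mp hy.2)
  rwa [hI _ fun y hy => by simp [(h0 y hy).2], hI _ fun y hy => by simp [(h0 y hy).1]] at key

theorem ae_restrict_Ioi_mono {a b : ℝ} (hab : a ≤ b) {q : ℝ → Prop}
    (h : ∀ᵐ y ∂volIoi a, q y) : ∀ᵐ y ∂volIoi b, q y :=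
  ae_mono (Measure.restrict_mono (Ioi_subset_Ioi hab) le_rfl) h

end WeakDeriv

/-! ### Comparison estimates for linear equations on a half line. -/

section Comparison

variable {a κ w : ℝ} {x f u z f₁ f₂ : ℝ → ℂ} {Ψ : ℝ → ℝ}

/-- The integrating factor is moved onto the test function: `η e^{-κy}` is a test function again. -/
theorem WeakDerivOn.exp_mul (hx : ∀ T, IntegrableOn x (Ioc a T)) (hf : ∀ T, IntegrableOn f (Ioc a T))
    (h : WeakDerivOn a x fun y => κ * x y + f y) :
    WeakDerivOn a (fun y => (exp (-(κ * y)) : ℂ) * x y)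
      fun y => (exp (-(κ * y)) : ℂ) * f y := by
  intro η hη
  obtain ⟨b, c, hb, hbc⟩ := hη.support
  have hexp : ContDiff ℝ ∞ fun y : ℝ => exp (-(κ * y)) := by fun_prop
  have hθ : IsHalfLineTest a fun y => η y * exp (-(κ * y)) :=
    ⟨hη.smooth.mul hexp, b, c, hb, fun y hy => hbc y (left_ne_zero_of_mul hy)⟩
  have hd : ∀ y, deriv (fun y => η y * exp (-(κ * y))) y =
      deriv η y * exp (-(κ * y)) - κ * (η y * exp (-(κ * y))) := fun y => by
    have h1 := (hη.smooth.differentiable (by simp) y).hasDerivAt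
    have h2 : HasDerivAt (fun y : ℝ => exp (-(κ * y))) (exp (-(κ * y)) * -κ) y := by
      have := ((hasDerivAt_id y).const_mul κ).neg.exp
      simpa using this
    rw [show (fun y => η y * exp (-(κ * y))) = η * fun y => exp (-(κ * y)) from rfl,
      (h1.mul h2).deriv]
    ring
  have key := h _ hθ
  have hdc : Continuous (deriv η) := hη.smooth.continuous_deriv (by simp)
  have i1 : IntegrableOn (fun y => ((deriv η y * exp (-(κ * y)) : ℝ) : ℂ) * x y) (Ioi a) :=
    integrableOn_mul_of_continuous hx (hdc.mul hexp.continuous) (c := c) fun y hy => by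
      by_contra hlt
      exact left_ne_zero_of_mul hy (deriv_eq_zero_of_upper (fun y hy => (hbc y hy).2) (not_le.mp hlt))
  have i2 : ∀ {v : ℝ → ℂ}, (∀ T, IntegrableOn v (Ioc a T)) →
      IntegrableOn (fun y => ((η y * exp (-(κ * y)) : ℝ) : ℂ) * v y) (Ioi a) := fun hv =>
    integrableOn_mul_of_continuous hv hθ.smooth.continuous (c := c) fun y hy =>
      (hbc y (left_ne_zero_of_mul hy)).2
  have e1 : ∀ y, ((deriv (fun y => η y * exp (-(κ * y))) y : ℝ) : ℂ) * x y =
      ((deriv η y * exp (-(κ * y)) : ℝ) : ℂ) * x y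
        - κ * (((η y * exp (-(κ * y)) : ℝ) : ℂ) * x y) := fun y => by rw [hd]; push_cast; ring
  have e2 : ∀ y, ((η y * exp (-(κ * y)) : ℝ) : ℂ) * (κ * x y + f y) =
      κ * (((η y * exp (-(κ * y)) : ℝ) : ℂ) * x y)
        + ((η y * exp (-(κ * y)) : ℝ) : ℂ) * f y := fun y => by ring
  simp only [e1, e2] at key
  rw [integral_sub i1 ((i2 hx).const_mul _), integral_add ((i2 hx).const_mul _) (i2 hf)] at key
  have e3 : ∀ y, ((deriv η y : ℝ) : ℂ) * ((exp (-(κ * y)) : ℂ) * x y) =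
      ((deriv η y * exp (-(κ * y)) : ℝ) : ℂ) * x y := fun y => by push_cast; ring
  have e4 : ∀ y, (η y : ℂ) * ((exp (-(κ * y)) : ℂ) * f y) =
      ((η y * exp (-(κ * y)) : ℝ) : ℂ) * f y := fun y => by push_cast; ring
  simp only [e3, e4]
  linear_combination key

/-- Duhamel's formula between almost all pairs of points. -/
theorem WeakDerivOn.exists_duhamel (hx : ∀ T, IntegrableOn x (Ioc a T))
    (hf : ∀ T, IntegrableOn f (Ioc a T)) (h : WeakDerivOn a x fun y => κ * x y + f y) :
    ∃ p : ℝ → Prop, (∀ᵐ y ∂volIoi a, p y) ∧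
      ∀ b Y, a < b → b ≤ Y → p b → p Y → (exp (-(κ * Y)) : ℂ) * x Y =
        (exp (-(κ * b)) : ℂ) * x b + ∫ s in Ioc b Y, (exp (-(κ * s)) : ℂ) * f s := by
  have hm : ∀ {v : ℝ → ℂ}, (∀ T, IntegrableOn v (Ioc a T)) →
      ∀ T, IntegrableOn (fun y => (exp (-(κ * y)) : ℂ) * v y) (Ioc a T) := fun hv T => by
    have hc : Continuous fun y : ℝ => (exp (-(κ * y)) : ℂ) := by fun_prop
    have := (IntegrableOn.Icc_of_Ioc (hv T)).continuousOn_mul hc.continuousOn isCompact_Icc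
    exact this.mono_set Ioc_subset_Icc_self
  obtain ⟨C, hC⟩ := (h.exp_mul hx hf).exists_eq_primitive (hm hx) (hm hf)
  refine ⟨_, hC, fun b Y hb hbY h1 h2 => ?_⟩
  have hu : Ioc a Y = Ioc a b ∪ Ioc b Y := (Ioc_union_Ioc_eq_Ioc hb.le hbY).symm
  rw [h2, h1, hu, setIntegral_union (Ioc_disjoint_Ioc_of_le le_rfl) measurableSet_Ioc
    (hm hf b) ((hm hf Y).mono_set (Ioc_subset_Ioc_left hb.le)), add_assoc]

/-- The hypothesis on `Ψ` says that `e^{-κs} Ψ` is at most the derivative of `2σ e^{-κs} Ψ`. The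
sign `σ = -1` is used for growing equations and `σ = 1` for decaying ones. -/
theorem norm_integral_exp_mul_le {σ b Y : ℝ} (hb : a < b) (hbY : b ≤ Y)
    (hd : ∀ y, a < y → DifferentiableAt ℝ Ψ y)
    (hσ : ∀ y, a < y → Ψ y ≤ σ * (2 * (deriv Ψ y - κ * Ψ y)))
    (hfΨ : ∀ᵐ y ∂volIoi a, ‖f y‖ ≤ Ψ y) :
    ‖∫ s in Ioc b Y, (exp (-(κ * s)) : ℂ) * f s‖ ≤
      σ * (2 * (exp (-(κ * Y)) * Ψ Y - exp (-(κ * b)) * Ψ b)) := by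
  have hexp : ∀ y, HasDerivAt (fun y : ℝ => exp (-(κ * y))) (exp (-(κ * y)) * -κ) y :=
    fun y => by
      have := ((hasDerivAt_id y).const_mul κ).neg.exp
      simpa using this
  have hg : ∀ y, a < y → HasDerivAt (fun y => σ * (2 * (exp (-(κ * y)) * Ψ y)))
      (σ * (2 * (exp (-(κ * y)) * -κ * Ψ y + exp (-(κ * y)) * deriv Ψ y))) y := fun y hy =>
    (((hexp y).mul (hd y hy).hasDerivAt).const_mul 2).const_mul σ
  have hcont : ContinuousOn (fun y => exp (-(κ * y)) * Ψ y) (Icc b Y) := fun y hy =>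
    ((hexp y).continuousAt.mul (hd y (hb.trans_le hy.1)).continuousAt).continuousWithinAt
  have hint : IntegrableOn (fun y => exp (-(κ * y)) * Ψ y) (Icc b Y) := hcont.integrableOn_Icc
  calc _ ≤ ∫ s in Ioc b Y, exp (-(κ * s)) * Ψ s := by
        refine norm_integral_le_of_norm_le (hint.mono_set Ioc_subset_Icc_self) ?_
        have := ae_mono (Measure.restrict_mono (Ioc_subset_Ioi_self.trans (Ioi_subset_Ioi hb.le))
          le_rfl : volume.restrict (Ioc b Y) ≤ volIoi a) hfΨ
        filter_upwards [this] with s hs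
        rw [norm_mul, Complex.norm_real, Real.norm_of_nonneg (Real.exp_nonneg _)]
        gcongr
    _ = ∫ s in b..Y, exp (-(κ * s)) * Ψ s := (intervalIntegral.integral_of_le hbY).symm
    _ ≤ σ * (2 * (exp (-(κ * Y)) * Ψ Y)) - σ * (2 * (exp (-(κ * b)) * Ψ b)) := by
        refine intervalIntegral.integral_le_sub_of_hasDeriv_right_of_le hbY
          (fun y hy => (hg y (hb.trans_le hy.1)).continuousAt.continuousWithinAt)
          (fun y hy => (hg y (hb.trans hy.1)).hasDerivWithinAt) hint fun y hy => ?_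
        have h1 := hσ y (hb.trans hy.1)
        have h2 := Real.exp_nonneg (-(κ * y))
        nlinarith [mul_le_mul_of_nonneg_left h1 h2]
    _ = _ := by ring

theorem MemLp.le_of_ae_norm_ge {ε b : ℝ} (hx : MemLp x 2 volIoi a) (hb : a ≤ b)
    (h : ∀ᵐ y ∂volIoi b, ε ≤ ‖x y‖) : ε ≤ 0 := by
  by_contra! hε
  have h1 : MemLp x 2 volIoi b := hx.mono_measure (Measure.restrict_mono (Ioi_subset_Ioi hb) le_rfl)
  have h2 : MemLp (fun _ : ℝ => ε) 2 volIoi b :=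
    h1.mono aestronglyMeasurable_const (h.mono fun y hy => by rwa [Real.norm_of_nonneg hε.le])
  rw [memLp_const_iff (by norm_num) (by norm_num)] at h2
  rcases h2 with h2 | h2
  · exact hε.ne' h2
  · simp at h2

/-- A square integrable solution of `x' = κ x + f`, `0 ≤ κ`, is controlled by `f` alone. -/
theorem WeakDerivOn.ae_le_of_growing (hκ : 0 ≤ κ) (hx : MemLp x 2 volIoi a)
    (hf : ∀ T, IntegrableOn f (Ioc a T)) (h : WeakDerivOn a x fun y => κ * x y + f y)
    (hd : ∀ y, a < y → DifferentiableAt ℝ Ψ y) (h0 : ∀ y, a < y → 0 ≤ Ψ y)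
    (hΨ : ∀ y, a < y → Ψ y ≤ 2 * (κ * Ψ y - deriv Ψ y))
    (hfΨ : ∀ᵐ y ∂volIoi a, ‖f y‖ ≤ Ψ y) :
    ∀ᵐ y ∂volIoi a, ‖x y‖ ≤ 2 * Ψ y := by
  obtain ⟨p, hp, hD⟩ := h.exists_duhamel (fun T => MemLp.integrableOn_Ioc hx T) hf
  filter_upwards [hp, ae_restrict_mem measurableSet_Ioi] with b hb hab
  have hab : a < b := hab
  have hE := Real.exp_pos (-(κ * b))
  -- By Duhamel's formula an excess of `‖x b‖` over `2 Ψ b` persists at almost every later height,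
  -- which is incompatible with square integrability if it is positive.
  have key : ∀ᵐ Y ∂volIoi b, ‖x b‖ - 2 * Ψ b ≤ ‖x Y‖ := by
    have := ae_restrict_Ioi_mono hab.le hp
    filter_upwards [this, ae_restrict_mem measurableSet_Ioi] with Y hY hbY
    have hbY : b < Y := hbY
    have h1 := hD b Y hab hbY.le hb hY
    have h2 := norm_integral_exp_mul_le (κ := κ) (σ := -1) hab hbY.le hd
      (fun y hy => by linarith [hΨ y hy]) hfΨ
    have h3 : ‖(exp (-(κ * b)) : ℂ) * x b‖ ≤ ‖(exp (-(κ * Y)) : ℂ) * x Y‖ +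
        ‖∫ s in Ioc b Y, (exp (-(κ * s)) : ℂ) * f s‖ := by
      rw [eq_sub_of_add_eq h1.symm]
      exact norm_sub_le _ _
    rw [norm_mul, norm_mul, Complex.norm_real, Complex.norm_real,
      Real.norm_of_nonneg (Real.exp_nonneg _), Real.norm_of_nonneg (Real.exp_nonneg _)] at h3
    have h4 : exp (-(κ * Y)) ≤ exp (-(κ * b)) :=
      Real.exp_le_exp.mpr (neg_le_neg (mul_le_mul_of_nonneg_left hbY.le hκ))
    have h5 := mul_le_mul_of_nonneg_right h4 (norm_nonneg (x Y))
    have h6 := mul_nonneg (Real.exp_nonneg (-(κ * Y))) (h0 Y (hab.trans hbY))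
    have h7 : exp (-(κ * b)) * (‖x b‖ - 2 * Ψ b) ≤ exp (-(κ * b)) * ‖x Y‖ := by linarith
    exact le_of_mul_le_mul_left h7 hE
  linarith [MemLp.le_of_ae_norm_ge hx hab.le key]

/-- A solution of `x' = -κ x + f`, `0 ≤ κ`, is controlled by its mean on `(a, b)` and by `f`. -/
theorem WeakDerivOn.ae_le_of_decaying {b M : ℝ} (hκ : 0 ≤ κ) (hab : a < b)
    (hx : ∀ T, IntegrableOn x (Ioc a T)) (hf : ∀ T, IntegrableOn f (Ioc a T))
    (h : WeakDerivOn a x fun y => ((-κ : ℝ) : ℂ) * x y + f y)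
    (hd : ∀ y, a < y → DifferentiableAt ℝ Ψ y) (h0 : ∀ y, a < y → 0 ≤ Ψ y)
    (hΨ : ∀ y, a < y → Ψ y ≤ 2 * (κ * Ψ y + deriv Ψ y))
    (hfΨ : ∀ᵐ y ∂volIoi a, ‖f y‖ ≤ Ψ y)
    (hM : ∫ y in Ioc a b, ‖x y‖ ≤ M * (b - a)) :
    ∀ᵐ y ∂volIoi b, ‖x y‖ ≤ M * exp (-(κ * (y - b))) + 2 * Ψ y := by
  obtain ⟨p, hp, hD⟩ := h.exists_duhamel hx hf
  have hpb := ae_restrict_Ioi_mono hab.le hp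
  filter_upwards [hpb, ae_restrict_mem measurableSet_Ioi] with Y hY hbY
  have hbY : b < Y := hbY
  -- The value at `Y` is compared with almost every `s` of the strip. Averaging over `s` replaces an
  -- initial value, for which no bound is given, by the mean.
  have key : ∀ᵐ s ∂(volume.restrict (Ioc a b)),
      ‖x Y‖ ≤ exp (-(κ * (Y - b))) * ‖x s‖ + 2 * Ψ Y := by
    have := ae_mono (Measure.restrict_mono Ioc_subset_Ioi_self le_rfl :
      volume.restrict (Ioc a b) ≤ volIoi a) hp
    filter_upwards [this, ae_restrict_mem measurableSet_Ioc] with s hs hsb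
    have hsY : s ≤ Y := hsb.2.trans hbY.le
    have h1 := hD s Y hsb.1 hsY hs hY
    have h2 := norm_integral_exp_mul_le (κ := -κ) (σ := 1) hsb.1 hsY hd
      (fun y hy => by linarith [hΨ y hy]) hfΨ
    have h3 := (congrArg norm h1).trans_le (norm_add_le _ _)
    rw [norm_mul, norm_mul, Complex.norm_real, Complex.norm_real,
      Real.norm_of_nonneg (Real.exp_nonneg _), Real.norm_of_nonneg (Real.exp_nonneg _)] at h3
    have h6 := mul_nonneg (Real.exp_nonneg (-(-κ * s))) (h0 s hsb.1)
    have hE := Real.exp_pos (-(-κ * Y))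
    have h8 : exp (-(-κ * s)) ≤ exp (-(-κ * Y)) * exp (-(κ * (Y - b))) := by
      rw [← Real.exp_add]
      refine Real.exp_le_exp.mpr ?_
      nlinarith [mul_le_mul_of_nonneg_left hsb.2 hκ]
    have h9 := mul_le_mul_of_nonneg_right h8 (norm_nonneg (x s))
    have h7 : exp (-(-κ * Y)) * ‖x Y‖ ≤
        exp (-(-κ * Y)) * (exp (-(κ * (Y - b))) * ‖x s‖ + 2 * Ψ Y) := by linarith
    exact le_of_mul_le_mul_left h7 hE
  have hfin : volume (Ioc a b) ≠ ⊤ := by simp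
  have hba : 0 < b - a := sub_pos.mpr hab
  have h1 := setIntegral_mono_ae_restrict (s := Ioc a b) (integrableOn_const hfin)
    (((hx b).norm.const_mul (exp (-(κ * (Y - b))))).add (integrableOn_const (C := 2 * Ψ Y) hfin))
    key
  have h2 := integral_add ((hx b).norm.const_mul (exp (-(κ * (Y - b)))))
    (integrableOn_const (C := 2 * Ψ Y) hfin)
  simp only [Pi.add_apply] at h1
  rw [h2] at h1
  rw [integral_const_mul] at h1
  simp only [integral_const, MeasurableSet.univ, measureReal_restrict_apply, univ_inter,
    Real.volume_real_Ioc_of_le hab.le, smul_eq_mul] at h1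
  have h3 := mul_le_mul_of_nonneg_left hM (Real.exp_nonneg (-(κ * (Y - b))))
  refine le_of_mul_le_mul_left (a := b - a) ?_ hba
  linarith

/-- Weights with logarithmic derivative between `-(w - 1/2)` and `w - 1/2`. -/
structure IsDecayWeight (w a : ℝ) (Ψ : ℝ → ℝ) : Prop where
  diff : ∀ y, a < y → DifferentiableAt ℝ Ψ y
  nonneg : ∀ y, a < y → 0 ≤ Ψ y
  upper : ∀ y, a < y → Ψ y ≤ 2 * (w * Ψ y - deriv Ψ y)
  lower : ∀ y, a < y → Ψ y ≤ 2 * (w * Ψ y + deriv Ψ y)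

theorem IsDecayWeight.mono {b : ℝ} (h : IsDecayWeight w a Ψ) (hab : a ≤ b) :
    IsDecayWeight w b Ψ :=
  ⟨fun y hy => h.diff y (hab.trans_lt hy), fun y hy => h.nonneg y (hab.trans_lt hy),
    fun y hy => h.upper y (hab.trans_lt hy), fun y hy => h.lower y (hab.trans_lt hy)⟩

theorem IsDecayWeight.const_mul (h : IsDecayWeight w a Ψ) {c : ℝ} (hc : 0 ≤ c) :
    IsDecayWeight w a fun y => c * Ψ y := by
  refine ⟨fun y hy => (h.diff y hy).const_mul c, fun y hy => mul_nonneg hc (h.nonneg y hy),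
    fun y hy => ?_, fun y hy => ?_⟩ <;> rw [deriv_const_mul _ (h.diff y hy)]
  · nlinarith [mul_le_mul_of_nonneg_left (h.upper y hy) hc]
  · nlinarith [mul_le_mul_of_nonneg_left (h.lower y hy) hc]

theorem IsDecayWeight.add {Φ : ℝ → ℝ} (h : IsDecayWeight w a Ψ) (h' : IsDecayWeight w a Φ) :
    IsDecayWeight w a fun y => Ψ y + Φ y := by
  refine ⟨fun y hy => (h.diff y hy).add (h'.diff y hy), fun y hy =>
    add_nonneg (h.nonneg y hy) (h'.nonneg y hy), fun y hy => ?_, fun y hy => ?_⟩ <;>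
    rw [deriv_fun_add (h.diff y hy) (h'.diff y hy)]
  · linarith [h.upper y hy, h'.upper y hy]
  · linarith [h.lower y hy, h'.lower y hy]

theorem isDecayWeight_exp (hw : 1 ≤ w) (a b : ℝ) :
    IsDecayWeight w a fun y => exp (-((w - 1 / 2) * (y - b))) := by
  have hd : ∀ y, HasDerivAt (fun y => exp (-((w - 1 / 2) * (y - b))))
      (exp (-((w - 1 / 2) * (y - b))) * -(w - 1 / 2)) y := fun y => by
    have := (((hasDerivAt_id y).sub_const b).const_mul (w - 1 / 2)).neg.exp
    simpa using this
  refine ⟨fun y _ => (hd y).differentiableAt, fun y _ => Real.exp_nonneg _, fun y _ => ?_,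
    fun y _ => ?_⟩ <;> rw [(hd y).deriv]
  · nlinarith [Real.exp_nonneg (-((w - 1 / 2) * (y - b)))]
  · nlinarith [Real.exp_nonneg (-((w - 1 / 2) * (y - b)))]

theorem isDecayWeight_const (hw : 1 ≤ w) (a : ℝ) {c : ℝ} (hc : 0 ≤ c) :
    IsDecayWeight w a fun _ => c :=
  ⟨fun _ _ => differentiableAt_const c, fun _ _ => hc, fun _ _ => by rw [deriv_const]; nlinarith,
    fun _ _ => by rw [deriv_const]; nlinarith⟩

/-- The system `u' = z + f₁`, `z' = w² u + f₂`. -/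
theorem WeakDerivOn.ae_le_of_second_order {b M : ℝ} (hw : 0 ≤ w) (hab : a < b)
    (hu : MemLp u 2 volIoi a) (hz : MemLp z 2 volIoi a)
    (hf₁ : ∀ T, IntegrableOn f₁ (Ioc a T)) (hf₂ : ∀ T, IntegrableOn f₂ (Ioc a T))
    (h₁ : WeakDerivOn a u fun y => z y + f₁ y)
    (h₂ : WeakDerivOn a z fun y => ((w ^ 2 : ℝ) : ℂ) * u y + f₂ y)
    (hΨ : IsDecayWeight w a Ψ)
    (hf : ∀ᵐ y ∂volIoi a, w * ‖f₁ y‖ + ‖f₂ y‖ ≤ Ψ y)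
    (hM : ∫ y in Ioc a b, (w * ‖u y‖ + ‖z y‖) ≤ M * (b - a)) :
    ∀ᵐ y ∂volIoi b,
      w * ‖u y‖ + ‖z y‖ ≤ M * exp (-(w * (y - b))) + 4 * Ψ y := by
  have huI := fun T => MemLp.integrableOn_Ioc hu T
  have hzI := fun T => MemLp.integrableOn_Ioc hz T
  -- The combinations `z + s u` with `s = ±w` decouple the system: `s = w` gives a growing equation
  -- and `s = -w` a decaying one.
  have hfac : ∀ s : ℝ, s ^ 2 = w ^ 2 → WeakDerivOn a (fun y => z y + s * u y)
      fun y => (s : ℂ) * (z y + s * u y) + (f₂ y + s * f₁ y) := fun s hs => by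
    refine (h₂.add (h₁.const_mul s) hzI (fun T => (huI T).const_mul _)
      (fun T => ((huI T).const_mul _).add (hf₂ T))
      fun T => ((hzI T).add (hf₁ T)).const_mul _).congr (ae_eq_refl _) (ae_of_all _ fun y => ?_)
    simp only [← hs]
    push_cast
    ring
  have hF : ∀ s : ℝ, |s| = w → ∀ᵐ y ∂volIoi a, ‖f₂ y + s * f₁ y‖ ≤ Ψ y :=
    fun s hs => by
      filter_upwards [hf] with y hy
      refine (norm_add_le _ _).trans ?_
      rw [norm_mul, Complex.norm_real, Real.norm_eq_abs, hs]
      linarith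
  have hFI : ∀ s : ℝ, ∀ T, IntegrableOn (fun y => f₂ y + s * f₁ y) (Ioc a T) := fun s T =>
    (hf₂ T).add ((hf₁ T).const_mul _)
  have hplus := WeakDerivOn.ae_le_of_growing hw (hz.add (hu.const_mul (w : ℂ))) (hFI w)
    (hfac w rfl) hΨ.diff hΨ.nonneg hΨ.upper (hF w (abs_of_nonneg hw))
  have hminus := WeakDerivOn.ae_le_of_decaying (M := M) hw hab
    (fun T => (hzI T).add ((huI T).const_mul ((-w : ℝ) : ℂ))) (hFI (-w)) (hfac (-w) (by ring)) hΨ.diff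
    hΨ.nonneg hΨ.lower (hF (-w) (by rw [abs_neg, abs_of_nonneg hw])) (by
      refine le_trans ?_ hM
      refine setIntegral_mono_on ((hzI b).add ((huI b).const_mul _)).norm
        (((huI b).norm.const_mul _).add (hzI b).norm) measurableSet_Ioc fun y _ => ?_
      refine (norm_add_le _ _).trans ?_
      rw [norm_mul, Complex.norm_real, Real.norm_eq_abs, abs_neg, abs_of_nonneg hw, add_comm])
  filter_upwards [hminus, ae_restrict_Ioi_mono hab.le hplus] with y h1 h2
  simp only [Pi.add_apply] at h1 h2
  have h3 : ‖2 * z y‖ ≤ ‖z y + (w : ℂ) * u y‖ + ‖z y + ((-w : ℝ) : ℂ) * u y‖ := by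
    refine le_trans (le_of_eq ?_) (norm_add_le _ _)
    congr 1; push_cast; ring
  have h4 : ‖2 * ((w : ℂ) * u y)‖ ≤ ‖z y + (w : ℂ) * u y‖ + ‖z y + ((-w : ℝ) : ℂ) * u y‖ := by
    refine le_trans (le_of_eq ?_) (norm_sub_le _ _)
    congr 1; push_cast; ring
  rw [norm_mul, Complex.norm_two] at h3 h4
  rw [norm_mul, Complex.norm_real, Real.norm_of_nonneg hw] at h4
  linarith

end Comparison

/-! ### The Stokes system for a single frequency. -/

section StokesModes

variable {d : ℕ} {a ν : ℝ} {j : Fin d → ℤ} {F u : Fin (d + 1) → ℝ → ℂ}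
  {g : Fin (d + 1) → Fin (d + 1) → ℝ → ℂ} {p : ℝ → ℂ}

/-- The Fourier symbol of the `k`-th horizontal derivative. -/
noncomputable def gradSymbol (j : Fin d → ℤ) (k : Fin d) : ℂ := 2 * π * Complex.I * j k

/-- The `j`-th Fourier mode of the Stokes system on `Y > a`; `g k l` is the mode of `∂_k U_l`. -/
structure IsStokesModes (ν a : ℝ) (j : Fin d → ℤ) (F u : Fin (d + 1) → ℝ → ℂ)
    (g : Fin (d + 1) → Fin (d + 1) → ℝ → ℂ) (p : ℝ → ℂ) : Prop where
  memF : ∀ l, MemLp (F l) 2 volIoi a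
  memG : ∀ k l, MemLp (g k l) 2 volIoi a
  memP : MemLp p 2 volIoi a
  locU : ∀ l T, IntegrableOn (u l) (Ioc a T)
  tang : ∀ k l, g k.castSucc l =ᵐ[volIoi a] fun y => gradSymbol j k * u l y
  normal : ∀ l, WeakDerivOn a (u l) (g (Fin.last d) l)
  div : ∀ᵐ y ∂volIoi a, ∑ i, g i i y = 0
  stress : ∀ l, WeakDerivOn a (fun y => ν * g (Fin.last d) l y - if Fin.last d = l then p y else 0)
    fun y => -F l y - ∑ k : Fin d, gradSymbol j k *
      (ν * g k.castSucc l y - if k.castSucc = l then p y else 0)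

theorem sum_gradSymbol_sq (j : Fin d → ℤ) :
    ∑ k, gradSymbol j k ^ 2 = -(((2 * π * freqNorm j) ^ 2 : ℝ) : ℂ) := by
  rw [mul_pow, freqNorm_sq]
  push_cast
  rw [Finset.mul_sum, ← Finset.sum_neg_distrib]
  refine Finset.sum_congr rfl fun k _ => ?_
  rw [gradSymbol]
  ring_nf
  rw [Complex.I_sq]
  ring

theorem norm_gradSymbol (j : Fin d → ℤ) (k : Fin d) :
    ‖gradSymbol j k‖ = 2 * π * |(j k : ℝ)| := by
  rw [gradSymbol]
  simp [abs_of_pos Real.pi_pos]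

theorem norm_gradSymbol_le (j : Fin d → ℤ) (k : Fin d) :
    ‖gradSymbol j k‖ ≤ 2 * π * freqNorm j := by
  rw [norm_gradSymbol]
  have := Real.pi_pos
  exact mul_le_mul_of_nonneg_left (abs_le_freqNorm j k) (by positivity)

theorem MemLp.restrict_Ioi_mono {a b : ℝ} (hab : a ≤ b) {x : ℝ → ℂ}
    (h : MemLp x 2 volIoi a) : MemLp x 2 volIoi b :=
  h.mono_measure (Measure.restrict_mono (Ioi_subset_Ioi hab) le_rfl)

theorem IsStokesModes.horizontal (h : IsStokesModes ν a j F u g p) (hν : ν ≠ 0) (m : Fin d) :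
    WeakDerivOn a (g (Fin.last d) m.castSucc) fun y =>
      (((2 * π * freqNorm j) ^ 2 : ℝ) : ℂ) * u m.castSucc y +
        (ν : ℂ)⁻¹ * (gradSymbol j m * p y - F m.castSucc y) := by
  have hν' : (ν : ℂ) ≠ 0 := by exact_mod_cast hν
  refine ((h.stress m.castSucc).const_mul (ν : ℂ)⁻¹).congr (ae_of_all _ fun y => ?_) ?_
  · have : Fin.last d ≠ m.castSucc := (Fin.castSucc_lt_last m).ne'
    simp only [this, if_false, sub_zero]
    rw [inv_mul_cancel_left₀ hν']
  · filter_upwards [ae_all_iff.mpr fun k => h.tang k m.castSucc] with y hy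
    simp only [hy, (Fin.castSucc_injective d).eq_iff, mul_sub, Finset.sum_sub_distrib, mul_ite,
      mul_zero, Finset.sum_ite_eq', Finset.mem_univ, if_true]
    have e1 : ∑ k, gradSymbol j k * ((ν : ℂ) * (gradSymbol j k * u m.castSucc y)) =
        (∑ k, gradSymbol j k ^ 2) * (ν * u m.castSucc y) := by
      rw [Finset.sum_mul]; exact Finset.sum_congr rfl fun k _ => by ring
    rw [e1, sum_gradSymbol_sq]
    field_simp
    ring

theorem IsStokesModes.divergence (h : IsStokesModes ν a j F u g p) :
    g (Fin.last d) (Fin.last d) =ᵐ[volIoi a]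
      fun y => -∑ k : Fin d, gradSymbol j k * u k.castSucc y := by
  filter_upwards [h.div, ae_all_iff.mpr fun k => h.tang k k.castSucc] with y h1 h2
  rw [Fin.sum_univ_castSucc] at h1
  simp only [h2] at h1
  exact eq_neg_of_add_eq_zero_right h1

/-- The quantity playing the role of the vertical derivative of the pressure. -/
noncomputable def pressureSlope (ν : ℝ) (j : Fin d → ℤ) (u : Fin (d + 1) → ℝ → ℂ)
    (g : Fin (d + 1) → Fin (d + 1) → ℝ → ℂ) (y : ℝ) : ℂ :=
  -(ν : ℂ) * ((((2 * π * freqNorm j) ^ 2 : ℝ) : ℂ) * u (Fin.last d) y +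
    ∑ k : Fin d, gradSymbol j k * g (Fin.last d) k.castSucc y)

theorem IsStokesModes.locG (h : IsStokesModes ν a j F u g p) (k l : Fin (d + 1)) (T : ℝ) :
    IntegrableOn (g k l) (Ioc a T) := MemLp.integrableOn_Ioc (h.memG k l) T

theorem IsStokesModes.locF (h : IsStokesModes ν a j F u g p) (l : Fin (d + 1)) (T : ℝ) :
    IntegrableOn (F l) (Ioc a T) := MemLp.integrableOn_Ioc (h.memF l) T

theorem IsStokesModes.locP (h : IsStokesModes ν a j F u g p) (T : ℝ) : IntegrableOn p (Ioc a T) :=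
  MemLp.integrableOn_Ioc h.memP T

/-- Obtained by differentiating the divergence constraint, not from the momentum equation;
`pressureSlope` is defined so that the two agree. -/
theorem IsStokesModes.vertical (h : IsStokesModes ν a j F u g p) (hν : ν ≠ 0) :
    WeakDerivOn a (g (Fin.last d) (Fin.last d)) fun y =>
      (((2 * π * freqNorm j) ^ 2 : ℝ) : ℂ) * u (Fin.last d) y +
        (ν : ℂ)⁻¹ * pressureSlope ν j u g y := by
  have hν' : (ν : ℂ) ≠ 0 := by exact_mod_cast hν
  have h1 := WeakDerivOn.sum Finset.univ (fun k : Fin d => (h.normal k.castSucc).const_mul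
    (-gradSymbol j k)) (fun k T => (h.locU _ T).const_mul _) fun k T => (h.locG _ _ T).const_mul _
  refine h1.congr ?_ (ae_of_all _ fun y => ?_)
  · filter_upwards [h.divergence] with y hy
    rw [hy]
    simp only [neg_mul, Finset.sum_neg_distrib]
  · simp only [pressureSlope, neg_mul, Finset.sum_neg_distrib]
    field_simp
    ring

/-- The pressure is `ν ∂_Y U_Y` minus the normal stress. The first has a weak derivative by the
divergence constraint, the second by the vertical momentum equation; thus the pressure has one too.
-/
theorem IsStokesModes.pressure (h : IsStokesModes ν a j F u g p) :
    WeakDerivOn a p fun y => pressureSlope ν j u g y + F (Fin.last d) y := by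
  have h1 := WeakDerivOn.sum Finset.univ (fun k : Fin d => (h.normal k.castSucc).const_mul
    (-gradSymbol j k)) (fun k T => (h.locU _ T).const_mul _) fun k T => (h.locG _ _ T).const_mul _
  have i1 : ∀ T, IntegrableOn (fun y => ∑ k : Fin d, -gradSymbol j k * u k.castSucc y) (Ioc a T) :=
    fun T => integrable_finsetSum _ fun k _ => (h.locU _ T).const_mul _
  have i2 : ∀ T, IntegrableOn (fun y => ∑ k : Fin d, -gradSymbol j k *
      g (Fin.last d) k.castSucc y) (Ioc a T) :=
    fun T => integrable_finsetSum _ fun k _ => (h.locG _ _ T).const_mul _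
  have h2 := (h1.const_mul (ν : ℂ)).add ((h.stress (Fin.last d)).const_mul (-1))
    (fun T => (i1 T).const_mul _)
    (fun T => by
      simp only [if_true]
      exact (((h.locG _ _ T).const_mul _).sub (h.locP T)).const_mul _)
    (fun T => (i2 T).const_mul _)
    (fun T => by
      simp only [(Fin.castSucc_lt_last _).ne, if_false, sub_zero]
      exact ((h.locF _ T).neg.sub (integrable_finsetSum _ fun k _ =>
        ((h.locG _ _ T).const_mul _).const_mul _)).const_mul _)
  refine h2.congr ?_ ?_
  · filter_upwards [h.divergence] with y hy
    simp only [if_true, hy, neg_mul, Finset.sum_neg_distrib]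
    ring
  · filter_upwards [ae_all_iff.mpr fun k => h.tang k (Fin.last d)] with y hy
    simp only [hy, (Fin.castSucc_lt_last _).ne, if_false, sub_zero, pressureSlope, neg_mul,
      Finset.sum_neg_distrib]
    have e1 : ∑ k, gradSymbol j k * ((ν : ℂ) * (gradSymbol j k * u (Fin.last d) y)) =
        (∑ k, gradSymbol j k ^ 2) * (ν * u (Fin.last d) y) := by
      rw [Finset.sum_mul]; exact Finset.sum_congr rfl fun k _ => by ring
    rw [e1, sum_gradSymbol_sq]
    ring

/-- Together with `IsStokesModes.pressure` this is the equation `Δp = div F` for one mode: the terms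
in `u` cancel through the horizontal momentum equations and the divergence constraint. -/
theorem IsStokesModes.weakDerivOn_slope (h : IsStokesModes ν a j F u g p) (hν : ν ≠ 0) :
    WeakDerivOn a (pressureSlope ν j u g) fun y =>
      (((2 * π * freqNorm j) ^ 2 : ℝ) : ℂ) * p y +
        ∑ k : Fin d, gradSymbol j k * F k.castSucc y := by
  have hν' : (ν : ℂ) ≠ 0 := by exact_mod_cast hν
  have i1 : ∀ (m : Fin d) T, IntegrableOn (fun y => gradSymbol j m *
      ((((2 * π * freqNorm j) ^ 2 : ℝ) : ℂ) * u m.castSucc y +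
        (ν : ℂ)⁻¹ * (gradSymbol j m * p y - F m.castSucc y))) (Ioc a T) := fun m T =>
    (((h.locU _ T).const_mul _).add
      ((((h.locP T).const_mul _).sub (h.locF _ T)).const_mul _)).const_mul _
  have h1 := WeakDerivOn.sum Finset.univ (fun k : Fin d => (h.horizontal hν k).const_mul
    (gradSymbol j k)) (fun k T => (h.locG _ _ T).const_mul _) i1
  have h2 := (((h.normal (Fin.last d)).const_mul (((2 * π * freqNorm j) ^ 2 : ℝ) : ℂ)).add h1
    (fun T => (h.locU _ T).const_mul _)
    (fun T => integrable_finsetSum _ fun k _ => (h.locG _ _ T).const_mul _)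
    (fun T => (h.locG _ _ T).const_mul _)
    (fun T => integrable_finsetSum _ fun k _ => i1 k T)).const_mul (-(ν : ℂ))
  refine h2.congr (ae_of_all _ fun y => rfl) ?_
  filter_upwards [h.divergence] with y hy
  have e1 : ∀ m : Fin d, gradSymbol j m * ((((2 * π * freqNorm j) ^ 2 : ℝ) : ℂ) * u m.castSucc y +
        (ν : ℂ)⁻¹ * (gradSymbol j m * p y - F m.castSucc y)) =
      (((2 * π * freqNorm j) ^ 2 : ℝ) : ℂ) * (gradSymbol j m * u m.castSucc y) +
        (ν : ℂ)⁻¹ * (gradSymbol j m ^ 2 * p y - gradSymbol j m * F m.castSucc y) := fun m => by ring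
  simp only [e1, Finset.sum_add_distrib, ← Finset.mul_sum, Finset.sum_sub_distrib, ← Finset.sum_mul,
    sum_gradSymbol_sq, hy]
  field_simp
  ring

theorem IsStokesModes.memU (h : IsStokesModes ν a j F u g p) (hj : j ≠ 0) (l : Fin (d + 1)) :
    MemLp (u l) 2 volIoi a := by
  obtain ⟨k, hk⟩ := Function.ne_iff.mp hj
  have hk' : gradSymbol j k ≠ 0 := by
    rw [← norm_ne_zero_iff, norm_gradSymbol]
    have : (j k : ℝ) ≠ 0 := by exact_mod_cast hk
    have := Real.pi_pos
    positivity
  refine (memLp_congr_ae ?_).mpr ((h.memG k.castSucc l).const_mul (gradSymbol j k)⁻¹)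
  filter_upwards [h.tang k l] with y hy
  rw [hy, inv_mul_cancel_left₀ hk']

theorem one_le_two_pi_freqNorm {j : Fin d → ℤ} (hj : j ≠ 0) : 1 ≤ 2 * π * freqNorm j := by
  have h1 := one_le_freqNorm hj
  have h2 := Real.pi_gt_three
  nlinarith

/-- Collects the constants of `IsStokesModes.ae_le` under one factor `w²`. There `x` and `y` are two
decaying exponentials dominated by `E`, `n` is `ν⁻¹`, `c` is `d` and `t` is half the width of the
strip. -/
theorem mode_bound_aux {w t M ψ E x y n c : ℝ} (hw : 1 ≤ w) (ht : 0 < t) (hM : 0 ≤ M) (hψ : 0 ≤ ψ)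
    (hE : 0 ≤ E) (hx : x ≤ E) (hy : y ≤ E) (hn : 1 ≤ n) (hc : 0 ≤ c) :
    w * M / t * x + 5 * (n * (w ^ 2 * M / t * y + (4 * ((c + 1) * w) + 1) * ψ)) ≤
      n * (25 * (c + 1) + 6 / t) * w ^ 2 * (ψ + M * E) := by
  have hww : w ≤ n * w ^ 2 := by nlinarith
  have h1 : w * M / t * x ≤ n * w ^ 2 * (M / t * E) := by
    calc w * M / t * x = w * (M / t * x) := by ring
      _ ≤ w * (M / t * E) := by gcongr
      _ ≤ _ := mul_le_mul_of_nonneg_right hww (by positivity)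
  have h2 : w ^ 2 * M / t * y ≤ w ^ 2 * (M / t * E) := by
    calc w ^ 2 * M / t * y = w ^ 2 * (M / t * y) := by ring
      _ ≤ _ := by gcongr
  have h3 : (4 * ((c + 1) * w) + 1) * ψ ≤ w ^ 2 * (5 * (c + 1)) * ψ := by
    refine mul_le_mul_of_nonneg_right ?_ hψ
    have h0 : 1 ≤ 5 * w ^ 2 - 4 * w := by nlinarith
    nlinarith [mul_nonneg hc (show 0 ≤ 5 * w ^ 2 - 4 * w by linarith)]
  have h4 := mul_le_mul_of_nonneg_left (add_le_add h2 h3) (show 0 ≤ 5 * n by linarith)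
  have h5 : 0 ≤ n * w ^ 2 * (25 * (c + 1) * (M * E) + 6 / t * ψ) := by positivity
  have h6 : n * (25 * (c + 1) + 6 / t) * w ^ 2 * (ψ + M * E) =
      n * w ^ 2 * (25 * (c + 1) * (M * E) + 6 / t * ψ) + n * w ^ 2 * (M / t * E) +
      5 * n * (w ^ 2 * (M / t * E) + w ^ 2 * (5 * (c + 1)) * ψ) := by ring
  linarith

/-- Decay of the oscillating modes, in terms of a weight dominating the forcing and of the size of
the solution near the bottom of the strip. -/
theorem IsStokesModes.ae_le (h : IsStokesModes ν a j F u g p) (hj : j ≠ 0) (hν : 0 < ν) (hν1 : ν ≤ 1)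
    {b M w : ℝ} (hw : w = 2 * π * freqNorm j) (hab : a < b) {Ψ : ℝ → ℝ}
    (hΨ : IsDecayWeight w a Ψ)
    (hF : ∀ l, ∀ᵐ y ∂volIoi a, ‖F l y‖ ≤ Ψ y)
    (hM : ∫ y in Ioc a b, (‖p y‖ + ∑ l, (‖u l y‖ + ‖g (Fin.last d) l y‖)) ≤ M) :
    ∀ᵐ y ∂volIoi b, ∀ l, ‖p y‖ + ‖u l y‖ ≤ ν⁻¹ * (25 * (d + 1) + 12 / (b - a)) * w ^ 2 *
        (Ψ y + M * exp (-((w - 1 / 2) * (y - b)))) := by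
  have hw1 : 1 ≤ w := hw ▸ one_le_two_pi_freqNorm hj
  have hw0 : 0 ≤ w := by linarith
  -- The strip is halved: the mean over `(a, s)` starts the estimate of the pressure, and the mean
  -- over `(s, b)` that of the velocity, which needs the pressure bound on all of `Y > s`.
  set s := (a + b) / 2 with hs
  set t := (b - a) / 2 with ht
  have ht0 : 0 < t := by rw [ht]; linarith
  have has : a < s := by rw [hs]; linarith
  have hsb : s < b := by rw [hs]; linarith
  have hsa : s - a = t := by rw [hs, ht]; ring
  have hbs : b - s = t := by rw [hs, ht]; ring
  set N : ℝ → ℝ := fun y => ‖p y‖ + ∑ l, (‖u l y‖ + ‖g (Fin.last d) l y‖) with hN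
  have hN0 : ∀ y, 0 ≤ N y := fun y => by positivity
  have hNi : IntegrableOn N (Ioc a b) := (h.locP b).norm.add
    (integrable_finsetSum _ fun l _ => (h.locU l b).norm.add (h.locG _ l b).norm)
  have hM0 : 0 ≤ M := (setIntegral_nonneg measurableSet_Ioc fun y _ => hN0 y).trans hM
  have hpN : ∀ y, ‖p y‖ ≤ N y := fun y =>
    le_add_of_nonneg_right (Finset.sum_nonneg fun l _ => by positivity)
  have hlN : ∀ l y, ‖u l y‖ + ‖g (Fin.last d) l y‖ ≤ N y := fun l y => by
    have := Finset.single_le_sum (f := fun l => ‖u l y‖ + ‖g (Fin.last d) l y‖)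
      (fun l _ => by positivity) (Finset.mem_univ l)
    simp only [hN]
    linarith [norm_nonneg (p y)]
  have hmono : ∀ {f : ℝ → ℝ} {c : ℝ} {S : Set ℝ}, MeasurableSet S → S ⊆ Ioc a b → (∀ y, 0 ≤ f y) →
      (∀ y, f y ≤ c * N y) → 0 ≤ c → ∫ y in S, f y ≤ c * M := by
    intro f c S hSm hS hf0 hfc hc
    calc _ ≤ ∫ y in S, c * N y := integral_mono_of_nonneg (ae_of_all _ hf0)
            ((hNi.mono_set hS).const_mul c) (ae_of_all _ hfc)
      _ = c * ∫ y in S, N y := integral_const_mul _ _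
      _ ≤ c * ∫ y in Ioc a b, N y := mul_le_mul_of_nonneg_left
            (setIntegral_mono_set hNi (ae_of_all _ hN0) hS.eventuallyLE) hc
      _ ≤ c * M := mul_le_mul_of_nonneg_left hM hc
  have hsym : ∀ k, ‖gradSymbol j k‖ ≤ w := fun k => hw ▸ norm_gradSymbol_le j k
  have hq : MemLp (pressureSlope ν j u g) 2 volIoi a := (((h.memU hj _).const_mul _).add
      (memLp_finsetSum _ fun k _ => (h.memG _ _).const_mul _)).const_mul _
  have hqN : ∀ y, ‖pressureSlope ν j u g y‖ ≤ w ^ 2 * (N y - ‖p y‖) := fun y => by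
    rw [pressureSlope, norm_mul, norm_neg, Complex.norm_real, Real.norm_of_nonneg hν.le, ← hw]
    have e1 : ‖((w ^ 2 : ℝ) : ℂ) * u (Fin.last d) y + ∑ k : Fin d, gradSymbol j k *
        g (Fin.last d) k.castSucc y‖ ≤ w ^ 2 * ‖u (Fin.last d) y‖ +
        ∑ k : Fin d, w ^ 2 * ‖g (Fin.last d) k.castSucc y‖ := by
      refine (norm_add_le _ _).trans (add_le_add (le_of_eq ?_) ((norm_sum_le _ _).trans
        (Finset.sum_le_sum fun k _ => ?_)))
      · rw [norm_mul, Complex.norm_real, Real.norm_of_nonneg (by positivity)]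
      · rw [norm_mul]
        exact mul_le_mul_of_nonneg_right ((hsym k).trans (by nlinarith)) (norm_nonneg _)
    have e2 : ‖u (Fin.last d) y‖ + ∑ k : Fin d, ‖g (Fin.last d) k.castSucc y‖ ≤ N y - ‖p y‖ := by
      simp only [hN, add_sub_cancel_left]
      rw [Fin.sum_univ_castSucc, add_comm]
      exact add_le_add (Finset.sum_le_sum fun k _ => le_add_of_nonneg_left (norm_nonneg _))
        (le_add_of_nonneg_right (norm_nonneg _))
    rw [← Finset.mul_sum, ← mul_add] at e1
    calc _ ≤ 1 * _ := mul_le_mul_of_nonneg_right hν1 (norm_nonneg _)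
      _ ≤ _ := by rw [one_mul]; exact e1.trans (mul_le_mul_of_nonneg_left e2 (by positivity))
  have hFall := ae_all_iff.mpr hF
  -- the pressure
  have hp := WeakDerivOn.ae_le_of_second_order (M := w ^ 2 * M / t) hw0 has h.memP hq (h.locF _)
    (fun T => integrable_finsetSum _ fun k _ => (h.locF _ T).const_mul _) h.pressure
    (hw ▸ h.weakDerivOn_slope hν.ne') (hΨ.const_mul (c := (d + 1) * w) (by positivity)) (by
      filter_upwards [hFall] with y hy
      have e1 : ‖∑ k : Fin d, gradSymbol j k * F k.castSucc y‖ ≤ ∑ _k : Fin d, w * Ψ y := by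
        refine (norm_sum_le _ _).trans (Finset.sum_le_sum fun k _ => ?_)
        rw [norm_mul]
        exact mul_le_mul (hsym k) (hy _) (norm_nonneg _) hw0
      rw [Finset.sum_const, Finset.card_univ, Fintype.card_fin, nsmul_eq_mul] at e1
      have := mul_le_mul_of_nonneg_left (hy (Fin.last d)) hw0
      linarith) (by
      rw [hsa, div_mul_cancel₀ _ ht0.ne']
      refine hmono measurableSet_Ioc (Ioc_subset_Ioc_right hsb.le) (fun y => by positivity)
        (fun y => ?_) (by positivity)
      have := mul_le_mul_of_nonneg_right (show w ≤ w ^ 2 by nlinarith) (norm_nonneg (p y))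
      linarith [hqN y])
  -- the velocity
  set E : ℝ → ℝ := fun y => exp (-((w - 1 / 2) * (y - b))) with hE
  -- The velocity is forced by a pressure term of rate `w`, the rate of its own homogeneous
  -- solutions. Giving up `1/2` in the rate turns this resonant term into an admissible weight.
  set Ψ₂ : ℝ → ℝ := fun y => ν⁻¹ * (w ^ 2 * M / t * exp (-((w - 1 / 2) * (y - s))) +
    (4 * ((d + 1) * w) + 1) * Ψ y) with hΨ₂
  have hΨ₂w : IsDecayWeight w s Ψ₂ := (((isDecayWeight_exp hw1 s s).const_mul (by positivity)).add
    ((hΨ.mono has.le).const_mul (by positivity))).const_mul (by positivity)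
  have hp' : ∀ᵐ y ∂volIoi s, w * ‖p y‖ + ‖pressureSlope ν j u g y‖ + Ψ y ≤ ν * Ψ₂ y := by
    filter_upwards [hp, ae_restrict_mem measurableSet_Ioi] with y hy hys
    have hys : s < y := hys
    have e1 : exp (-(w * (y - s))) ≤ exp (-((w - 1 / 2) * (y - s))) :=
      Real.exp_le_exp.mpr (by nlinarith)
    have e2 := mul_le_mul_of_nonneg_left e1 (show 0 ≤ w ^ 2 * M / t by positivity)
    rw [hΨ₂, mul_inv_cancel_left₀ hν.ne']
    linarith
  have hvel : ∀ l, ∃ f : ℝ → ℂ, (∀ T, IntegrableOn f (Ioc a T)) ∧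
      WeakDerivOn a (g (Fin.last d) l) (fun y => ((w ^ 2 : ℝ) : ℂ) * u l y + f y) ∧
      ∀ᵐ y ∂volIoi s, ‖f y‖ ≤ Ψ₂ y := by
    have hfin : ∀ {f : ℂ} {y : ℝ}, ‖f‖ ≤ ν * Ψ₂ y → ‖(ν : ℂ)⁻¹ * f‖ ≤ Ψ₂ y := fun {f y} hf => by
      rw [norm_mul, norm_inv, Complex.norm_real, Real.norm_of_nonneg hν.le]
      rwa [inv_mul_le_iff₀ hν]
    refine Fin.lastCases ?_ fun m => ?_
    · refine ⟨_, fun T => (MemLp.integrableOn_Ioc hq T).const_mul _, hw ▸ h.vertical hν.ne', ?_⟩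
      filter_upwards [hp', ae_restrict_mem measurableSet_Ioi] with y hy hys
      have h0 := hΨ.nonneg y (has.trans hys)
      refine hfin ?_
      have := mul_nonneg hw0 (norm_nonneg (p y))
      linarith
    · refine ⟨_, fun T => (((h.locP T).const_mul _).sub (h.locF _ T)).const_mul _,
        hw ▸ h.horizontal hν.ne' m, ?_⟩
      filter_upwards [hp', ae_restrict_Ioi_mono has.le hFall] with y hy hys
      refine hfin ((norm_sub_le _ _).trans ?_)
      rw [norm_mul]
      have e2 := mul_le_mul_of_nonneg_right (hsym m) (norm_nonneg (p y))
      linarith [hys m.castSucc, norm_nonneg (pressureSlope ν j u g y)]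
  have hu : ∀ l, ∀ᵐ y ∂volIoi b, w * ‖u l y‖ + ‖g (Fin.last d) l y‖ ≤
      w * M / t * exp (-(w * (y - b))) + 4 * Ψ₂ y := fun l => by
    obtain ⟨f, hfi, hfd, hfb⟩ := hvel l
    refine WeakDerivOn.ae_le_of_second_order (f₁ := fun _ => 0) (f₂ := f) hw0 hsb
      (MemLp.restrict_Ioi_mono has.le (h.memU hj l)) (MemLp.restrict_Ioi_mono has.le (h.memG _ l))
      (fun T => integrableOn_zero) (fun T => (hfi T).mono_set (Ioc_subset_Ioc_left has.le))
      (by simpa using (h.normal l).mono has.le) (hfd.mono has.le) hΨ₂w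
      (by simpa using hfb) ?_
    rw [hbs, div_mul_cancel₀ _ ht0.ne']
    refine hmono measurableSet_Ioc (Ioc_subset_Ioc_left has.le) (fun y => by positivity)
      (fun y => ?_) hw0
    have e1 := mul_le_mul_of_nonneg_left (hlN l y) hw0
    have e2 := mul_le_mul_of_nonneg_right hw1 (norm_nonneg (g (Fin.last d) l y))
    linarith
  filter_upwards [ae_all_iff.mpr hu, ae_restrict_Ioi_mono hsb.le hp', ae_restrict_mem measurableSet_Ioi]
    with y h1 h2 hyb l
  have hyb : b < y := hyb
  have hΨ0 := hΨ.nonneg y (hab.trans hyb)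
  have e1 : exp (-(w * (y - b))) ≤ E y := Real.exp_le_exp.mpr (by nlinarith)
  have e2 : exp (-((w - 1 / 2) * (y - s))) ≤ E y := Real.exp_le_exp.mpr (by nlinarith)
  have k3 : ‖p y‖ ≤ Ψ₂ y := by
    have e3 : ‖p y‖ ≤ w * ‖p y‖ := le_mul_of_one_le_left (norm_nonneg _) hw1
    have e4 : ν * Ψ₂ y ≤ Ψ₂ y := mul_le_of_le_one_left (hΨ₂w.nonneg y (hsb.trans hyb)) hν1
    linarith [norm_nonneg (pressureSlope ν j u g y)]
  have k4 : ‖u l y‖ ≤ w * ‖u l y‖ := le_mul_of_one_le_left (norm_nonneg _) hw1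
  have k5 : ‖p y‖ + ‖u l y‖ ≤ w * M / t * exp (-(w * (y - b))) + 5 * Ψ₂ y := by
    linarith [h1 l, norm_nonneg (g (Fin.last d) l y)]
  have e5 : 12 / (b - a) = 6 / t := by rw [ht]; field_simp; norm_num
  rw [e5]
  exact k5.trans (mode_bound_aux hw1 ht0 hM0 hΨ0 (Real.exp_nonneg _) e1 e2
    ((one_le_inv₀ hν).mpr hν1) (Nat.cast_nonneg d))

end StokesModes

/-! ### Modes of a weak solution, and bounds uniform in the frequency. -/

section Modes

variable {d : ℕ} {H : (Fin d → ℝ) → ℝ} {ν a : ℝ} {F U : LayerPt d → LayerVec d}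
  {D : (Fin d → ℝ) → LayerVec d} {G : Fin (d + 1) → LayerPt d → LayerVec d} {P : LayerPt d → ℝ}

theorem layerMeasure_const_le (ha : ∀ X, -H X ≤ a) :
    layerMeasure (fun _ : Fin d → ℝ => -a) ≤ layerMeasure H :=
  Measure.restrict_mono (s := layerCell _) (s' := layerCell H)
    (fun z hz => ⟨hz.1, (ha z.1).trans_lt (by simpa using hz.2)⟩) le_rfl

theorem IsTracePair.isWeakDiv {V : LayerPt d → ℝ} {g : Fin (d + 1) → LayerPt d → ℝ}
    {D : (Fin d → ℝ) → ℝ} (h : IsTracePair H V g D) (i : Fin (d + 1)) :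
    IsWeakDiv H (fun l z => if l = i then V z else 0) (g i) := fun φ hφ => by
  have h1 := h.green φ hφ.isBoundaryTest i
  simp only [hφ.apply_boundary, mul_zero, zero_mul, integral_zero] at h1
  simpa using h1

theorem LayerLocL2.slabL2_of_le {V : LayerPt d → ℝ} (ha : ∀ X, -H X ≤ a) (h : LayerLocL2 H V) :
    SlabL2 a fun z => (V z : ℂ) := LayerLocL2.slabL2 fun R => (h R).mono_measure
    (Measure.restrict_mono_measure (layerMeasure_const_le ha) _)

theorem MemLp.slab_of_le {f : LayerPt d → ℝ} (ha : ∀ X, -H X ≤ a) (h : MemLp f 2 (layerMeasure H)) :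
    MemLp (fun z => (f z : ℂ)) 2 (slabMeasure d volIoi a) :=
  MemLp.slab_ofReal (h.mono_measure (layerMeasure_const_le ha))

/-- The `j`-th Fourier mode of a real field. -/
noncomputable abbrev rMode (f : LayerPt d → ℝ) (j : Fin d → ℤ) : ℝ → ℂ := rcMode f j

/-- Each scalar equation of the system is a weak divergence equation, which restricts to a half
space inside the domain and then passes to modes. -/
theorem IsStokesComponents.modes (hH : ContDiff ℝ ∞ H) (hHper : TorusPeriodic H)
    (hF : MemLp F 2 (layerMeasure H)) (h : IsStokesComponents H ν F D U G P)
    (ha : ∀ X, -H X ≤ a) (j : Fin d → ℤ) :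
    IsStokesModes ν a j (fun l => rMode (fun z => F z l) j) (fun l => rMode (fun z => U z l) j)
      (fun k l => rMode (fun z => G k z l) j) (rMode P j) := by
  have hHm := hH.continuous.measurable
  have sF : ∀ l, MemLp (fun z => (F z l : ℂ)) 2 (slabMeasure d volIoi a) :=
    fun l => MemLp.slab_of_le ha (hF.eval_piLp l)
  have sG : ∀ k l, MemLp (fun z => (G k z l : ℂ)) 2 (slabMeasure d volIoi a) :=
    fun k l => MemLp.slab_of_le ha ((h.pair l).memLp k)
  have sP := MemLp.slab_of_le ha h.memLp
  have sU : ∀ l, SlabL2 a (fun z => (U z l : ℂ)) := fun l => (h.pair l).locL2.slabL2_of_le ha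
  have sS : ∀ l k, MemLp (fun z => (stress ν G P l k z : ℂ)) 2
      (slabMeasure d volIoi a) := fun l k => MemLp.slab_of_le ha (memLp_stress h l k)
  have hw : ∀ l i, IsWeakDiv (fun _ => -a) (fun m z => if m = i then U z l else 0)
      (fun z => G i z l) := fun l i => ((h.pair l).isWeakDiv i).restrict hHm ha
  have hS : ∀ l k, rMode (stress ν G P l k) j =ᵐ[volIoi a] fun y =>
      ν * rMode (fun z => G k z l) j y - if k = l then rMode P j y else 0 := fun l k => by
    have h1 := cMode_add ((sG k l).const_mul (ν : ℂ)) (sP.const_mul (if k = l then -1 else 0)) j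
    have e1 : (fun z => (stress ν G P l k z : ℂ)) = fun z =>
        (ν : ℂ) * (G k z l : ℂ) + (if k = l then -1 else 0) * (P z : ℂ) := by
      ext z
      rw [stress]
      split_ifs <;> push_cast <;> ring
    rw [rMode, e1]
    filter_upwards [h1] with y hy
    rw [hy, cMode_const_mul, cMode_const_mul]
    split_ifs <;> ring
  refine ⟨fun l => MemLp.cMode (sF l) j, fun k l => MemLp.cMode (sG k l) j, MemLp.cMode sP j,
    fun l T => (sU l).cMode_integrableOn j T,
    fun k l => (hw l k.castSucc).modes_castSucc (sU l) (MemLp.slabL2 (sG _ l)) j,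
    fun l => (hw l (Fin.last d)).modes_last (sU l) (MemLp.slabL2 (sG _ l)) j, ?_, fun l => ?_⟩
  · have h1 := cMode_sum Finset.univ (fun i _ => sG i i) j
    have h2 : (fun z => ∑ i, (G i z i : ℂ)) =ᵐ[slabMeasure d volIoi a] fun _ => 0 := by
      rw [← layerMeasure_const]
      filter_upwards [ae_mono (layerMeasure_const_le ha) h.div] with z hz
      exact_mod_cast hz
    filter_upwards [h1, cMode_congr_ae h2 j] with y h3 h4
    rw [← h3, h4, cMode_zero]
  · have h1 := (((h.isWeakDiv_stress hH hHper hF l).restrict hHm ha).modes (fun i => MemLp.slabL2 (sS l i))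
      (B := fun z => -F z l) (by simpa using (MemLp.slabL2 (sF l)).const_mul (-1)) j)
    refine h1.congr (hS l (Fin.last d)) ?_
    filter_upwards [ae_all_iff.mpr fun k : Fin d => hS l k.castSucc] with y hy
    have e1 : cMode (fun z => ((-F z l : ℝ) : ℂ)) j y = -rMode (fun z => F z l) j y := by
      have := cMode_const_mul (-1) (fun z => (F z l : ℂ)) j y
      simpa using this
    rw [e1]
    exact congrArg₂ _ rfl (Finset.sum_congr rfl fun k _ => congrArg₂ _ rfl (hy k))

/-- Every coefficient is at most the mean of `|f|` over the slice, so the `L¹` norm on the slab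
bounds all modes at once. -/
theorem SlabL2.exists_bound_integral_cMode {f : LayerPt d → ℂ} (hf : SlabL2 a f) (b : ℝ) :
    ∃ M, ∀ j, ∫ y in Ioc a b, ‖cMode f j y‖ ≤ M := by
  have hi : Integrable f ((volume.restrict (unitCube d)).prod (volume.restrict (Ioc a b))) :=
    MemLp.integrable (q := 2) (by norm_num) (hf b)
  refine ⟨∫ y in Ioc a b, ∫ X in unitCube d, ‖f (X, y)‖, fun j => ?_⟩
  exact integral_mono_of_nonneg (ae_of_all _ fun y => norm_nonneg _)
    hi.integral_norm_prod_right (ae_of_all _ fun y => norm_charCoeff_le _ j)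

theorem IsStokesComponents.exists_bound_modes (h : IsStokesComponents H ν F D U G P)
    (ha : ∀ X, -H X ≤ a) (b : ℝ) :
    ∃ M, 0 ≤ M ∧ ∀ j, ∫ y in Ioc a b, (‖rMode P j y‖ + ∑ l, (‖rMode (fun z => U z l) j y‖ +
      ‖rMode (fun z => G (Fin.last d) z l) j y‖)) ≤ M := by
  have sP := MemLp.slabL2 (MemLp.slab_of_le ha h.memLp)
  have sU : ∀ l, SlabL2 a (fun z => (U z l : ℂ)) := fun l => (h.pair l).locL2.slabL2_of_le ha
  have sG : ∀ l, SlabL2 a (fun z => (G (Fin.last d) z l : ℂ)) := fun l =>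
    MemLp.slabL2 (MemLp.slab_of_le ha ((h.pair l).memLp _))
  obtain ⟨M, hM⟩ := sP.exists_bound_integral_cMode b
  choose K hK using fun l => (sU l).exists_bound_integral_cMode b
  choose L hL using fun l => (sG l).exists_bound_integral_cMode b
  have hle : ∀ j, ∫ y in Ioc a b, (‖rMode P j y‖ + ∑ l, (‖rMode (fun z => U z l) j y‖ +
      ‖rMode (fun z => G (Fin.last d) z l) j y‖)) ≤ M + ∑ l, (K l + L l) := fun j => by
    have iU := fun l => ((sU l).cMode_integrableOn j b).norm
    have iG := fun l => ((sG l).cMode_integrableOn j b).norm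
    have iUG : ∀ l, IntegrableOn (fun y => ‖rMode (fun z => U z l) j y‖ +
      ‖rMode (fun z => G (Fin.last d) z l) j y‖) (Ioc a b) := fun l => (iU l).add (iG l)
    rw [integral_add (sP.cMode_integrableOn j b).norm (integrable_finsetSum _ fun l _ => iUG l),
      integral_finsetSum _ fun l _ => iUG l]
    refine add_le_add (hM j) (Finset.sum_le_sum fun l _ => ?_)
    rw [integral_add (iU l) (iG l)]
    exact add_le_add (hK l j) (hL l j)
  exact ⟨_, (setIntegral_nonneg measurableSet_Ioc fun y _ => by positivity).trans (hle 0), hle⟩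

end Modes

/-! ### The mean values. -/

section ZeroMode

variable {Ψ : ℝ → ℝ} {f x : ℝ → ℂ}

/-- Weights for the mean values. -/
structure IsMeanWeight (Ψ : ℝ → ℝ) : Prop where
  diff : ∀ y, 0 < y → DifferentiableAt ℝ Ψ y
  nonneg : ∀ y, 0 < y → 0 ≤ Ψ y
  -- A logarithmic rate of at least `1/2` bounds tail integrals by `2 Ψ`; a rate of at most `1`
  -- turns increments of `Ψ` into bounds for derivatives.
  upper : ∀ y, 0 < y → Ψ y ≤ -2 * deriv Ψ y
  lower : ∀ y, 0 < y → -deriv Ψ y ≤ Ψ y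
  bdd : ∃ K, ∀ y, 0 < y → Ψ y ≤ K

theorem IsMeanWeight.const_mul (h : IsMeanWeight Ψ) {c : ℝ} (hc : 0 ≤ c) :
    IsMeanWeight fun y => c * Ψ y := by
  obtain ⟨K, hK⟩ := h.bdd
  refine ⟨fun y hy => (h.diff y hy).const_mul c, fun y hy => mul_nonneg hc (h.nonneg y hy),
    fun y hy => ?_, fun y hy => ?_, c * K, fun y hy => mul_le_mul_of_nonneg_left (hK y hy) hc⟩ <;>
    rw [deriv_const_mul _ (h.diff y hy)]
  · linarith [mul_le_mul_of_nonneg_left (h.upper y hy) hc]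
  · linarith [mul_le_mul_of_nonneg_left (h.lower y hy) hc]

theorem IsMeanWeight.norm_integral_le (h : IsMeanWeight Ψ)
    (hf : ∀ᵐ y ∂volIoi 0, ‖f y‖ ≤ Ψ y) {y Y : ℝ} (hy : 0 < y) (hyY : y ≤ Y) :
    ‖∫ s in Ioc y Y, f s‖ ≤ 2 * (Ψ y - Ψ Y) := by
  have := norm_integral_exp_mul_le (κ := 0) (σ := -1) hy hyY h.diff
    (fun y hy => by linarith [h.upper y hy]) hf
  simp only [zero_mul, neg_zero, Real.exp_zero, Complex.ofReal_one, one_mul] at this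
  linarith

theorem IsMeanWeight.integrableOn (h : IsMeanWeight Ψ) (hfm : ∀ T, IntegrableOn f (Ioc 0 T))
    (hf : ∀ᵐ y ∂volIoi 0, ‖f y‖ ≤ Ψ y) : IntegrableOn f (Ioi 0) := by
  obtain ⟨K, hK⟩ := h.bdd
  refine integrableOn_Ioi_of_intervalIntegral_norm_bounded
    ((∫ s in Ioc 0 1, ‖f s‖) + 2 * K) 0 hfm Filter.tendsto_id
    (Filter.eventually_atTop.mpr ⟨1, fun T hT => ?_⟩)
  have hT0 : (0 : ℝ) ≤ T := by linarith
  rw [intervalIntegral.integral_of_le hT0, ← Ioc_union_Ioc_eq_Ioc zero_le_one hT,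
    setIntegral_union (Ioc_disjoint_Ioc_of_le le_rfl) measurableSet_Ioc (hfm 1).norm
      ((hfm T).mono_set (Ioc_subset_Ioc_left zero_le_one)).norm]
  gcongr
  have h1 := h.norm_integral_le (f := fun s => (‖f s‖ : ℂ)) (by simpa using hf) one_pos hT
  rw [integral_complex_ofReal, Complex.norm_real] at h1
  have h2 := (Real.le_norm_self _).trans h1
  linarith [hK 1 one_pos, h.nonneg T (by linarith)]

theorem primitive_sub {C : ℂ} (hfm : ∀ T, IntegrableOn f (Ioc 0 T)) {y Y : ℝ} (hy : 0 < y)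
    (hyY : y ≤ Y) :
    (C + ∫ s in Ioc 0 Y, f s) - (C + ∫ s in Ioc 0 y, f s) = ∫ s in Ioc y Y, f s := by
  rw [← Ioc_union_Ioc_eq_Ioc hy.le hyY, setIntegral_union (Ioc_disjoint_Ioc_of_le le_rfl)
    measurableSet_Ioc (hfm y) ((hfm Y).mono_set (Ioc_subset_Ioc_left hy.le))]
  ring

/-- The derivative is integrable up to infinity, and the distance to the limit is the integral over
the tail. -/
theorem IsMeanWeight.exists_limit (h : IsMeanWeight Ψ) (hfm : ∀ T, IntegrableOn f (Ioc 0 T))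
    (hf : ∀ᵐ y ∂volIoi 0, ‖f y‖ ≤ Ψ y) (C : ℂ) :
    ∃ L, ∀ y, 0 < y → ‖(C + ∫ s in Ioc 0 y, f s) - L‖ ≤ 2 * Ψ y := by
  have hi := h.integrableOn hfm hf
  refine ⟨C + ∫ s in Ioi 0, f s, fun y hy => ?_⟩
  have ht := intervalIntegral_tendsto_integral_Ioi 0 hi Filter.tendsto_id
  have ht' : Filter.Tendsto (fun Y => ‖(C + ∫ s in Ioc 0 y, f s) - (C + ∫ s in (0 : ℝ)..id Y, f s)‖)
      Filter.atTop (nhds ‖(C + ∫ s in Ioc 0 y, f s) - (C + ∫ s in Ioi 0, f s)‖) :=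
    ((ht.const_add C).const_sub _).norm
  refine le_of_tendsto ht' (Filter.eventually_atTop.mpr ⟨y, fun Y hY => ?_⟩)
  simp only [id_eq]
  rw [intervalIntegral.integral_of_le (hy.le.trans hY), norm_sub_rev, primitive_sub hfm hy hY]
  linarith [h.norm_integral_le hf hy hY, h.nonneg Y (hy.trans_le hY)]

/-- The set where the inequality fails is open and null, hence empty. -/
theorem le_of_ae_le_of_continuousOn {a : ℝ} {f g : ℝ → ℝ} (hf : ContinuousOn f (Ioi a))
    (hg : ContinuousOn g (Ioi a)) (h : ∀ᵐ y ∂volIoi a, f y ≤ g y) :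
    ∀ y, a < y → f y ≤ g y := by
  intro y hy
  by_contra! hlt
  have hopen : IsOpen (Ioi a ∩ {t | g t - f t < 0}) := by
    have := (hg.sub hf).isOpen_inter_preimage isOpen_Ioi (isOpen_Iio (a := (0 : ℝ)))
    exact this
  have hpos := hopen.measure_pos volume ⟨y, hy, by simpa using hlt⟩
  rw [ae_restrict_iff' measurableSet_Ioi] at h
  refine hpos.ne' (measure_mono_null ?_ h)
  intro t ht h2
  have h3 := h2 ht.1
  have h4 : g t - f t < 0 := ht.2
  linarith

/-- Right difference quotients are dominated by those of `-2 Ψ`. Where the derivative does not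
exist, `deriv` is zero by convention. -/
theorem norm_deriv_le_of_mean_weight (h : IsMeanWeight Ψ)
    (hx : ∀ y Y, 0 < y → y ≤ Y → ‖x Y - x y‖ ≤ 2 * (Ψ y - Ψ Y)) {y : ℝ} (hy : 0 < y) :
    ‖deriv x y‖ ≤ 2 * Ψ y := by
  by_cases hd : DifferentiableAt ℝ x y
  · have h1 := (hd.hasDerivAt.tendsto_slope.mono_left (nhdsWithin_mono y fun t (ht : t ∈ Ioi y) =>
      (ne_of_gt ht : t ≠ y))).norm
    have h2 := ((h.diff y hy).hasDerivAt.tendsto_slope.mono_left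
      (nhdsWithin_mono y fun t (ht : t ∈ Ioi y) => (ne_of_gt ht : t ≠ y))).const_mul (-2)
    have h3 : ‖deriv x y‖ ≤ -2 * deriv Ψ y := by
      refine le_of_tendsto_of_tendsto h1 h2 ?_
      filter_upwards [self_mem_nhdsWithin] with t ht
      have ht : y < t := ht
      have h4 : 0 < t - y := sub_pos.mpr ht
      rw [slope_def_module, slope_def_field, norm_smul, norm_inv, Real.norm_of_nonneg h4.le,
        inv_mul_le_iff₀ h4]
      have := hx y t hy ht.le
      field_simp
      linarith
    linarith [h.lower y hy]
  · rw [deriv_zero_of_not_differentiableAt hd, norm_zero]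
    linarith [h.nonneg y hy]

theorem lipschitzOnWith_of_mean_weight (h : IsMeanWeight Ψ)
    (hx : ∀ y Y, 0 < y → y ≤ Y → ‖x Y - x y‖ ≤ 2 * (Ψ y - Ψ Y)) :
    ∃ K, LipschitzOnWith K x (Ioi 0) := by
  obtain ⟨K, hK⟩ := h.bdd
  have hK0 : 0 ≤ K := (h.nonneg 1 one_pos).trans (hK 1 one_pos)
  have hmv : ∀ y Y, 0 < y → y ≤ Y → Ψ y - Ψ Y ≤ K * (Y - y) := fun y Y hy hyY => by
    have := (convex_Ici y).mul_sub_le_image_sub_of_le_deriv (C := -K)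
      (fun t ht => (h.diff t (hy.trans_le ht)).continuousAt.continuousWithinAt)
      (fun t ht => (h.diff t (hy.trans_le (interior_subset ht))).differentiableWithinAt)
      (fun t ht => by
        have ht : y ≤ t := interior_subset ht
        linarith [h.lower t (hy.trans_le ht), hK t (hy.trans_le ht)])
      y self_mem_Ici Y hyY hyY
    linarith
  refine ⟨(2 * K).toNNReal, LipschitzOnWith.of_dist_le_mul fun y hy Y hY => ?_⟩
  rw [Real.coe_toNNReal _ (by positivity)]
  rcases le_total y Y with hyY | hyY
  · rw [dist_comm, dist_comm y, dist_eq_norm, Real.dist_eq, abs_of_nonneg (sub_nonneg.mpr hyY)]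
    linarith [hx y Y hy hyY, hmv y Y hy hyY]
  · rw [dist_eq_norm, Real.dist_eq, abs_of_nonneg (sub_nonneg.mpr hyY)]
    linarith [hx Y y hY hyY, hmv Y y hY hyY]

theorem hasDerivAt_primitive_Ioc {C : ℂ} {y : ℝ} (hfm : ∀ T, IntegrableOn f (Ioc 0 T)) (hy : 0 < y)
    (hc : ContinuousOn f (Ioi 0)) : HasDerivAt (fun y => C + ∫ s in Ioc 0 y, f s) (f y) y := by
  have h1 : IntervalIntegrable f volume 0 y :=
    (intervalIntegrable_iff_integrableOn_Ioc_of_le hy.le).mpr (hfm y)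
  have h2 := intervalIntegral.integral_hasDerivAt_right h1
    (hc.stronglyMeasurableAtFilter isOpen_Ioi y hy) (hc.continuousAt (Ioi_mem_nhds hy))
  refine (h2.const_add C).congr_of_eventuallyEq ?_
  filter_upwards [Ioi_mem_nhds hy] with t ht
  rw [intervalIntegral.integral_of_le (le_of_lt ht)]

/-- The mean values of a solution of the Stokes system. -/
theorem IsStokesModes.zero_mode {d : ℕ} {ν : ℝ} {F u : Fin (d + 1) → ℝ → ℂ}
    {g : Fin (d + 1) → Fin (d + 1) → ℝ → ℂ} {p : ℝ → ℂ} (h : IsStokesModes ν 0 0 F u g p) (hν : 0 < ν)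
    (hΨ : IsMeanWeight Ψ) (hF : ∀ l, ∀ᵐ y ∂volIoi 0, ‖F l y‖ ≤ Ψ y) :
    ∃ (v z : Fin (d + 1) → ℝ → ℂ) (L : Fin (d + 1) → ℂ) (C : ℂ),
      (∀ l, u l =ᵐ[volIoi 0] v l) ∧ (p =ᵐ[volIoi 0] fun y => C + ∫ s in Ioc 0 y, F (Fin.last d) s) ∧
      ∀ y, 0 < y → (∀ l, HasDerivAt (v l) (z l y) y ∧ ‖z l y‖ ≤ 2 * (ν⁻¹ * Ψ y) ∧
        ‖v l y - L l‖ ≤ 4 * (ν⁻¹ * Ψ y)) ∧ ‖C + ∫ s in Ioc 0 y, F (Fin.last d) s‖ ≤ 2 * Ψ y := by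
  have hf0 : freqNorm (0 : Fin d → ℤ) = 0 := freqNorm_eq_zero.mpr rfl
  have hs0 : ∀ k, gradSymbol (0 : Fin d → ℤ) k = 0 := fun k => by simp [gradSymbol]
  -- A square integrable function whose derivative is dominated by `c Ψ` has no free constant of
  -- integration, so its size is controlled by `Ψ` alone. This keeps the boundary data out of the
  -- final constants.
  have hcont : ∀ {x f : ℝ → ℂ}, MemLp x 2 volIoi 0 →
      (∀ T, IntegrableOn f (Ioc 0 T)) → WeakDerivOn 0 x f → ∀ {c : ℝ}, 0 ≤ c →
      (∀ᵐ y ∂volIoi 0, ‖f y‖ ≤ c * Ψ y) →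
      ∃ C : ℂ, (x =ᵐ[volIoi 0] fun y => C + ∫ s in Ioc 0 y, f s) ∧
        ∀ y, 0 < y → ‖C + ∫ s in Ioc 0 y, f s‖ ≤ 2 * (c * Ψ y) := by
    intro x f hx hf hd c hc hfc
    obtain ⟨C, hC⟩ := hd.exists_eq_primitive (fun T => MemLp.integrableOn_Ioc hx T) hf
    have hw := hΨ.const_mul hc
    have h1 := WeakDerivOn.ae_le_of_growing (κ := 0) (f := f) le_rfl hx hf (by simpa using hd)
      hw.diff hw.nonneg (fun y hy => by linarith [hw.upper y hy]) hfc
    refine ⟨C, hC, le_of_ae_le_of_continuousOn ?_ ?_ ?_⟩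
    · exact ((continuousOn_primitive_Ioc hf).mono Ioi_subset_Ici_self).const_add C |>.norm
    · exact fun y hy => ((hw.diff y hy).continuousAt.const_mul 2).continuousWithinAt
    · filter_upwards [hC, h1] with y h2 h3
      rwa [← h2]
  -- At frequency zero the divergence constraint makes the vertical derivative of the mean vertical
  -- velocity constant, and the horizontal momentum equations become `ν g' = -F`.
  have hder : ∀ l, ∃ f : ℝ → ℂ, (∀ T, IntegrableOn f (Ioc 0 T)) ∧
      WeakDerivOn 0 (g (Fin.last d) l) f ∧ ∀ᵐ y ∂volIoi 0, ‖f y‖ ≤ ν⁻¹ * Ψ y := by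
    refine Fin.lastCases ⟨fun _ => 0, fun _ => integrableOn_zero, ?_, ?_⟩ fun m =>
      ⟨fun y => -(ν : ℂ)⁻¹ * F m.castSucc y, fun T => (h.locF _ T).const_mul _, ?_, ?_⟩
    · simpa [pressureSlope, hf0, hs0] using h.vertical hν.ne'
    · filter_upwards [ae_restrict_mem measurableSet_Ioi] with y hy
      rw [norm_zero]
      have := hΨ.nonneg y hy
      positivity
    · simpa [hf0, hs0] using h.horizontal hν.ne' m
    · filter_upwards [hF m.castSucc] with y hy
      rw [norm_mul, norm_neg, norm_inv, Complex.norm_real, Real.norm_of_nonneg hν.le]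
      gcongr
  choose f hfi hfd hfb using hder
  choose K hK1 hK2 using fun l =>
    hcont (h.memG (Fin.last d) l) (hfi l) (hfd l) (inv_nonneg.mpr hν.le) (hfb l)
  obtain ⟨C, hC1, hC2⟩ := hcont h.memP (h.locF (Fin.last d))
    (by simpa [pressureSlope, hf0, hs0] using h.pressure) zero_le_one
    (by simpa using hF (Fin.last d))
  have hzc : ∀ l, ContinuousOn (fun y => K l + ∫ s in Ioc 0 y, f l s) (Ici 0) := fun l =>
    (continuousOn_primitive_Ioc (hfi l)).const_add _
  have hzi : ∀ l T, IntegrableOn (fun y => K l + ∫ s in Ioc 0 y, f l s) (Ioc 0 T) := fun l T =>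
    (((hzc l).mono Icc_subset_Ici_self).integrableOn_Icc).mono_set Ioc_subset_Icc_self
  choose B hB using fun l => ((h.normal l).congr Filter.EventuallyEq.rfl (hK1 l)).exists_eq_primitive
    (h.locU l) (hzi l)
  have hw := hΨ.const_mul (show 0 ≤ 2 * ν⁻¹ by positivity)
  have hzb : ∀ l, ∀ᵐ y ∂volIoi 0, ‖K l + ∫ s in Ioc 0 y, f l s‖ ≤ 2 * ν⁻¹ * Ψ y :=
    fun l => by
      filter_upwards [ae_restrict_mem measurableSet_Ioi] with y hy
      linarith [hK2 l y hy]
  choose L hL using fun l => hw.exists_limit (hzi l) (hzb l) (B l)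
  refine ⟨fun l y => B l + ∫ s in Ioc 0 y, (K l + ∫ s in Ioc 0 s, f l s), _, L, C, hB, hC1,
    fun y hy => ⟨fun l => ⟨hasDerivAt_primitive_Ioc (hzi l) hy ((hzc l).mono Ioi_subset_Ici_self),
      hK2 l y hy, ?_⟩, by linarith [hC2 y hy]⟩⟩
  linarith [hL l y hy]

end ZeroMode

/-! ### Summable weights on the frequency lattice. -/

section LatticeSums

theorem summable_prod_pi {f : ℤ → ℝ} (hf0 : ∀ n, 0 ≤ f n) (hf : Summable f) (d : ℕ) :
    Summable fun j : Fin d → ℤ => ∏ k, f (j k) := by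
  induction d with
  | zero => exact (hasSum_fintype _).summable
  | succ d ih =>
    rw [← (Fin.consEquiv fun _ => ℤ).summable_iff]
    have := hf.mul_of_nonneg ih hf0 fun j => Finset.prod_nonneg fun k _ => hf0 _
    refine this.congr fun x => ?_
    simp [Fin.consEquiv, Fin.prod_univ_succ]

variable {d : ℕ}

/-- A summable weight on the frequencies. -/
noncomputable def latticeWeight (j : Fin d → ℤ) : ℝ := ∏ k, (1 + (j k : ℝ) ^ 2)⁻¹

theorem latticeWeight_pos (j : Fin d → ℤ) : 0 < latticeWeight j :=
  Finset.prod_pos fun k _ => by positivity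

theorem summable_latticeWeight : Summable (latticeWeight (d := d)) := by
  refine summable_prod_pi (f := fun n : ℤ => (1 + (n : ℝ) ^ 2)⁻¹) (fun n => by positivity) ?_ d
  have h1 := (Real.summable_one_div_int_pow (p := 2)).mpr one_lt_two
  refine Summable.of_norm_bounded_eventually h1 ?_
  have : ({0} : Set ℤ)ᶜ ∈ Filter.cofinite := (finite_singleton 0).compl_mem_cofinite
  filter_upwards [this] with n hn
  have hn' : (n : ℝ) ≠ 0 := by exact_mod_cast hn
  rw [Real.norm_of_nonneg (by positivity), one_div]
  gcongr
  linarith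

/-- Each factor `1 + j_k²` is at most `2 |j|²`, so `2d` powers of the frequency can be traded for
the summable weight. -/
theorem one_le_mul_latticeWeight {j : Fin d → ℤ} (hj : j ≠ 0) :
    1 ≤ 2 ^ d * freqNorm j ^ (2 * d) * latticeWeight j := by
  have h1 := one_le_freqNorm hj
  have h2 : ∏ k, (1 + (j k : ℝ) ^ 2) ≤ ∏ _k : Fin d, (2 * freqNorm j ^ 2) :=
    Finset.prod_le_prod (fun k _ => by positivity) fun k _ => by
      have := abs_le_freqNorm j k
      have := sq_abs (j k : ℝ)
      nlinarith [abs_nonneg (j k : ℝ)]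
  rw [Finset.prod_const, Finset.card_univ, Fintype.card_fin, mul_pow, ← pow_mul] at h2
  rw [latticeWeight, Finset.prod_inv_distrib, ← div_eq_mul_inv, one_le_div
    (Finset.prod_pos fun k _ => by positivity)]
  exact h2

theorem le_mul_latticeWeight {j : Fin d → ℤ} (hj : j ≠ 0) {l : ℕ} {x C : ℝ} (hx : 0 ≤ x)
    (h : freqNorm j ^ (l + 2 * d) * x ≤ C) :
    freqNorm j ^ l * x ≤ 2 ^ d * C * latticeWeight j := by
  have h0 := freqNorm_nonneg j
  calc freqNorm j ^ l * x ≤ freqNorm j ^ l * x * (2 ^ d * freqNorm j ^ (2 * d) * latticeWeight j) :=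
        le_mul_of_one_le_right (by positivity) (one_le_mul_latticeWeight hj)
    _ = 2 ^ d * (freqNorm j ^ (l + 2 * d) * x) * latticeWeight j := by ring
    _ ≤ _ := by gcongr; exact (latticeWeight_pos j).le

theorem exists_pow_mul_exp_le (m : ℕ) {δ : ℝ} (hδ : 0 < δ) :
    ∃ C, ∀ x, 0 ≤ x → x ^ m * exp (-(δ * x)) ≤ C := by
  refine ⟨m.factorial / δ ^ m, fun x hx => ?_⟩
  have h1 := Real.pow_div_factorial_le_exp (δ * x) (by positivity) m
  rw [div_le_iff₀ (by positivity), mul_pow] at h1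
  rw [le_div_iff₀ (by positivity), Real.exp_neg]
  have := Real.exp_pos (δ * x)
  field_simp
  linarith

theorem exists_exp_le_latticeWeight (l : ℕ) {δ : ℝ} (hδ : 0 < δ) :
    ∃ C, 0 ≤ C ∧ ∀ j : Fin d → ℤ, j ≠ 0 →
      freqNorm j ^ l * exp (-(δ * freqNorm j)) ≤ C * latticeWeight j := by
  obtain ⟨C, hC⟩ := exists_pow_mul_exp_le (l + 2 * d) hδ
  refine ⟨2 ^ d * |C|, by positivity, fun j hj => le_mul_latticeWeight hj (Real.exp_nonneg _) ?_⟩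
  exact (hC _ (freqNorm_nonneg j)).trans (le_abs_self C)

end LatticeSums

/-! ### Polynomial times exponential as a weight. -/

section Weights

/-- A polynomial times a decaying exponential. -/
noncomputable def decayWeight (n : ℕ) (μ y : ℝ) : ℝ := (2 * n + 2 + y) ^ n * exp (-(μ * y))

theorem decayWeight_pos (n : ℕ) (μ : ℝ) {y : ℝ} (hy : 0 ≤ y) : 0 < decayWeight n μ y := by
  unfold decayWeight; positivity

theorem hasDerivAt_decayWeight (n : ℕ) (μ y : ℝ) : HasDerivAt (decayWeight n μ)
    ((n * (2 * n + 2 + y) ^ (n - 1)) * exp (-(μ * y)) - μ * decayWeight n μ y) y := by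
  have h1 : HasDerivAt (fun y : ℝ => (2 * n + 2 + y : ℝ) ^ n) (n * (2 * n + 2 + y) ^ (n - 1)) y := by
    simpa using ((hasDerivAt_id y).const_add (2 * n + 2 : ℝ)).fun_pow n
  have h2 : HasDerivAt (fun y : ℝ => exp (-(μ * y))) (exp (-(μ * y)) * -μ) y := by
    simpa using ((hasDerivAt_id y).const_mul μ).neg.exp
  refine (h1.mul h2).congr_deriv ?_
  rw [decayWeight]; ring

/-- The shift `2n + 2` keeps the logarithmic derivative of the polynomial factor, `n / (2n + 2 +
y)`, between `0` and `1/2`. The whole weight then decays at a rate between `μ - 1/2` and `μ`. -/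
theorem deriv_decayWeight_bounds (n : ℕ) (μ : ℝ) {y : ℝ} (hy : 0 ≤ y) :
    -(μ * decayWeight n μ y) ≤ deriv (decayWeight n μ) y ∧
      2 * deriv (decayWeight n μ) y ≤ (1 - 2 * μ) * decayWeight n μ y := by
  rw [(hasDerivAt_decayWeight n μ y).deriv]
  have h1 : 0 ≤ (n * (2 * n + 2 + y) ^ (n - 1)) * exp (-(μ * y)) := by positivity
  have h2 : 2 * ((n * (2 * n + 2 + y) ^ (n - 1)) * exp (-(μ * y))) ≤ decayWeight n μ y := by
    rw [decayWeight, ← mul_assoc]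
    refine mul_le_mul_of_nonneg_right ?_ (Real.exp_nonneg _)
    rcases n with - | n
    · simp
    · rw [Nat.add_sub_cancel, pow_succ]
      have : (0 : ℝ) ≤ (2 * (n + 1 : ℕ) + 2 + y) ^ n := by positivity
      push_cast at this ⊢
      nlinarith [mul_nonneg this hy]
  constructor <;> linarith

theorem isDecayWeight_decayWeight (n : ℕ) {μ w : ℝ} (h1 : μ + 1 / 2 ≤ w) (h2 : 1 ≤ w + μ) :
    IsDecayWeight w 0 (decayWeight n μ) := by
  refine ⟨fun y _ => (hasDerivAt_decayWeight n μ y).differentiableAt,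
    fun y hy => (decayWeight_pos n μ hy.le).le, fun y hy => ?_, fun y hy => ?_⟩
  · nlinarith [(deriv_decayWeight_bounds n μ hy.le).2, decayWeight_pos n μ hy.le]
  · nlinarith [(deriv_decayWeight_bounds n μ hy.le).1, decayWeight_pos n μ hy.le]

theorem decayWeight_le_zero (n : ℕ) {y : ℝ} (hy : 0 ≤ y) :
    decayWeight n 1 y ≤ decayWeight n 1 0 := by
  refine antitoneOn_of_deriv_nonpos (convex_Ici 0)
    (fun t _ => (hasDerivAt_decayWeight n 1 t).continuousAt.continuousWithinAt)
    (fun t _ => (hasDerivAt_decayWeight n 1 t).differentiableAt.differentiableWithinAt)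
    (fun t ht => ?_) self_mem_Ici hy hy
  have ht : 0 ≤ t := interior_subset ht
  linarith [(deriv_decayWeight_bounds n 1 ht).2, decayWeight_pos n 1 ht]

theorem isMeanWeight_decayWeight (n : ℕ) : IsMeanWeight (decayWeight n 1) := by
  refine ⟨fun y _ => (hasDerivAt_decayWeight n 1 y).differentiableAt,
    fun y hy => (decayWeight_pos n 1 hy.le).le, fun y hy => ?_, fun y hy => ?_,
    _, fun y hy => decayWeight_le_zero n hy.le⟩
  · linarith [(deriv_decayWeight_bounds n 1 hy.le).2]
  · linarith [(deriv_decayWeight_bounds n 1 hy.le).1]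

theorem Polynomial.exists_eval_le (Q : Polynomial ℝ) :
    ∃ (n : ℕ) (A : ℝ), 0 ≤ A ∧ ∀ y : ℝ, 0 ≤ y → Q.eval y ≤ A * (2 * n + 2 + y) ^ n := by
  refine ⟨Q.natDegree, ∑ i ∈ Finset.range (Q.natDegree + 1), |Q.coeff i|,
    Finset.sum_nonneg fun i _ => abs_nonneg _, fun y hy => ?_⟩
  rw [Polynomial.eval_eq_sum_range, Finset.sum_mul]
  refine Finset.sum_le_sum fun i hi => mul_le_mul (le_abs_self _) ?_ (by positivity) (abs_nonneg _)
  have hi : i ≤ Q.natDegree := Nat.lt_succ_iff.mp (Finset.mem_range.mp hi)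
  have h1 : y ≤ 2 * (Q.natDegree : ℝ) + 2 + y := by linarith [(Q.natDegree).cast_nonneg (α := ℝ)]
  exact (pow_le_pow_left₀ hy h1 i).trans
    (pow_le_pow_right₀ (by linarith [(Q.natDegree).cast_nonneg (α := ℝ)]) hi)

theorem exists_poly_eval (n : ℕ) (c : ℝ) :
    ∃ q : Polynomial ℝ, ∀ y, q.eval y * exp (-y) = c * decayWeight n 1 y :=
  ⟨Polynomial.C c * (Polynomial.C (2 * n + 2 : ℝ) + Polynomial.X) ^ n, fun y => by
    simp [decayWeight, mul_assoc]⟩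

end Weights

/-! ### Weighted square integrability of the force. -/

section Forcing

variable {d : ℕ} {H : (Fin d → ℝ) → ℝ}

theorem summable_exp_freqNorm :
    Summable fun j : Fin d → ℤ => exp (-(2 * (max (freqNorm j) 1 - 1))) := by
  obtain ⟨C, hC0, hC⟩ := exists_exp_le_latticeWeight (d := d) 0 two_pos
  refine Summable.of_norm_bounded_eventually (summable_latticeWeight.mul_left (exp 2 * C)) ?_
  have : ({0} : Set (Fin d → ℤ))ᶜ ∈ Filter.cofinite := (finite_singleton 0).compl_mem_cofinite
  filter_upwards [this] with j hj
  have h1 := hC j hj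
  rw [Real.norm_of_nonneg (Real.exp_nonneg _), max_eq_left (one_le_freqNorm hj), mul_assoc,
    show -(2 * (freqNorm j - 1)) = 2 + -(2 * freqNorm j) by ring, Real.exp_add]
  rw [pow_zero, one_mul] at h1
  gcongr

/-- Above `Y = 1` Parseval is applied on slices: with `m = max |j| 1` one has `2 m y ≥ 2 y + 2 (m -
1)`, so the sum over `j` converges and `e^{-2y}` outweighs the weight `e^y`. For `Y ≤ 1` the weight
is bounded and `F ∈ L²` suffices. The shear alters the weight by a bounded factor. -/
theorem flatWeightedL2_of_modes (hH : Continuous H) (hHper : TorusPeriodic H) (hH0 : ∀ X, 0 < H X)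
    {f : LayerPt d → ℝ} (hf : MemLp f 2 (layerMeasure H)) {n : ℕ} {A : ℝ}
    (h : ∀ j, ∀ᵐ y ∂volIoi 0, ‖rMode f j y‖ ≤ A * decayWeight n (max (freqNorm j) 1) y) :
    FlatWeightedL2 fun z => f (layerShear H z) := by
  have hHm := hH.measurable
  obtain ⟨M, hM0, hM⟩ := exists_bound_of_torusPeriodic hH hHper
  have hexp : Continuous fun z : LayerPt d => exp (z.2 / 2) := by fun_prop
  have hslab : MemLp f 2 (slabMeasure d volIoi 0) := by
    rw [← layerMeasure_const]
    exact hf.mono_measure (layerMeasure_const_le fun X => by linarith [hH0 X])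
  -- the part above `Y = 1`
  have hup : MemLp (fun z : LayerPt d => exp (z.2 / 2) * f z) 2
      (slabMeasure d volIoi 1) := by
    have hsl1 : MemLp f 2 (slabMeasure d volIoi 1) :=
      hslab.mono_measure (slabMeasure_mono (Ioi_subset_Ioi zero_le_one))
    have hmeas : AEStronglyMeasurable (fun z : LayerPt d => exp (z.2 / 2) * f z)
        (slabMeasure d volIoi 1) := hexp.aestronglyMeasurable.mul hsl1.1
    rw [memLp_two_iff_lintegral hmeas]
    set K := ∑' j : Fin d → ℤ, exp (-(2 * (max (freqNorm j) 1 - 1))) with hK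
    have hslice : ∀ᵐ y ∂volIoi 1,
        ∫⁻ X in unitCube d, ‖exp (y / 2) * f (X, y)‖ₑ ^ 2 ≤
          ENNReal.ofReal (K * A ^ 2 * decayWeight (2 * n) 1 y) := by
      have hall := ae_restrict_Ioi_mono zero_le_one (ae_all_iff.mpr h)
      filter_upwards [hall, MemLp.slice hsl1, ae_restrict_mem measurableSet_Ioi] with y h1 h2 hy
      have hy : 1 < y := hy
      have h3 := hasSum_norm_sq_charCoeff h2.ofReal (d := d)
      have h4 : ∀ j, ‖charCoeff (fun X => (f (X, y) : ℂ)) j‖ ^ 2 ≤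
          A ^ 2 * (decayWeight (2 * n) 1 y * exp (-y)) *
            exp (-(2 * (max (freqNorm j) 1 - 1))) := fun j => by
        have h5 := pow_le_pow_left₀ (norm_nonneg _) (h1 j) 2
        refine h5.trans ?_
        rw [mul_pow, mul_assoc]
        refine mul_le_mul_of_nonneg_left ?_ (sq_nonneg A)
        have h6 : ((2 * n + 2 + y) ^ n) ^ 2 ≤ (2 * (2 * n : ℕ) + 2 + y : ℝ) ^ (2 * n) := by
          rw [← pow_mul, mul_comm n 2]
          have : (0 : ℝ) ≤ n := Nat.cast_nonneg n
          refine pow_le_pow_left₀ (by positivity) ?_ _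
          push_cast; linarith
        have h7 : (exp (-(max (freqNorm j) 1 * y))) ^ 2 ≤
            exp (-(1 * y)) * exp (-y) * exp (-(2 * (max (freqNorm j) 1 - 1))) := by
          rw [← Real.exp_nat_mul, ← Real.exp_add, ← Real.exp_add]
          refine Real.exp_le_exp.mpr ?_
          have := le_max_right (freqNorm j) 1
          push_cast
          nlinarith
        calc _ = ((2 * n + 2 + y) ^ n) ^ 2 * (exp (-(max (freqNorm j) 1 * y))) ^ 2 := by
              rw [decayWeight, mul_pow]
          _ ≤ _ := mul_le_mul h6 h7 (by positivity) (by positivity)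
          _ = _ := by rw [decayWeight]; ring
      have h8 := hasSum_le h4 h3 (summable_exp_freqNorm.hasSum.mul_left _)
      have h9 : ∫⁻ X in unitCube d, ‖exp (y / 2) * f (X, y)‖ₑ ^ 2 =
          ENNReal.ofReal (∫ X in unitCube d, ‖exp (y / 2) * f (X, y)‖ ^ 2) := by
        rw [ofReal_integral_eq_lintegral_ofReal (h2.const_mul _).norm.integrable_sq
          (ae_of_all _ fun X => sq_nonneg _)]
        refine lintegral_congr fun X => ?_
        rw [ENNReal.ofReal_pow (norm_nonneg _), ofReal_norm]
      rw [h9]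
      refine ENNReal.ofReal_le_ofReal ?_
      have h10 : ∀ X, ‖exp (y / 2) * f (X, y)‖ ^ 2 = exp y * ‖(f (X, y) : ℂ)‖ ^ 2 := fun X => by
        rw [norm_mul, mul_pow, Real.norm_of_nonneg (Real.exp_nonneg _), ← Real.exp_nat_mul,
          Complex.norm_real]
        congr 2; push_cast; ring
      simp only [h10, integral_const_mul]
      refine (mul_le_mul_of_nonneg_left h8 (Real.exp_nonneg y)).trans (le_of_eq ?_)
      rw [← hK]
      have : exp y * exp (-y) = 1 := by rw [← Real.exp_add]; simp
      linear_combination (A ^ 2 * decayWeight (2 * n) 1 y * K) * this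
    have hm : AEMeasurable (fun z : LayerPt d => ‖exp (z.2 / 2) * f z‖ₑ ^ 2)
        (slabMeasure d volIoi 1) := hmeas.enorm.pow_const 2
    unfold slabMeasure at hm ⊢
    rw [lintegral_prod_symm _ hm]
    refine (lintegral_mono_ae hslice).trans_lt ?_
    have hcont : Continuous (decayWeight (2 * n) 1) := continuous_iff_continuousAt.mpr fun y =>
      (hasDerivAt_decayWeight _ 1 y).continuousAt
    have hint : IntegrableOn (fun y => (decayWeight (2 * n) 1 y : ℂ)) (Ioi 0) := by
      refine (isMeanWeight_decayWeight (2 * n)).integrableOn (fun T =>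
        (Complex.continuous_ofReal.comp hcont).integrableOn_Ioc) ?_
      filter_upwards [ae_restrict_mem measurableSet_Ioi] with y hy
      rw [Complex.norm_real, Real.norm_of_nonneg (decayWeight_pos _ _ (le_of_lt hy)).le]
    have hint' : Integrable (fun y => K * A ^ 2 * decayWeight (2 * n) 1 y)
        volIoi 1 := (hint.mono_set (Ioi_subset_Ioi zero_le_one)).re.const_mul _
    exact hint'.lintegral_lt_top
  have hlay : MemLp (fun z : LayerPt d => exp (z.2 / 2) * f z) 2 (layerMeasure H) := by
    have hS : MeasurableSet {z : LayerPt d | 1 < z.2} := measurableSet_lt measurable_const measurable_snd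
    have hm : AEStronglyMeasurable (fun z : LayerPt d => exp (z.2 / 2) * f z) (layerMeasure H) :=
      hexp.aestronglyMeasurable.mul hf.1
    rw [memLp_two_iff_lintegral hm, ← lintegral_add_compl _ hS, ENNReal.add_lt_top,
      ← memLp_two_iff_lintegral hm.restrict, ← memLp_two_iff_lintegral hm.restrict]
    refine ⟨?_, ?_⟩
    · refine hup.mono_measure ?_
      rw [slabMeasure_restrict, layerMeasure, Measure.restrict_restrict hS]
      exact Measure.restrict_mono (s := {z : LayerPt d | 1 < z.2} ∩ layerCell H)
        (s' := unitCube d ×ˢ Ioi 1) (fun z hz => ⟨hz.2.1, hz.1⟩) le_rfl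
    · refine (hf.restrict _).of_le_mul (c := exp (1 / 2))
        (hexp.aestronglyMeasurable.mul (hf.restrict _).1) ?_
      filter_upwards [ae_restrict_mem hS.compl] with z hz
      rw [norm_mul, Real.norm_of_nonneg (Real.exp_nonneg _)]
      have hz : z.2 ≤ 1 := not_lt.mp hz
      gcongr
  have hfin : MemLp (fun z : LayerPt d => exp ((z.2 + H z.1) / 2) * f z) 2 (layerMeasure H) := by
    refine hlay.of_le_mul (c := exp (M / 2)) (AEStronglyMeasurable.mul ?_ hf.1)
      (ae_of_all _ fun z => ?_)
    · exact (Real.continuous_exp.comp ((continuous_snd.add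
        (hH.comp continuous_fst)).div_const 2)).aestronglyMeasurable
    · rw [norm_mul, norm_mul, Real.norm_of_nonneg (Real.exp_nonneg _),
        Real.norm_of_nonneg (Real.exp_nonneg _), ← mul_assoc, ← Real.exp_add]
      gcongr
      linarith [Real.le_norm_self (H z.1), hM z.1]
  have := MemLp.flat hHm hfin
  simpa [FlatWeightedL2, layerShear] using this

end Forcing

/-! ### Rapidly converging Fourier series and their derivatives. -/

section Series

variable {d : ℕ}

/-- The character is `t ↦ e^{it}` after a linear form, and each derivative costs the norm of that
form. The factor `d` comes from bounding the coordinates one by one in the sup norm. -/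
theorem norm_iteratedFDeriv_torusChar_le (l : ℕ) (j : Fin d → ℤ) (X : Fin d → ℝ) :
    ‖iteratedFDeriv ℝ l (torusChar j) X‖ ≤ (2 * π * d * freqNorm j) ^ l := by
  set g : ℝ → ℂ := fun t => Complex.exp (t * Complex.I) with hg
  set L : (Fin d → ℝ) →L[ℝ] ℝ :=
    ∑ k, (2 * π * (j k : ℝ)) • ContinuousLinearMap.proj (R := ℝ) (φ := fun _ => ℝ) k with hL
  have hgs : ContDiff ℝ ∞ g :=
    Complex.contDiff_exp.comp (Complex.ofRealCLM.contDiff.mul contDiff_const)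
  have hcomp : torusChar j = g ∘ L := by
    ext X
    simp only [torusChar, hg, hL, Function.comp_apply, _root_.sum_apply,
      _root_.smul_apply, ContinuousLinearMap.proj_apply, smul_eq_mul, Finset.mul_sum,
      mul_assoc]
  have hit : ∀ l : ℕ, iteratedDeriv l g = fun t => Complex.I ^ l * g t := fun l => by
    induction l with
    | zero => simp
    | succ l ih =>
      rw [iteratedDeriv_succ, ih]
      ext t
      have h1 : HasDerivAt g (g t * Complex.I) t := by
        have := ((Complex.ofRealCLM.hasDerivAt (x := t)).mul_const Complex.I).cexp
        simpa [hg] using this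
      rw [(h1.const_mul _).deriv, pow_succ]
      ring
  have hLn : ‖L‖ ≤ 2 * π * d * freqNorm j := by
    refine ContinuousLinearMap.opNorm_le_bound _ (by have := freqNorm_nonneg j; positivity)
      fun X => ?_
    simp only [hL, _root_.sum_apply, _root_.smul_apply, ContinuousLinearMap.proj_apply, smul_eq_mul]
    calc _ ≤ ∑ _k : Fin d, 2 * π * freqNorm j * ‖X‖ := by
          refine (norm_sum_le _ _).trans (Finset.sum_le_sum fun k _ => ?_)
          rw [norm_mul, norm_mul, Real.norm_of_nonneg (by positivity), Real.norm_eq_abs]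
          gcongr
          · have := freqNorm_nonneg j; positivity
          · exact abs_le_freqNorm j k
          · exact norm_le_pi_norm X k
      _ = _ := by rw [Finset.sum_const, Finset.card_univ, Fintype.card_fin, nsmul_eq_mul]; ring
  rw [hcomp, L.iteratedFDeriv_comp_right hgs X (i := l) (by exact_mod_cast le_top)]
  refine (ContinuousMultilinearMap.norm_compContinuousLinearMap_le _ _).trans ?_
  have hn : ‖g (L X)‖ = 1 := Complex.norm_exp_ofReal_mul_I _
  rw [norm_iteratedFDeriv_eq_norm_iteratedDeriv, hit, norm_mul, norm_pow, Complex.norm_I, one_pow,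
    one_mul, hn, one_mul, Finset.prod_const, Finset.card_univ, Fintype.card_fin]
  gcongr

/-- The real part of a Fourier series. -/
noncomputable def charSeries (c : (Fin d → ℤ) → ℂ) (X : Fin d → ℝ) : ℝ :=
  (∑' j, c j * torusChar j X).re

variable {c : (Fin d → ℤ) → ℂ}

theorem summable_of_le_latticeWeight {l : ℕ} {C : ℝ}
    (h : ∀ j, j ≠ 0 → freqNorm j ^ l * ‖c j‖ ≤ C * latticeWeight j) :
    Summable fun j => (2 * π * d * freqNorm j) ^ l * ‖c j‖ := by
  refine Summable.of_norm_bounded_eventually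
    (summable_latticeWeight.mul_left ((2 * π * d) ^ l * C)) ?_
  have : ({0} : Set (Fin d → ℤ))ᶜ ∈ Filter.cofinite := (finite_singleton 0).compl_mem_cofinite
  filter_upwards [this] with j hj
  have h0 := freqNorm_nonneg j
  rw [Real.norm_of_nonneg (by positivity), mul_pow, mul_assoc (_ ^ l), mul_assoc (_ ^ l)]
  exact mul_le_mul_of_nonneg_left (h j hj) (by positivity)

theorem summable_norm_of_le_latticeWeight {C : ℝ}
    (h : ∀ j, j ≠ 0 → freqNorm j ^ 0 * ‖c j‖ ≤ C * latticeWeight j) : Summable fun j => ‖c j‖ := by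
  simpa using summable_of_le_latticeWeight h

theorem contDiff_charSeries_aux
    (h : ∀ l, ∃ C, ∀ j, j ≠ 0 → freqNorm j ^ l * ‖c j‖ ≤ C * latticeWeight j) :
    ContDiff ℝ ∞ (fun X => ∑' j, c j * torusChar j X) ∧ ∀ (l : ℕ) X,
      ‖iteratedFDeriv ℝ l (fun X => ∑' j, c j * torusChar j X) X‖ ≤
        ∑' j, (2 * π * d * freqNorm j) ^ l * ‖c j‖ := by
  have hs : ∀ l : ℕ, Summable fun j => (2 * π * d * freqNorm j) ^ l * ‖c j‖ := fun l =>
    (h l).elim fun C hC => summable_of_le_latticeWeight hC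
  have h1 : ∀ j, ContDiff ℝ ∞ fun X => c j * torusChar j X := fun j =>
    contDiff_const.mul (contDiff_torusChar j)
  have h2 : ∀ (l : ℕ) j X, ‖iteratedFDeriv ℝ l (fun X => c j * torusChar j X) X‖ ≤
      (2 * π * d * freqNorm j) ^ l * ‖c j‖ := fun l j X => by
    have := iteratedFDeriv_const_smul_apply (𝕜 := ℝ) (i := l) (a := c j) (x := X)
      (((contDiff_torusChar j).of_le (by exact_mod_cast le_top)).contDiffAt)
    rw [show (fun X => c j * torusChar j X) = c j • torusChar j from rfl, this, norm_smul, mul_comm]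
    gcongr
    exact norm_iteratedFDeriv_torusChar_le l j X
  refine ⟨contDiff_tsum (N := ⊤) h1 (fun l _ => hs l) fun l j X _ => h2 l j X, fun l X => ?_⟩
  rw [iteratedFDeriv_tsum (N := ⊤) h1 (fun l _ => hs l) (fun l j X _ => h2 l j X) (by exact le_top)]
  exact tsum_of_norm_bounded (hs l).hasSum fun j => h2 l j X

theorem contDiff_charSeries
    (h : ∀ l, ∃ C, ∀ j, j ≠ 0 → freqNorm j ^ l * ‖c j‖ ≤ C * latticeWeight j) :
    ContDiff ℝ ∞ (charSeries c) := Complex.reCLM.contDiff.comp (contDiff_charSeries_aux h).1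

theorem norm_iteratedFDeriv_charSeries_le
    (h : ∀ l, ∃ C, ∀ j, j ≠ 0 → freqNorm j ^ l * ‖c j‖ ≤ C * latticeWeight j) {l : ℕ} (hl : 1 ≤ l)
    {C : ℝ} (hC0 : 0 ≤ C) (hC : ∀ j, j ≠ 0 → freqNorm j ^ l * ‖c j‖ ≤ C * latticeWeight j)
    (X : Fin d → ℝ) : ‖iteratedFDeriv ℝ l (charSeries c) X‖ ≤
      (2 * π * d) ^ l * (∑' j : Fin d → ℤ, latticeWeight j) * C := by
  have h1 := Complex.reCLM.norm_iteratedFDeriv_comp_left (x := X) (n := l)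
    (contDiff_charSeries_aux h).1.contDiffAt (by exact_mod_cast le_top)
  rw [Complex.reCLM_norm, one_mul] at h1
  refine h1.trans (((contDiff_charSeries_aux h).2 l X).trans ?_)
  rw [mul_right_comm ((2 * π * d) ^ l), ← tsum_mul_left]
  refine (summable_of_le_latticeWeight hC).tsum_le_tsum (fun j => ?_)
    (summable_latticeWeight.mul_left _)
  by_cases hj : j = 0
  · rw [hj, freqNorm_eq_zero.mpr rfl, mul_zero, zero_pow (by omega), zero_mul]
    have := latticeWeight_pos (0 : Fin d → ℤ)
    positivity
  · rw [mul_pow, mul_assoc (_ ^ l), mul_assoc (_ ^ l)]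
    exact mul_le_mul_of_nonneg_left (hC j hj) (by positivity)

theorem abs_charSeries_sub_le {C : ℝ} (hC0 : 0 ≤ C)
    (hC : ∀ j, j ≠ 0 → freqNorm j ^ 0 * ‖c j‖ ≤ C * latticeWeight j) (X : Fin d → ℝ) :
    |charSeries c X - (c 0).re| ≤ (∑' j : Fin d → ℤ, latticeWeight j) * C := by
  have hs := summable_norm_of_le_latticeWeight hC
  have hs' : Summable fun j => c j * torusChar j X :=
    Summable.of_norm (by simpa [norm_torusChar] using hs)
  have h1 : HasSum (fun j => c j * torusChar j X - if j = 0 then c 0 else 0)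
      ((∑' j, c j * torusChar j X) - c 0) := hs'.hasSum.sub (hasSum_ite_eq 0 (c 0))
  have h2 : ‖(∑' j, c j * torusChar j X) - c 0‖ ≤ ∑' j : Fin d → ℤ, C * latticeWeight j := by
    rw [← h1.tsum_eq]
    refine tsum_of_norm_bounded (summable_latticeWeight.mul_left C).hasSum fun j => ?_
    split_ifs with hj
    · rw [hj, torusChar_zero, mul_one, sub_self, norm_zero]
      have := latticeWeight_pos (0 : Fin d → ℤ)
      positivity
    · rw [sub_zero, norm_mul, norm_torusChar, mul_one]
      simpa using hC j hj
  rw [tsum_mul_left, mul_comm] at h2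
  exact (Complex.abs_re_le_norm _).trans h2

/-- No symmetry of the coefficients is assumed, so the series is averaged with its conjugate and
only the real part of `c 0` survives. -/
theorem charCoeff_charSeries_zero (hc : Summable fun j => ‖c j‖) :
    charCoeff (fun X => (charSeries c X : ℂ)) 0 = ((c 0).re : ℂ) := by
  have hcont := continuous_tsum_torusChar hc
  have h1 := charCoeff_tsum hc 0
  have h2 : ∀ X, ((charSeries c X : ℝ) : ℂ) = (1 / 2) * ((∑' j, c j * torusChar j X) +
      conj (∑' j, c j * torusChar j X)) := fun X => by
    rw [Complex.add_conj, charSeries]; push_cast; ring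
  simp only [h2]
  rw [charCoeff_const_mul, charCoeff_add (integrable_unitCube_of_continuous hcont) (g := fun X => conj (∑' j, c j * _))
    (integrable_unitCube_of_continuous (Complex.continuous_conj.comp hcont)), charCoeff_conj, neg_zero,
    h1, Complex.add_conj]
  push_cast; ring

end Series

/-! ### Fields given by Fourier series with coefficients depending on `Y`. -/

section FieldSeries

variable {d n : ℕ} {S : Set ℝ}

/-- Decay of the oscillating Fourier modes, with arbitrarily many derivatives. -/
def ModeDecay (n : ℕ) (S : Set ℝ) (c : (Fin d → ℤ) → ℝ → ℂ) : Prop :=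
  ∀ l : ℕ, ∃ C, 0 ≤ C ∧ ∀ j, j ≠ 0 → ∀ Y ∈ S,
    freqNorm j ^ l * ‖c j Y‖ ≤ C * decayWeight n 1 Y * latticeWeight j

theorem ModeDecay.slice {c : (Fin d → ℤ) → ℝ → ℂ} (h : ModeDecay n S c) {Y : ℝ} (hY : Y ∈ S) (l : ℕ) :
    ∃ C, ∀ j, j ≠ 0 → freqNorm j ^ l * ‖c j Y‖ ≤ C * latticeWeight j :=
  (h l).elim fun _ hC => ⟨_, fun j hj => hC.2 j hj Y hY⟩

theorem toLp_eq_sum_single (f : Fin (d + 1) → ℝ) :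
    (WithLp.toLp 2 f : LayerVec d) = ∑ i, f i • EuclideanSpace.single i (1 : ℝ) := by
  ext k
  simp [Finset.sum_apply, Pi.single_apply]

theorem norm_iteratedFDeriv_toLp_le {f : Fin (d + 1) → (Fin d → ℝ) → ℝ}
    (hf : ∀ i, ContDiff ℝ ∞ (f i)) (l : ℕ) (X : Fin d → ℝ) :
    ‖iteratedFDeriv ℝ l (fun X => (WithLp.toLp 2 fun i => f i X : LayerVec d)) X‖ ≤
      ∑ i, ‖iteratedFDeriv ℝ l (f i) X‖ := by
  have h1 : ∀ i, ContDiff ℝ ∞ fun X => f i X • (EuclideanSpace.single i (1 : ℝ) : LayerVec d) :=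
    fun i => (hf i).smul contDiff_const
  simp only [toLp_eq_sum_single]
  rw [iteratedFDeriv_fun_sum_apply fun i _ => ((h1 i).of_le (by exact_mod_cast le_top)).contDiffAt]
  refine (norm_sum_le _ _).trans (Finset.sum_le_sum fun i _ => ?_)
  have h2 := (ContinuousLinearMap.toSpanSingleton ℝ
    (EuclideanSpace.single i (1 : ℝ) : LayerVec d)).norm_iteratedFDeriv_comp_left (x := X) (n := l)
    (hf i).contDiffAt (by exact_mod_cast le_top)
  simpa [Function.comp_def] using h2

theorem layerDecay_of_modes {c : Fin (d + 1) → (Fin d → ℤ) → ℝ → ℂ} {e : (Fin d → ℤ) → ℝ → ℂ}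
    {U : LayerPt d → LayerVec d} {P : LayerPt d → ℝ} {Uinf : LayerVec d} (hS : S ⊆ Ioi 0)
    (hU : ∀ X, ∀ Y ∈ S, U (X, Y) = WithLp.toLp 2 fun i => charSeries (fun j => c i j Y) X)
    (hP : ∀ X, ∀ Y ∈ S, P (X, Y) = charSeries (fun j => e j Y) X)
    (hc : ∀ i, ModeDecay n S (c i)) (he : ModeDecay n S e) {K : ℝ}
    (hc0 : ∀ Y ∈ S, ∀ i, |(c i 0 Y).re - Uinf i| ≤ K * decayWeight n 1 Y)
    (he0 : ∀ Y ∈ S, |(e 0 Y).re| ≤ K * decayWeight n 1 Y) : LayerDecay U P Uinf S := by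
  have hψ : ∀ Y ∈ S, 0 < decayWeight n 1 Y := fun Y hY => decayWeight_pos n 1 (hS hY).le
  set W := ∑' j : Fin d → ℤ, latticeWeight j
  constructor
  · choose C hC0 hC using fun i => hc i 0
    obtain ⟨C', hC0', hC'⟩ := he 0
    obtain ⟨q, hq⟩ := exists_poly_eval n (∑ i, (W * C i + K) + (W * C' + K))
    refine ⟨q, fun X Y hY => ?_⟩
    have h1 : ∀ i, |charSeries (fun j => c i j Y) X - Uinf i| ≤ (W * C i + K) * decayWeight n 1 Y :=
      fun i => by
        have := abs_charSeries_sub_le (c := fun j => c i j Y)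
          (mul_nonneg (hC0 i) (hψ Y hY).le) (fun j hj => hC i j hj Y hY) X
        linarith [hc0 Y hY i, abs_sub_le (charSeries (fun j => c i j Y) X) (c i 0 Y).re (Uinf i)]
    have h2 : |charSeries (fun j => e j Y) X| ≤ (W * C' + K) * decayWeight n 1 Y := by
      have := abs_charSeries_sub_le (c := fun j => e j Y)
        (mul_nonneg hC0' (hψ Y hY).le) (fun j hj => hC' j hj Y hY) X
      have h3 := abs_sub_abs_le_abs_sub (charSeries (fun j => e j Y) X) (e 0 Y).re
      linarith [he0 Y hY]
    rw [hq, hU X Y hY, hP X Y hY, add_mul, Finset.sum_mul]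
    refine add_le_add ?_ h2
    have h4 : (WithLp.toLp 2 fun i => charSeries (fun j => c i j Y) X) - Uinf =
        ∑ i, (charSeries (fun j => c i j Y) X - Uinf i) • EuclideanSpace.single i (1 : ℝ) := by
      rw [← toLp_eq_sum_single]; ext i; simp
    rw [h4]
    refine (norm_sum_le _ _).trans (Finset.sum_le_sum fun i _ => ?_)
    rw [norm_smul]
    simpa using h1 i
  · intro l hl
    choose C hC0 hC using fun i => hc i l
    obtain ⟨C', hC0', hC'⟩ := he l
    set B := (2 * π * d) ^ l * W
    obtain ⟨q, hq⟩ := exists_poly_eval n (∑ i, B * C i + B * C')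
    refine ⟨q, fun X Y hY => ?_⟩
    rw [hq, funext fun X => hU X Y hY, funext fun X => hP X Y hY, add_mul, Finset.sum_mul]
    refine add_le_add ((norm_iteratedFDeriv_toLp_le (fun i => contDiff_charSeries
      fun l => (hc i).slice hY l) l X).trans (Finset.sum_le_sum fun i _ => ?_)) ?_
    · rw [mul_assoc]
      exact norm_iteratedFDeriv_charSeries_le (fun l => (hc i).slice hY l) hl
        (mul_nonneg (hC0 i) (hψ Y hY).le) (fun j hj => hC i j hj Y hY) X
    · rw [mul_assoc]
      exact norm_iteratedFDeriv_charSeries_le (fun l => he.slice hY l) hl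
        (mul_nonneg hC0' (hψ Y hY).le) (fun j hj => hC' j hj Y hY) X

variable {c : (Fin d → ℤ) → ℝ → ℂ}

/-- Near a point at height `z.2` the series converges uniformly, because the coefficients have a
summable bound on heights above `z.2 / 2`. -/
theorem continuousOn_series (hcont : ∀ j, ContinuousOn (c j) (Ioi 0))
    (hb : ∀ δ > 0, ∃ C, ∀ j, ∀ Y, δ ≤ Y → ‖c j Y‖ ≤ C * latticeWeight j) :
    ContinuousOn (fun z : LayerPt d => ∑' j, c j z.2 * torusChar j z.1) {z | 0 < z.2} := by
  intro z hz
  have hz : 0 < z.2 := hz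
  obtain ⟨C, hC⟩ := hb (z.2 / 2) (by positivity)
  have h1 : ContinuousOn (fun z : LayerPt d => ∑' j, c j z.2 * torusChar j z.1)
      {w | z.2 / 2 < w.2} := by
    refine continuousOn_tsum (fun j => ?_) (summable_latticeWeight.mul_left C) fun j w hw => ?_
    · exact ((hcont j).comp continuousOn_snd fun w hw => (half_pos hz).trans hw).mul
        ((continuous_torusChar j).comp continuous_fst).continuousOn
    · rw [norm_mul, norm_torusChar, mul_one]
      exact hC j w.2 (le_of_lt hw)
  exact (h1.continuousAt ((isOpen_lt continuous_const continuous_snd).mem_nhds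
    (half_lt_self hz))).continuousWithinAt

/-- On each slab `1/(m+1) < Y ≤ m` the series is bounded, hence in `L²`, and has the same modes as
`f`. Countably many such slabs cover `Y > 0`. -/
theorem ae_eq_charSeries {f : LayerPt d → ℝ} (hf : SlabL2 0 fun z => (f z : ℂ))
    (hfc : ∀ j, rMode f j =ᵐ[volIoi 0] c j)
    (hcont : ∀ j, ContinuousOn (c j) (Ioi 0))
    (hb : ∀ δ > 0, ∃ C, ∀ j, ∀ Y, δ ≤ Y → ‖c j Y‖ ≤ C * latticeWeight j) :
    ∀ᵐ z ∂(slabMeasure d volIoi 0), f z = charSeries (fun j => c j z.2) z.1 := by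
  have key : ∀ m : ℕ, ∀ᵐ z ∂(slabMeasure d (volume.restrict (Ioc ((m : ℝ) + 1)⁻¹ m))),
      f z = charSeries (fun j => c j z.2) z.1 := fun m => by
    set δ : ℝ := ((m : ℝ) + 1)⁻¹
    have hδ : 0 < δ := by positivity
    obtain ⟨C, hC⟩ := hb δ hδ
    have hsub : Ioc δ m ⊆ Ioi 0 := fun y hy => hδ.trans hy.1
    set g : LayerPt d → ℂ := fun z => ∑' j, c j z.2 * torusChar j z.1
    have hfm : MemLp (fun z => (f z : ℂ)) 2 (slabMeasure d (volume.restrict (Ioc δ m))) :=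
      (hf m).mono_measure (slabMeasure_mono (Ioc_subset_Ioc_left hδ.le))
    have hgm : MemLp g 2 (slabMeasure d (volume.restrict (Ioc δ m))) := by
      have hms : MeasurableSet (unitCube d ×ˢ Ioc δ (m : ℝ)) :=
        measurableSet_unitCube.prod measurableSet_Ioc
      have hfin : IsFiniteMeasure (slabMeasure d (volume.restrict (Ioc δ (m : ℝ)))) :=
        inferInstanceAs (IsFiniteMeasure ((volume.restrict (unitCube d)).prod _))
      refine MemLp.of_bound (C := C * ∑' j : Fin d → ℤ, latticeWeight j) ?_ ?_
      · rw [slabMeasure_restrict]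
        exact ((continuousOn_series hcont hb).mono fun z hz =>
          hsub hz.2).aestronglyMeasurable hms
      · rw [slabMeasure_restrict]
        filter_upwards [ae_restrict_mem hms] with z hz
        rw [← tsum_mul_left]
        refine tsum_of_norm_bounded (summable_latticeWeight.mul_left C).hasSum fun j => ?_
        rw [norm_mul, norm_torusChar, mul_one]
        exact hC j z.2 hz.2.1.le
    have h1 := ae_eq_zero_of_cMode (hfm.add (hgm.const_mul (-1))) fun j => by
      filter_upwards [cMode_add hfm (hgm.const_mul (-1)) j, ae_mono (Measure.restrict_mono hsub le_rfl)
        (hfc j), ae_restrict_mem measurableSet_Ioc] with y h2 h3 h4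
      have h5 : cMode g j y = c j y := charCoeff_tsum (c := fun j => c j y)
        (Summable.of_nonneg_of_le (fun _ => norm_nonneg _) (fun j => hC j y h4.1.le)
          (summable_latticeWeight.mul_left C)) j
      refine h2.trans ?_
      rw [cMode_const_mul, h5, ← h3]
      simp
    filter_upwards [h1] with z hz
    have h2 : (f z : ℂ) = g z := by
      have : (f z : ℂ) + -1 * g z = 0 := hz
      linear_combination this
    rw [charSeries, ← Complex.ofReal_re (f z), h2]
  have hU : (unitCube d ×ˢ Ioi (0 : ℝ)) ⊆ ⋃ m : ℕ, unitCube d ×ˢ Ioc ((m : ℝ) + 1)⁻¹ (m : ℝ) := by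
    rintro z ⟨h1, h2⟩
    have h2 : 0 < z.2 := h2
    obtain ⟨m, hm⟩ := exists_nat_gt (max z.2 z.2⁻¹)
    refine mem_iUnion.mpr ⟨m, h1, ?_, ((le_max_left _ _).trans hm.le)⟩
    rw [inv_lt_comm₀ (by positivity) h2]
    linarith [le_max_right z.2 z.2⁻¹]
  simp only [slabMeasure_restrict] at key ⊢
  exact ae_mono (Measure.restrict_mono hU le_rfl) ((ae_restrict_iUnion_iff _ _).mpr key)

end FieldSeries

/-! ### Rapid decay of the modes of the solution above a positive height. -/

section StokesModeDecay

variable {d n : ℕ} {H : (Fin d → ℝ) → ℝ} {ν A : ℝ} {F U : LayerPt d → LayerVec d}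
  {D : (Fin d → ℝ) → LayerVec d} {G : Fin (d + 1) → LayerPt d → LayerVec d} {P : LayerPt d → ℝ}

/-- A representative of the mean values of a solution: the velocity `v` is differentiable and the
pressure `q` is a primitive of the vertical force `f`. -/
def IsMeanRep (ν : ℝ) (Ψ : ℝ → ℝ) (f : ℝ → ℂ) (v : Fin (d + 1) → ℝ → ℂ) (q : ℝ → ℂ) : Prop :=
  ∃ (z : Fin (d + 1) → ℝ → ℂ) (L : Fin (d + 1) → ℂ) (C : ℂ),
    (q = fun y => C + ∫ s in Ioc 0 y, f s) ∧ ∀ y, 0 < y →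
      (∀ l, HasDerivAt (v l) (z l y) y ∧ ‖z l y‖ ≤ 2 * (ν⁻¹ * Ψ y) ∧
        ‖v l y - L l‖ ≤ 4 * (ν⁻¹ * Ψ y)) ∧ ‖q y‖ ≤ 2 * Ψ y

/-- Continuous representatives of the Fourier modes of `(U, P)` on the half line `Y > 0`. -/
structure IsModeRep (ν : ℝ) (Ψ : ℝ → ℝ) (F U : LayerPt d → LayerVec d) (P : LayerPt d → ℝ)
    (c : Fin (d + 1) → (Fin d → ℤ) → ℝ → ℂ) (e : (Fin d → ℤ) → ℝ → ℂ) : Prop where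
  velocity : ∀ l j, rMode (fun z => U z l) j =ᵐ[volIoi 0] c l j
  pressure : ∀ j, rMode P j =ᵐ[volIoi 0] e j
  contVelocity : ∀ l j, ContinuousOn (c l j) (Ioi 0)
  contPressure : ∀ j, ContinuousOn (e j) (Ioi 0)
  mean : IsMeanRep ν Ψ (rMode (fun z => F z (Fin.last d)) 0) (fun l => c l 0) (e 0)

theorem WeakDerivOn.exists_continuousOn {a : ℝ} {u f : ℝ → ℂ} (h : WeakDerivOn a u f)
    (hu : ∀ T, IntegrableOn u (Ioc a T)) (hf : ∀ T, IntegrableOn f (Ioc a T)) :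
    ∃ v, u =ᵐ[volIoi a] v ∧ ContinuousOn v (Ioi a) := by
  obtain ⟨C, hC⟩ := h.exists_eq_primitive hu hf
  exact ⟨_, hC, (continuousOn_const.add (continuousOn_primitive_Ioc hf)).mono Ioi_subset_Ici_self⟩

theorem IsStokesComponents.exists_isModeRep (hH : ContDiff ℝ ∞ H) (hHper : TorusPeriodic H)
    (hF : MemLp F 2 (layerMeasure H)) (h : IsStokesComponents H ν F D U G P)
    (ha : ∀ X, -H X ≤ 0) (hν : 0 < ν) {Ψ : ℝ → ℝ} (hΨ : IsMeanWeight Ψ)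
    (hF0 : ∀ l, ∀ᵐ y ∂volIoi 0, ‖rMode (fun z => F z l) 0 y‖ ≤ Ψ y) :
    ∃ c e, IsModeRep ν Ψ F U P c e := by
  have key : ∀ j, ∃ (c : Fin (d + 1) → ℝ → ℂ) (e : ℝ → ℂ),
      (∀ l, rMode (fun z => U z l) j =ᵐ[volIoi 0] c l) ∧
      rMode P j =ᵐ[volIoi 0] e ∧ (∀ l, ContinuousOn (c l) (Ioi 0)) ∧ ContinuousOn e (Ioi 0) ∧
      (j = 0 → IsMeanRep ν Ψ (rMode (fun z => F z (Fin.last d)) 0) c e) := fun j => by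
    have hm := h.modes hH hHper hF ha j
    -- The mean needs the explicit representative of `zero_mode`, whose derivative is known; for the
    -- other frequencies continuity is enough.
    by_cases hj : j = 0
    · subst hj
      obtain ⟨v, z, L, C, h1, h2, h3⟩ := hm.zero_mode hν hΨ hF0
      exact ⟨v, _, h1, h2, fun l y hy => (((h3 y hy).1 l).1).continuousAt.continuousWithinAt,
        (continuousOn_const.add (continuousOn_primitive_Ioc (hm.locF _))).mono
          Ioi_subset_Ici_self, fun _ => ⟨z, L, C, rfl, h3⟩⟩
    · choose c hc1 hc2 using fun l =>
        (hm.normal l).exists_continuousOn (hm.locU l) (hm.locG _ _)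
      have hs : ∀ T, IntegrableOn (fun y => pressureSlope ν j (fun l => rMode (fun z => U z l) j)
          (fun k l => rMode (fun z => G k z l) j) y + rMode (fun z => F z (Fin.last d)) j y)
          (Ioc 0 T) := fun T => by
        exact IntegrableOn.add (((hm.locU _ T).const_mul _).add
          (integrable_finsetSum _ fun k _ => (hm.locG _ _ T).const_mul _) |>.const_mul _)
          (hm.locF _ T)
      obtain ⟨e, he1, he2⟩ := hm.pressure.exists_continuousOn hm.locP hs
      exact ⟨c, e, hc1, he1, hc2, he2, fun h => absurd h hj⟩
  choose c e h1 h2 h3 h4 h5 using key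
  exact ⟨fun l j => c j l, e, fun l j => h1 j l, h2, fun l j => h3 j l, h4, h5 0 rfl⟩

/-- The bound of `IsStokesModes.ae_le` with constants independent of `j` and the weight left free.
Continuity of the representatives makes it hold at every height, and `2π|j| - 1/2 ≥ 2|j|` simplifies
the rate. -/
theorem IsStokesComponents.exists_mode_bound (hH : ContDiff ℝ ∞ H) (hHper : TorusPeriodic H)
    (hF : MemLp F 2 (layerMeasure H)) (h : IsStokesComponents H ν F D U G P) {a b : ℝ}
    (ha : ∀ X, -H X ≤ a) (hab : a < b) (hν : 0 < ν) (hν1 : ν ≤ 1) {Φ : ℝ → ℝ}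
    {c : Fin (d + 1) → (Fin d → ℤ) → ℝ → ℂ} {e : (Fin d → ℤ) → ℝ → ℂ}
    (hr : IsModeRep ν Φ F U P c e) :
    ∃ C M : ℝ, 0 ≤ C ∧ 0 ≤ M ∧ ∀ j, j ≠ 0 → ∀ Ψ, IsDecayWeight (2 * π * freqNorm j) a Ψ →
      (∀ l, ∀ᵐ y ∂volIoi a, ‖rMode (fun z => F z l) j y‖ ≤ Ψ y) →
      ∀ l Y, 0 < Y → b < Y → ‖e j Y‖ + ‖c l j Y‖ ≤
        C * freqNorm j ^ 2 * (Ψ Y + M * exp (-(freqNorm j * (2 * (Y - b))))) := by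
  obtain ⟨M, hM0, hM⟩ := h.exists_bound_modes ha b
  have hC : 0 ≤ ν⁻¹ * (25 * ((d : ℝ) + 1) + 12 / (b - a)) :=
    mul_nonneg (inv_nonneg.mpr hν.le) (add_nonneg (by positivity)
      (div_nonneg (by norm_num) (sub_nonneg.mpr hab.le)))
  refine ⟨ν⁻¹ * (25 * (d + 1) + 12 / (b - a)) * (2 * π) ^ 2, M, by positivity, hM0,
    fun j hj Ψ hΨ hFj l Y hY hbY => ?_⟩
  have h1 := (h.modes hH hHper hF ha j).ae_le hj hν hν1 rfl hab hΨ hFj (hM j)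
  set w := 2 * π * freqNorm j with hw
  have hsub : Ioi (max b 0) ⊆ Ioi 0 := Ioi_subset_Ioi (le_max_right _ _)
  have h2 := le_of_ae_le_of_continuousOn (a := max b 0)
    (((hr.contPressure j).mono hsub).norm.add ((hr.contVelocity l j).mono hsub).norm)
    (g := fun y => ν⁻¹ * (25 * (d + 1) + 12 / (b - a)) * w ^ 2 *
      (Ψ y + M * exp (-((w - 1 / 2) * (y - b)))))
    (continuousOn_const.mul (ContinuousOn.add (fun y hy => (hΨ.diff y
      (hab.trans ((le_max_left b 0).trans_lt hy))).continuousAt.continuousWithinAt) (by fun_prop)))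
    (by
      filter_upwards [ae_restrict_Ioi_mono (le_max_left b 0) h1,
        ae_restrict_Ioi_mono (le_max_right b 0) (hr.pressure j),
        ae_restrict_Ioi_mono (le_max_right b 0) (hr.velocity l j)] with y h1 h2 h3
      change ‖e j y‖ + ‖c l j y‖ ≤ _
      rw [← h2, ← h3]
      exact h1 l) Y (max_lt hbY hY)
  refine h2.trans ?_
  rw [hw, mul_pow, ← mul_assoc]
  have h3 : freqNorm j * (2 * (Y - b)) ≤ (2 * π * freqNorm j - 1 / 2) * (Y - b) := by
    have : 2 * freqNorm j ≤ 2 * π * freqNorm j - 1 / 2 := by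
      nlinarith [one_le_freqNorm hj, Real.pi_gt_three]
    nlinarith [mul_le_mul_of_nonneg_right this (sub_nonneg.mpr hbY.le)]
  gcongr

theorem exists_le_of_add_le {S : Set ℝ} {c : Fin (d + 1) → (Fin d → ℤ) → ℝ → ℂ}
    {e : (Fin d → ℤ) → ℝ → ℂ} (B : ℝ → (Fin d → ℤ) → ℝ → ℝ)
    (h : ∀ m : ℕ, ∃ K, 0 ≤ K ∧ ∀ j, j ≠ 0 → ∀ Y ∈ S, ∀ l,
      freqNorm j ^ m * (‖e j Y‖ + ‖c l j Y‖) ≤ B K j Y) :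
    (∀ l, ∀ m : ℕ, ∃ K, 0 ≤ K ∧ ∀ j, j ≠ 0 → ∀ Y ∈ S, freqNorm j ^ m * ‖c l j Y‖ ≤ B K j Y) ∧
      ∀ m : ℕ, ∃ K, 0 ≤ K ∧ ∀ j, j ≠ 0 → ∀ Y ∈ S, freqNorm j ^ m * ‖e j Y‖ ≤ B K j Y := by
  have hp (j : Fin d → ℤ) (m : ℕ) := pow_nonneg (freqNorm_nonneg j) m
  exact ⟨fun l m => (h m).imp fun K hK => ⟨hK.1, fun j hj Y hY => (mul_le_mul_of_nonneg_left
      (le_add_of_nonneg_left (norm_nonneg _)) (hp j m)).trans (hK.2 j hj Y hY l)⟩,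
    fun m => (h m).imp fun K hK => ⟨hK.1, fun j hj Y hY => (mul_le_mul_of_nonneg_left
      (le_add_of_nonneg_right (norm_nonneg _)) (hp j m)).trans (hK.2 j hj Y hY 0)⟩⟩

/-- The strip `(0, δ/2)` is used. For `Y ≥ δ` one has `2 (Y - δ/2) ≥ Y`, so the strip contributes at
most `e^{-|j|Y}`, like the force. Then `(|j| - 1)(Y - δ) ≥ 0` splits off `e^{-Y}` and leaves
`e^{-δ|j|}` to absorb all powers of `|j|`. -/
theorem IsStokesComponents.modeDecay_Ici (hH : ContDiff ℝ ∞ H) (hHper : TorusPeriodic H)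
    (hF : MemLp F 2 (layerMeasure H)) (h : IsStokesComponents H ν F D U G P)
    (ha : ∀ X, -H X ≤ 0) (hν : 0 < ν) (hν1 : ν ≤ 1) {Φ : ℝ → ℝ}
    {c : Fin (d + 1) → (Fin d → ℤ) → ℝ → ℂ} {e : (Fin d → ℤ) → ℝ → ℂ}
    (hr : IsModeRep ν Φ F U P c e) (hA : 0 ≤ A)
    (hFj : ∀ l j, ∀ᵐ y ∂volIoi 0,
      ‖rMode (fun z => F z l) j y‖ ≤ A * decayWeight n (max (freqNorm j) 1) y)
    {δ : ℝ} (hδ : 0 < δ) : (∀ l, ModeDecay n (Ici δ) (c l)) ∧ ModeDecay n (Ici δ) e := by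
  obtain ⟨C, M, hC, hM, hb⟩ := h.exists_mode_bound hH hHper hF ha (half_pos hδ) hν hν1 hr
  have key : ∀ m : ℕ, ∃ B, 0 ≤ B ∧ ∀ j, j ≠ 0 → ∀ Y ∈ Ici δ, ∀ l,
      freqNorm j ^ m * (‖e j Y‖ + ‖c l j Y‖) ≤ B * decayWeight n 1 Y * latticeWeight j :=
    fun m => by
    obtain ⟨B, hB0, hB⟩ := exists_exp_le_latticeWeight (d := d) (m + 2) hδ
    refine ⟨C * (A + M) * exp δ * B, by positivity, fun j hj Y hY l => ?_⟩
    have hY : δ ≤ Y := hY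
    have hj1 := one_le_freqNorm hj
    have h1 := hb j hj (fun y => A * decayWeight n (freqNorm j) y)
      ((isDecayWeight_decayWeight n (by nlinarith [Real.pi_gt_three])
        (by nlinarith [Real.pi_gt_three])).const_mul hA)
      (fun l => by simpa only [max_eq_left hj1] using hFj l j) l Y (hδ.trans_le hY) (by linarith)
    have hY0 : 0 ≤ Y := hδ.le.trans hY
    have h2 : decayWeight n (freqNorm j) Y ≤
        decayWeight n 1 Y * (exp δ * exp (-(δ * freqNorm j))) := by
      rw [decayWeight, decayWeight, mul_assoc, ← Real.exp_add, ← Real.exp_add]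
      gcongr
      nlinarith
    have h3 : exp (-(freqNorm j * (2 * (Y - δ / 2)))) ≤ decayWeight n (freqNorm j) Y := by
      refine le_trans ?_ (le_mul_of_one_le_left (Real.exp_nonneg _) (one_le_pow₀ (by linarith)))
      gcongr
      nlinarith
    calc freqNorm j ^ m * (‖e j Y‖ + ‖c l j Y‖)
        ≤ freqNorm j ^ m * (C * freqNorm j ^ 2 * (A * decayWeight n (freqNorm j) Y +
          M * decayWeight n (freqNorm j) Y)) := by
          have := freqNorm_nonneg j
          refine mul_le_mul_of_nonneg_left (h1.trans ?_) (by positivity)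
          gcongr
      _ = C * (A + M) * freqNorm j ^ (m + 2) * decayWeight n (freqNorm j) Y := by ring
      _ ≤ C * (A + M) * freqNorm j ^ (m + 2) *
          (decayWeight n 1 Y * (exp δ * exp (-(δ * freqNorm j)))) := by
          have := freqNorm_nonneg j
          gcongr
      _ = C * (A + M) * exp δ * decayWeight n 1 Y *
          (freqNorm j ^ (m + 2) * exp (-(δ * freqNorm j))) := by ring
      _ ≤ C * (A + M) * exp δ * decayWeight n 1 Y * (B * latticeWeight j) := by
          have := decayWeight_pos n 1 hY0
          have := hB j hj
          gcongr
      _ = _ := by ring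
  exact exists_le_of_add_le (fun B j Y => B * decayWeight n 1 Y * latticeWeight j) key

end StokesModeDecay

/-! ### The representative of the solution built from its modes. -/

section ModeFields

variable {d n : ℕ} {c : (Fin d → ℤ) → ℝ → ℂ} {f : LayerPt d → ℝ}

theorem ModeDecay.exists_le_latticeWeight (h : ∀ δ > 0, ModeDecay n (Ici δ) c) {K : ℝ}
    (h0 : ∀ Y, 0 < Y → ‖c 0 Y‖ ≤ K) {δ : ℝ} (hδ : 0 < δ) :
    ∃ C, ∀ j, ∀ Y, δ ≤ Y → ‖c j Y‖ ≤ C * latticeWeight j := by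
  obtain ⟨C, hC0, hC⟩ := h δ hδ 0
  have hw := latticeWeight_pos (0 : Fin d → ℤ)
  refine ⟨max (C * decayWeight n 1 0) (K / latticeWeight (0 : Fin d → ℤ)), fun j Y hY => ?_⟩
  by_cases hj : j = 0
  · subst hj
    calc ‖c 0 Y‖ ≤ K := h0 Y (hδ.trans_le hY)
      _ = K / latticeWeight (0 : Fin d → ℤ) * latticeWeight 0 := by field_simp
      _ ≤ _ := mul_le_mul_of_nonneg_right (le_max_right _ _) hw.le
  · have h1 := hC j hj Y hY
    rw [pow_zero, one_mul] at h1
    refine h1.trans (mul_le_mul_of_nonneg_right (le_trans ?_ (le_max_left _ _))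
      (latticeWeight_pos j).le)
    exact mul_le_mul_of_nonneg_left (decayWeight_le_zero n (hδ.le.trans hY)) hC0

/-- The field with modes `c` for `Y > 0`, and the periodic extension of `f` below. -/
noncomputable def modeField (f : LayerPt d → ℝ) (c : (Fin d → ℤ) → ℝ → ℂ) (z : LayerPt d) : ℝ :=
  open Classical in
  if 0 < z.2 then charSeries (fun j => c j z.2) z.1 else f (fun k => Int.fract (z.1 k), z.2)

theorem modeField_of_pos (f : LayerPt d → ℝ) (c : (Fin d → ℤ) → ℝ → ℂ) (X : Fin d → ℝ) {Y : ℝ}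
    (hY : 0 < Y) : modeField f c (X, Y) = charSeries (fun j => c j Y) X := if_pos hY

theorem layerPeriodic_modeField (f : LayerPt d → ℝ) (c : (Fin d → ℤ) → ℝ → ℂ) :
    LayerPeriodic (modeField f c) := fun Y j X => by
  simp only [modeField, charSeries, Int.fract_add_intCast]
  congr! 4
  exact congrArg _ (torusChar_periodic _ j X)

theorem continuousOn_modeField (hcont : ∀ j, ContinuousOn (c j) (Ioi 0))
    (hb : ∀ δ > 0, ∃ C, ∀ j, ∀ Y, δ ≤ Y → ‖c j Y‖ ≤ C * latticeWeight j) :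
    ContinuousOn (modeField f c) {z | 0 < z.2} :=
  (Complex.continuous_re.comp_continuousOn (continuousOn_series hcont hb)).congr
    fun z hz => modeField_of_pos f c z.1 hz

/-- For `Y > 0` this is the series identity; below, taking fractional parts changes nothing on the
unit cube. -/
theorem modeField_ae_eq {H : (Fin d → ℝ) → ℝ} (hH : Continuous H) (ha : ∀ X, -H X ≤ 0)
    (hf : LayerLocL2 H f) (hfc : ∀ j, rMode f j =ᵐ[volIoi 0] c j)
    (hcont : ∀ j, ContinuousOn (c j) (Ioi 0))
    (hb : ∀ δ > 0, ∃ C, ∀ j, ∀ Y, δ ≤ Y → ‖c j Y‖ ≤ C * latticeWeight j) :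
    f =ᵐ[layerMeasure H] modeField f c := by
  have h1 := ae_eq_charSeries (hf.slabL2_of_le ha) hfc hcont hb
  rw [slabMeasure_restrict, ae_restrict_iff' (measurableSet_unitCube.prod measurableSet_Ioi)] at h1
  rw [Filter.EventuallyEq, layerMeasure, ae_restrict_iff' (measurableSet_layerCell hH.measurable)]
  filter_upwards [h1] with z h1 hz
  rw [modeField]
  split_ifs with h
  · exact h1 ⟨hz.1, h⟩
  · congr 1
    exact Prod.ext (funext fun k => (Int.fract_eq_self.mpr (hz.1 k (mem_univ k))).symm) rfl

theorem torusCoeff_modeField_zero {Y : ℝ} (hY : 0 < Y) (hc : Summable fun j => ‖c j Y‖) :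
    torusCoeff (fun X => modeField f c (X, Y)) 0 = ((c 0 Y).re : ℂ) := by
  simp only [torusCoeff_eq_charCoeff, modeField_of_pos f c _ hY]
  exact charCoeff_charSeries_zero (c := fun j => c j Y) hc

theorem norm_toLp_le_sum {𝕜 : Type*} [RCLike 𝕜] {m : ℕ} (v : Fin m → 𝕜) :
    ‖(WithLp.toLp 2 v : EuclideanSpace 𝕜 (Fin m))‖ ≤ ∑ i, ‖v i‖ := by
  rw [EuclideanSpace.norm_eq]
  exact Real.sqrt_le_iff.mpr ⟨Finset.sum_nonneg fun i _ => norm_nonneg _,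
    Finset.sum_sq_le_sq_sum_of_nonneg fun i _ => norm_nonneg _⟩

theorem hasDerivAt_toLp {m : ℕ} {v : ℝ → Fin m → ℂ} {v' : Fin m → ℂ} {y : ℝ}
    (h : ∀ i, HasDerivAt (fun y => v y i) (v' i) y) :
    HasDerivAt (fun y => (WithLp.toLp 2 (v y) : EuclideanSpace ℂ (Fin m))) (WithLp.toLp 2 v') y :=
  ((PiLp.hasFDerivAt_toLp (𝕜 := ℝ) 2 (v y)).comp_hasDerivAt y (hasDerivAt_pi.mpr h) :)

end ModeFields

/-! ### Changing the solution on null sets. -/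

section Congr

variable {d : ℕ} {H : (Fin d → ℝ) → ℝ} {ν : ℝ} {F U V : LayerPt d → LayerVec d}
  {D : (Fin d → ℝ) → LayerVec d} {G : Fin (d + 1) → LayerPt d → LayerVec d} {P R : LayerPt d → ℝ}

theorem IsTracePair.congr {v w : LayerPt d → ℝ} {g : Fin (d + 1) → LayerPt d → ℝ}
    {D : (Fin d → ℝ) → ℝ} (h : IsTracePair H v g D) (hvw : v =ᵐ[layerMeasure H] w) :
    IsTracePair H w g D := by
  refine ⟨fun R => (h.locL2 R).ae_eq (ae_restrict_of_ae hvw), h.memLp, fun φ hφ i => ?_⟩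
  rw [← h.green φ hφ i]
  refine integral_congr_ae ?_
  filter_upwards [hvw] with z hz
  rw [hz]

theorem IsStokesComponents.congr (h : IsStokesComponents H ν F D U G P)
    (hU : ∀ l, (fun z => U z l) =ᵐ[layerMeasure H] fun z => V z l) (hP : P =ᵐ[layerMeasure H] R) :
    IsStokesComponents H ν F D V G R := by
  refine ⟨fun l => (h.pair l).congr (hU l), h.memLp.ae_eq hP, h.div, fun φ hφ i => ?_⟩
  rw [← h.eq φ hφ i]
  congr 1
  refine integral_congr_ae ?_
  filter_upwards [hP] with z hz
  rw [hz]

end Congr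

/-! ### Smooth force: decay of the modes down to `Y = 0`. -/

section SmoothForce

variable {d n : ℕ} {H : (Fin d → ℝ) → ℝ} {ν A : ℝ} {F U : LayerPt d → LayerVec d}
  {D : (Fin d → ℝ) → LayerVec d} {G : Fin (d + 1) → LayerPt d → LayerVec d} {P : LayerPt d → ℝ}

/-- Integration by parts on the torus, for Fourier coefficients. -/
theorem charCoeff_fderiv {g : (Fin d → ℝ) → ℝ} (hg : ContDiff ℝ 1 g) (hper : TorusPeriodic g)
    (j : Fin d → ℤ) (k : Fin d) :
    charCoeff (fun X => (fderiv ℝ g X (Pi.single k 1) : ℂ)) j =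
      gradSymbol j k * charCoeff (fun X => (g X : ℂ)) j := by
  have hχ : ContDiff ℝ 1 (torusChar (-j)) := (contDiff_torusChar _).of_le (by simp)
  have hgc : ContDiff ℝ 1 fun X => (g X : ℂ) := Complex.ofRealCLM.contDiff.comp hg
  have h1 := integral_unitCube_partial (hχ.mul hgc) (fun m X => by
    simp only [torusChar_periodic (-j) m X, hper m X]) k
  have h2 : ∀ X, fderiv ℝ (fun X => torusChar (-j) X * (g X : ℂ)) X (Pi.single k 1) =
      conj (torusChar j X) * (fderiv ℝ g X (Pi.single k 1) : ℂ) +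
        -gradSymbol j k * (conj (torusChar j X) * (g X : ℂ)) := fun X => by
    have e1 := (hχ.differentiable (by norm_num) X).hasFDerivAt
    have e2 := Complex.ofRealCLM.hasFDerivAt.comp X (hg.differentiable (by norm_num) X).hasFDerivAt
    have e3 : fderiv ℝ (fun X => torusChar (-j) X * (g X : ℂ)) X = _ := (e1.mul e2).fderiv
    rw [e3]
    simp [fderiv_torusChar, ← torusChar_neg, gradSymbol]
    ring
  have hc : Continuous fun X => conj (torusChar j X) :=
    Complex.continuous_conj.comp (continuous_torusChar j)
  have i1 : Integrable (fun X => conj (torusChar j X) * (fderiv ℝ g X (Pi.single k 1) : ℂ))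
      (volume.restrict (unitCube d)) := integrable_unitCube_of_continuous (hc.mul (Complex.continuous_ofReal.comp
    ((hg.continuous_fderiv (by norm_num)).clm_apply (continuous_const (y := Pi.single k 1)))))
  have i2 : Integrable (fun X => -gradSymbol j k * (conj (torusChar j X) * (g X : ℂ)))
      (volume.restrict (unitCube d)) :=
    (integrable_unitCube_of_continuous (hc.mul hgc.continuous)).const_mul _
  simp only [h2] at h1
  rw [integral_add i1 i2, integral_const_mul] at h1
  rw [charCoeff, charCoeff]
  linear_combination h1

theorem exists_pos_le_of_torusPeriodic (hH : Continuous H) (hHper : TorusPeriodic H)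
    (hHpos : ∀ X, 0 < H X) : ∃ h, 0 < h ∧ ∀ X, h ≤ H X := by
  obtain ⟨M, hM0, hM⟩ := exists_bound_of_torusPeriodic (f := fun X => (H X)⁻¹)
    (hH.inv₀ fun X => (hHpos X).ne') fun j X => congrArg _ (hHper j X)
  refine ⟨(M + 1)⁻¹, by positivity, fun X => inv_le_of_inv_le₀ (hHpos X) ?_⟩
  linarith [hM X, le_abs_self (H X)⁻¹, Real.norm_eq_abs (H X)⁻¹]

theorem isOpen_layerDomain (hH : Continuous H) : IsOpen (layerDomain H) :=
  isOpen_lt (hH.neg.comp continuous_fst) continuous_snd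

variable {f : LayerPt d → ℝ} {h : ℝ}

theorem ContDiffOn.slice (hf : ContDiffOn ℝ ∞ f (layerDomain H)) {Y : ℝ} (hY : ∀ X, -H X < Y) :
    ContDiff ℝ ∞ fun X => f (X, Y) := hf.comp_contDiff (contDiff_prodMk_left Y) hY

theorem ContDiffOn.layerPartial (hH : Continuous H) (hf : ContDiffOn ℝ ∞ f (layerDomain H))
    (i : Fin (d + 1)) : ContDiffOn ℝ ∞ (_root_.layerPartial i f) (layerDomain H) :=
  (hf.fderiv_of_isOpen (isOpen_layerDomain hH) (by simp)).clm_apply contDiffOn_const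

theorem rMode_layerPartial (hH : Continuous H) (hf : ContDiffOn ℝ ∞ f (layerDomain H))
    (hper : LayerPeriodic f) {Y : ℝ} (hY : ∀ X, -H X < Y) (j : Fin d → ℤ) (k : Fin d) :
    rMode (layerPartial k.castSucc f) j Y = gradSymbol j k * rMode f j Y := by
  rw [rMode, rMode, cMode, cMode, ← charCoeff_fderiv ((hf.slice hY).of_le (by simp)) (hper Y) j k]
  congr 1
  ext X
  have h1 : DifferentiableAt ℝ f (X, Y) := ((hf.contDiffAt
    ((isOpen_layerDomain hH).mem_nhds (hY X))).differentiableAt (by simp))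
  have h2 : fderiv ℝ (fun X => f (X, Y)) X = _ :=
    (h1.hasFDerivAt.comp X (hasFDerivAt_prodMk_left X Y)).fderiv
  rw [h2]
  simp [layerPartial, layerDir_castSucc]

theorem freqNorm_le_sum (j : Fin d → ℤ) : freqNorm j ≤ ∑ k, |(j k : ℝ)| := by
  refine Real.sqrt_le_iff.mpr ⟨Finset.sum_nonneg fun i _ => abs_nonneg _, ?_⟩
  simpa only [sq_abs] using Finset.sum_sq_le_sq_sum_of_nonneg (s := Finset.univ)
    fun k _ => abs_nonneg (j k : ℝ)

/-- The Fourier modes of a smooth function decay rapidly, uniformly on compact sets of heights. -/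
theorem exists_rMode_le_of_contDiffOn (hH : Continuous H) {a b : ℝ} (ha : ∀ X, -H X < a) (N : ℕ)
    (hf : ContDiffOn ℝ ∞ f (layerDomain H)) (hper : LayerPeriodic f) :
    ∃ B, 0 ≤ B ∧ ∀ j, ∀ Y ∈ Icc a b, freqNorm j ^ N * ‖rMode f j Y‖ ≤ B := by
  induction N generalizing f with
  | zero =>
    obtain ⟨B, hB⟩ := ((isCompact_Icc (a := (0 : Fin d → ℝ)) (b := 1)).prod
      (isCompact_Icc (a := a) (b := b))).exists_bound_of_continuousOn
      (hf.continuousOn.mono fun z hz => (ha z.1).trans_le hz.2.1)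
    refine ⟨|B|, abs_nonneg B, fun j Y hY => ?_⟩
    have h1 := norm_setIntegral_le_of_norm_le_const (C := |B|) (s := unitCube d) (μ := volume)
      (f := fun X => conj (torusChar j X) * (f (X, Y) : ℂ)) (by simp [volume_unitCube])
      fun X hX => by
        rw [norm_mul, RCLike.norm_conj, norm_torusChar, one_mul, Complex.norm_real]
        exact (hB (X, Y) ⟨⟨fun k => (hX k (mem_univ k)).1, fun k => (hX k (mem_univ k)).2.le⟩,
          hY⟩).trans (le_abs_self B)
    simpa [rMode, cMode, charCoeff, Measure.real, volume_unitCube] using h1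
  | succ N ih =>
    -- One power of the frequency is at most `∑ |j_k|`, and each `|j_k|` is absorbed by a horizontal
    -- derivative, which is smooth and periodic again.
    choose B hB0 hB using fun k : Fin d => ih (hf.layerPartial hH k.castSucc)
      (periodic_layerPartial hper k.castSucc)
    refine ⟨∑ k, B k, Finset.sum_nonneg fun k _ => hB0 k, fun j Y hY => ?_⟩
    have hN := pow_nonneg (freqNorm_nonneg j) N
    calc freqNorm j ^ (N + 1) * ‖rMode f j Y‖
        ≤ freqNorm j ^ N * (∑ k, |(j k : ℝ)|) * ‖rMode f j Y‖ := by
          rw [pow_succ]; gcongr; exact freqNorm_le_sum j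
      _ = ∑ k, freqNorm j ^ N * (|(j k : ℝ)| * ‖rMode f j Y‖) := by
          rw [Finset.mul_sum, Finset.sum_mul]; simp only [mul_assoc]
      _ ≤ ∑ k, B k := Finset.sum_le_sum fun k _ => by
          refine le_trans (mul_le_mul_of_nonneg_left ?_ hN) (hB k j Y hY)
          rw [rMode_layerPartial hH hf hper (fun X => (ha X).trans_le hY.1), norm_mul,
            norm_gradSymbol]
          refine mul_le_mul_of_nonneg_right (le_mul_of_one_le_left (abs_nonneg _) ?_)
            (norm_nonneg _)
          linarith [Real.pi_gt_three]

theorem continuousOn_rMode_of_contDiffOn (hHpos : ∀ X, 0 < H X)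
    (hf : ContDiffOn ℝ ∞ f (layerDomain H)) (j : Fin d → ℤ) :
    ContinuousOn (rMode f j) (Ioi 0) := by
  rw [continuousOn_iff_continuous_domRestrict]
  have : LocallyCompactSpace (Ioi (0 : ℝ)) := isOpen_Ioi.isLocallyClosed.locallyCompactSpace
  have hsub : ∀ z : Ioi (0 : ℝ) × (Fin d → ℝ), (z.2, (z.1 : ℝ)) ∈ layerDomain H := fun z =>
    (neg_neg_of_pos (hHpos z.2)).trans z.1.2
  have h1 : Continuous fun z : Ioi (0 : ℝ) × (Fin d → ℝ) =>
      conj (torusChar j z.2) * (f (z.2, (z.1 : ℝ)) : ℂ) :=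
    (Complex.continuous_conj.comp ((continuous_torusChar j).comp continuous_snd)).mul
      (Complex.continuous_ofReal.comp (hf.continuousOn.comp_continuous (by fun_prop) hsub))
  refine (continuous_parametric_integral_of_continuous (μ := volume)
    (f := fun (y : Ioi (0 : ℝ)) X => conj (torusChar j X) * (f (X, (y : ℝ)) : ℂ)) h1
    (isCompact_Icc (a := (0 : Fin d → ℝ)) (b := 1))).congr fun y => ?_
  exact (setIntegral_congr_set (Measure.univ_pi_Ico_ae_eq_Icc
    (μ := fun _ : Fin d => (volume : Measure ℝ)) (f := fun _ => (0 : ℝ))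
    (g := fun _ => (1 : ℝ)))).symm

/-- Up to height `1` smoothness on a compact set applies; above it the assumed bound contains
`e^{-|j|y} ≤ e^{-y} e^{1-|j|}`, which beats the power of `|j|`. -/
theorem exists_weight_of_contDiffOn (hH : Continuous H) {a : ℝ} (ha : ∀ X, -H X < a) (N : ℕ)
    (hA : 0 ≤ A) (hf : ContDiffOn ℝ ∞ f (layerDomain H)) (hper : LayerPeriodic f)
    (hfj : ∀ j, ∀ᵐ y ∂volIoi 0, ‖rMode f j y‖ ≤ A * decayWeight n (max (freqNorm j) 1) y) :
    ∃ B, 0 ≤ B ∧ ∀ j, j ≠ 0 → ∀ᵐ y ∂volIoi a,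
      freqNorm j ^ N * ‖rMode f j y‖ ≤ B := by
  obtain ⟨B, hB0, hB⟩ := exists_rMode_le_of_contDiffOn hH (b := 1) ha N hf hper
  obtain ⟨C, hC⟩ := exists_pow_mul_exp_le N one_pos
  refine ⟨max B (A * decayWeight n 1 0 * exp 1 * C), hB0.trans (le_max_left _ _), fun j hj => ?_⟩
  have h1 := hfj j
  rw [ae_restrict_iff' measurableSet_Ioi] at h1 ⊢
  filter_upwards [h1] with y hy hay
  rcases le_or_gt y 1 with h | h
  · exact (hB j y ⟨le_of_lt hay, h⟩).trans (le_max_left _ _)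
  · have hj1 := one_le_freqNorm hj
    have h2 := hy (zero_lt_one.trans h)
    rw [max_eq_left hj1] at h2
    have h3 : decayWeight n (freqNorm j) y ≤
        decayWeight n 1 y * (exp 1 * exp (-(1 * freqNorm j))) := by
      rw [decayWeight, decayWeight, mul_assoc, ← Real.exp_add, ← Real.exp_add]
      gcongr
      nlinarith
    have h4 := decayWeight_le_zero n (zero_lt_one.trans h).le
    have h5 := hC _ (freqNorm_nonneg j)
    have h6 := (decayWeight_pos n 1 le_rfl).le
    refine le_trans ?_ (le_max_right _ _)
    calc freqNorm j ^ N * ‖rMode f j y‖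
        ≤ freqNorm j ^ N * (A * (decayWeight n 1 0 * (exp 1 * exp (-(1 * freqNorm j))))) := by
          have := freqNorm_nonneg j
          refine mul_le_mul_of_nonneg_left (h2.trans ?_) (by positivity)
          refine mul_le_mul_of_nonneg_left (h3.trans ?_) hA
          gcongr
      _ = A * decayWeight n 1 0 * exp 1 *
          (freqNorm j ^ N * exp (-(1 * freqNorm j))) := by ring
      _ ≤ _ := by gcongr

/-- For `Y ≤ 1` the weight is at least `e^{-1}`, so a bound without decay in `Y` is as good there,
at the price of the factor `exp 1`. -/
theorem ModeDecay.Ioi {c : (Fin d → ℤ) → ℝ → ℂ} (h1 : ModeDecay n (Ici 1) c)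
    (h0 : ∀ m : ℕ, ∃ K, 0 ≤ K ∧ ∀ j, j ≠ 0 → ∀ Y, 0 < Y →
      freqNorm j ^ m * ‖c j Y‖ ≤ K * latticeWeight j) : ModeDecay n (Ioi 0) c := fun m => by
  obtain ⟨C, hC0, hC⟩ := h1 m
  obtain ⟨K, hK0, hK⟩ := h0 m
  refine ⟨C + K * exp 1, by positivity, fun j hj Y hY => ?_⟩
  have hY : 0 < Y := hY
  have hp := decayWeight_pos n 1 hY.le
  have hw := latticeWeight_pos j
  rw [add_mul, add_mul]
  rcases le_total 1 Y with h | h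
  · exact (hC j hj Y h).trans (le_add_of_nonneg_right (by positivity))
  · refine (hK j hj Y hY).trans (le_trans ?_ (le_add_of_nonneg_left (by positivity)))
    refine mul_le_mul_of_nonneg_right ?_ hw.le
    rw [mul_assoc]
    refine le_mul_of_one_le_right hK0 ?_
    rw [decayWeight, mul_left_comm, ← Real.exp_add]
    have hn : (0 : ℝ) ≤ n := n.cast_nonneg
    exact one_le_mul_of_one_le_of_one_le (one_le_pow₀ (by linarith))
      (Real.one_le_exp (by linarith))

/-- With `t` a positive lower bound of `H`, the strip `(-t/2, -t/4)` lies inside the domain and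
below `Y = 0`. Its contribution at `Y > 0` is at most `e^{-t|j|/2}`, and the force is dominated by a
constant weight carrying an arbitrarily high negative power of `|j|`. -/
theorem IsStokesComponents.modeDecay_Ioi (hH : ContDiff ℝ ∞ H) (hHper : TorusPeriodic H)
    (hHpos : ∀ X, 0 < H X) (hF : MemLp F 2 (layerMeasure H))
    (h : IsStokesComponents H ν F D U G P) (hν : 0 < ν) (hν1 : ν ≤ 1) {Φ : ℝ → ℝ}
    {c : Fin (d + 1) → (Fin d → ℤ) → ℝ → ℂ} {e : (Fin d → ℤ) → ℝ → ℂ}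
    (hr : IsModeRep ν Φ F U P c e) (hA : 0 ≤ A)
    (hFj : ∀ l j, ∀ᵐ y ∂volIoi 0,
      ‖rMode (fun z => F z l) j y‖ ≤ A * decayWeight n (max (freqNorm j) 1) y)
    (hFper : LayerPeriodic F) (hFs : ContDiffOn ℝ ∞ F (layerDomain H)) :
    (∀ l, ModeDecay n (Ioi 0) (c l)) ∧ ModeDecay n (Ioi 0) e := by
  obtain ⟨t, ht, htH⟩ := exists_pos_le_of_torusPeriodic hH.continuous hHper hHpos
  obtain ⟨C, M, hC, hM, hb⟩ := h.exists_mode_bound hH hHper hF (a := -(t / 2)) (b := -(t / 4))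
    (fun X => by linarith [htH X]) (by linarith) hν hν1 hr
  have h1 := h.modeDecay_Ici hH hHper hF (fun X => (neg_neg_of_pos (hHpos X)).le) hν hν1 hr hA hFj
    one_pos
  have key : ∀ m : ℕ, ∃ K, 0 ≤ K ∧ ∀ j, j ≠ 0 → ∀ Y, 0 < Y → ∀ l,
      freqNorm j ^ m * (‖e j Y‖ + ‖c l j Y‖) ≤ K * latticeWeight j := fun m => by
    choose B hB0 hB using fun l => exists_weight_of_contDiffOn hH.continuous (a := -(t / 2))
      (fun X => by linarith [htH X]) (m + 2 + 2 * d) hA (contDiffOn_euclidean.mp hFs l)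
      (fun Y j X => congrArg (fun v : LayerVec d => v l) (hFper Y j X)) (hFj l)
    obtain ⟨E, hE0, hE⟩ := exists_exp_le_latticeWeight (d := d) (m + 2) (half_pos ht)
    have hS0 : 0 ≤ ∑ l, B l := Finset.sum_nonneg fun l _ => hB0 l
    refine ⟨C * (2 ^ d * (∑ l, B l) + M * E), by positivity, fun j hj Y hY l => ?_⟩
    have hj0 : 0 < freqNorm j := zero_lt_one.trans_le (one_le_freqNorm hj)
    set x := (∑ l, B l) / freqNorm j ^ (m + 2 + 2 * d)
    have hx0 : 0 ≤ x := by positivity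
    have h2 := hb j hj (fun _ => x)
      (isDecayWeight_const (one_le_two_pi_freqNorm hj) _ hx0) (fun l => by
        filter_upwards [hB l j hj] with y hy
        rw [le_div_iff₀' (by positivity)]
        exact hy.trans (Finset.single_le_sum (fun l _ => hB0 l) (Finset.mem_univ l)))
      l Y hY (by linarith)
    have h3 := le_mul_latticeWeight hj hx0 (mul_div_cancel₀ _ (by positivity)).le
    have h4 : exp (-(freqNorm j * (2 * (Y - -(t / 4))))) ≤ exp (-(t / 2 * freqNorm j)) := by
      refine Real.exp_le_exp.mpr ?_
      nlinarith [mul_pos hj0 hY]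
    calc freqNorm j ^ m * (‖e j Y‖ + ‖c l j Y‖)
        ≤ freqNorm j ^ m * (C * freqNorm j ^ 2 * (x + M * exp (-(t / 2 * freqNorm j)))) := by
          refine mul_le_mul_of_nonneg_left (h2.trans ?_) (by positivity)
          gcongr
      _ = C * (freqNorm j ^ (m + 2) * x +
          M * (freqNorm j ^ (m + 2) * exp (-(t / 2 * freqNorm j)))) := by ring
      _ ≤ C * (2 ^ d * (∑ l, B l) * latticeWeight j + M * (E * latticeWeight j)) := by
          have := hE j hj
          gcongr
      _ = _ := by ring
  have h2 := exists_le_of_add_le (S := Ioi 0) (fun K j _ => K * latticeWeight j) key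
  exact ⟨fun l => (h1.1 l).Ioi (h2.1 l), h1.2.Ioi h2.2⟩

end SmoothForce

/-! ### The hypotheses on the force, mode by mode. -/

section ForceModes

variable {d n : ℕ} {A : ℝ} {F : LayerPt d → LayerVec d}

/-- The exponent is kept as a function `f` so that the separate hypotheses for `j = 0` and `j ≠ 0`
both fit the common form `max |j| 1 * y`. -/
theorem ae_norm_rMode_le_of_vecMode {f : ℝ → ℝ} {j : Fin d → ℤ} {Q : Polynomial ℝ}
    (hQ : ∀ y, 0 ≤ y → Q.eval y ≤ A * (2 * n + 2 + y) ^ n) (hf : ∀ y, f y = max (freqNorm j) 1 * y)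
    (h : ∀ᵐ Y : ℝ, 0 < Y → ‖vecMode F j Y‖ ≤ Q.eval Y * exp (-f Y)) (l : Fin (d + 1)) :
    ∀ᵐ y ∂(volIoi 0),
      ‖rMode (fun z => F z l) j y‖ ≤ A * decayWeight n (max (freqNorm j) 1) y := by
  rw [ae_restrict_iff' measurableSet_Ioi]
  filter_upwards [h] with y hy h0
  have h0 : 0 < y := h0
  have h1 : rMode (fun z => F z l) j y = vecMode F j y l :=
    (torusCoeff_eq_charCoeff (fun X => F (X, y) l) j).symm
  rw [h1, decayWeight, ← mul_assoc, ← hf]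
  exact ((PiLp.norm_apply_le _ l).trans (hy h0)).trans
    (mul_le_mul_of_nonneg_right (hQ y h0.le) (Real.exp_nonneg _))

theorem contDiff_modeField {c : (Fin d → ℤ) → ℝ → ℂ} {f : LayerPt d → ℝ}
    (h : ∀ δ > 0, ModeDecay n (Ici δ) c) {Y : ℝ} (hY : 0 < Y) :
    ContDiff ℝ ∞ fun X => modeField f c (X, Y) := by
  simp only [modeField_of_pos f c _ hY]
  exact contDiff_charSeries ((h Y hY).slice (mem_Ici.mpr le_rfl))

end ForceModes

/-! ### Assembly of the theorem. -/

theorem proposition1 (d : ℕ) (hd : d = 1 ∨ d = 2)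
    (H : (Fin d → ℝ) → ℝ) (hH : ContDiff ℝ ∞ H) (hHper : TorusPeriodic H) (hHpos : ∀ X, 0 < H X)
    (r : ℝ) (hr0 : 0 ≤ r) (hr1 : r < 1) (Q : Polynomial ℝ) :
    ∃ Q₁ : Polynomial ℝ,
      ∀ (F : LayerPt d → LayerVec d) (D : (Fin d → ℝ) → LayerVec d),
        LayerPeriodic F → MemLp F 2 (layerMeasure H) → MemTorusHalf D →
        (∀ᵐ Y : ℝ, 0 < Y → ‖vecMode F 0 Y‖ ≤ Q.eval Y * Real.exp (-Y)) →
        (∀ j : Fin d → ℤ, j ≠ 0 →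
          ∀ᵐ Y : ℝ, 0 < Y → ‖vecMode F j Y‖ ≤ Q.eval Y * Real.exp (-(freqNorm j * Y))) →
        ∃ (U : LayerPt d → LayerVec d) (P : LayerPt d → ℝ),
          -- existence and uniqueness
          IsStokesLayerSolution H r F D U P ∧
          (∀ (V : LayerPt d → LayerVec d) (R : LayerPt d → ℝ),
            IsStokesLayerSolution H r F D V R →
              V =ᵐ[layerMeasure H] U ∧ R =ᵐ[layerMeasure H] P) ∧
          -- the chosen representative is continuous for `Y > 0`, and smooth in `X`
          ContinuousOn U {z | 0 < z.2} ∧ ContinuousOn P {z | 0 < z.2} ∧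
          (∀ Y : ℝ, 0 < Y →
            ContDiff ℝ ∞ (fun X => U (X, Y)) ∧ ContDiff ℝ ∞ (fun X => P (X, Y))) ∧
          ∃ Uinf : LayerVec d,
            -- the mean values
            (∀ Y : ℝ, 0 < Y →
              ‖vecMode U 0 Y - toComplexVec Uinf‖ + ‖scalarMode P 0 Y‖
                ≤ Q₁.eval Y * Real.exp (-Y)) ∧
            (∀ Y : ℝ, 0 < Y → DifferentiableAt ℝ (vecMode U 0) Y) ∧
            (∃ K, LipschitzOnWith K (scalarMode P 0) (Set.Ioi 0)) ∧
            (∀ Y : ℝ, 0 < Y →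
              ‖deriv (vecMode U 0) Y‖ + ‖deriv (scalarMode P 0) Y‖
                ≤ Q₁.eval Y * Real.exp (-Y)) ∧
            -- pointwise bounds for square integrable `F`
            (∀ δ : ℝ, 0 < δ → LayerDecay U P Uinf (Set.Ici δ)) ∧
            -- for smooth `F`, everything holds for every `Y > 0`
            (ContDiffOn ℝ ∞ F (layerDomain H) →
              (∀ Y : ℝ, 0 < Y → DifferentiableAt ℝ (scalarMode P 0) Y) ∧
              LayerDecay U P Uinf (Set.Ioi 0)) := by
  obtain ⟨n, A, hA, hQ⟩ := Q.exists_eval_le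
  set ν := 1 - r with hνr
  have hν : 0 < ν := by linarith
  -- Each of the `d + 1` velocity means contributes `4 ν⁻¹ A` and the pressure `2 A`; both constants
  -- are fixed before `F` and `D`.
  obtain ⟨Q₁, hQ₁⟩ := exists_poly_eval n ((d + 1 : ℝ) * (4 * (ν⁻¹ * A)) + 2 * A)
  refine ⟨Q₁, fun F D hFper hF hD hF0 hFj => ?_⟩
  have hM : ∀ l j, ∀ᵐ y ∂(volIoi 0),
      ‖rMode (fun z => F z l) j y‖ ≤ A * decayWeight n (max (freqNorm j) 1) y := fun l j => by
    by_cases hj : j = 0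
    · subst hj
      exact ae_norm_rMode_le_of_vecMode hQ (f := id) (fun y => by simp [freqNorm]) hF0 l
    · exact ae_norm_rMode_le_of_vecMode hQ (f := fun y => freqNorm j * y)
        (fun y => by rw [max_eq_left (one_le_freqNorm hj)]) (hFj j hj) l
  obtain ⟨V, G, R, hS⟩ := exists_isStokesComponents hH hHper hν (fun l =>
    flatWeightedL2_of_modes hH.continuous hHper hHpos (hF.eval_piLp l) (hM l)) hD
  have ha : ∀ X, -H X ≤ 0 := fun X => (neg_neg_of_pos (hHpos X)).le
  have hΨ := (isMeanWeight_decayWeight n).const_mul hA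
  set Ψ : ℝ → ℝ := fun y => A * decayWeight n 1 y with hΨdef
  have hM0 : ∀ l, ∀ᵐ y ∂(volIoi 0), ‖rMode (fun z => F z l) 0 y‖ ≤ Ψ y :=
    fun l => by simpa [freqNorm] using hM l 0
  obtain ⟨c, e, hr⟩ := hS.exists_isModeRep hH hHper hF ha hν hΨ hM0
  have hdec := fun δ (hδ : 0 < δ) => hS.modeDecay_Ici hH hHper hF ha hν (by linarith) hr hA hM hδ
  have hdc : ∀ l, ∀ δ > 0, ModeDecay n (Ici δ) (c l) := fun l δ hδ => (hdec δ hδ).1 l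
  have hde : ∀ δ > 0, ModeDecay n (Ici δ) e := fun δ hδ => (hdec δ hδ).2
  obtain ⟨z, L, C, heC, hmean⟩ := hr.mean
  have hΨle : ∀ y, 0 < y → Ψ y ≤ Ψ 0 := fun y hy =>
    mul_le_mul_of_nonneg_left (decayWeight_le_zero n hy.le) hA
  have hbc : ∀ l, ∀ δ > 0, ∃ C, ∀ j, ∀ Y, δ ≤ Y → ‖c l j Y‖ ≤ C * latticeWeight j :=
    fun l δ hδ => ModeDecay.exists_le_latticeWeight (hdc l)
      (K := 4 * (ν⁻¹ * Ψ 0) + ‖L l‖) (fun Y hY => by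
        have h1 := ((hmean Y hY).1 l).2.2
        have h2 : ν⁻¹ * Ψ Y ≤ ν⁻¹ * Ψ 0 := mul_le_mul_of_nonneg_left (hΨle Y hY) (by positivity)
        linarith [norm_le_norm_sub_add (c l 0 Y) (L l)]) hδ
  have hbe : ∀ δ > 0, ∃ C, ∀ j, ∀ Y, δ ≤ Y → ‖e j Y‖ ≤ C * latticeWeight j :=
    fun δ hδ => ModeDecay.exists_le_latticeWeight hde (K := 2 * Ψ 0)
      (fun Y hY => by linarith [(hmean Y hY).2, hΨle Y hY]) hδ
  set U : LayerPt d → LayerVec d := fun z =>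
    WithLp.toLp 2 fun l => modeField (fun z => V z l) (c l) z with hU
  set P : LayerPt d → ℝ := modeField R e with hP
  -- The weak solution is replaced by its Fourier series for `Y > 0`, which agrees with it almost
  -- everywhere.
  have hS' : IsStokesComponents H ν F D U G P := hS.congr
    (fun l => modeField_ae_eq hH.continuous ha (hS.pair l).locL2 (hr.velocity l)
      (hr.contVelocity l) (hbc l))
    (modeField_ae_eq hH.continuous ha (MemLp.layerLocL2 hS.memLp) hr.pressure hr.contPressure hbe)
  have hUper : LayerPeriodic U := fun Y j X => by
    have := fun l => layerPeriodic_modeField (fun z => V z l) (c l) Y j X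
    simp only at this
    simp only [hU, this]
  have hUser : ∀ X Y, 0 < Y → U (X, Y) = WithLp.toLp 2 fun i => charSeries (fun j => c i j Y) X :=
    fun X Y hY => by simp only [hU, modeField_of_pos _ _ _ hY]
  have hsum : ∀ {x : (Fin d → ℤ) → ℝ → ℂ}, (∀ δ > 0, ModeDecay n (Ici δ) x) → ∀ {Y}, 0 < Y →
      Summable fun j => ‖x j Y‖ := fun hx Y hY => by
    obtain ⟨C, hC⟩ := (hx Y hY).slice (mem_Ici.mpr le_rfl) 0
    exact summable_norm_of_le_latticeWeight hC
  have hU0 : ∀ Y, 0 < Y → vecMode U 0 Y = WithLp.toLp 2 fun l => ((c l 0 Y).re : ℂ) :=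
    fun Y hY => by
      simp only [vecMode, torusVecCoeff, hU, torusCoeff_modeField_zero hY (hsum (hdc _) hY)]
  have hP0 : ∀ Y, 0 < Y → scalarMode P 0 Y = ((e 0 Y).re : ℂ) := fun Y hY =>
    torusCoeff_modeField_zero hY (hsum hde hY)
  -- Increments of the mean pressure are integrals of the mean vertical force. This gives the
  -- Lipschitz continuity and the bound on the derivative wherever it exists.
  have hPlip : ∀ y Y, 0 < y → y ≤ Y →
      ‖scalarMode P 0 Y - scalarMode P 0 y‖ ≤ 2 * (Ψ y - Ψ Y) := fun y Y hy hyY => by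
    rw [hP0 Y (hy.trans_le hyY), hP0 y hy, ← Complex.ofReal_sub, ← Complex.sub_re,
      Complex.norm_real]
    refine (Complex.abs_re_le_norm _).trans ?_
    have hm := (hS.modes hH hHper hF ha 0).locF (Fin.last d)
    rw [heC]
    simp only
    rw [primitive_sub hm hy hyY]
    exact hΨ.norm_integral_le (hM0 _) hy hyY
  have hder : ∀ Y, 0 < Y → HasDerivAt (vecMode U 0) (WithLp.toLp 2 fun l => ((z l Y).re : ℂ)) Y :=
    fun Y hY => by
      refine HasDerivAt.congr_of_eventuallyEq (hasDerivAt_toLp fun l => ?_)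
        (Filter.mem_of_superset (Ioi_mem_nhds hY) fun y hy => hU0 y hy)
      have h1 := ((hmean Y hY).1 l).1
      exact (Complex.ofRealCLM.comp Complex.reCLM).hasFDerivAt.comp_hasDerivAt Y h1
  have hre : ∀ x : ℂ, ‖((x.re : ℝ) : ℂ)‖ ≤ ‖x‖ := fun x => by
    rw [Complex.norm_real]; exact Complex.abs_re_le_norm x
  have hcard : ∀ (x : Fin (d + 1) → ℂ) (b : ℝ), (∀ l, ‖x l‖ ≤ b) →
      ‖(WithLp.toLp 2 fun l => ((x l).re : ℂ) : EuclideanSpace ℂ (Fin (d + 1)))‖ ≤ (d + 1) * b :=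
    fun x b hb => by
      refine (norm_toLp_le_sum _).trans ((Finset.sum_le_sum fun l _ =>
        (hre (x l)).trans (hb l)).trans_eq ?_)
      simp
  set Uinf : LayerVec d := WithLp.toLp 2 fun l => (L l).re with hUinf
  have hνA : 0 ≤ ν⁻¹ * A := by positivity
  -- One argument for both `Y ≥ δ` and `Y > 0`; only the set of heights on which the modes decay
  -- differs.
  have hlayer : ∀ S ⊆ Ioi 0, (∀ l, ModeDecay n S (c l)) → ModeDecay n S e →
      LayerDecay U P Uinf S := fun S hS hc he => by
    refine layerDecay_of_modes hS (fun X Y hY => hUser X Y (hS hY))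
      (fun X Y hY => modeField_of_pos R e X (hS hY)) hc he (K := 4 * (ν⁻¹ * A) + 2 * A)
      (fun Y hY i => ?_) fun Y hY => ?_
    · have h1 := ((hmean Y (hS hY)).1 i).2.2
      have h2 := (Complex.abs_re_le_norm _).trans h1
      have h3 := mul_nonneg hA (decayWeight_pos n 1 (le_of_lt (hS hY))).le
      rw [Complex.sub_re] at h2
      refine h2.trans ?_
      simp only [hΨdef]
      linarith
    · have h1 := (Complex.abs_re_le_norm _).trans (hmean Y (hS hY)).2
      have h3 := mul_nonneg hνA (decayWeight_pos n 1 (le_of_lt (hS hY))).le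
      refine h1.trans ?_
      simp only [hΨdef]
      linarith
  refine ⟨U, P, (isStokesLayerSolution_iff hH hHper hD.sq_integrable).mpr
    ⟨hUper, layerPeriodic_modeField _ _, G, hS'⟩, fun W T hW => ?_, ?_,
    continuousOn_modeField hr.contPressure hbe, fun Y hY => ⟨?_, contDiff_modeField hde hY⟩, Uinf,
    fun Y hY => ?_, fun Y hY => (hder Y hY).differentiableAt,
    lipschitzOnWith_of_mean_weight hΨ hPlip, fun Y hY => ?_, fun δ hδ => ?_, fun hFs => ⟨?_, ?_⟩⟩
  · obtain ⟨-, -, G', hG'⟩ := (isStokesLayerSolution_iff hH hHper hD.sq_integrable).mp hW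
    exact hS'.unique hH hHper hν hF hG'
  · exact (PiLp.continuous_toLp 2 _).comp_continuousOn
      (continuousOn_pi.mpr fun l => continuousOn_modeField (hr.contVelocity l) (hbc l))
  · exact PiLp.contDiff_toLp.comp (contDiff_pi.mpr fun l => contDiff_modeField (hdc l) hY)
  · have h1 : vecMode U 0 Y - toComplexVec Uinf =
        WithLp.toLp 2 fun l => ((c l 0 Y - L l).re : ℂ) := by
      rw [hU0 Y hY]
      ext l
      simp [toComplexVec, hUinf]
    rw [h1, hP0 Y hY, hQ₁]
    refine (add_le_add (hcard _ _ fun l => ((hmean Y hY).1 l).2.2)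
      ((hre _).trans (hmean Y hY).2)).trans_eq ?_
    simp only [hΨdef]
    ring
  · rw [(hder Y hY).deriv, hQ₁]
    refine (add_le_add (hcard _ _ fun l => ((hmean Y hY).1 l).2.1)
      (norm_deriv_le_of_mean_weight hΨ hPlip hY)).trans ?_
    have h3 := mul_nonneg hνA (decayWeight_pos n 1 hY.le).le
    simp only [hΨdef]
    nlinarith [mul_nonneg (Nat.cast_nonneg (α := ℝ) d) h3]
  · exact hlayer _ (fun y hy => hδ.trans_le hy) (fun l => hdc l δ hδ) (hde δ hδ)
  · intro Y hY
    have hm := (hS.modes hH hHper hF ha 0).locF (Fin.last d)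
    -- For smooth `F` the mean vertical force is continuous, so its primitive is differentiable at
    -- every height.
    have h1 := hasDerivAt_primitive_Ioc (C := C) hm hY (continuousOn_rMode_of_contDiffOn hHpos
      (contDiffOn_euclidean.mp hFs _) 0)
    rw [← heC] at h1
    refine ((Complex.ofRealCLM.comp Complex.reCLM).hasFDerivAt.comp_hasDerivAt Y
      h1).differentiableAt.congr_of_eventuallyEq (Filter.mem_of_superset (Ioi_mem_nhds hY) fun y hy => hP0 y hy)
  · have h1 := hS.modeDecay_Ioi hH hHper hHpos hF hν (by linarith) hr hA hM hFper hFs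
    exact hlayer _ subset_rfl h1.1 h1.2
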